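/- Let $d\ge 1$, $T>0$, and let $b:\mathbb R\to\mathbb R$ be globally Lipschitz. Write $\mathcal F f(\xi)=\int_{\mathbb R^d}e^{-i\langle\xi,x\rangle}f(x)\,dx$, and let $\mathcal D$ be the space of real $C^\infty$ functions with compact support on $[0,\infty)\times\mathbb R^d$. **Noise.** For a measure $\nu$ on $\mathbb R^d$, a spatially homogeneous Gaussian noise with spectral measure $\nu$ on a complete probability space is a centered Gaussian process $\{W(\varphi),\varphi\in\mathcal D\}$ with $$\mathbb E[W(\varphi)W(\psi)]=\int_0^\infty\!\int_{\mathbb R^d}\mathcal F\varphi(t,\cdot)(\xi)\,\overline{\mathcal F\psi(t,\cdot)(\xi)}\,\nu(d\xi)\,dt .$$ Wiener integrals $W(g)=\int\!\!\int g(t,x)\,W(dt,dx)$ are defined by $L^2(\Omega)$-isometric extension to the completion of $\mathcal D$ for the corresponding norm $\big(\int_0^\infty\int|\mathcal F g(t)(\xi)|^2\nu(d\xi)dt\big)^{1/2}$. The filtration of $W$ is generated by the variables $W(\mathbf 1_{[0,s]}\varphi)$, $s\le t$, $\varphi\in\mathcal D$, and the null sets. **Equations.** Let $G_t$, $t>0$,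 be the fundamental solution of the heat equation $\partial_tu=\frac12\Delta u$, namely $G_t(dx)=(2\pi t)^{-d/2}e^{-|x|^2/(2t)}dx$, or, if $d\le 3$, of the wave equation $\partial_{tt}u=\Delta u$, namely $\frac12\mathbf 1_{\{|x|<t\}}dx$ for $d=1$, $\frac1{2\pi}(t^2-|x|^2)^{-1/2}\mathbf 1_{\{|x|<t\}}dx$ for $d=2$, and $\frac1{4\pi t}\sigma_t(dx)$ for $d=3$, with $\sigma_t$ the surface measure on the sphere of radius $t$ centered at $0$. Let $I_0(0,x)=u_0(x)$ and, for $t>0$, $I_0(t,x)=(u_0*G_t)(x)$ (heat) or $I_0(t,x)=(v_0*G_t)(x)+\frac{\partial}{\partial t}(u_0*G_t)(x)$ (wave). Fix a real $p\ge2$. A solution driven by $W$ is a jointly measurable random field $u$ on $[0,T]\times\mathbb R^d$, adapted to the filtration of $W$, with $\sup_{(t,x)\in[0,T]\times\mathbb R^d}\mathbb E|u(t,x)|^p<\infty$, such that for every $(t,x)\in[0,T]\times\mathbb R^d$, almost surely, $$u(t,x)=I_0(t,x)+\int_0^t\!\int_{\mathbb R^d}G_{t-s}(x-y)\,W(ds,dy)+\int_0^t\big(b(u(s,\cdot))*G_{t-s}\big)(x)\,ds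 .$$ **Assumptions on the noises.** Let $\mu_n$ ($n\ge1$) and $\mu$ be (non-negative) Borel measures on $\mathbb R^d$ such that - (H1) there is $q\in(0,2)$ with $\sup_{n}\int_{\mathbb R^d}\frac{\mu_n(d\xi)}{1+|\xi|^q}<\infty$; - (H2) for every continuous $f:\mathbb R^d\to\mathbb R$ with $|f(\xi)|\le C/(1+|\xi|^2)$ for some constant $C$, $f$ is $\mu$-integrable and $\int f\,d\mu_n\to\int f\,d\mu$. Let $W^n$ and $W$ be spatially homogeneous Gaussian noises with spectral measures $\mu_n$ and $\mu$, each on a complete probability space. **Conclusion.** Consider the following cases. - (a) Wave equation, $d\in\{1,2,3\}$. If $d=1$: $u_0$ is bounded and continuous, $v_0$ is bounded and measurable. If $d=2$: $u_0\in C^1(\mathbb R^2)$ and there is $r\in(2,\infty]$ with $u_0,\nabla u_0,v_0\in L^r(\mathbb R^2)$. If $d=3$: $u_0\in C^1(\mathbb R^3)$, $u_0$ and $\nabla u_0$ are bounded, and $v_0$ is bounded and continuous. Put $J=[0,T]$. - (b) Heat equation, $b$ bounded, $u_0$ bounded and measurable. Put $J=(0,T]$; if moreover $u_0$ is continuous,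 one may also take $J=[0,T]$. - (c) Heat equation, $u_0$ bounded and $\alpha$-Hölder continuous on $\mathbb R^d$ for some $\alpha\in(0,1)$. Put $J=[0,T]$. In each case the equations driven by $W^n$, $n\ge1$, and by $W$ have solutions $u^n$ and $u$, these are unique up to modification and have versions with continuous paths on $J\times\mathbb R^d$, and, as $n\to\infty$, (the continuous versions of) $u^n$ converge in law to $u$ in the space $\mathcal C(J\times\mathbb R^d)$ with the topology of uniform convergence on compact sets. -/

import Mathlib

open MeasureTheory ProbabilityTheory Filter Set Topology
open scoped ENNReal NNReal

noncomputable section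

/-- The space `ℝ^d` with its Euclidean norm. -/
abbrev Rd (d : ℕ) : Type := EuclideanSpace ℝ (Fin d)

/-! ### Spaces of continuous functions -/

/-- A space `C(X, ℝ)` carries the compact-open topology (uniform convergence on compact sets);
it is given the corresponding Borel σ-algebra. -/
instance instMeasurableSpaceContinuousReal {X : Type*} [TopologicalSpace X] :
    MeasurableSpace C(X, ℝ) := borel _

instance instBorelSpaceContinuousReal {X : Type*} [TopologicalSpace X] :
    BorelSpace C(X, ℝ) := ⟨rfl⟩

/-! ### Spatially homogeneous Gaussian noise -/

/-- Smooth compactly supported real functions on `ℝ × ℝ^d`. Only their restrictions to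
`[0, ∞) × ℝ^d` matter below; these restrictions are the smooth functions with compact support in
the closed half-space `[0, ∞) × ℝ^d`, which need not vanish at `t = 0`. -/
def TestFn (d : ℕ) : Type :=
  {φ : ℝ × Rd d → ℝ // ContDiff ℝ ((⊤ : ℕ∞) : WithTop ℕ∞) φ ∧ HasCompactSupport φ}

/-- The Fourier transform in space, `ℱφ(t, ·)(ξ) = ∫ exp(-i⟨ξ, x⟩) φ(t, x) dx`. -/
def spaceFourier {d : ℕ} (φ : TestFn d) (t : ℝ) (ξ : Rd d) : ℂ :=
  ∫ x : Rd d, Complex.exp (-(Complex.I * ((inner ℝ ξ x : ℝ) : ℂ))) * ((φ.1 (t, x) : ℝ) : ℂ)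

/-- `W` is a centered Gaussian process indexed by the test functions, white in time and spatially
homogeneous with spectral measure `μ`. -/
structure IsHomogeneousNoise {d : ℕ} {Ω : Type*} [MeasurableSpace Ω] (P : Measure Ω)
    (μ : Measure (Rd d)) (W : TestFn d → Ω → ℝ) : Prop where
  gaussian : IsGaussianProcess W P
  centered : ∀ φ, ∫ ω, W φ ω ∂P = 0
  covariance : ∀ φ ψ : TestFn d,
    ((∫ ω, W φ ω * W ψ ω ∂P : ℝ) : ℂ) =
      ∫ t in Ioi (0 : ℝ), ∫ ξ, spaceFourier φ t ξ * (starRingEnd ℂ) (spaceFourier ψ t ξ) ∂μ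

/-- `X` is (a version of) the Wiener integral `W(g)` of the element `g` of the completion of the
test functions whose Fourier transform in space is `ghat`: there are test functions `φ k`
converging to `g` in the norm `(∫₀^∞ ∫ |ℱg(t)(ξ)|² μ(dξ) dt)^{1/2}`, and `W(φ k)` converges to `X`
in `L²(Ω)`. -/
structure IsWienerIntegral {d : ℕ} {Ω : Type*} [MeasurableSpace Ω] (P : Measure Ω)
    (μ : Measure (Rd d)) (W : TestFn d → Ω → ℝ) (ghat : ℝ → Rd d → ℂ) (X : Ω → ℝ) : Prop where
  measurable : Measurable X
  approx : ∃ φ : ℕ → TestFn d,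
    Tendsto (fun k => ∫⁻ t in Ioi (0 : ℝ), ∫⁻ ξ, ‖spaceFourier (φ k) t ξ - ghat t ξ‖ₑ ^ 2 ∂μ)
      atTop (𝓝 0) ∧
    Tendsto (fun k => eLpNorm (W (φ k) - X) 2 P) atTop (𝓝 0)

/-- The filtration of the noise: `ℱ_t` is generated by the Wiener integrals `W(1_{[0,s]} φ)`,
`0 ≤ s ≤ t`, `φ` a test function, and by the null sets. -/
@[reducible] def noiseFiltration {d : ℕ} {Ω : Type*} [MeasurableSpace Ω] (P : Measure Ω)
    (μ : Measure (Rd d)) (W : TestFn d → Ω → ℝ) (t : ℝ) : MeasurableSpace Ω :=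
  MeasurableSpace.generateFrom
    ({A | MeasurableSet A ∧ P A = 0} ∪
      {A | ∃ s ∈ Icc 0 t, ∃ (φ : TestFn d) (X : Ω → ℝ),
        IsWienerIntegral P μ W
          (fun r ξ => (Icc (0 : ℝ) s).indicator (fun r' => spaceFourier φ r' ξ) r) X ∧
        ∃ B : Set ℝ, MeasurableSet B ∧ A = X ⁻¹' B})

/-! ### Fundamental solutions and initial data -/

/-- The two equations: `∂_t u - ½ Δu = b(u) + Ẇ` and `∂_tt u - Δu = b(u) + Ẇ`. -/
inductive Equation
  | heat
  | wave

/-- The heat kernel `G_t(dx) = (2πt)^{-d/2} exp(-|x|²/(2t)) dx`, for `t > 0`. -/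
def heatKernel (d : ℕ) (t : ℝ) : Measure (Rd d) :=
  volume.withDensity fun x =>
    ENNReal.ofReal (1 / (2 * Real.pi * t) ^ ((d : ℝ) / 2) * Real.exp (-‖x‖ ^ 2 / (2 * t)))

/-- The surface measure on the sphere of radius `t > 0` centered at the origin of `ℝ³`. -/
def sphereMeasure (t : ℝ) : Measure (Rd 3) :=
  ENNReal.ofReal (t ^ 2) •
    ((volume : Measure (Rd 3)).toSphere).map (fun y : Metric.sphere (0 : Rd 3) 1 => t • (y : Rd 3))

/-- The fundamental solution `G_t(dx)`, `t > 0`, of the wave equation in dimensions `1`, `2`, `3`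
(it is given the value `0` in the other dimensions, which are not considered). -/
def waveKernel : (d : ℕ) → ℝ → Measure (Rd d)
  | 1, t => volume.withDensity ((Metric.ball (0 : Rd 1) t).indicator fun _ => ENNReal.ofReal (1 / 2))
  | 2, t => volume.withDensity ((Metric.ball (0 : Rd 2) t).indicator fun x =>
      ENNReal.ofReal (1 / (2 * Real.pi) * (1 / Real.sqrt (t ^ 2 - ‖x‖ ^ 2))))
  | 3, t => ENNReal.ofReal (1 / (4 * Real.pi * t)) • sphereMeasure t
  | _, _ => 0

/-- The fundamental solution of the equation. -/
def fundamentalSolution (eqn : Equation) (d : ℕ) (t : ℝ) : Measure (Rd d) :=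
  match eqn with
  | .heat => heatKernel d t
  | .wave => waveKernel d t

/-- The convolution `(f * G_t)(x) = ∫ f(x - y) G_t(dy)`. -/
def kernelConv {d : ℕ} (eqn : Equation) (f : Rd d → ℝ) (t : ℝ) (x : Rd d) : ℝ :=
  ∫ y, f (x - y) ∂(fundamentalSolution eqn d t)

/-- The data of the Cauchy problem on `[0, T] × ℝ^d`: the equation, the time horizon, the drift
`b` and the initial data (`v0`, the initial velocity, is only used for the wave equation). -/
structure CauchyProblem (d : ℕ) where
  eqn : Equation
  T : ℝ
  b : ℝ → ℝ
  u0 : Rd d → ℝ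
  v0 : Rd d → ℝ

/-- The solution `I_0` of the deterministic linear equation: for `t > 0` it is `u0 * G_t` for the
heat equation and `v0 * G_t + ∂/∂t (u0 * G_t)` for the wave equation; at `t = 0` it is `u0`. -/
def linearPart {d : ℕ} (pb : CauchyProblem d) (t : ℝ) (x : Rd d) : ℝ :=
  if t = 0 then pb.u0 x
  else
    match pb.eqn with
    | .heat => kernelConv .heat pb.u0 t x
    | .wave => kernelConv .wave pb.v0 t x + deriv (fun r => kernelConv .wave pb.u0 r x) t

/-- Assumption on the initial condition of the heat equation: measurable and bounded. -/
def HeatData {d : ℕ} (u0 : Rd d → ℝ) : Prop :=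
  Measurable u0 ∧ ∃ M, ∀ x, |u0 x| ≤ M

/-- Assumption on the initial data of the wave equation, in dimensions `1`, `2`, `3`. -/
def WaveData : (d : ℕ) → (u0 v0 : Rd d → ℝ) → Prop
  | 1, u0, v0 =>
      (Continuous u0 ∧ ∃ M, ∀ x, |u0 x| ≤ M) ∧ (Measurable v0 ∧ ∃ M, ∀ x, |v0 x| ≤ M)
  | 2, u0, v0 =>
      ContDiff ℝ 1 u0 ∧ ∃ p : ℝ≥0∞, 2 < p ∧
        MemLp u0 p volume ∧ MemLp (gradient u0) p volume ∧ MemLp v0 p volume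
  | 3, u0, v0 =>
      (ContDiff ℝ 1 u0 ∧ (∃ M, ∀ x, |u0 x| ≤ M) ∧ ∃ M, ∀ x, ‖gradient u0 x‖ ≤ M) ∧
        (Continuous v0 ∧ ∃ M, ∀ x, |v0 x| ≤ M)
  | _, _, _ => False

/-! ### Mild solutions -/

/-- The Fourier transform in space of the integrand `(s, y) ↦ 1_{(0,t)}(s) G_{t-s}(x - y)` of the
stochastic convolution, `ℱ(G_{t-s}(x - ·))(ξ) = ∫ exp(-i⟨ξ, x - z⟩) G_{t-s}(dz)`. -/
def convIntegrand (eqn : Equation) {d : ℕ} (t : ℝ) (x : Rd d) (s : ℝ) (ξ : Rd d) : ℂ :=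
  (Ioo (0 : ℝ) t).indicator
    (fun s' => ∫ z, Complex.exp (-(Complex.I * ((inner ℝ ξ (x - z) : ℝ) : ℂ)))
      ∂(fundamentalSolution eqn d (t - s'))) s

/-- `u` is a mild solution on `[0, T] × ℝ^d` of the problem driven by the noise `W` with spectral
measure `μ`: it is adapted, jointly measurable, bounded in `L^p(Ω)`, and for every `(t, x)`, almost
surely, `u(t,x) = I_0(t,x) + ∫_0^t ∫ G_{t-s}(x-y) W(ds,dy) + ∫_0^t (b(u(s)) * G_{t-s})(x) ds`. -/
structure IsMildSolution {d : ℕ} {Ω : Type*} [MeasurableSpace Ω] (P : Measure Ω)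
    (μ : Measure (Rd d)) (W : TestFn d → Ω → ℝ) (pb : CauchyProblem d) (p : ℝ≥0)
    (u : ℝ → Rd d → Ω → ℝ) : Prop where
  adapted : ∀ t ∈ Icc 0 pb.T, ∀ x, Measurable[noiseFiltration P μ W t] (u t x)
  jointly_measurable :
    Measurable fun z : Icc (0 : ℝ) pb.T × Rd d × Ω => u (z.1 : ℝ) z.2.1 z.2.2
  moment_bound : ∃ C : ℝ≥0, ∀ t ∈ Icc 0 pb.T, ∀ x, eLpNorm (u t x) (p : ℝ≥0∞) P ≤ (C : ℝ≥0∞)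
  mild : ∀ t ∈ Icc 0 pb.T, ∀ x, ∃ X : Ω → ℝ,
    IsWienerIntegral P μ W (convIntegrand pb.eqn t x) X ∧
    ∀ᵐ ω ∂P, u t x ω = linearPart pb t x + X ω +
      ∫ s in (0 : ℝ)..t, kernelConv pb.eqn (fun y => pb.b (u s y ω)) (t - s) x

/-- `U`, with values in `C(J × ℝ^d)`, is a version with continuous paths of the restriction of the
random field `u` to `J × ℝ^d`. -/
def IsContinuousVersion {d : ℕ} {Ω : Type*} [MeasurableSpace Ω] (P : Measure Ω) (J : Set ℝ)
    (u : ℝ → Rd d → Ω → ℝ) (U : Ω → C(J × Rd d, ℝ)) : Prop :=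
  ∀ (t : J) (x : Rd d), ∀ᵐ ω ∂P, U ω (t, x) = u (t : ℝ) x ω

/-- The problem driven by `W` has a mild solution, it is unique up to modification, and it has a
version with continuous paths on `J × ℝ^d`. -/
def IsWellPosed {d : ℕ} {Ω : Type*} [MeasurableSpace Ω] (P : Measure Ω)
    (μ : Measure (Rd d)) (W : TestFn d → Ω → ℝ) (pb : CauchyProblem d) (p : ℝ≥0)
    (J : Set ℝ) : Prop :=
  ∃ u, IsMildSolution P μ W pb p u ∧
    (∃ U : Ω → C(J × Rd d, ℝ), IsContinuousVersion P J u U) ∧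
    ∀ u', IsMildSolution P μ W pb p u' → ∀ t ∈ Icc 0 pb.T, ∀ x, u' t x =ᵐ[P] u t x

/-! ### Hypotheses on the spectral measures -/

/-- There is `q ∈ (0, 2)` with `sup_n ∫ μ_n(dξ) / (1 + |ξ|^q) < ∞`. -/
def HypH1 {d : ℕ} (μs : ℕ → Measure (Rd d)) : Prop :=
  ∃ q : ℝ, 0 < q ∧ q < 2 ∧ (⨆ n, ∫⁻ ξ, ENNReal.ofReal (1 / (1 + ‖ξ‖ ^ q)) ∂(μs n)) < ∞

/-- `∫ f dμ_n → ∫ f dμ` for every continuous `f` with `|f(ξ)| ≤ C / (1 + |ξ|²)`, where it is part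
of the requirement that such `f` are integrable for `μ`. -/
def HypH2 {d : ℕ} (μs : ℕ → Measure (Rd d)) (μ : Measure (Rd d)) : Prop :=
  ∀ f : Rd d → ℝ, Continuous f → (∃ C : ℝ, ∀ ξ, |f ξ| ≤ C * (1 / (1 + ‖ξ‖ ^ 2))) →
    Integrable f μ ∧ Tendsto (fun n => ∫ ξ, f ξ ∂(μs n)) atTop (𝓝 (∫ ξ, f ξ ∂μ))

/-! ### Convergence in law of the solutions -/

/-- The problems driven by `Ws n` and by `W` are well posed with solutions continuous on
`J × ℝ^d`, and the solutions of the former converge in law in `C(J × ℝ^d)` to that of the latter. -/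
def SolutionsConvergeInLaw {d : ℕ} {Ωs : ℕ → Type*} [∀ n, MeasurableSpace (Ωs n)]
    (Ps : ∀ n, Measure (Ωs n)) [∀ n, IsProbabilityMeasure (Ps n)]
    (μs : ℕ → Measure (Rd d)) (Ws : ∀ n, TestFn d → Ωs n → ℝ)
    {Ω : Type*} [MeasurableSpace Ω] (P : Measure Ω) [IsProbabilityMeasure P]
    (μ : Measure (Rd d)) (W : TestFn d → Ω → ℝ)
    (pb : CauchyProblem d) (p : ℝ≥0) (J : Set ℝ) : Prop :=
  (∀ n, IsWellPosed (Ps n) (μs n) (Ws n) pb p J) ∧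
  IsWellPosed P μ W pb p J ∧
  ∀ (us : ∀ n, ℝ → Rd d → Ωs n → ℝ) (u : ℝ → Rd d → Ω → ℝ)
    (Us : ∀ n, Ωs n → C(J × Rd d, ℝ)) (U : Ω → C(J × Rd d, ℝ)),
    (∀ n, IsMildSolution (Ps n) (μs n) (Ws n) pb p (us n)) →
    IsMildSolution P μ W pb p u →
    (∀ n, IsContinuousVersion (Ps n) J (us n) (Us n)) →
    IsContinuousVersion P J u U →
    TendstoInDistribution Us atTop U Ps P

end

/-! The noise is additive, so each solution is a deterministic continuous function of the stochastic
convolution `Z(t,x) = ∫∫ G_{t-s}(x-y) W(ds,dy)`. With the weight `w = e^{lt}(1+|x|)` and `u = I_0 +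
w v`, the equation reads `v = Z/w + Q v`, where `Q` is the drift integral. For large `l` the map `Q`
contracts by the factor 1/2 on bounded continuous functions (`exists_contraction`), hence `v =
S(Z/w)` with `S` Lipschitz (`exists_resolvent`). Since `S` depends on the equation but not on the
noise, the continuous mapping theorem reduces everything to the convergence in law of `Z`, suitably
weighted, in a space of bounded continuous functions.

Finite-dimensional laws of `Z` are centered Gaussian. The variance of a linear combination is `∫
specVar dμ`, where `specVar` is continuous and `O(1/(1+|ξ|²))`; (H2) is exactly the convergence of
such integrals, and characteristic functions converge (`tendstoInDistribution_stochConv`).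

Passing to function space does not go through relative compactness. The squared kernel increments,
integrated in time, are at most `C min(1/(1+|ξ|²), δ)`, where `δ` is the space-time distance; (H1),
interpolated between the two terms, makes the variance of an increment of `Z` at most `C δ^{1-q/2}`,
uniformly in `n`. Gaussian moments of high order then feed a chaining argument
(`exists_continuous_version`): the dyadic interpolations of `Z/(1+|x|)` converge in `L¹` of the sup
norm at a geometric rate that is the same for all `n`. Each interpolation is a continuous function
of finitely many values of `Z`, so it converges in law, and the uniform rate lets the limits be
exchanged (`tendstoInDistribution_of_approx`).

Both equations are treated at once through `IsScaledKernel`: `G_r` is `c(r)` times the law of `a(r)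
Y`, where `Y` has a fixed law `ν`. For the wave equation `ν` projects uniformly onto `(-1,1)` along
every direction in dimensions 1, 2, 3, so its Fourier transform is always `sin(r|ξ|)/|ξ|`. What
remains is that `I_0` is bounded and continuous, which is where the conditions on the initial data
enter.

Adaptedness comes from approximating the kernel by test functions that vanish after time `t`, and
from the causality of Picard iteration. Uniqueness and moment bounds uniform in `x` are Volterra
estimates in `L¹(Ω)` and `L^N(Ω)`. -/

noncomputable section

namespace AdditiveSPDE


/-! ### Kernels obtained by scaling a fixed probability measure -/

/-- The Fourier transform of the kernel `c(r) • (a(r) • ·)_* ν`. -/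
def kHat {d : ℕ} (ν : Measure (Rd d)) (c a : ℝ → ℝ) (r : ℝ) (ξ : Rd d) : ℂ :=
  (c r : ℂ) * charFun ν (a r • ξ)

/-- The family `G` is obtained by scaling the probability measure `ν`, with amplitude `c` and
dilation `a`, and its Fourier transform is square integrable in time with the decay and regularity
common to the heat and wave kernels. -/
structure IsScaledKernel {d : ℕ} (G : ℝ → Measure (Rd d)) (ν : Measure (Rd d)) (c a : ℝ → ℝ) :
    Prop where
  prob : IsProbabilityMeasure ν
  moment : Integrable (fun y => ‖y‖) ν
  amp_cont : Continuous c
  dil_cont : Continuous a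
  amp_nonneg : ∀ r, 0 ≤ c r
  dil_nonneg : ∀ r, 0 ≤ a r
  eq_map : ∀ r, 0 < r → G r = ENNReal.ofReal (c r) • ν.map (fun y => a r • y)
  decay : ∀ T, ∃ C : ℝ, 0 ≤ C ∧ ∀ (ξ : Rd d) (δ : ℝ), 0 ≤ δ → δ ≤ T →
    ∫⁻ r in Ioc 0 δ, ‖kHat ν c a r ξ‖ₑ ^ 2 ≤
      ENNReal.ofReal (C * min (1 / (1 + ‖ξ‖ ^ 2)) δ) ∧
    ∫⁻ r in Ioc 0 T, ‖kHat ν c a (r + δ) ξ - kHat ν c a r ξ‖ₑ ^ 2 ≤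
      ENNReal.ofReal (C * min (1 / (1 + ‖ξ‖ ^ 2)) δ)

/-- The Fourier transform in space of `(s, y) ↦ 1_{(0,t)}(s) G_{t-s}(x - y)`. -/
def gHat {d : ℕ} (ν : Measure (Rd d)) (c a : ℝ → ℝ) (t : ℝ) (x : Rd d) (s : ℝ) (ξ : Rd d) : ℂ :=
  (Ioo (0 : ℝ) t).indicator (fun s' =>
    Complex.exp (-(Complex.I * ((inner ℝ ξ x : ℝ) : ℂ))) * kHat ν c a (t - s') ξ) s

variable {d : ℕ} {G : ℝ → Measure (Rd d)} {ν : Measure (Rd d)} {c a : ℝ → ℝ}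

lemma IsScaledKernel.integral_eq {E : Type*} [NormedAddCommGroup E] [NormedSpace ℝ E]
    (h : IsScaledKernel G ν c a) {r : ℝ} (hr : 0 < r) {f : Rd d → E}
    (hf : AEStronglyMeasurable f (ν.map (fun y => a r • y))) :
    ∫ y, f y ∂(G r) = c r • ∫ y, f (a r • y) ∂ν := by
  rw [h.eq_map r hr, integral_smul_measure, ENNReal.toReal_ofReal (h.amp_nonneg r),
    integral_map (by fun_prop) hf]

lemma norm_exp_neg_I_mul (θ : ℝ) : ‖Complex.exp (-(Complex.I * (θ : ℂ)))‖ = 1 := by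
  have : -(Complex.I * (θ : ℂ)) = ((-θ : ℝ) : ℂ) * Complex.I := by push_cast; ring
  rw [this, Complex.norm_exp_ofReal_mul_I]

lemma enorm_exp_neg_I_mul (θ : ℝ) : ‖Complex.exp (-(Complex.I * (θ : ℂ)))‖ₑ = 1 := by
  rw [← ofReal_norm, norm_exp_neg_I_mul]; simp

lemma norm_exp_sub_exp_le (θ η : ℝ) :
    ‖Complex.exp (-(Complex.I * (θ : ℂ))) - Complex.exp (-(Complex.I * (η : ℂ)))‖ ≤ |θ - η| := by
  have h1 : Complex.exp (-(Complex.I * (θ : ℂ))) - Complex.exp (-(Complex.I * (η : ℂ))) =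
      Complex.exp (-(Complex.I * (η : ℂ))) * (Complex.exp (Complex.I * ((η - θ : ℝ) : ℂ)) - 1) := by
    rw [mul_sub, ← Complex.exp_add]; push_cast; ring_nf
  rw [h1, norm_mul, norm_exp_neg_I_mul, one_mul, abs_sub_comm]
  exact Real.norm_exp_I_mul_ofReal_sub_one_le

/-- The reflection in `y ↦ G(x - y)` turns the factor `e^{-i⟨ξ,·⟩}` of the Fourier transform into
the factor `e^{+i⟨ξ,·⟩}` of `charFun`, so no conjugate appears. -/
lemma convIntegrand_eq_gHat {eqn : Equation} (h : IsScaledKernel (fundamentalSolution eqn d) ν c a)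
    (t : ℝ) (x : Rd d) : convIntegrand eqn t x = gHat ν c a t x := by
  funext s ξ
  unfold convIntegrand gHat
  by_cases hs : s ∈ Ioo (0 : ℝ) t
  · rw [indicator_of_mem hs, indicator_of_mem hs, h.integral_eq (sub_pos.2 hs.2)
      (Continuous.aestronglyMeasurable (by fun_prop))]
    rw [kHat, charFun_apply, Complex.real_smul, mul_left_comm]
    congr 1
    rw [← integral_const_mul]
    congr 1
    funext y
    rw [← Complex.exp_add, inner_sub_right, real_inner_smul_right, real_inner_smul_right,
      real_inner_comm y ξ]
    push_cast
    ring_nf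
  · rw [indicator_of_notMem hs, indicator_of_notMem hs]

lemma IsScaledKernel.continuous_kHat (h : IsScaledKernel G ν c a) :
    Continuous (fun p : ℝ × Rd d => kHat ν c a p.1 p.2) := by
  have := h.prob
  have h1 := h.amp_cont
  have h2 := h.dil_cont
  unfold kHat
  have h3 : Continuous (charFun ν) := continuous_charFun
  fun_prop

lemma norm_kHat_le [IsProbabilityMeasure ν] (hc : ∀ r, 0 ≤ c r) (r : ℝ) (ξ : Rd d) :
    ‖kHat ν c a r ξ‖ ≤ c r := by
  rw [kHat, norm_mul, Complex.norm_real, Real.norm_eq_abs, abs_of_nonneg (hc r)]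
  exact mul_le_of_le_one_right (hc r) (norm_charFun_le_one _)

lemma IsScaledKernel.measurable_gHat (h : IsScaledKernel G ν c a) (t : ℝ) (x : Rd d) :
    Measurable (fun p : ℝ × Rd d => gHat ν c a t x p.1 p.2) := by
  have h1 : (fun p : ℝ × Rd d => gHat ν c a t x p.1 p.2) =
      (Prod.fst ⁻¹' Ioo (0 : ℝ) t).indicator (fun p : ℝ × Rd d =>
        Complex.exp (-(Complex.I * ((inner ℝ p.2 x : ℝ) : ℂ))) * kHat ν c a (t - p.1) p.2) := by
    funext p
    by_cases hp : p.1 ∈ Ioo (0 : ℝ) t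
    · rw [indicator_of_mem (by exact hp), gHat, indicator_of_mem hp]
    · rw [indicator_of_notMem (by exact hp), gHat, indicator_of_notMem hp]
  rw [h1]
  refine Measurable.indicator (Continuous.measurable ?_) (measurable_fst measurableSet_Ioo)
  have h2 : Continuous (fun p : ℝ × Rd d => kHat ν c a (t - p.1) p.2) :=
    h.continuous_kHat.comp (by fun_prop : Continuous fun p : ℝ × Rd d => (t - p.1, p.2))
  fun_prop

lemma IsScaledKernel.measurable_gHat_left (h : IsScaledKernel G ν c a) (t : ℝ) (x ξ : Rd d) :
    Measurable fun r => gHat ν c a t x r ξ := by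
  have hk : Continuous fun s' => kHat ν c a (t - s') ξ :=
    h.continuous_kHat.comp (by fun_prop : Continuous fun r : ℝ => (t - r, ξ))
  unfold gHat
  exact (hk.measurable.const_mul _).indicator measurableSet_Ioo

lemma lintegral_Ioo_sub_left (s : ℝ) (f : ℝ → ℝ≥0∞) :
    ∫⁻ r in Ioo 0 s, f (s - r) = ∫⁻ r in Ioo 0 s, f r := by
  rw [← lintegral_indicator measurableSet_Ioo, ← lintegral_indicator measurableSet_Ioo,
    ← lintegral_sub_left_eq_self _ s]
  congr 1
  funext r
  have : s - r ∈ Ioo 0 s ↔ r ∈ Ioo 0 s := by simp only [mem_Ioo]; constructor <;> intro h <;> constructor <;> linarith [h.1, h.2]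
  by_cases hr : r ∈ Ioo 0 s
  · rw [indicator_of_mem hr, indicator_of_mem (this.2 hr), sub_sub_cancel]
  · rw [indicator_of_notMem hr, indicator_of_notMem (mt this.1 hr)]

lemma enorm_add_sq_le {E : Type*} [NormedAddCommGroup E] (x y : E) :
    ‖x + y‖ₑ ^ 2 ≤ 2 * (‖x‖ₑ ^ 2 + ‖y‖ₑ ^ 2) := by
  calc ‖x + y‖ₑ ^ 2 ≤ (‖x‖ₑ + ‖y‖ₑ) ^ 2 := by gcongr; exact enorm_add_le x y
    _ ≤ 2 * (‖x‖ₑ ^ 2 + ‖y‖ₑ ^ 2) := by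
        simp only [enorm_eq_nnnorm]
        exact_mod_cast add_sq_le (a := ‖x‖₊) (b := ‖y‖₊)

lemma two_mul_ofReal (x : ℝ) : 2 * ENNReal.ofReal x = ENNReal.ofReal (2 * x) := by
  rw [ENNReal.ofReal_mul (by norm_num)]; simp

lemma enorm_gHat (t : ℝ) (x : Rd d) (s : ℝ) (ξ : Rd d) :
    ‖gHat ν c a t x s ξ‖ₑ = (Ioo (0 : ℝ) t).indicator (fun s => ‖kHat ν c a (t - s) ξ‖ₑ) s := by
  unfold gHat
  by_cases hs : s ∈ Ioo 0 t
  · rw [indicator_of_mem hs, indicator_of_mem hs, enorm_mul, enorm_exp_neg_I_mul, one_mul]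
  · rw [indicator_of_notMem hs, indicator_of_notMem hs, enorm_zero]

lemma lintegral_gHat (t : ℝ) (x ξ : Rd d) :
    ∫⁻ r in Ioi 0, ‖gHat ν c a t x r ξ‖ₑ ^ 2 = ∫⁻ r in Ioo 0 t, ‖kHat ν c a r ξ‖ₑ ^ 2 := by
  rw [← lintegral_Ioo_sub_left t (fun r => ‖kHat ν c a r ξ‖ₑ ^ 2),
    ← lintegral_indicator measurableSet_Ioo, ← lintegral_indicator measurableSet_Ioi]
  congr 1
  funext r
  simp only [enorm_gHat]
  by_cases hr : r ∈ Ioo 0 t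
  · rw [indicator_of_mem hr, indicator_of_mem (show r ∈ Ioi 0 from hr.1), indicator_of_mem hr]
  · rw [indicator_of_notMem hr, indicator]
    split_ifs
    · rw [indicator_of_notMem hr]; simp
    · rfl

lemma IsScaledKernel.lintegral_gHat_le (h : IsScaledKernel G ν c a) (T : ℝ) :
    ∃ C : ℝ, 0 ≤ C ∧ ∀ t ∈ Icc 0 T, ∀ x ξ : Rd d,
      ∫⁻ r in Ioi 0, ‖gHat ν c a t x r ξ‖ₑ ^ 2 ≤ ENNReal.ofReal (C * (1 / (1 + ‖ξ‖ ^ 2))) := by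
  obtain ⟨C, hC, hh⟩ := h.decay T
  refine ⟨C, hC, fun t ht x ξ => ?_⟩
  rw [lintegral_gHat]
  refine (lintegral_mono_set Ioo_subset_Ioc_self).trans (((hh ξ t ht.1 ht.2).1).trans ?_)
  gcongr
  exact min_le_left _ _

/-- For `s ≤ t` the two integrands differ on `(0, s)` by a shift of the kernel by `t - s`, and on
`[s, t)` only the later one survives. These are the two estimates in `decay`, after the time
reversals `r ↦ s - r` and `r ↦ t - r`. -/
lemma IsScaledKernel.lintegral_gHat_sub_time_le (h : IsScaledKernel G ν c a) (T : ℝ) :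
    ∃ C : ℝ, 0 ≤ C ∧ ∀ t ∈ Icc 0 T, ∀ s ∈ Icc 0 T, ∀ x ξ : Rd d,
      ∫⁻ r in Ioi 0, ‖gHat ν c a t x r ξ - gHat ν c a s x r ξ‖ₑ ^ 2 ≤
        ENNReal.ofReal (C * min (1 / (1 + ‖ξ‖ ^ 2)) |t - s|) := by
  obtain ⟨C, hC, hh⟩ := h.decay T
  refine ⟨C + C, by positivity, fun t ht s hs x ξ => ?_⟩
  wlog hst : s ≤ t generalizing s t
  · have := this s hs t ht (le_of_not_ge hst)
    rw [abs_sub_comm]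
    refine le_trans (le_of_eq ?_) this
    congr 1; funext r; rw [← enorm_neg, neg_sub]
  have hδ : 0 ≤ t - s := sub_nonneg.2 hst
  obtain ⟨h1, h2⟩ := hh ξ (t - s) hδ (by linarith [hs.1, ht.2])
  rw [abs_of_nonneg hδ, add_mul, ENNReal.ofReal_add (by positivity) (by positivity)]
  have hk : Measurable fun r => kHat ν c a r ξ :=
    (h.continuous_kHat.comp (by fun_prop : Continuous fun r : ℝ => (r, ξ))).measurable
  have key : ∀ r, (Ioi (0 : ℝ)).indicator
      (fun r => ‖gHat ν c a t x r ξ - gHat ν c a s x r ξ‖ₑ ^ 2) r ≤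
      (Ioo 0 s).indicator (fun r => ‖kHat ν c a (s - r + (t - s)) ξ - kHat ν c a (s - r) ξ‖ₑ ^ 2) r +
      (Ioc 0 (t - s)).indicator (fun r => ‖kHat ν c a r ξ‖ₑ ^ 2) (t - r) := by
    intro r
    by_cases hr : 0 < r
    · rw [indicator_of_mem (show r ∈ Ioi (0 : ℝ) from hr)]
      unfold gHat
      rcases lt_or_ge r s with h3 | h3
      · rw [indicator_of_mem (show r ∈ Ioo 0 t from ⟨hr, h3.trans_le hst⟩),
          indicator_of_mem (show r ∈ Ioo 0 s from ⟨hr, h3⟩),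
          indicator_of_mem (show r ∈ Ioo 0 s from ⟨hr, h3⟩), ← mul_sub, enorm_mul,
          enorm_exp_neg_I_mul, one_mul]
        ring_nf
        exact le_self_add
      · rw [indicator_of_notMem (show r ∉ Ioo 0 s from fun h => absurd h.2 (not_lt.2 h3)), sub_zero]
        refine le_trans ?_ le_add_self
        rcases lt_or_ge r t with h4 | h4
        · rw [indicator_of_mem (show r ∈ Ioo 0 t from ⟨hr, h4⟩),
            indicator_of_mem (show t - r ∈ Ioc 0 (t - s) from ⟨by linarith, by linarith⟩), enorm_mul,
            enorm_exp_neg_I_mul, one_mul]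
        · rw [indicator_of_notMem (show r ∉ Ioo 0 t from fun h => absurd h.2 (not_lt.2 h4))]
          simp
    · rw [indicator_of_notMem (show r ∉ Ioi (0 : ℝ) from hr)]; exact zero_le
  rw [← lintegral_indicator measurableSet_Ioi]
  refine (lintegral_mono key).trans ?_
  rw [lintegral_add_left]
  · rw [add_comm]
    refine add_le_add (le_trans (le_of_eq ?_) h1) (le_trans ?_ h2)
    · rw [lintegral_sub_left_eq_self (fun r => (Ioc 0 (t - s)).indicator
        (fun r => ‖kHat ν c a r ξ‖ₑ ^ 2) r) t, lintegral_indicator measurableSet_Ioc]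
    · rw [lintegral_indicator measurableSet_Ioo, lintegral_Ioo_sub_left s
        (fun r => ‖kHat ν c a (r + (t - s)) ξ - kHat ν c a r ξ‖ₑ ^ 2)]
      exact lintegral_mono_set fun r hr => ⟨hr.1, hr.2.le.trans hs.2⟩
  · refine Measurable.indicator ?_ measurableSet_Ioo
    fun_prop

/-- Moving `x` multiplies the integrand by a difference of characters of modulus `D ≤ min(2,
|ξ||x-y|)`. Then `D² ≤ 2|ξ||x-y| ≤ (1+|ξ|²)|x-y|`, which trades the whole spectral weight for one
power of the distance. -/
lemma IsScaledKernel.lintegral_gHat_sub_space_le (h : IsScaledKernel G ν c a) (T : ℝ) :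
    ∃ C : ℝ, 0 ≤ C ∧ ∀ t ∈ Icc 0 T, ∀ x y ξ : Rd d,
      ∫⁻ r in Ioi 0, ‖gHat ν c a t x r ξ - gHat ν c a t y r ξ‖ₑ ^ 2 ≤
        ENNReal.ofReal (C * min (1 / (1 + ‖ξ‖ ^ 2)) ‖x - y‖) := by
  obtain ⟨C, hC, hh⟩ := h.lintegral_gHat_le T
  refine ⟨4 * C, by positivity, fun t ht x y ξ => ?_⟩
  set D : ℝ := ‖Complex.exp (-(Complex.I * ((inner ℝ ξ x : ℝ) : ℂ))) -
    Complex.exp (-(Complex.I * ((inner ℝ ξ y : ℝ) : ℂ)))‖ with hD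
  have h1 : ∀ r, ‖gHat ν c a t x r ξ - gHat ν c a t y r ξ‖ₑ ^ 2 =
      ENNReal.ofReal (D ^ 2) * ‖gHat ν c a t x r ξ‖ₑ ^ 2 := by
    intro r
    rw [enorm_gHat]
    unfold gHat
    by_cases hr : r ∈ Ioo 0 t
    · rw [indicator_of_mem hr, indicator_of_mem hr, indicator_of_mem hr, ← sub_mul, enorm_mul,
        mul_pow, hD, ENNReal.ofReal_pow (norm_nonneg _), ofReal_norm]
    · rw [indicator_of_notMem hr, indicator_of_notMem hr, indicator_of_notMem hr]; simp
  simp_rw [h1]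
  rw [lintegral_const_mul' _ _ ENNReal.ofReal_ne_top]
  refine (mul_le_mul_right (hh t ht x ξ) _).trans ?_
  rw [← ENNReal.ofReal_mul (by positivity)]
  refine ENNReal.ofReal_le_ofReal ?_
  have hD2 : D ≤ 2 := by
    refine (norm_sub_le _ _).trans ?_
    rw [norm_exp_neg_I_mul, norm_exp_neg_I_mul]; norm_num
  have hD1 : D ≤ ‖ξ‖ * ‖x - y‖ := by
    refine (norm_exp_sub_exp_le _ _).trans ?_
    rw [← inner_sub_right]
    exact abs_real_inner_le_norm _ _
  have hD0 : 0 ≤ D := norm_nonneg _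
  have hp : 0 < 1 + ‖ξ‖ ^ 2 := by positivity
  have h4 : D ^ 2 * (1 / (1 + ‖ξ‖ ^ 2)) ≤ 4 * min (1 / (1 + ‖ξ‖ ^ 2)) ‖x - y‖ := by
    have e1 : D ^ 2 * (1 / (1 + ‖ξ‖ ^ 2)) ≤ 4 * (1 / (1 + ‖ξ‖ ^ 2)) := by
      gcongr; nlinarith
    have e3 : D ^ 2 ≤ 2 * (‖ξ‖ * ‖x - y‖) := by nlinarith
    have e2 : D ^ 2 * (1 / (1 + ‖ξ‖ ^ 2)) ≤ 4 * ‖x - y‖ := by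
      rw [mul_one_div, div_le_iff₀ hp]
      have e4 : 2 * (‖ξ‖ * ‖x - y‖) ≤ (1 + ‖ξ‖ ^ 2) * ‖x - y‖ := by
        rw [← mul_assoc]
        exact mul_le_mul_of_nonneg_right (by linarith [sq_nonneg (‖ξ‖ - 1)]) (norm_nonneg _)
      have e5 : 0 ≤ (1 + ‖ξ‖ ^ 2) * ‖x - y‖ := by positivity
      linarith
    rw [mul_min_of_nonneg _ _ (by norm_num : (0 : ℝ) ≤ 4)]
    exact le_min e1 e2
  calc D ^ 2 * (C * (1 / (1 + ‖ξ‖ ^ 2))) = C * (D ^ 2 * (1 / (1 + ‖ξ‖ ^ 2))) := by ring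
    _ ≤ C * (4 * min (1 / (1 + ‖ξ‖ ^ 2)) ‖x - y‖) := by gcongr
    _ = _ := by ring

lemma IsScaledKernel.lintegral_gHat_sub_le (h : IsScaledKernel G ν c a) (T : ℝ) :
    ∃ C : ℝ, 0 ≤ C ∧ ∀ t ∈ Icc 0 T, ∀ s ∈ Icc 0 T, ∀ x y ξ : Rd d,
      ∫⁻ r in Ioi 0, ‖gHat ν c a t x r ξ - gHat ν c a s y r ξ‖ₑ ^ 2 ≤
        ENNReal.ofReal (C * min (1 / (1 + ‖ξ‖ ^ 2)) (|t - s| + ‖x - y‖)) := by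
  obtain ⟨C1, hC1, h1⟩ := h.lintegral_gHat_sub_time_le T
  obtain ⟨C2, hC2, h2⟩ := h.lintegral_gHat_sub_space_le T
  refine ⟨2 * (C1 + C2), by positivity, fun t ht s hs x y ξ => ?_⟩
  have hm : ∀ t x, Measurable fun r => gHat ν c a t x r ξ := fun t x =>
    h.measurable_gHat_left t x ξ
  have hm2 : Measurable fun r => ‖gHat ν c a t x r ξ - gHat ν c a s x r ξ‖ₑ ^ 2 :=
    ((hm t x).sub (hm s x)).enorm.pow_const 2
  have e1 : ∫⁻ r in Ioi 0, ‖gHat ν c a t x r ξ - gHat ν c a s y r ξ‖ₑ ^ 2 ≤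
      ∫⁻ r in Ioi 0, 2 * (‖gHat ν c a t x r ξ - gHat ν c a s x r ξ‖ₑ ^ 2 +
          ‖gHat ν c a s x r ξ - gHat ν c a s y r ξ‖ₑ ^ 2) := by
    refine lintegral_mono fun r => ?_
    rw [← sub_add_sub_cancel _ (gHat ν c a s x r ξ)]
    exact enorm_add_sq_le _ _
  rw [lintegral_const_mul' _ _ (by norm_num), lintegral_add_left hm2] at e1
  refine e1.trans ((mul_le_mul_right (add_le_add (h1 t ht s hs x ξ) (h2 s hs x y ξ)) 2).trans ?_)
  have hp : 0 < 1 / (1 + ‖ξ‖ ^ 2) := by positivity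
  have e2 : min (1 / (1 + ‖ξ‖ ^ 2)) |t - s| ≤ min (1 / (1 + ‖ξ‖ ^ 2)) (|t - s| + ‖x - y‖) :=
    min_le_min le_rfl (by linarith [norm_nonneg (x - y)])
  have e3 : min (1 / (1 + ‖ξ‖ ^ 2)) ‖x - y‖ ≤ min (1 / (1 + ‖ξ‖ ^ 2)) (|t - s| + ‖x - y‖) :=
    min_le_min le_rfl (by linarith [abs_nonneg (t - s)])
  generalize min (1 / (1 + ‖ξ‖ ^ 2)) (|t - s| + ‖x - y‖) = m at *
  have hn1 : 0 ≤ min (1 / (1 + ‖ξ‖ ^ 2)) |t - s| := le_min hp.le (abs_nonneg _)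
  have hn2 : 0 ≤ min (1 / (1 + ‖ξ‖ ^ 2)) ‖x - y‖ := le_min hp.le (norm_nonneg _)
  rw [← ENNReal.ofReal_add (mul_nonneg hC1 hn1) (mul_nonneg hC2 hn2), two_mul_ofReal]
  refine ENNReal.ofReal_le_ofReal ?_
  have e4 := mul_le_mul_of_nonneg_left e2 hC1
  have e5 := mul_le_mul_of_nonneg_left e3 hC2
  linarith

end AdditiveSPDE

end

noncomputable section

namespace AdditiveSPDE


/-! ### Spectral measures and the Fourier transform of test functions -/

variable {d : ℕ}

/-- The spectral measure `μ` integrates `1 / (1 + |ξ|²)`. -/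
def IsSpectral (μ : Measure (Rd d)) : Prop :=
  ∫⁻ ξ, ENNReal.ofReal (1 / (1 + ‖ξ‖ ^ 2)) ∂μ < ∞

lemma continuous_specWeight : Continuous fun ξ : Rd d => 1 / (1 + ‖ξ‖ ^ 2) :=
  continuous_const.div (by fun_prop) fun ξ => by positivity

/-- The positive density `1/(1+|ξ|²)` makes `μ` finite, and `μ` is recovered from that finite
measure by the inverse density. Tonelli's theorem for `dt ⊗ μ` rests on this. -/
lemma IsSpectral.sigmaFinite {μ : Measure (Rd d)} (h : IsSpectral μ) : SigmaFinite μ := by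
  set f : Rd d → ℝ≥0∞ := fun ξ => ENNReal.ofReal (1 / (1 + ‖ξ‖ ^ 2)) with hf
  have hm : Measurable f := (continuous_specWeight.measurable).ennreal_ofReal
  have h0 : ∀ ξ, f ξ ≠ 0 := fun ξ => by
    have : 0 < 1 / (1 + ‖ξ‖ ^ 2) := by positivity
    simpa [hf] using this
  have : IsFiniteMeasure (μ.withDensity f) := isFiniteMeasure_withDensity h.ne
  have h2 := withDensity_inv_same (μ := μ) hm (ae_of_all _ h0)
    (ae_of_all _ fun ξ => ENNReal.ofReal_ne_top)
  rw [← h2]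
  refine SigmaFinite.withDensity_of_ne_top (ae_of_all _ fun ξ => ?_)
  exact ENNReal.inv_ne_top.2 (h0 ξ)

lemma integrable_exp_mul {f : Rd d → ℝ} (hf : Integrable f) (ξ : Rd d) :
    Integrable fun x => Complex.exp (-(Complex.I * ((inner ℝ ξ x : ℝ) : ℂ))) * ((f x : ℝ) : ℂ) := by
  refine hf.ofReal.bdd_mul (c := 1) (Continuous.aestronglyMeasurable (by fun_prop)) ?_
  exact ae_of_all _ fun x => (norm_exp_neg_I_mul _).le

lemma integral_abs_le_of_support {f : Rd d → ℝ} {B R : ℝ} (hB : ∀ x, |f x| ≤ B)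
    (hR : ∀ x, R < ‖x‖ → f x = 0) :
    ∫ x, |f x| ≤ B * volume.real (Metric.closedBall (0 : Rd d) R) := by
  have h1 : ∀ x, |f x| ≤ (Metric.closedBall (0 : Rd d) R).indicator (fun _ => B) x := by
    intro x
    by_cases hx : x ∈ Metric.closedBall (0 : Rd d) R
    · rw [indicator_of_mem hx]; exact hB x
    · rw [indicator_of_notMem hx, hR x (by simpa using hx), abs_zero]
  refine (integral_mono_of_nonneg (ae_of_all _ fun x => abs_nonneg _) ?_ (ae_of_all _ h1)).trans ?_
  · exact (integrable_indicator_iff measurableSet_closedBall).2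
      (integrableOn_const (measure_closedBall_lt_top).ne)
  · rw [integral_indicator measurableSet_closedBall, setIntegral_const, smul_eq_mul, mul_comm]

/-- The Fourier transform of a Lipschitz function with bounded support decays like `1 / |ξ|`. -/
lemma norm_fourier_sq_le (K : ℝ≥0) (B R : ℝ) : ∃ C : ℝ, 0 ≤ C ∧ ∀ f : Rd d → ℝ,
    LipschitzWith K f → (∀ x, |f x| ≤ B) → (∀ x, R < ‖x‖ → f x = 0) → ∀ ξ : Rd d,
    ‖∫ x, Complex.exp (-(Complex.I * ((inner ℝ ξ x : ℝ) : ℂ))) * ((f x : ℝ) : ℂ)‖ ^ 2 ≤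
      C * (1 / (1 + ‖ξ‖ ^ 2)) := by
  set V := volume.real (Metric.closedBall (0 : Rd d) (R + Real.pi)) with hV
  refine ⟨2 * (B * V) ^ 2 + 2 * (K * Real.pi * V) ^ 2, by positivity, fun f hK hB hR ξ => ?_⟩
  have hB0 : 0 ≤ B := (abs_nonneg _).trans (hB 0)
  have hV0 : 0 ≤ V := measureReal_nonneg
  have hcs : HasCompactSupport f := by
    refine HasCompactSupport.intro (isCompact_closedBall (0 : Rd d) R) fun x hx => hR x ?_
    simpa using hx
  have hfi : Integrable f := hK.continuous.integrable_of_hasCompactSupport hcs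
  set F := ∫ x, Complex.exp (-(Complex.I * ((inner ℝ ξ x : ℝ) : ℂ))) * ((f x : ℝ) : ℂ) with hF
  have hp : 0 < 1 + ‖ξ‖ ^ 2 := by positivity
  have hF1 : ‖F‖ ≤ B * V := by
    refine (norm_integral_le_integral_norm _).trans ?_
    simp only [norm_mul, norm_exp_neg_I_mul, one_mul, Complex.norm_real, Real.norm_eq_abs]
    exact integral_abs_le_of_support hB fun x hx => hR x (by linarith [Real.pi_pos])
  rw [mul_one_div, le_div_iff₀ hp]
  rcases le_or_gt ‖ξ‖ 1 with h1 | h1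
  · have : ‖ξ‖ ^ 2 ≤ 1 := by nlinarith [norm_nonneg ξ]
    have h3 : ‖F‖ ^ 2 ≤ (B * V) ^ 2 := by gcongr
    nlinarith [sq_nonneg (K * Real.pi * V), sq_nonneg ‖F‖]
  · have hξ : 0 < ‖ξ‖ := by linarith
    -- Half a period: `e^{-i⟨ξ,h⟩} = -1`, so `2F` is the transform of `f - f(· + h)`, which is
    -- bounded by `K|h| = Kπ/|ξ|`. A Lipschitz bound thus replaces an integration by parts. Since
    -- `|h| ≤ π`, the difference is supported in the ball of radius `R + π` used for `V`.
    set h : Rd d := (Real.pi / ‖ξ‖ ^ 2) • ξ with hh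
    have hn : ‖h‖ = Real.pi / ‖ξ‖ := by
      rw [hh, norm_smul, Real.norm_eq_abs, abs_of_nonneg (by positivity)]
      field_simp
    have hnpi : ‖h‖ ≤ Real.pi := by
      rw [hn]; exact div_le_self Real.pi_pos.le h1.le
    have hin : inner ℝ ξ h = Real.pi := by
      rw [hh, real_inner_smul_right, real_inner_self_eq_norm_sq]; field_simp
    have hshift : F = -∫ x, Complex.exp (-(Complex.I * ((inner ℝ ξ x : ℝ) : ℂ))) *
        ((f (x + h) : ℝ) : ℂ) := by
      rw [hF, ← integral_add_right_eq_self _ h, ← integral_neg]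
      congr 1
      funext x
      rw [inner_add_right, hin]
      push_cast
      rw [mul_add, neg_add, Complex.exp_add, show -(Complex.I * (Real.pi : ℂ)) = -(Real.pi * Complex.I) by ring,
        Complex.exp_neg (Real.pi * Complex.I), Complex.exp_pi_mul_I]
      norm_num
    have h2F : 2 * F = ∫ x, Complex.exp (-(Complex.I * ((inner ℝ ξ x : ℝ) : ℂ))) *
        ((f x - f (x + h) : ℝ) : ℂ) := by
      rw [two_mul]
      nth_rewrite 2 [hshift]
      rw [← sub_eq_add_neg, hF, ← integral_sub (integrable_exp_mul hfi ξ)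
        (integrable_exp_mul (hfi.comp_add_right h) ξ)]
      congr 1; funext x; push_cast; ring
    have h3 : ‖2 * F‖ ≤ (K * ‖h‖) * V := by
      rw [h2F]
      refine (norm_integral_le_integral_norm _).trans ?_
      simp only [norm_mul, norm_exp_neg_I_mul, one_mul, Complex.norm_real, Real.norm_eq_abs]
      refine integral_abs_le_of_support (fun x => ?_) fun x hx => ?_
      · have := hK.dist_le_mul x (x + h)
        rwa [Real.dist_eq, dist_eq_norm, sub_add_cancel_left, norm_neg] at this
      · rw [hR x (by linarith [Real.pi_pos]), hR (x + h) ?_, sub_zero]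
        have := norm_sub_norm_le x (-h)
        rw [sub_neg_eq_add, norm_neg] at this
        linarith
    rw [norm_mul, hn] at h3
    have h4 : ‖F‖ * ‖ξ‖ ≤ K * Real.pi * V := by
      have : (2 * ‖F‖) * ‖ξ‖ ≤ K * Real.pi * V := by
        have e := mul_le_mul_of_nonneg_right h3 hξ.le
        simp only [Complex.norm_ofNat] at e
        calc _ ≤ _ := e
          _ = _ := by field_simp
      nlinarith [mul_nonneg (norm_nonneg F) hξ.le]
    have h5 : (‖F‖ * ‖ξ‖) ^ 2 ≤ (K * Real.pi * V) ^ 2 := by gcongr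
    have h6 : 1 ≤ ‖ξ‖ ^ 2 := by nlinarith
    nlinarith [sq_nonneg (B * V), mul_le_mul_of_nonneg_left h6 (sq_nonneg ‖F‖)]

lemma exists_bounds_testFn (φ : TestFn d) : ∃ (K : ℝ≥0) (B R : ℝ), 0 ≤ B ∧ 0 ≤ R ∧
    LipschitzWith K φ.1 ∧ (∀ p, |φ.1 p| ≤ B) ∧ ∀ p, R < ‖p‖ → φ.1 p = 0 := by
  obtain ⟨K, hK⟩ := ContDiff.lipschitzWith_of_hasCompactSupport φ.2.2 φ.2.1 (by simp)
  obtain ⟨B, hB⟩ := φ.2.2.exists_bound_of_continuous φ.2.1.continuous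
  obtain ⟨R, hR⟩ := φ.2.2.isCompact.isBounded.subset_closedBall 0
  refine ⟨K, B, max R 0, (norm_nonneg _).trans (hB 0), le_max_right _ _, hK, hB, fun p hp => ?_⟩
  by_contra hne
  have := hR (subset_tsupport _ (Function.mem_support.2 hne))
  rw [mem_closedBall_zero_iff] at this
  exact absurd (hp.trans_le this) (not_lt.2 (le_max_left _ _))

lemma norm_spaceFourier_sq_le (φ : TestFn d) : ∃ C R : ℝ, 0 ≤ C ∧ 0 ≤ R ∧ ∀ t ξ,
    ‖spaceFourier φ t ξ‖ ^ 2 ≤ (Icc (-R) R).indicator (fun _ => C * (1 / (1 + ‖ξ‖ ^ 2))) t := by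
  obtain ⟨K, B, R, hB0, hR0, hK, hB, hR⟩ := exists_bounds_testFn φ
  obtain ⟨C, hC, h⟩ := norm_fourier_sq_le (d := d) K B R
  refine ⟨C, R, hC, hR0, fun t ξ => ?_⟩
  by_cases ht : t ∈ Icc (-R) R
  · rw [indicator_of_mem ht]
    refine h (fun x => φ.1 (t, x)) ?_ (fun x => hB _) (fun x hx => hR _ ?_) ξ
    · have := hK.comp (LipschitzWith.prodMk_left t)
      rwa [mul_one] at this
    · exact hx.trans_le (norm_snd_le (t, x))
  · rw [indicator_of_notMem ht, spaceFourier]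
    have : ∀ x, φ.1 (t, x) = 0 := fun x => hR _ (by
      refine lt_of_lt_of_le ?_ (norm_fst_le (t, x))
      rw [Real.norm_eq_abs]
      by_contra hcon
      exact ht (abs_le.1 (not_lt.1 hcon)))
    simp [this]

lemma continuous_spaceFourier (φ : TestFn d) :
    Continuous fun p : ℝ × Rd d => spaceFourier φ p.1 p.2 := by
  obtain ⟨K, B, R, hB0, hR0, hK, hB, hR⟩ := exists_bounds_testFn φ
  unfold spaceFourier
  have hc := hK.continuous
  refine continuous_of_dominated
    (bound := (Metric.closedBall (0 : Rd d) R).indicator fun _ => B) (fun p => ?_) (fun p => ?_) ?_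
    (ae_of_all _ fun x => ?_)
  · exact Continuous.aestronglyMeasurable (by fun_prop)
  · refine ae_of_all _ fun x => ?_
    rw [norm_mul, norm_exp_neg_I_mul, one_mul, Complex.norm_real]
    by_cases hx : x ∈ Metric.closedBall (0 : Rd d) R
    · rw [indicator_of_mem hx]; exact hB _
    · rw [indicator_of_notMem hx, hR]
      · simp
      · refine lt_of_lt_of_le ?_ (norm_snd_le (p.1, x)); simpa using hx
  · exact (integrable_indicator_iff measurableSet_closedBall).2
      (integrableOn_const (measure_closedBall_lt_top).ne)
  · fun_prop

/-! ### The space-time spectral measure -/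

/-- The measure `dt ⊗ μ(dξ)` on `(0, ∞) × ℝ^d`. -/
def stMeasure (μ : Measure (Rd d)) : Measure (ℝ × Rd d) := (volume.restrict (Ioi (0 : ℝ))).prod μ

/-- The spatial Fourier transform of a test function, as a function of `(t, ξ)`. -/
def stFourier (φ : TestFn d) (p : ℝ × Rd d) : ℂ := spaceFourier φ p.1 p.2

lemma lintegral_stMeasure {μ : Measure (Rd d)} [SFinite μ] {f : ℝ → Rd d → ℝ≥0∞}
    (hf : Measurable fun p : ℝ × Rd d => f p.1 p.2) :
    ∫⁻ p, f p.1 p.2 ∂(stMeasure μ) = ∫⁻ t in Ioi (0 : ℝ), ∫⁻ ξ, f t ξ ∂μ :=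
  lintegral_prod _ hf.aemeasurable

lemma eLpNorm_two_sq {α E : Type*} [MeasurableSpace α] [NormedAddCommGroup E] (f : α → E)
    (m : Measure α) : eLpNorm f 2 m ^ 2 = ∫⁻ x, ‖f x‖ₑ ^ 2 ∂m := by
  have := eLpNorm_nnreal_pow_eq_lintegral (f := f) (μ := m) (p := 2) (by norm_num)
  simpa using this

lemma memLp_stFourier {μ : Measure (Rd d)} (hμ : IsSpectral μ) (φ : TestFn d) :
    MemLp (stFourier φ) 2 (stMeasure μ) := by
  have := hμ.sigmaFinite
  refine ⟨(continuous_spaceFourier φ).aestronglyMeasurable, ?_⟩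
  obtain ⟨C, R, hC, hR, hb⟩ := norm_spaceFourier_sq_le φ
  have h1 : eLpNorm (stFourier φ) 2 (stMeasure μ) ^ 2 < ∞ := by
    rw [eLpNorm_two_sq, stMeasure]
    calc ∫⁻ p, ‖stFourier φ p‖ₑ ^ 2 ∂((volume.restrict (Ioi (0 : ℝ))).prod μ)
        ≤ ∫⁻ p, (Icc (-R) R).indicator (fun _ => 1) p.1 *
            ENNReal.ofReal (C * (1 / (1 + ‖p.2‖ ^ 2))) ∂((volume.restrict (Ioi (0 : ℝ))).prod μ) := by
          refine lintegral_mono fun p => ?_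
          have := hb p.1 p.2
          rw [stFourier, ← ofReal_norm, ← ENNReal.ofReal_pow (norm_nonneg _)]
          refine (ENNReal.ofReal_le_ofReal this).trans ?_
          by_cases hp : p.1 ∈ Icc (-R) R
          · simp only [indicator_of_mem hp, one_mul]; exact le_rfl
          · simp [indicator_of_notMem hp]
      _ = (∫⁻ t in Ioi (0 : ℝ), (Icc (-R) R).indicator (fun _ => 1) t) *
            ∫⁻ ξ, ENNReal.ofReal (C * (1 / (1 + ‖ξ‖ ^ 2))) ∂μ := by
          refine lintegral_prod_mul (μ := volume.restrict (Ioi (0 : ℝ))) (ν := μ)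
            (f := (Icc (-R) R).indicator (fun _ => 1))
            (g := fun ξ : Rd d => ENNReal.ofReal (C * (1 / (1 + ‖ξ‖ ^ 2)))) ?_ ?_
          · exact (measurable_const.indicator measurableSet_Icc).aemeasurable
          · exact ((continuous_specWeight.measurable.const_mul C).ennreal_ofReal).aemeasurable
      _ < ∞ := by
          refine ENNReal.mul_lt_top ?_ ?_
          · rw [lintegral_indicator measurableSet_Icc, setLIntegral_one]
            exact (Measure.restrict_apply_le _ _).trans_lt (by simp)
          · simp_rw [ENNReal.ofReal_mul hC]
            rw [lintegral_const_mul' _ _ ENNReal.ofReal_ne_top]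
            exact ENNReal.mul_lt_top ENNReal.ofReal_lt_top hμ
  by_contra hcon
  rw [not_lt, top_le_iff] at hcon
  rw [hcon] at h1
  simp at h1

end AdditiveSPDE

end

noncomputable section

namespace AdditiveSPDE


/-! ### Wiener integrals -/

variable {d : ℕ} {Ω : Type*} [MeasurableSpace Ω] {P : Measure Ω} {μ : Measure (Rd d)}
  {W : TestFn d → Ω → ℝ}

/-- The test function `α φ + ψ`. -/
def linComb (α : ℝ) (φ ψ : TestFn d) : TestFn d :=
  ⟨fun p => α * φ.1 p + ψ.1 p, (contDiff_const.mul φ.2.1).add ψ.2.1, by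
    have h : HasCompactSupport fun p => α * φ.1 p := φ.2.2.mul_left
    exact h.add ψ.2.2⟩

lemma integrable_testFn (φ : TestFn d) (t : ℝ) : Integrable fun x : Rd d => φ.1 (t, x) := by
  obtain ⟨K, B, R, hB0, hR0, hK, hB, hR⟩ := exists_bounds_testFn φ
  have hc := hK.continuous
  refine Continuous.integrable_of_hasCompactSupport (by fun_prop) ?_
  refine HasCompactSupport.intro (isCompact_closedBall (0 : Rd d) R) fun x hx => hR _ ?_
  refine lt_of_lt_of_le ?_ (norm_snd_le (t, x)); simpa using hx

lemma stFourier_linComb (α : ℝ) (φ ψ : TestFn d) :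
    stFourier (linComb α φ ψ) = (α : ℂ) • stFourier φ + stFourier ψ := by
  funext p
  simp only [stFourier, spaceFourier, linComb, Pi.add_apply, Pi.smul_apply, smul_eq_mul]
  rw [← integral_const_mul, ← integral_add]
  · congr 1; funext x; push_cast; ring
  · exact (integrable_exp_mul (integrable_testFn φ p.1) p.2).const_mul _
  · exact integrable_exp_mul (integrable_testFn ψ p.1) p.2

section Isometry

variable (hW : IsHomogeneousNoise P μ W) (hμ : IsSpectral μ)

include hW in
lemma memLp_noise (φ : TestFn d) : MemLp (W φ) 2 P :=
  (hW.gaussian.hasGaussianLaw_eval φ).memLp_two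

include hW hμ in
-- The arguments are exchanged on the spectral side because `inner ℂ` conjugates its first entry.
-- The spectral inner product is real since it equals a covariance, which is why a real isometry
-- into a complex `L²` space makes sense.
lemma inner_noise (φ ψ : TestFn d) :
    ((inner ℝ ((memLp_noise hW φ).toLp (W φ)) ((memLp_noise hW ψ).toLp (W ψ)) : ℝ) : ℂ) =
      inner ℂ ((memLp_stFourier hμ ψ).toLp (stFourier ψ)) ((memLp_stFourier hμ φ).toLp (stFourier φ)) := by
  have := hμ.sigmaFinite
  rw [L2.inner_def, L2.inner_def]
  have h1 : ∫ ω, inner ℝ ((memLp_noise hW φ).toLp (W φ) ω) ((memLp_noise hW ψ).toLp (W ψ) ω) ∂P =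
      ∫ ω, W φ ω * W ψ ω ∂P := by
    refine integral_congr_ae ?_
    filter_upwards [(memLp_noise hW φ).coeFn_toLp, (memLp_noise hW ψ).coeFn_toLp] with ω h1 h2
    rw [h1, h2, real_inner_eq_re_inner]; simp [mul_comm]
  have h2 : ∫ p, inner ℂ ((memLp_stFourier hμ ψ).toLp (stFourier ψ) p) ((memLp_stFourier hμ φ).toLp (stFourier φ) p)
      ∂(stMeasure μ) = ∫ p, stFourier φ p * (starRingEnd ℂ) (stFourier ψ p) ∂(stMeasure μ) := by
    refine integral_congr_ae ?_
    filter_upwards [(memLp_stFourier hμ φ).coeFn_toLp, (memLp_stFourier hμ ψ).coeFn_toLp]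
      with p h1 h2
    rw [h1, h2, RCLike.inner_apply]
  rw [h1, h2, hW.covariance, stMeasure, integral_prod]
  · rfl
  · have := (memLp_stFourier hμ φ).integrable_mul ((memLp_stFourier hμ ψ).star)
    exact this

include hW hμ in
-- The isometry is stated for three terms so that it covers norms, differences and the linearity of
-- the noise in one computation.
lemma eLpNorm_noise_comb (α β : ℝ) (φ ψ χ : TestFn d) :
    eLpNorm (W φ - α • W ψ - β • W χ) 2 P =
      eLpNorm (stFourier φ - (α : ℂ) • stFourier ψ - (β : ℂ) • stFourier χ) 2 (stMeasure μ) := by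
  have hw : ∀ φ, MemLp (W φ) 2 P := memLp_noise hW
  have hf : ∀ φ, MemLp (stFourier φ) 2 (stMeasure μ) := memLp_stFourier hμ
  have h1 : MemLp (W φ - α • W ψ - β • W χ) 2 P :=
    ((hw φ).sub ((hw ψ).const_smul α)).sub ((hw χ).const_smul β)
  have h2 : MemLp (stFourier φ - (α : ℂ) • stFourier ψ - (β : ℂ) • stFourier χ) 2
    (stMeasure μ) := ((hf φ).sub ((hf ψ).const_smul (α : ℂ))).sub ((hf χ).const_smul (β : ℂ))
  have e1 : h1.toLp _ = (hw φ).toLp _ - α • (hw ψ).toLp _ - β • (hw χ).toLp _ := rfl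
  have e2 : h2.toLp _ = (hf φ).toLp _ - (α : ℂ) • (hf ψ).toLp _ - (β : ℂ) • (hf χ).toLp _ := rfl
  have key : ((‖h1.toLp _‖ : ℂ)) ^ 2 = (‖h2.toLp _‖ : ℂ) ^ 2 := by
    have k1 := inner_self_eq_norm_sq_to_K (𝕜 := ℂ) (h2.toLp _)
    have k2 := real_inner_self_eq_norm_sq (h1.toLp _)
    rw [show ((‖h2.toLp _‖ : ℂ)) ^ 2 = inner ℂ (h2.toLp _) (h2.toLp _) from k1.symm]
    rw [← Complex.ofReal_pow, ← k2, e1, e2]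
    simp only [inner_sub_left, inner_sub_right, inner_smul_left, inner_smul_right]
    push_cast
    simp only [inner_noise hW hμ, RCLike.conj_to_real, Complex.conj_ofReal]
    ring
  have key2 : ‖h1.toLp _‖ = ‖h2.toLp _‖ := by
    have : ‖h1.toLp _‖ ^ 2 = ‖h2.toLp _‖ ^ 2 := by exact_mod_cast key
    exact (pow_left_inj₀ (norm_nonneg _) (norm_nonneg _) two_ne_zero).1 this
  rw [Lp.norm_toLp, Lp.norm_toLp] at key2
  exact (ENNReal.toReal_eq_toReal_iff' h1.2.ne h2.2.ne).1 key2

include hW hμ in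
lemma eLpNorm_noise_sub (φ ψ : TestFn d) :
    eLpNorm (W φ - W ψ) 2 P = eLpNorm (stFourier φ - stFourier ψ) 2 (stMeasure μ) := by
  have := eLpNorm_noise_comb hW hμ 1 0 φ ψ φ
  simpa using this

include hW hμ in
lemma eLpNorm_noise (φ : TestFn d) :
    eLpNorm (W φ) 2 P = eLpNorm (stFourier φ) 2 (stMeasure μ) := by
  have := eLpNorm_noise_comb hW hμ 0 0 φ φ φ
  simpa using this

include hW hμ in
-- Linearity of `φ ↦ W φ` is not part of the definition of the noise. It follows from the
-- covariance: the defect has the `L²` norm of the corresponding defect of Fourier transforms, which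
-- is zero.
lemma noise_linComb (α : ℝ) (φ ψ : TestFn d) :
    W (linComb α φ ψ) =ᵐ[P] α • W φ + W ψ := by
  have h := eLpNorm_noise_comb hW hμ α 1 (linComb α φ ψ) φ ψ
  rw [stFourier_linComb] at h
  have h0 : (α : ℂ) • stFourier φ + stFourier ψ - (α : ℂ) • stFourier φ -
      ((1 : ℝ) : ℂ) • stFourier ψ = 0 := by
    simp
  rw [h0, eLpNorm_zero, eLpNorm_eq_zero_iff _ (by norm_num)] at h
  · filter_upwards [h] with ω hω
    simp only [Pi.sub_apply, Pi.smul_apply, smul_eq_mul, one_mul, Pi.zero_apply] at hω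
    simp only [Pi.add_apply, Pi.smul_apply, smul_eq_mul]
    linarith
  · exact (((memLp_noise hW _).sub ((memLp_noise hW φ).const_smul α)).sub
      ((memLp_noise hW ψ).const_smul 1)).1

end Isometry

lemma tendsto_sq_zero_iff {u : ℕ → ℝ≥0∞} :
    Tendsto (fun k => u k ^ 2) atTop (𝓝 0) ↔ Tendsto u atTop (𝓝 0) := by
  constructor
  · intro h
    have := ((ENNReal.continuous_rpow_const (y := (1 / 2 : ℝ))).tendsto 0).comp h
    simp only [Function.comp_def] at this
    rw [ENNReal.zero_rpow_of_pos (by norm_num)] at this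
    refine this.congr fun k => ?_
    rw [← ENNReal.rpow_natCast, ← ENNReal.rpow_mul]; norm_num
  · intro h
    have := ((ENNReal.continuous_pow 2).tendsto 0).comp h
    simpa [Function.comp_def] using this

lemma lintegral_sub_eq_eLpNorm [SFinite μ] {g : ℝ → Rd d → ℂ}
    (hg : Measurable fun p : ℝ × Rd d => g p.1 p.2) (φ : TestFn d) :
    ∫⁻ t in Ioi (0 : ℝ), ∫⁻ ξ, ‖spaceFourier φ t ξ - g t ξ‖ₑ ^ 2 ∂μ =
      eLpNorm (stFourier φ - fun p => g p.1 p.2) 2 (stMeasure μ) ^ 2 := by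
  rw [eLpNorm_two_sq, ← lintegral_stMeasure]
  · rfl
  · exact (((continuous_spaceFourier φ).measurable.sub hg).enorm.pow_const 2)

lemma isWienerIntegral_iff [SFinite μ] {g : ℝ → Rd d → ℂ}
    (hg : Measurable fun p : ℝ × Rd d => g p.1 p.2) {X : Ω → ℝ} :
    IsWienerIntegral P μ W g X ↔ Measurable X ∧ ∃ φ : ℕ → TestFn d,
      Tendsto (fun k => eLpNorm (stFourier (φ k) - fun p => g p.1 p.2) 2 (stMeasure μ))
        atTop (𝓝 0) ∧
      Tendsto (fun k => eLpNorm (W (φ k) - X) 2 P) atTop (𝓝 0) := by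
  have h : ∀ φ : ℕ → TestFn d,
      Tendsto (fun k => ∫⁻ t in Ioi (0 : ℝ), ∫⁻ ξ, ‖spaceFourier (φ k) t ξ - g t ξ‖ₑ ^ 2 ∂μ)
        atTop (𝓝 0) ↔
      Tendsto (fun k => eLpNorm (stFourier (φ k) - fun p => g p.1 p.2) 2 (stMeasure μ))
        atTop (𝓝 0) := by
    intro φ
    simp_rw [lintegral_sub_eq_eLpNorm hg]
    exact tendsto_sq_zero_iff
  constructor
  · rintro ⟨h1, φ, h2, h3⟩; exact ⟨h1, φ, (h φ).1 h2, h3⟩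
  · rintro ⟨h1, φ, h2, h3⟩; exact ⟨h1, φ, (h φ).2 h2, h3⟩

lemma ne_top_of_tendsto_sub {α E : Type*} [MeasurableSpace α] {m : Measure α}
    [NormedAddCommGroup E] {f : ℕ → α → E} {g : α → E} (hf : ∀ k, MemLp (f k) 2 m)
    (hg : AEStronglyMeasurable g m)
    (h : Tendsto (fun k => eLpNorm (f k - g) 2 m) atTop (𝓝 0)) : eLpNorm g 2 m ≠ ∞ := by
  obtain ⟨k, hk⟩ := (h.eventually_lt_const (show (0 : ℝ≥0∞) < 1 by norm_num)).exists
  have e : g = f k - (f k - g) := by abel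
  rw [e]
  refine ((eLpNorm_sub_le (hf k).1 ((hf k).1.sub hg) (by norm_num)).trans_lt ?_).ne
  exact ENNReal.add_lt_top.2 ⟨(hf k).2, hk.trans (by simp)⟩

lemma tendsto_eLpNorm_of_tendsto_sub {α E : Type*} [MeasurableSpace α] {m : Measure α}
    [NormedAddCommGroup E] {f : ℕ → α → E} {g : α → E} (hf : ∀ k, MemLp (f k) 2 m)
    (hg : AEStronglyMeasurable g m)
    (h : Tendsto (fun k => eLpNorm (f k - g) 2 m) atTop (𝓝 0)) :
    Tendsto (fun k => eLpNorm (f k) 2 m) atTop (𝓝 (eLpNorm g 2 m)) := by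
  have hgf := ne_top_of_tendsto_sub hf hg h
  have l1 : Tendsto (fun k => eLpNorm g 2 m - eLpNorm (f k - g) 2 m) atTop
      (𝓝 (eLpNorm g 2 m)) := by
    have := ENNReal.Tendsto.sub (tendsto_const_nhds (x := eLpNorm g 2 m)) h (Or.inl hgf)
    rwa [tsub_zero] at this
  have l2 : Tendsto (fun k => eLpNorm (f k - g) 2 m + eLpNorm g 2 m) atTop
      (𝓝 (eLpNorm g 2 m)) := by
    have := h.add (tendsto_const_nhds (x := eLpNorm g 2 m))
    rwa [zero_add] at this
  refine tendsto_of_tendsto_of_tendsto_of_le_of_le l1 l2 (fun k => ?_) fun k => ?_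
  · rw [tsub_le_iff_right, ← eLpNorm_neg (f := f k - g)]
    have e : g = f k + -(f k - g) := by abel
    nth_rewrite 1 [e]
    exact eLpNorm_add_le (hf k).1 ((hf k).1.sub hg).neg (by norm_num)
  · have e : f k = (f k - g) + g := by abel
    nth_rewrite 1 [e]
    exact eLpNorm_add_le ((hf k).1.sub hg) hg (by norm_num)

section Properties

variable (hW : IsHomogeneousNoise P μ W) (hμ : IsSpectral μ)

include hW hμ in
-- Two approximating sequences of the same integrand are close to each other in the spectral norm,
-- and the isometry carries this over to the variables.
lemma _root_.IsWienerIntegral.ae_eq {g : ℝ → Rd d → ℂ} (hg : Measurable fun p : ℝ × Rd d => g p.1 p.2)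
    {X Y : Ω → ℝ} (hX : IsWienerIntegral P μ W g X) (hY : IsWienerIntegral P μ W g Y) :
    X =ᵐ[P] Y := by
  have := hμ.sigmaFinite
  obtain ⟨mX, φ, h1, h2⟩ := (isWienerIntegral_iff hg).1 hX
  obtain ⟨mY, ψ, h3, h4⟩ := (isWienerIntegral_iff hg).1 hY
  have hw : ∀ φ, AEStronglyMeasurable (W φ) P := fun φ => (memLp_noise hW φ).1
  have hf : ∀ φ, AEStronglyMeasurable (stFourier φ) (stMeasure μ) :=
    fun φ => (memLp_stFourier hμ φ).1
  have hgm : AEStronglyMeasurable (fun p : ℝ × Rd d => g p.1 p.2) (stMeasure μ) :=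
    hg.aestronglyMeasurable
  have key : ∀ k, eLpNorm (X - Y) 2 P ≤ eLpNorm (W (φ k) - X) 2 P +
      ((eLpNorm (stFourier (φ k) - fun p => g p.1 p.2) 2 (stMeasure μ) +
        eLpNorm (stFourier (ψ k) - fun p => g p.1 p.2) 2 (stMeasure μ)) +
      eLpNorm (W (ψ k) - Y) 2 P) := by
    intro k
    have e1 : X - Y = -(W (φ k) - X) + ((W (φ k) - W (ψ k)) + (W (ψ k) - Y)) := by abel
    have e2 : stFourier (φ k) - stFourier (ψ k) =
        (stFourier (φ k) - fun p => g p.1 p.2) + -(stFourier (ψ k) - fun p => g p.1 p.2) := by abel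
    rw [e1]
    refine (eLpNorm_add_le ((hw _).sub mX.aestronglyMeasurable).neg
      (((hw _).sub (hw _)).add ((hw _).sub mY.aestronglyMeasurable)) (by norm_num)).trans ?_
    rw [eLpNorm_neg]
    gcongr
    refine (eLpNorm_add_le ((hw _).sub (hw _)) ((hw _).sub mY.aestronglyMeasurable)
      (by norm_num)).trans ?_
    gcongr
    rw [eLpNorm_noise_sub hW hμ, e2]
    refine (eLpNorm_add_le ((hf _).sub hgm) ((hf _).sub hgm).neg (by norm_num)).trans ?_
    rw [eLpNorm_neg]
  have lim := h2.add ((h1.add h3).add h4)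
  simp only [add_zero] at lim
  have h0 : eLpNorm (X - Y) 2 P = 0 := le_antisymm (ge_of_tendsto' lim key) zero_le
  rw [eLpNorm_eq_zero_iff (mX.sub mY).aestronglyMeasurable (by norm_num)] at h0
  filter_upwards [h0] with ω hω
  exact sub_eq_zero.1 hω

include hW hμ in
-- By the isometry the variables `W (φ k)` are Cauchy in `L²`. The almost surely convergent
-- subsequence is recorded because measurability with respect to the filtration passes to pointwise
-- limits.
lemma exists_isWienerIntegral {g : ℝ → Rd d → ℂ} (hg : Measurable fun p : ℝ × Rd d => g p.1 p.2)
    (φ : ℕ → TestFn d) (h : Tendsto (fun k => eLpNorm (stFourier (φ k) - fun p => g p.1 p.2) 2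
      (stMeasure μ)) atTop (𝓝 0)) :
    ∃ X, IsWienerIntegral P μ W g X ∧
      ∃ ns : ℕ → ℕ, ∀ᵐ ω ∂P, Tendsto (fun k => W (φ (ns k)) ω) atTop (𝓝 (X ω)) := by
  have := hμ.sigmaFinite
  have hf : ∀ φ, AEStronglyMeasurable (stFourier φ) (stMeasure μ) :=
    fun φ => (memLp_stFourier hμ φ).1
  have hgm : AEStronglyMeasurable (fun p : ℝ × Rd d => g p.1 p.2) (stMeasure μ) :=
    hg.aestronglyMeasurable
  have hev : ∀ N : ℕ, ∃ n : ℕ, ∀ m ≥ n,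
      eLpNorm (stFourier (φ m) - fun p => g p.1 p.2) 2 (stMeasure μ) < 2⁻¹ * 2⁻¹ ^ (N + 1) := by
    intro N
    have := h.eventually_lt_const (show (0 : ℝ≥0∞) < 2⁻¹ * 2⁻¹ ^ (N + 1) from
      ENNReal.mul_pos (by simp) (by simp))
    exact eventually_atTop.1 this
  choose n hn using hev
  -- The supremum puts `nn M` beyond every threshold `n N` with `N ≤ M`; the summand `N` forces the
  -- extraction to tend to infinity.
  set nn : ℕ → ℕ := fun N => N + (Finset.range (N + 1)).sup n with hnn
  have hnn1 : ∀ N M, N ≤ M → n N ≤ nn M := fun N M hNM =>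
    (Finset.le_sup (f := n) (Finset.mem_range.2 (Nat.lt_succ_of_le hNM))).trans
      (Nat.le_add_left _ _)
  have hcau : ∀ N k m : ℕ, N ≤ k → N ≤ m →
      eLpNorm (W (φ (nn k)) - W (φ (nn m))) 2 P < 2⁻¹ ^ (N + 1) := by
    intro N k m hk hm
    rw [eLpNorm_noise_sub hW hμ]
    have e2 : stFourier (φ (nn k)) - stFourier (φ (nn m)) =
        (stFourier (φ (nn k)) - fun p => g p.1 p.2) +
          -(stFourier (φ (nn m)) - fun p => g p.1 p.2) := by abel
    rw [e2]
    refine (eLpNorm_add_le ((hf _).sub hgm) ((hf _).sub hgm).neg (by norm_num)).trans_lt ?_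
    rw [eLpNorm_neg]
    refine (ENNReal.add_lt_add (hn N _ (hnn1 N k hk)) (hn N _ (hnn1 N m hm))).trans_le ?_
    rw [← two_mul, ← mul_assoc, ENNReal.mul_inv_cancel (by norm_num) (by norm_num), one_mul]
  obtain ⟨X, hX, hlim⟩ := Lp.cauchy_complete_eLpNorm (p := 2) (μ := P) (by norm_num)
    (fun k => memLp_noise hW (φ (nn k))) (B := fun N => 2⁻¹ ^ (N + 1))
    (by rw [ENNReal.tsum_geometric_add_one]; norm_num) hcau
  set Y := hX.1.mk X with hY
  have hYm : StronglyMeasurable Y := hX.1.stronglyMeasurable_mk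
  have hlim2 : Tendsto (fun k => eLpNorm (W (φ (nn k)) - Y) 2 P) atTop (𝓝 0) := by
    refine hlim.congr fun k => eLpNorm_congr_ae ?_
    filter_upwards [hX.1.ae_eq_mk] with ω hω
    simp only [Pi.sub_apply, hω, hY]
  have hmono : Tendsto nn atTop atTop :=
    tendsto_atTop_mono (fun N => Nat.le_add_right _ _) tendsto_id
  refine ⟨Y, (isWienerIntegral_iff hg).2 ⟨hYm.measurable, fun k => φ (nn k), h.comp hmono, hlim2⟩,
    ?_⟩
  have htm := tendstoInMeasure_of_tendsto_eLpNorm (p := 2) (by norm_num)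
    (fun k => (memLp_noise hW (φ (nn k))).1) hYm.aestronglyMeasurable hlim2
  obtain ⟨ms, -, hms⟩ := htm.exists_seq_tendsto_ae
  exact ⟨fun k => nn (ms k), hms⟩

include hW hμ in
lemma _root_.IsWienerIntegral.linComb {g h : ℝ → Rd d → ℂ}
    (hg : Measurable fun p : ℝ × Rd d => g p.1 p.2)
    (hh : Measurable fun p : ℝ × Rd d => h p.1 p.2) {X Y : Ω → ℝ}
    (hX : IsWienerIntegral P μ W g X) (hY : IsWienerIntegral P μ W h Y) (α : ℝ) :
    IsWienerIntegral P μ W (fun t ξ => (α : ℂ) * g t ξ + h t ξ) (fun ω => α * X ω + Y ω) := by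
  have := hμ.sigmaFinite
  obtain ⟨mX, φ, h1, h2⟩ := (isWienerIntegral_iff hg).1 hX
  obtain ⟨mY, ψ, h3, h4⟩ := (isWienerIntegral_iff hh).1 hY
  have hw : ∀ φ, AEStronglyMeasurable (W φ) P := fun φ => (memLp_noise hW φ).1
  have hf : ∀ φ, AEStronglyMeasurable (stFourier φ) (stMeasure μ) :=
    fun φ => (memLp_stFourier hμ φ).1
  refine (isWienerIntegral_iff ((hg.const_mul _).add hh)).2
    ⟨(mX.const_mul α).add mY, fun k => AdditiveSPDE.linComb α (φ k) (ψ k), ?_, ?_⟩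
  · have lim := (ENNReal.Tendsto.const_mul (a := ‖(α : ℂ)‖ₑ) h1 (Or.inr enorm_ne_top)).add h3
    simp only [mul_zero, add_zero] at lim
    refine tendsto_of_tendsto_of_tendsto_of_le_of_le tendsto_const_nhds lim (fun _ => zero_le)
      fun k => ?_
    have e : (stFourier (AdditiveSPDE.linComb α (φ k) (ψ k)) -
        fun p : ℝ × Rd d => (α : ℂ) * g p.1 p.2 + h p.1 p.2) =
        (α : ℂ) • (stFourier (φ k) - fun p => g p.1 p.2) +
          (stFourier (ψ k) - fun p => h p.1 p.2) := by
      rw [stFourier_linComb]; funext p; simp; ring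
    simp only [e]
    refine (eLpNorm_add_le (((hf _).sub hg.aestronglyMeasurable).const_smul _)
      ((hf _).sub hh.aestronglyMeasurable) (by norm_num)).trans ?_
    rw [eLpNorm_const_smul]
  · have lim := (ENNReal.Tendsto.const_mul (a := ‖α‖ₑ) h2 (Or.inr enorm_ne_top)).add h4
    simp only [mul_zero, add_zero] at lim
    refine tendsto_of_tendsto_of_tendsto_of_le_of_le tendsto_const_nhds lim (fun _ => zero_le)
      fun k => ?_
    have e : eLpNorm (W (AdditiveSPDE.linComb α (φ k) (ψ k)) - fun ω => α * X ω + Y ω) 2 P =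
        eLpNorm (α • (W (φ k) - X) + (W (ψ k) - Y)) 2 P := by
      refine eLpNorm_congr_ae ?_
      filter_upwards [noise_linComb hW hμ α (φ k) (ψ k)] with ω hω
      simp only [Pi.sub_apply, hω, Pi.add_apply, Pi.smul_apply, smul_eq_mul]
      ring
    simp only [e]
    refine (eLpNorm_add_le (((hw _).sub mX.aestronglyMeasurable).const_smul _)
      ((hw _).sub mY.aestronglyMeasurable) (by norm_num)).trans ?_
    rw [eLpNorm_const_smul]

include hW hμ in
/-- The Wiener integral of `g` is a centered Gaussian variable with variance `‖g‖²`. -/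
lemma _root_.IsWienerIntegral.map_eq [IsProbabilityMeasure P] {g : ℝ → Rd d → ℂ}
    (hg : Measurable fun p : ℝ × Rd d => g p.1 p.2) {X : Ω → ℝ}
    (hX : IsWienerIntegral P μ W g X) :
    P.map X = gaussianReal 0 ((eLpNorm (fun p : ℝ × Rd d => g p.1 p.2) 2
      (stMeasure μ)).toNNReal ^ 2) := by
  have := hμ.sigmaFinite
  obtain ⟨mX, φ, h1, h2⟩ := (isWienerIntegral_iff hg).1 hX
  have hgm : AEStronglyMeasurable (fun p : ℝ × Rd d => g p.1 p.2) (stMeasure μ) :=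
    hg.aestronglyMeasurable
  have hw : ∀ φ, AEStronglyMeasurable (W φ) P := fun φ => (memLp_noise hW φ).1
  have hlaw : ∀ φ, P.map (W φ) =
      gaussianReal 0 ((eLpNorm (stFourier φ) 2 (stMeasure μ)).toNNReal ^ 2) := by
    intro φ
    rw [(hW.gaussian.hasGaussianLaw_eval φ).map_eq_gaussianReal, hW.centered φ]
    congr 1
    rw [variance_of_integral_eq_zero (hw φ).aemeasurable (hW.centered φ)]
    have e := eLpNorm_two_sq (W φ) P
    rw [eLpNorm_noise hW hμ] at e
    rw [← ENNReal.toNNReal_pow, e, integral_eq_lintegral_of_nonneg_ae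
      (ae_of_all _ fun ω => sq_nonneg _) ((hw φ).pow 2)]
    rw [ENNReal.toNNReal_toReal_eq]
    congr 1
    refine lintegral_congr fun ω => ?_
    rw [← enorm_pow, Real.enorm_eq_ofReal (sq_nonneg _)]
  have hnorm : Tendsto (fun k => eLpNorm (stFourier (φ k)) 2 (stMeasure μ)) atTop
      (𝓝 (eLpNorm (fun p : ℝ × Rd d => g p.1 p.2) 2 (stMeasure μ))) :=
    tendsto_eLpNorm_of_tendsto_sub (fun k => (memLp_stFourier hμ (φ k))) hgm h1
  have hgf := ne_top_of_tendsto_sub (fun k => (memLp_stFourier hμ (φ k))) hgm h1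
  have hprob : ∀ φ, IsProbabilityMeasure (P.map (W φ)) := fun φ =>
    Measure.isProbabilityMeasure_map (hw φ).aemeasurable
  have hprobX : IsProbabilityMeasure (P.map X) := Measure.isProbabilityMeasure_map mX.aemeasurable
  have htm := tendstoInMeasure_of_tendsto_eLpNorm (p := 2) (by norm_num)
    (fun k => hw (φ k)) mX.aestronglyMeasurable h2
  have htd := (htm.tendstoInDistribution fun k => (hw (φ k)).aemeasurable).tendsto
  have htd2 := ProbabilityMeasure.tendsto_iff_tendsto_charFun.1 htd
  -- The characteristic functions of `W (φ k)` have two limits: that of `X`, by convergence in `L²`,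
  -- and a Gaussian one, because the variances converge.
  refine Measure.ext_of_charFun (funext fun s => ?_)
  refine tendsto_nhds_unique (htd2 s) ?_
  simp only [ProbabilityMeasure.coe_mk, hlaw, charFun_gaussianReal]
  have hv : Tendsto (fun k => (eLpNorm (stFourier (φ k)) 2 (stMeasure μ)).toNNReal ^ 2) atTop
      (𝓝 ((eLpNorm (fun p : ℝ × Rd d => g p.1 p.2) 2 (stMeasure μ)).toNNReal ^ 2)) :=
    ((ENNReal.tendsto_toNNReal hgf).comp hnorm).pow 2
  have hc : Continuous fun v : ℝ≥0 => Complex.exp (s * ((0 : ℝ) : ℂ) * Complex.I -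
      (v : ℂ) * s ^ 2 / 2) := by
    have : Continuous fun v : ℝ≥0 => ((v : ℝ) : ℂ) :=
      Complex.continuous_ofReal.comp NNReal.continuous_coe
    fun_prop
  exact (hc.tendsto _).comp hv

end Properties

end AdditiveSPDE

end

noncomputable section

namespace AdditiveSPDE


/-! ### Approximation of the stochastic convolution by test functions -/

variable {d : ℕ} {ν : Measure (Rd d)} {c a : ℝ → ℝ}

/-- The Fourier transform of a function on `ℝ^d`. -/
def fourierRd (ψ : Rd d → ℝ) (ξ : Rd d) : ℂ :=
  ∫ x : Rd d, Complex.exp (-(Complex.I * ((inner ℝ ξ x : ℝ) : ℂ))) * ((ψ x : ℝ) : ℂ)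

lemma fourierRd_shift (ψ : Rd d → ℝ) (ξ w : Rd d) :
    ∫ y, Complex.exp (-(Complex.I * ((inner ℝ ξ y : ℝ) : ℂ))) * ((ψ (y - w) : ℝ) : ℂ) =
      Complex.exp (-(Complex.I * ((inner ℝ ξ w : ℝ) : ℂ))) * fourierRd ψ ξ := by
  rw [← integral_add_right_eq_self _ w, fourierRd, ← integral_const_mul]
  congr 1
  funext y
  rw [add_sub_cancel_right, ← mul_assoc, ← Complex.exp_add, inner_add_right]
  push_cast
  ring_nf

lemma exp_inner_sub_smul (ξ x y : Rd d) (α : ℝ) :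
    Complex.exp (-(Complex.I * ((inner ℝ ξ (x - α • y) : ℝ) : ℂ))) =
      Complex.exp (-(Complex.I * ((inner ℝ ξ x : ℝ) : ℂ))) *
        Complex.exp ((inner ℝ y (α • ξ) : ℝ) * Complex.I) := by
  rw [← Complex.exp_add, inner_sub_right, real_inner_smul_right, real_inner_smul_right,
    real_inner_comm y ξ]
  push_cast
  ring_nf

/-- The kernel, seen from `(t, x)`, is the image of `dr ⊗ ν` under `(r, z) ↦ (r, x - a(t-r) z)` with
density `c(t-r)`: a measure of compact support. Its convolution with `ρ ⊗ ψ` is a test function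
whose spatial transform is the product of `fourierRd ψ` and a time average of `gHat`. As `ρ`
vanishes on the positive half-line, the mollification only looks backward and the test function
vanishes from time `t` on. -/
lemma exists_testFn_mollified [IsFiniteMeasure ν] (hc : Continuous c) (ha : Continuous a) {R : ℝ}
    (hν : ∀ᵐ z ∂ν, ‖z‖ ≤ R) {ρ : ℝ → ℝ} (hρ : ContDiff ℝ ((⊤ : ℕ∞) : WithTop ℕ∞) ρ)
    (hρc : HasCompactSupport ρ) (hρ0 : ∀ u, 0 < u → ρ u = 0) {ψ : Rd d → ℝ}
    (hψ : ContDiff ℝ ((⊤ : ℕ∞) : WithTop ℕ∞) ψ) (hψc : HasCompactSupport ψ) {t : ℝ} (x : Rd d) :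
    ∃ φ : TestFn d, (∀ s, t ≤ s → ∀ y, φ.1 (s, y) = 0) ∧ ∀ s ξ, spaceFourier φ s ξ =
      fourierRd ψ ξ * ∫ u, ρ u • gHat ν c a t x (s - u) ξ := by
  obtain ⟨A, hA⟩ : ∃ A, ∀ r ∈ Icc 0 t, ‖a r‖ ≤ A :=
    isCompact_Icc.exists_bound_of_continuousOn ha.continuousOn
  obtain ⟨Cc, hCc⟩ : ∃ A, ∀ r ∈ Icc 0 t, ‖c r‖ ≤ A :=
    isCompact_Icc.exists_bound_of_continuousOn hc.continuousOn
  obtain ⟨R1, hR1⟩ := hρc.isCompact.isBounded.subset_closedBall 0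
  obtain ⟨R2, hR2⟩ := hψc.isCompact.isBounded.subset_closedBall 0
  obtain ⟨B1, hB1⟩ := hρc.exists_bound_of_continuous hρ.continuous
  obtain ⟨B2, hB2⟩ := hψc.exists_bound_of_continuous hψ.continuous
  have hρR : ∀ u, R1 < |u| → ρ u = 0 := fun u hu => by
    by_contra hne
    have := hR1 (subset_tsupport _ (Function.mem_support.2 hne))
    rw [mem_closedBall_zero_iff, Real.norm_eq_abs] at this
    linarith
  have hψR : ∀ u, R2 < ‖u‖ → ψ u = 0 := fun u hu => by
    by_contra hne
    have := hR2 (subset_tsupport _ (Function.mem_support.2 hne))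
    rw [mem_closedBall_zero_iff] at this
    linarith
  set κ : Measure (ℝ × Rd d) := (volume.restrict (Ioo 0 t)).prod ν with hκ
  set w : ℝ × Rd d → Rd d := fun q => x - a (t - q.1) • q.2 with hw
  have hwc : Continuous w := by fun_prop
  have hκae : ∀ᵐ q ∂κ, q.1 ∈ Ioo 0 t ∧ ‖q.2‖ ≤ R := by
    have h1 : ∀ᵐ q ∂κ, q.1 ∈ Ioo 0 t :=
      Measure.quasiMeasurePreserving_fst.ae (ae_restrict_mem measurableSet_Ioo)
    have h2 : ∀ᵐ q ∂κ, ‖q.2‖ ≤ R := Measure.quasiMeasurePreserving_snd.ae hν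
    filter_upwards [h1, h2] with q h1 h2 using ⟨h1, h2⟩
  have hwb : ∀ᵐ q ∂κ, ‖w q‖ ≤ ‖x‖ + A * R := by
    filter_upwards [hκae] with q hq
    refine (norm_sub_le _ _).trans ?_
    rw [norm_smul]
    have := hA (t - q.1) ⟨by linarith [hq.1.2], by linarith [hq.1.1]⟩
    gcongr
    exact (norm_nonneg _).trans this
    exact hq.2
  set F : ℝ × Rd d → ℝ × Rd d → ℝ := fun p q => c (t - q.1) * (ρ (p.1 - q.1) * ψ (p.2 - w q))
    with hF
  set M : Measure (ℝ × Rd d) := κ.map (fun q => (q.1, w q)) with hM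
  set g : ℝ × Rd d → ℝ := fun p => ρ p.1 * ψ p.2 with hg
  have hgs : ContDiff ℝ ((⊤ : ℕ∞) : WithTop ℕ∞) g :=
    (hρ.comp contDiff_fst).mul (hψ.comp contDiff_snd)
  have hgc : HasCompactSupport g := by
    refine HasCompactSupport.intro ((isCompact_closedBall (0 : ℝ) R1).prod
      (isCompact_closedBall (0 : Rd d) R2)) fun p hp => ?_
    simp only [mem_prod, mem_closedBall_zero_iff, not_and_or, not_le, Real.norm_eq_abs] at hp
    rcases hp with hp | hp
    · simp [hg, hρR _ hp]
    · simp [hg, hψR _ hp]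
  have hconv : ContDiff ℝ ((⊤ : ℕ∞) : WithTop ℕ∞) (fun p => ∫ q, F p q ∂κ) := by
    -- Only the smooth factor `g` is differentiated, so the other factor of the convolution may be a
    -- singular measure.
    have h1 := hgc.contDiff_convolution_right (ContinuousLinearMap.mul ℝ ℝ) (μ := M)
      (f := fun q => c (t - q.1)) (n := ⊤) (Continuous.locallyIntegrable (by fun_prop)) hgs
    have h2 : (fun p => ∫ q, F p q ∂κ) =
        convolution (fun q => c (t - q.1)) g (ContinuousLinearMap.mul ℝ ℝ) M := by
      funext p
      have := hgs.continuous
      rw [convolution_def, hM, integral_map (by fun_prop)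
        (Continuous.aestronglyMeasurable (by fun_prop))]
      rfl
    rw [h2]
    exact h1
  have hF0 : ∀ s y, t ≤ s → ∀ᵐ q ∂κ, F (s, y) q = 0 := by
    intro s y hs
    filter_upwards [hκae] with q hq
    simp only [hF]
    rw [hρ0 (s - q.1) (by linarith [hq.1.2])]
    ring
  have hF1 : ∀ s y, R2 + (‖x‖ + A * R) < ‖y‖ → ∀ᵐ q ∂κ, F (s, y) q = 0 := by
    intro s y hs
    filter_upwards [hwb] with q hq
    simp only [hF]
    rw [hψR (y - w q) (by have := norm_sub_norm_le y (w q); linarith)]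
    ring
  have hF2 : ∀ s y, R1 + |t| < |s| → ∀ᵐ q ∂κ, F (s, y) q = 0 := by
    intro s y hs
    filter_upwards [hκae] with q hq
    simp only [hF]
    rw [hρR (s - q.1) ?_]
    · ring
    · have h1 := abs_sub_abs_le_abs_sub s q.1
      have h2 : |q.1| ≤ |t| := by
        rw [abs_of_pos hq.1.1]; exact hq.1.2.le.trans (le_abs_self t)
      linarith
  have hcs : HasCompactSupport (fun p => ∫ q, F p q ∂κ) := by
    refine HasCompactSupport.intro ((isCompact_closedBall (0 : ℝ) (R1 + |t|)).prod
      (isCompact_closedBall (0 : Rd d) (R2 + (‖x‖ + A * R)))) fun p hp => ?_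
    simp only [mem_prod, mem_closedBall_zero_iff, not_and_or, not_le, Real.norm_eq_abs] at hp
    rcases hp with hp | hp
    · exact integral_eq_zero_of_ae (hF2 p.1 p.2 hp)
    · exact integral_eq_zero_of_ae (hF1 p.1 p.2 hp)
  refine ⟨⟨fun p => ∫ q, F p q ∂κ, hconv, hcs⟩, fun s hs y =>
    integral_eq_zero_of_ae (hF0 s y hs), fun s ξ => ?_⟩
  have hρcont := hρ.continuous
  have hψcont := hψ.continuous
  have hint : Integrable (fun z : Rd d × (ℝ × Rd d) =>
      Complex.exp (-(Complex.I * ((inner ℝ ξ z.1 : ℝ) : ℂ))) * ((F (s, z.1) z.2 : ℝ) : ℂ))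
      (volume.prod κ) := by
    have hdom : Integrable (fun z : Rd d × (ℝ × Rd d) =>
        (Metric.closedBall (0 : Rd d) (R2 + (‖x‖ + A * R))).indicator (fun _ => Cc * (B1 * B2)) z.1
          * (1 : ℝ)) (volume.prod κ) :=
      Integrable.mul_prod ((integrable_indicator_iff measurableSet_closedBall).2
        (integrableOn_const (measure_closedBall_lt_top).ne)) (integrable_const (1 : ℝ))
    refine hdom.mono' (Continuous.aestronglyMeasurable (by fun_prop)) ?_
    have hz1 : ∀ᵐ z ∂((volume : Measure (Rd d)).prod κ), z.2.1 ∈ Ioo 0 t ∧ ‖z.2.2‖ ≤ R :=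
      Measure.quasiMeasurePreserving_snd.ae hκae
    have hz2 : ∀ᵐ z ∂((volume : Measure (Rd d)).prod κ), ‖w z.2‖ ≤ ‖x‖ + A * R :=
      Measure.quasiMeasurePreserving_snd.ae hwb
    filter_upwards [hz1, hz2] with z hz1 hz2
    rw [norm_mul, norm_exp_neg_I_mul, one_mul, mul_one, Complex.norm_real]
    by_cases hy : z.1 ∈ Metric.closedBall (0 : Rd d) (R2 + (‖x‖ + A * R))
    · rw [indicator_of_mem hy, hF, norm_mul, norm_mul]
      have h1 := hCc (t - z.2.1) ⟨by linarith [hz1.1.2], by linarith [hz1.1.1]⟩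
      have h2 := hB1 (s - z.2.1)
      have h3 := hB2 (z.1 - w z.2)
      have h0 := (norm_nonneg _).trans h1
      have h02 := (norm_nonneg _).trans h2
      gcongr
    · rw [indicator_of_notMem hy]
      have : R2 + (‖x‖ + A * R) < ‖z.1‖ := by simpa using hy
      simp only [hF]
      rw [hψR (z.1 - w z.2) (by have := norm_sub_norm_le z.1 (w z.2); linarith)]
      simp
  have e1 : spaceFourier (⟨fun p => ∫ q, F p q ∂κ, hconv, hcs⟩ : TestFn d) s ξ =
      ∫ y, ∫ q, Complex.exp (-(Complex.I * ((inner ℝ ξ y : ℝ) : ℂ))) * ((F (s, y) q : ℝ) : ℂ) ∂κ := by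
    unfold spaceFourier
    congr 1
    funext y
    rw [integral_const_mul, integral_complex_ofReal]
  have e2 : ∀ q, ∫ y, Complex.exp (-(Complex.I * ((inner ℝ ξ y : ℝ) : ℂ))) * ((F (s, y) q : ℝ) : ℂ) =
      fourierRd ψ ξ * (((ρ (s - q.1) * c (t - q.1) : ℝ) : ℂ) *
        Complex.exp (-(Complex.I * ((inner ℝ ξ (w q) : ℝ) : ℂ)))) := by
    intro q
    have : ∀ y, Complex.exp (-(Complex.I * ((inner ℝ ξ y : ℝ) : ℂ))) * ((F (s, y) q : ℝ) : ℂ) =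
        ((ρ (s - q.1) * c (t - q.1) : ℝ) : ℂ) *
          (Complex.exp (-(Complex.I * ((inner ℝ ξ y : ℝ) : ℂ))) * ((ψ (y - w q) : ℝ) : ℂ)) := by
      intro y; simp only [hF]; push_cast; ring
    simp_rw [this]
    rw [integral_const_mul, fourierRd_shift]
    ring
  rw [e1, integral_integral_swap hint]
  simp_rw [e2]
  rw [integral_const_mul]
  congr 1
  have hint2 : Integrable (fun q : ℝ × Rd d => ((ρ (s - q.1) * c (t - q.1) : ℝ) : ℂ) *
        Complex.exp (-(Complex.I * ((inner ℝ ξ (w q) : ℝ) : ℂ)))) κ := by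
    refine Integrable.of_bound (Continuous.aestronglyMeasurable (by fun_prop)) (B1 * Cc) ?_
    filter_upwards [hκae] with q hq
    rw [norm_mul, norm_exp_neg_I_mul, mul_one, Complex.norm_real, norm_mul]
    have h1 := hCc (t - q.1) ⟨by linarith [hq.1.2], by linarith [hq.1.1]⟩
    have h2 := hB1 (s - q.1)
    have h02 := (norm_nonneg _).trans h2
    gcongr
  rw [integral_prod _ hint2, ← integral_indicator measurableSet_Ioo,
    ← integral_sub_left_eq_self _ _ s]
  congr 1
  funext r
  unfold gHat
  by_cases hr : s - r ∈ Ioo 0 t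
  · rw [indicator_of_mem hr, indicator_of_mem hr]
    simp only [hw, exp_inner_sub_smul]
    rw [integral_const_mul, integral_const_mul, kHat, charFun_apply, Complex.real_smul,
      sub_sub_cancel]
    push_cast
    ring
  · rw [indicator_of_notMem hr, indicator_of_notMem hr, smul_zero]

end AdditiveSPDE

end

/-! ### Approximation of the kernel in the spectral norm by test functions of the past -/

noncomputable section

namespace AdditiveSPDE


variable {d : ℕ} {μ : Measure (Rd d)} {ν : Measure (Rd d)} {c a : ℝ → ℝ}

/-- `g` is approximated by Fourier transforms of test functions vanishing after time `t`. -/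
def BackApprox (μ : Measure (Rd d)) (t : ℝ) (g : ℝ × Rd d → ℂ) : Prop :=
  ∀ ε : ℝ≥0∞, 0 < ε → ∃ φ : TestFn d, (∀ s, t ≤ s → ∀ y, φ.1 (s, y) = 0) ∧
    eLpNorm (stFourier φ - g) 2 (stMeasure μ) ≤ ε

lemma aestronglyMeasurable_stFourier (φ : TestFn d) (m : Measure (ℝ × Rd d)) :
    AEStronglyMeasurable (stFourier φ) m :=
  (continuous_spaceFourier φ).aestronglyMeasurable

lemma BackApprox.of_tendsto {t : ℝ} {F : ℕ → ℝ × Rd d → ℂ} {g : ℝ × Rd d → ℂ}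
    (hF : ∀ k, BackApprox μ t (F k)) (hFm : ∀ k, Measurable (F k)) (hg : Measurable g)
    (h : Tendsto (fun k => eLpNorm (F k - g) 2 (stMeasure μ)) atTop (𝓝 0)) :
    BackApprox μ t g := by
  intro ε hε
  have hε2 : 0 < ε / 2 := ENNReal.half_pos hε.ne'
  obtain ⟨k, hk⟩ := (h.eventually_le_const hε2).exists
  obtain ⟨φ, h1, h2⟩ := hF k _ hε2
  refine ⟨φ, h1, ?_⟩
  have e : stFourier φ - g = (stFourier φ - F k) + (F k - g) := by abel
  rw [e]
  refine (eLpNorm_add_le ((aestronglyMeasurable_stFourier φ _).sub (hFm k).aestronglyMeasurable)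
    ((hFm k).sub hg).aestronglyMeasurable (by norm_num)).trans ?_
  exact (add_le_add h2 hk).trans (ENNReal.add_halves ε).le

lemma tendsto_eLpNorm_of_dominated {α : Type*} [MeasurableSpace α] {m : Measure α}
    {F : ℕ → α → ℂ} {g : α → ℂ} (H : α → ℝ≥0∞) (hF : ∀ k, Measurable (F k))
    (hg : Measurable g) (hH : ∫⁻ p, H p ∂m ≠ ∞) (hb : ∀ k, ∀ᵐ p ∂m, ‖F k p‖ₑ ^ 2 ≤ H p)
    (hlim : ∀ᵐ p ∂m, Tendsto (fun k => F k p) atTop (𝓝 (g p))) :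
    Tendsto (fun k => eLpNorm (F k - g) 2 m) atTop (𝓝 0) := by
  rw [← tendsto_sq_zero_iff]
  simp_rw [eLpNorm_two_sq]
  have hgb : ∀ᵐ p ∂m, ‖g p‖ₑ ^ 2 ≤ H p := by
    filter_upwards [ae_all_iff.2 hb, hlim] with p h1 h2
    refine le_of_tendsto (((ENNReal.continuous_pow 2).tendsto _).comp
      ((continuous_enorm.tendsto _).comp h2)) (Eventually.of_forall h1)
  have := tendsto_lintegral_of_dominated_convergence (μ := m)
    (F := fun k p => ‖(F k - g) p‖ₑ ^ 2) (f := fun _ => 0) (fun p => 2 * (H p + H p))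
    (fun k => (((hF k).sub hg).enorm.pow_const 2)) (fun k => ?_) ?_ ?_
  · simpa using this
  · filter_upwards [hb k, hgb] with p h1 h2
    rw [Pi.sub_apply, sub_eq_add_neg]
    refine (enorm_add_sq_le _ _).trans ?_
    rw [enorm_neg]
    gcongr
  · have : ∫⁻ p, 2 * (H p + H p) ∂m = 4 * ∫⁻ p, H p ∂m := by
      rw [← lintegral_const_mul' _ _ (by norm_num)]
      congr 1; funext p; ring
    rw [this]
    exact ENNReal.mul_ne_top (by norm_num) hH
  · filter_upwards [hlim] with p hp
    have h1 : Tendsto (fun k => F k p - g p) atTop (𝓝 0) := by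
      simpa using hp.sub_const (g p)
    have h2 := ((ENNReal.continuous_pow 2).tendsto _).comp ((continuous_enorm.tendsto _).comp h1)
    simpa [Function.comp_def] using h2

lemma lintegral_weight_lt_top (hμ : IsSpectral μ) {C : ℝ} (hC : 0 ≤ C) (t : ℝ) :
    ∫⁻ p, (Ioo 0 t).indicator (fun _ => 1) p.1 * ENNReal.ofReal (C * (1 / (1 + ‖p.2‖ ^ 2)))
      ∂(stMeasure μ) < ∞ := by
  have := hμ.sigmaFinite
  rw [stMeasure, lintegral_prod_mul (μ := volume.restrict (Ioi (0 : ℝ))) (ν := μ)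
    (f := (Ioo 0 t).indicator (fun _ => 1))
    (g := fun ξ : Rd d => ENNReal.ofReal (C * (1 / (1 + ‖ξ‖ ^ 2))))
    (measurable_const.indicator measurableSet_Ioo).aemeasurable
    ((continuous_specWeight.measurable.const_mul C).ennreal_ofReal).aemeasurable]
  refine ENNReal.mul_lt_top ?_ ?_
  · rw [lintegral_indicator measurableSet_Ioo, setLIntegral_one]
    exact (Measure.restrict_apply_le _ _).trans_lt (by simp)
  · simp_rw [ENNReal.ofReal_mul hC]
    rw [lintegral_const_mul' _ _ ENNReal.ofReal_ne_top]
    exact ENNReal.mul_lt_top ENNReal.ofReal_lt_top hμ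

lemma continuous_kHat_of_finite [IsFiniteMeasure ν] (hc : Continuous c) (ha : Continuous a) :
    Continuous (fun p : ℝ × Rd d => kHat ν c a p.1 p.2) := by
  unfold kHat
  have h3 : Continuous (charFun ν) := continuous_charFun
  fun_prop

lemma measurable_gHat_of_finite [IsFiniteMeasure ν] (hc : Continuous c) (ha : Continuous a) (t : ℝ)
    (x : Rd d) : Measurable (fun p : ℝ × Rd d => gHat ν c a t x p.1 p.2) := by
  have h1 : (fun p : ℝ × Rd d => gHat ν c a t x p.1 p.2) =
      (Prod.fst ⁻¹' Ioo (0 : ℝ) t).indicator (fun p : ℝ × Rd d =>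
        Complex.exp (-(Complex.I * ((inner ℝ p.2 x : ℝ) : ℂ))) * kHat ν c a (t - p.1) p.2) := by
    funext p
    by_cases hp : p.1 ∈ Ioo (0 : ℝ) t
    · rw [indicator_of_mem (by exact hp), gHat, indicator_of_mem hp]
    · rw [indicator_of_notMem (by exact hp), gHat, indicator_of_notMem hp]
  rw [h1]
  refine Measurable.indicator (Continuous.measurable ?_) (measurable_fst measurableSet_Ioo)
  have h2 : Continuous (fun p : ℝ × Rd d => kHat ν c a (t - p.1) p.2) :=
    (continuous_kHat_of_finite hc ha).comp
      (by fun_prop : Continuous fun p : ℝ × Rd d => (t - p.1, p.2))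
  fun_prop

lemma continuousAt_gHat [IsFiniteMeasure ν] (hc : Continuous c) (ha : Continuous a) {t s : ℝ}
    (x ξ : Rd d) (h0 : s ≠ 0) (ht : s ≠ t) : ContinuousAt (fun s => gHat ν c a t x s ξ) s := by
  have hk : Continuous fun s' => kHat ν c a (t - s') ξ :=
    (continuous_kHat_of_finite hc ha).comp (by fun_prop : Continuous fun r : ℝ => (t - r, ξ))
  unfold gHat
  refine ContinuousOn.continuousAt_indicator (f := fun s' =>
    Complex.exp (-(Complex.I * ((inner ℝ ξ x : ℝ) : ℂ))) * kHat ν c a (t - s') ξ)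
    (Continuous.continuousOn (by fun_prop)) ?_
  rcases le_or_gt t 0 with h | h
  · rw [Ioo_eq_empty (not_lt.2 h)]; simp
  · rw [frontier_Ioo h]; simp [h0, ht]

lemma exists_norm_gHat_le [IsFiniteMeasure ν] (hc : Continuous c) (t : ℝ) :
    ∃ M, 0 ≤ M ∧ ∀ x : Rd d, ∀ s ξ, ‖gHat (ν.restrict univ) c a t x s ξ‖ ≤ M ∧
      ∀ B : Set (Rd d), ‖gHat (ν.restrict B) c a t x s ξ‖ ≤ M := by
  obtain ⟨C, hC⟩ : ∃ A, ∀ r ∈ Icc 0 t, ‖c r‖ ≤ A :=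
    isCompact_Icc.exists_bound_of_continuousOn hc.continuousOn
  have key : ∀ x : Rd d, ∀ s ξ, ∀ B : Set (Rd d),
      ‖gHat (ν.restrict B) c a t x s ξ‖ ≤ |C| * ν.real univ := by
    intro x s ξ B
    unfold gHat
    by_cases hs : s ∈ Ioo 0 t
    · rw [indicator_of_mem hs, norm_mul, norm_exp_neg_I_mul, one_mul, kHat, norm_mul,
        Complex.norm_real]
      have h1 := (hC (t - s) ⟨by linarith [hs.2], by linarith [hs.1]⟩).trans (le_abs_self C)
      have h2 : ‖charFun (ν.restrict B) (a (t - s) • ξ)‖ ≤ ν.real univ := by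
        refine (norm_charFun_le _).trans ?_
        rw [measureReal_restrict_apply_univ]
        exact measureReal_mono (subset_univ _)
      gcongr
    · rw [indicator_of_notMem hs, norm_zero]; positivity
  exact ⟨|C| * ν.real univ, by positivity, fun x s ξ => ⟨key x s ξ univ, key x s ξ⟩⟩

lemma measurable_fourierRd {ψ : Rd d → ℝ} (hψ : Integrable ψ) : Measurable (fourierRd ψ) := by
  refine Continuous.measurable ?_
  unfold fourierRd
  refine continuous_of_dominated (bound := fun x => |ψ x|)
    (fun ξ => (integrable_exp_mul hψ ξ).1) (fun ξ => ae_of_all _ fun x => ?_) hψ.abs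
    (ae_of_all _ fun x => by fun_prop)
  rw [norm_mul, norm_exp_neg_I_mul, one_mul, Complex.norm_real, Real.norm_eq_abs]

lemma exists_norm_fourierRd_sq_le {ψ : Rd d → ℝ}
    (hψ : ContDiff ℝ ((⊤ : ℕ∞) : WithTop ℕ∞) ψ) (hψc : HasCompactSupport ψ) :
    ∃ C, 0 ≤ C ∧ ∀ ξ, ‖fourierRd ψ ξ‖ ^ 2 ≤ C * (1 / (1 + ‖ξ‖ ^ 2)) := by
  obtain ⟨K, hK⟩ := ContDiff.lipschitzWith_of_hasCompactSupport hψc hψ (by simp)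
  obtain ⟨B, hB⟩ := hψc.exists_bound_of_continuous hψ.continuous
  obtain ⟨R, hR⟩ := hψc.isCompact.isBounded.subset_closedBall 0
  obtain ⟨C, hC, h⟩ := norm_fourier_sq_le (d := d) K B R
  refine ⟨C, hC, h ψ hK hB fun x hx => ?_⟩
  by_contra hne
  have := hR (subset_tsupport _ (Function.mem_support.2 hne))
  rw [mem_closedBall_zero_iff] at this
  linarith

/-- A smooth probability density on `(-2ε, 0)`. -/
def timeBump (k : ℕ) : ContDiffBump (-(1 / (k + 1)) : ℝ) where
  rIn := 1 / (2 * (k + 1))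
  rOut := 1 / (k + 1)
  rIn_pos := by positivity
  rIn_lt_rOut := by
    have : (0 : ℝ) < k + 1 := by positivity
    rw [div_lt_div_iff₀ (by positivity) this]; linarith

/-- A smooth probability density on the ball of radius `1 / (k + 1)`. -/
def spaceBump (d k : ℕ) : ContDiffBump (0 : Rd d) where
  rIn := 1 / (2 * (k + 1))
  rOut := 1 / (k + 1)
  rIn_pos := by positivity
  rIn_lt_rOut := by
    have : (0 : ℝ) < k + 1 := by positivity
    rw [div_lt_div_iff₀ (by positivity) this]; linarith

/-- First of three approximations. Restricting `ν` to a ball gives compact support, so that time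
mollification yields test functions. The factor `fourierRd ψ` supplies the decay in `ξ` that makes a
merely bounded kernel dominated; pointwise convergence holds at all times other than the jumps `0`
and `t`. -/
lemma backApprox_truncated (hμ : IsSpectral μ) [IsFiniteMeasure ν] (hc : Continuous c)
    (ha : Continuous a) {R : ℝ} {ψ : Rd d → ℝ} (hψ : ContDiff ℝ ((⊤ : ℕ∞) : WithTop ℕ∞) ψ)
    (hψc : HasCompactSupport ψ) (t : ℝ) (x : Rd d) :
    BackApprox μ t (fun p => fourierRd ψ p.2 *
      gHat (ν.restrict (Metric.closedBall 0 R)) c a t x p.1 p.2) := by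
  set ν' := ν.restrict (Metric.closedBall (0 : Rd d) R) with hν'
  have := hμ.sigmaFinite
  obtain ⟨M, hM, hMb⟩ := exists_norm_gHat_le (ν := ν) (a := a) hc t
  obtain ⟨C, hC, hCb⟩ := exists_norm_fourierRd_sq_le hψ hψc
  have hψi : Integrable ψ := hψ.continuous.integrable_of_hasCompactSupport hψc
  have hae : ∀ᵐ z ∂ν', ‖z‖ ≤ R := by
    filter_upwards [ae_restrict_mem measurableSet_closedBall] with z hz
    simpa using hz
  set ρ : ℕ → ℝ → ℝ := fun k => (timeBump k).normed volume with hρ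
  have hsupp : ∀ k, Function.support (ρ k) = Metric.ball (-(1 / (k + 1)) : ℝ) (1 / (k + 1)) :=
    fun k => (timeBump k).support_normed_eq
  have hρ0 : ∀ k, ∀ u, 0 < u → ρ k u = 0 := by
    intro k u hu
    by_contra hne
    have h1 : u ∈ Metric.ball (-(1 / (k + 1)) : ℝ) (1 / (k + 1)) := hsupp k ▸ hne
    rw [Metric.mem_ball, Real.dist_eq] at h1
    have := (abs_lt.1 h1).2
    linarith
  have hex := fun k => exists_testFn_mollified (ν := ν') hc ha hae (ρ := ρ k)
    (timeBump k).contDiff_normed (timeBump k).hasCompactSupport_normed (hρ0 k) hψ hψc (t := t) x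
  choose φ hφ0 hφ using hex
  -- The density `ρ k` lives on `(-2/(k+1), 0)`, so the average only sees the values of `gHat` at
  -- distance less than `2/(k+1)` from `s`.
  have hconv : ∀ (k : ℕ) (s : ℝ) (ξ : Rd d) {z : ℂ} {ε : ℝ}, 0 ≤ ε → (∀ s' ∈ Metric.ball s (2 / (k + 1)),
      dist (gHat ν' c a t x s' ξ) z ≤ ε) →
      dist (∫ u, ρ k u • gHat ν' c a t x (s - u) ξ) z ≤ ε := by
    intro k s ξ z ε hε hd
    refine dist_convolution_le (f := ρ k) (g := fun s => gHat ν' c a t x s ξ) (x₀ := s)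
      (R := 2 / (k + 1)) hε ?_ (fun u => (timeBump k).nonneg_normed u) (timeBump k).integral_normed
      ?_ hd
    · rw [hsupp]
      refine Metric.ball_subset_ball' ?_
      rw [dist_zero_right, Real.norm_eq_abs, abs_neg, abs_of_nonneg (by positivity)]
      exact le_of_eq (by ring)
    · exact ((measurable_gHat_of_finite hc ha t x).comp
        (measurable_id.prodMk measurable_const : Measurable fun r : ℝ => (r, ξ))).aestronglyMeasurable
  have hgm : Measurable fun p : ℝ × Rd d => fourierRd ψ p.2 * gHat ν' c a t x p.1 p.2 :=
    ((measurable_fourierRd hψi).comp measurable_snd).mul (measurable_gHat_of_finite hc ha t x)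
  have hlim := tendsto_eLpNorm_of_dominated (m := stMeasure μ)
    (F := fun k => stFourier (φ k)) (g := fun p => fourierRd ψ p.2 * gHat ν' c a t x p.1 p.2)
    (fun p => (Ioo 0 t).indicator (fun _ => 1) p.1 *
      ENNReal.ofReal (M ^ 2 * C * (1 / (1 + ‖p.2‖ ^ 2))))
    (fun k => (continuous_spaceFourier (φ k)).measurable) hgm
    (lintegral_weight_lt_top hμ (by positivity) t).ne (fun k => ?_) ?_
  · intro ε hε
    obtain ⟨k, hk⟩ := (hlim.eventually_le_const hε).exists
    exact ⟨φ k, hφ0 k, hk⟩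
  · have h0 : ∀ᵐ p ∂(stMeasure μ), 0 < p.1 :=
      Measure.quasiMeasurePreserving_fst.ae (ae_restrict_mem measurableSet_Ioi)
    filter_upwards [h0] with p hp
    by_cases hpt : p.1 < t
    · rw [indicator_of_mem (show p.1 ∈ Ioo 0 t from ⟨hp, hpt⟩), one_mul, stFourier, hφ,
        ← ofReal_norm, ← ENNReal.ofReal_pow (norm_nonneg _)]
      refine ENNReal.ofReal_le_ofReal ?_
      rw [norm_mul, mul_pow]
      have h1 := hconv k p.1 p.2 (z := 0) hM fun s' _ => by
        rw [dist_zero_right]; exact (hMb x s' p.2).2 _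
      rw [dist_zero_right] at h1
      have h2 := hCb p.2
      calc _ ≤ (C * (1 / (1 + ‖p.2‖ ^ 2))) * M ^ 2 := by gcongr
        _ = _ := by ring
    · have : stFourier (φ k) p = 0 := by
        simp [stFourier, spaceFourier, hφ0 k p.1 (not_lt.1 hpt)]
      rw [this]; simp
  · have h0 : ∀ᵐ p ∂(stMeasure μ), 0 < p.1 ∧ p.1 ≠ t := by
      have h1 : ∀ᵐ s ∂(volume.restrict (Ioi (0 : ℝ))), 0 < s ∧ s ≠ t := by
        filter_upwards [ae_restrict_mem measurableSet_Ioi,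
          ae_restrict_of_ae (Measure.ae_ne volume t)] with s h1 h2 using ⟨h1, h2⟩
      exact Measure.quasiMeasurePreserving_fst.ae h1
    filter_upwards [h0] with p hp
    simp only [stFourier, hφ]
    refine Tendsto.const_mul _ ?_
    rw [Metric.tendsto_atTop]
    intro ε hε
    have hcont := continuousAt_gHat (ν := ν') hc ha x p.2 hp.1.ne' hp.2
    obtain ⟨δ, hδ, hδ2⟩ := Metric.continuousAt_iff.1 hcont (ε / 2) (by positivity)
    obtain ⟨N, hN⟩ := exists_nat_one_div_lt (show 0 < δ / 2 by positivity)
    refine ⟨N, fun k hk => ?_⟩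
    refine (hconv k p.1 p.2 (half_pos hε).le fun s' hs' => (hδ2 ?_).le).trans_lt (half_lt_self hε)
    refine (Metric.mem_ball.1 hs').trans ?_
    have h3 : (1 : ℝ) / (k + 1) ≤ 1 / (N + 1) := by gcongr
    have h4 : (2 : ℝ) / (k + 1) = 2 * (1 / (k + 1)) := by ring
    rw [h4]; linarith

lemma tendsto_charFun_restrict [IsFiniteMeasure ν] (ξ : Rd d) :
    Tendsto (fun k : ℕ => charFun (ν.restrict (Metric.closedBall 0 (k : ℝ))) ξ) atTop
      (𝓝 (charFun ν ξ)) := by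
  simp only [charFun_apply]
  have hmono : Monotone fun k : ℕ => Metric.closedBall (0 : Rd d) (k : ℝ) :=
    fun i j hij => Metric.closedBall_subset_closedBall (by exact_mod_cast hij)
  have hU : ⋃ k : ℕ, Metric.closedBall (0 : Rd d) (k : ℝ) = univ :=
    Metric.iUnion_closedBall_nat 0
  have := tendsto_setIntegral_of_monotone (μ := ν)
    (f := fun z => Complex.exp ((inner ℝ z ξ : ℝ) * Complex.I))
    (s := fun k : ℕ => Metric.closedBall (0 : Rd d) (k : ℝ))
    (fun k => measurableSet_closedBall) hmono ?_
  · rw [hU, setIntegral_univ] at this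
    exact this
  · refine Integrable.integrableOn (Integrable.of_bound
      (Continuous.aestronglyMeasurable (by fun_prop)) 1 (ae_of_all _ fun z => ?_))
    rw [Complex.norm_exp_ofReal_mul_I]

/-- Second approximation: the truncation radius tends to infinity. The characteristic functions of
the restrictions converge pointwise and the same domination applies. -/
lemma backApprox_smooth (hμ : IsSpectral μ) [IsProbabilityMeasure ν] (hc : Continuous c)
    (ha : Continuous a) {ψ : Rd d → ℝ} (hψ : ContDiff ℝ ((⊤ : ℕ∞) : WithTop ℕ∞) ψ)
    (hψc : HasCompactSupport ψ) (t : ℝ) (x : Rd d) :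
    BackApprox μ t (fun p => fourierRd ψ p.2 * gHat ν c a t x p.1 p.2) := by
  have hψi : Integrable ψ := hψ.continuous.integrable_of_hasCompactSupport hψc
  obtain ⟨M, hM, hMb⟩ := exists_norm_gHat_le (ν := ν) (a := a) hc t
  obtain ⟨C, hC, hCb⟩ := exists_norm_fourierRd_sq_le hψ hψc
  have hm : ∀ ν' : Measure (Rd d), IsFiniteMeasure ν' →
      Measurable fun p : ℝ × Rd d => fourierRd ψ p.2 * gHat ν' c a t x p.1 p.2 := fun ν' _ =>
    ((measurable_fourierRd hψi).comp measurable_snd).mul (measurable_gHat_of_finite hc ha t x)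
  refine BackApprox.of_tendsto (fun k : ℕ => backApprox_truncated (ν := ν) (R := k) hμ hc ha hψ hψc
    t x) (fun k => hm _ inferInstance) (hm _ inferInstance) ?_
  refine tendsto_eLpNorm_of_dominated (fun p => (Ioo 0 t).indicator (fun _ => 1) p.1 *
      ENNReal.ofReal (M ^ 2 * C * (1 / (1 + ‖p.2‖ ^ 2)))) (fun k => hm _ inferInstance)
      (hm _ inferInstance) (lintegral_weight_lt_top hμ (by positivity) t).ne (fun k => ?_) ?_
  · refine ae_of_all _ fun p => ?_
    by_cases hp : p.1 ∈ Ioo 0 t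
    · rw [indicator_of_mem hp, one_mul, ← ofReal_norm, ← ENNReal.ofReal_pow (norm_nonneg _)]
      refine ENNReal.ofReal_le_ofReal ?_
      rw [norm_mul, mul_pow]
      have h1 := (hMb x p.1 p.2).2 (Metric.closedBall 0 (k : ℝ))
      have h2 := hCb p.2
      calc _ ≤ (C * (1 / (1 + ‖p.2‖ ^ 2))) * M ^ 2 := by gcongr
        _ = _ := by ring
    · rw [gHat, indicator_of_notMem hp]; simp
  · refine ae_of_all _ fun p => ?_
    refine Tendsto.const_mul _ ?_
    unfold gHat
    by_cases hp : p.1 ∈ Ioo 0 t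
    · simp only [indicator_of_mem hp, kHat]
      exact ((tendsto_charFun_restrict _).const_mul _).const_mul _
    · simp only [indicator_of_notMem hp]; exact tendsto_const_nhds

lemma fourierRd_spaceBump (k : ℕ) (ξ : Rd d) :
    ‖fourierRd ((spaceBump d k).normed volume) ξ‖ ≤ 1 ∧
      ‖fourierRd ((spaceBump d k).normed volume) ξ - 1‖ ≤ ‖ξ‖ * (1 / (k + 1)) := by
  set ψ := (spaceBump d k).normed volume with hψ
  have h0 : ∀ y, 0 ≤ ψ y := (spaceBump d k).nonneg_normed
  have h1 : ∫ y, ψ y = 1 := (spaceBump d k).integral_normed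
  have hi : Integrable ψ := integrable_of_integral_eq_one h1
  constructor
  · refine (norm_integral_le_integral_norm _).trans (le_of_eq ?_)
    rw [← h1]
    congr 1; funext y
    rw [norm_mul, norm_exp_neg_I_mul, one_mul, Complex.norm_real, Real.norm_eq_abs,
      abs_of_nonneg (h0 y)]
  · have e : fourierRd ψ ξ - 1 = ∫ y, (Complex.exp (-(Complex.I * ((inner ℝ ξ y : ℝ) : ℂ))) -
        Complex.exp (-(Complex.I * ((0 : ℝ) : ℂ)))) * ((ψ y : ℝ) : ℂ) := by
      simp_rw [sub_mul]
      rw [integral_sub (integrable_exp_mul hi ξ)]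
      · simp only [Complex.ofReal_zero, mul_zero, neg_zero, Complex.exp_zero, one_mul]
        rw [integral_complex_ofReal, h1, fourierRd]; simp
      · exact hi.ofReal.const_mul _
    rw [e]
    refine (norm_integral_le_integral_norm _).trans ?_
    have h2 : ∀ y, ‖(Complex.exp (-(Complex.I * ((inner ℝ ξ y : ℝ) : ℂ))) -
        Complex.exp (-(Complex.I * ((0 : ℝ) : ℂ)))) * ((ψ y : ℝ) : ℂ)‖ ≤
        ‖ξ‖ * (1 / (k + 1)) * ψ y := by
      intro y
      by_cases hy : y ∈ Metric.ball (0 : Rd d) (1 / (k + 1))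
      · rw [norm_mul, Complex.norm_real, Real.norm_eq_abs, abs_of_nonneg (h0 y)]
        refine mul_le_mul_of_nonneg_right ((norm_exp_sub_exp_le _ _).trans ?_) (h0 y)
        rw [sub_zero]
        refine (abs_real_inner_le_norm _ _).trans ?_
        have : ‖y‖ ≤ 1 / (k + 1) := (mem_ball_zero_iff.1 hy).le
        gcongr
      · have : ψ y = 0 := by
          by_contra hne
          have h3 : y ∈ Function.support ψ := hne
          rw [hψ, (spaceBump d k).support_normed_eq] at h3
          exact hy h3
        simp [this]
    refine (integral_mono_of_nonneg (ae_of_all _ fun y => norm_nonneg _) (hi.const_mul _)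
      (ae_of_all _ h2)).trans ?_
    rw [integral_const_mul, h1, mul_one]

lemma lintegral_stMeasure_symm [SFinite μ] {f : ℝ → Rd d → ℝ≥0∞}
    (hf : Measurable fun p : ℝ × Rd d => f p.1 p.2) :
    ∫⁻ p, f p.1 p.2 ∂(stMeasure μ) = ∫⁻ ξ, (∫⁻ t in Ioi (0 : ℝ), f t ξ) ∂μ :=
  lintegral_prod_symm' _ hf

lemma lintegral_gHat_lt_top {G : ℝ → Measure (Rd d)} (h : IsScaledKernel G ν c a)
    (hμ : IsSpectral μ) (t : ℝ) (x : Rd d) :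
    ∫⁻ p, ‖gHat ν c a t x p.1 p.2‖ₑ ^ 2 ∂(stMeasure μ) < ∞ := by
  have := hμ.sigmaFinite
  rw [lintegral_stMeasure_symm (f := fun s ξ => ‖gHat ν c a t x s ξ‖ₑ ^ 2)
    ((h.measurable_gHat t x).enorm.pow_const 2)]
  obtain ⟨C, hC, hb⟩ := h.lintegral_gHat_le |t|
  rcases le_or_gt 0 t with ht | ht
  · refine (lintegral_mono fun ξ => hb t ⟨ht, le_abs_self t⟩ x ξ).trans_lt ?_
    simp_rw [ENNReal.ofReal_mul hC]
    rw [lintegral_const_mul' _ _ ENNReal.ofReal_ne_top]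
    exact ENNReal.mul_lt_top ENNReal.ofReal_lt_top hμ
  · simp [gHat, Ioo_eq_empty (not_lt.2 ht.le)]

/-- Third approximation: the spatial mollifier is removed. Its transform is bounded by one and tends
to one, so `‖gHat‖²` itself dominates; its integrability uses the decay of the kernel. -/
lemma backApprox_gHat {G : ℝ → Measure (Rd d)} (h : IsScaledKernel G ν c a)
    (hμ : IsSpectral μ) (t : ℝ) (x : Rd d) :
    BackApprox μ t (fun p => gHat ν c a t x p.1 p.2) := by
  have := h.prob
  have hψi : ∀ k, Integrable ((spaceBump d k).normed volume) := fun k =>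
    integrable_of_integral_eq_one (spaceBump d k).integral_normed
  have hm : ∀ k, Measurable fun p : ℝ × Rd d =>
      fourierRd ((spaceBump d k).normed volume) p.2 * gHat ν c a t x p.1 p.2 := fun k =>
    ((measurable_fourierRd (hψi k)).comp measurable_snd).mul (h.measurable_gHat t x)
  refine BackApprox.of_tendsto (fun k => backApprox_smooth hμ h.amp_cont h.dil_cont
    (spaceBump d k).contDiff_normed (spaceBump d k).hasCompactSupport_normed t x) hm
    (h.measurable_gHat t x) ?_
  refine tendsto_eLpNorm_of_dominated (fun p => ‖gHat ν c a t x p.1 p.2‖ₑ ^ 2) hm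
    (h.measurable_gHat t x) (lintegral_gHat_lt_top h hμ t x).ne (fun k => ?_) ?_
  · refine ae_of_all _ fun p => ?_
    rw [enorm_mul]
    have h1 : ‖fourierRd ((spaceBump d k).normed volume) p.2‖ₑ ≤ 1 := by
      rw [← ofReal_norm]
      exact ENNReal.ofReal_le_one.2 (fourierRd_spaceBump k p.2).1
    gcongr
    exact mul_le_of_le_one_left zero_le h1
  · refine ae_of_all _ fun p => ?_
    have h1 : Tendsto (fun k => fourierRd ((spaceBump d k).normed volume) p.2) atTop (𝓝 1) := by
      rw [tendsto_iff_norm_sub_tendsto_zero]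
      refine squeeze_zero (fun k => norm_nonneg _) (fun k => (fourierRd_spaceBump k p.2).2) ?_
      have := (tendsto_one_div_add_atTop_nhds_zero_nat (𝕜 := ℝ)).const_mul ‖p.2‖
      simpa using this
    simpa using h1.mul_const (gHat ν c a t x p.1 p.2)

end AdditiveSPDE

end

noncomputable section

namespace AdditiveSPDE


/-! ### The filtration of the noise and adaptedness of the stochastic convolution -/

variable {d : ℕ} {Ω : Type*} [m0 : MeasurableSpace Ω] {P : Measure Ω} {μ : Measure (Rd d)}
  {W : TestFn d → Ω → ℝ}

lemma _root_.IsWienerIntegral.congr {g : ℝ → Rd d → ℂ} {X Y : Ω → ℝ} (hX : IsWienerIntegral P μ W g X)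
    (hY : Measurable Y) (h : X =ᵐ[P] Y) : IsWienerIntegral P μ W g Y := by
  obtain ⟨mX, φ, h1, h2⟩ := hX
  refine ⟨hY, φ, h1, h2.congr fun k => eLpNorm_congr_ae ?_⟩
  filter_upwards [h] with ω hω
  simp [hω]

lemma noiseFiltration_le (t : ℝ) : noiseFiltration P μ W t ≤ m0 := by
  refine MeasurableSpace.generateFrom_le ?_
  rintro A (hA | ⟨s, hs, φ, X, hX, B, hB, rfl⟩)
  · exact hA.1
  · exact hX.measurable hB

lemma measurableSet_noiseFiltration_of_null [P.IsComplete] (t : ℝ) {A : Set Ω} (hA : P A = 0) :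
    MeasurableSet[noiseFiltration P μ W t] A :=
  MeasurableSpace.measurableSet_generateFrom
    (Or.inl ⟨Measure.IsComplete.out' A hA, hA⟩)

/-- The σ-algebras of the filtration contain the null sets, and completeness makes every subset of a
null set one of them. -/
lemma measurable_noiseFiltration_congr [P.IsComplete] {t : ℝ} {X Y : Ω → ℝ}
    (hX : Measurable[noiseFiltration P μ W t] X) (h : X =ᵐ[P] Y) :
    Measurable[noiseFiltration P μ W t] Y := by
  intro B hB
  have hN : P {ω | X ω ≠ Y ω} = 0 := h
  have e : Y ⁻¹' B = ((X ⁻¹' B) \ {ω | X ω ≠ Y ω}) ∪ (Y ⁻¹' B ∩ {ω | X ω ≠ Y ω}) := by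
    ext ω
    by_cases hω : X ω = Y ω <;> simp [hω]
  rw [e]
  refine @MeasurableSet.union _ (noiseFiltration P μ W t) _ _
    (@MeasurableSet.diff _ (noiseFiltration P μ W t) _ _ (hX hB)
      (measurableSet_noiseFiltration_of_null t hN)) ?_
  exact measurableSet_noiseFiltration_of_null t (measure_mono_null inter_subset_right hN)

/-- The σ-algebra is arbitrary, so the limit stays measurable for a small one: off the measurable
set of convergence the sequence is replaced by zero. -/
lemma exists_measurable_limit {Ω' : Type*} {m : MeasurableSpace Ω'} {f : ℕ → Ω' → ℝ}
    (hf : ∀ k, Measurable (f k)) :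
    ∃ Y : Ω' → ℝ, Measurable Y ∧ ∀ ω l, Tendsto (fun k => f k ω) atTop (𝓝 l) → Y ω = l := by
  set A : Set Ω' := {ω | ∃ l, Tendsto (fun k => f k ω) atTop (𝓝 l)} with hA
  have hAm : MeasurableSet A := measurableSet_exists_tendsto hf
  have hex : ∀ ω, ∃ l, Tendsto (fun k => A.indicator (f k) ω) atTop (𝓝 l) := by
    intro ω
    by_cases hω : ω ∈ A
    · obtain ⟨l, hl⟩ := hω
      refine ⟨l, ?_⟩
      simp only [indicator_of_mem (show ω ∈ A from ⟨l, hl⟩)]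
      exact hl
    · exact ⟨0, by simp only [indicator_of_notMem hω]; exact tendsto_const_nhds⟩
  choose Y hY using hex
  refine ⟨Y, measurable_of_tendsto_metrizable (fun k => (hf k).indicator hAm)
    (tendsto_pi_nhds.2 hY), fun ω l hl => ?_⟩
  have h3 := hY ω
  simp only [indicator_of_mem (show ω ∈ A from ⟨l, hl⟩)] at h3
  exact tendsto_nhds_unique h3 hl

lemma measurable_of_aemeasurable [P.IsComplete] {X : Ω → ℝ} (hX : AEMeasurable X P) :
    Measurable X := fun _ hB => (hX.nullMeasurable hB).measurable_of_complete

section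

variable [P.IsComplete] (hW : IsHomogeneousNoise P μ W)

include hW in
-- At positive times `φ` coincides with `1_{[0,t]} φ`, so `W φ` is itself one of the Wiener
-- integrals generating the σ-algebra at time `t`.
lemma measurable_noise_of_vanish {t : ℝ} (ht : 0 ≤ t) {φ : TestFn d}
    (hφ : ∀ s, t ≤ s → ∀ y, φ.1 (s, y) = 0) :
    Measurable[noiseFiltration P μ W t] (W φ) := by
  have hm : Measurable (W φ) := measurable_of_aemeasurable (hW.gaussian.aemeasurable φ)
  intro B hB
  refine MeasurableSpace.measurableSet_generateFrom (Or.inr ⟨t, ⟨ht, le_rfl⟩, φ, W φ, ?_, B, hB, rfl⟩)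
  refine ⟨hm, fun _ => φ, ?_, by simp⟩
  have h0 : ∀ r ∈ Ioi (0 : ℝ), ∀ ξ, spaceFourier φ r ξ -
      (Icc (0 : ℝ) t).indicator (fun r' => spaceFourier φ r' ξ) r = 0 := by
    intro r hr ξ
    by_cases hrt : r ∈ Icc 0 t
    · rw [indicator_of_mem hrt, sub_self]
    · have : t ≤ r := by
        by_contra hcon
        exact hrt ⟨(le_of_lt hr), (not_le.1 hcon).le⟩
      rw [indicator_of_notMem hrt, sub_zero]
      simp [spaceFourier, hφ r this]
  have : ∫⁻ r in Ioi (0 : ℝ), ∫⁻ ξ, ‖spaceFourier φ r ξ -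
      (Icc (0 : ℝ) t).indicator (fun r' => spaceFourier φ r' ξ) r‖ₑ ^ 2 ∂μ = 0 := by
    rw [setLIntegral_congr_fun (g := fun _ => 0) measurableSet_Ioi]
    · simp
    · intro r hr
      simp [h0 r hr]
  simp only [this]
  exact tendsto_const_nhds

include hW in
-- The approximating test functions vanish after `t`, so their noise variables are measurable at
-- time `t`, and so is a version of their almost sure limit.
lemma exists_stochConv (hμ : IsSpectral μ) {ν : Measure (Rd d)} {c a : ℝ → ℝ}
    {G : ℝ → Measure (Rd d)} (h : IsScaledKernel G ν c a) {t : ℝ} (ht : 0 ≤ t) (x : Rd d) :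
    ∃ X : Ω → ℝ, IsWienerIntegral P μ W (gHat ν c a t x) X ∧
      Measurable[noiseFiltration P μ W t] X := by
  have happ := backApprox_gHat h hμ t x
  have hpos : ∀ k : ℕ, (0 : ℝ≥0∞) < ((k : ℝ≥0∞) + 1)⁻¹ := fun k =>
    ENNReal.inv_pos.2 (ENNReal.add_ne_top.2 ⟨ENNReal.natCast_ne_top k, ENNReal.one_ne_top⟩)
  choose φ h0 hφ using fun k : ℕ => happ _ (hpos k)
  have hlim : Tendsto (fun k => eLpNorm (stFourier (φ k) - fun p => gHat ν c a t x p.1 p.2) 2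
      (stMeasure μ)) atTop (𝓝 0) := by
    refine tendsto_of_tendsto_of_tendsto_of_le_of_le tendsto_const_nhds ?_ (fun _ => zero_le) hφ
    have h1 := ENNReal.tendsto_inv_nat_nhds_zero.comp (tendsto_add_atTop_nat 1)
    simpa [Function.comp_def] using h1
  obtain ⟨X, hX, ns, hns⟩ := exists_isWienerIntegral hW hμ (h.measurable_gHat t x) φ hlim
  have hmk : ∀ k, Measurable[noiseFiltration P μ W t] (W (φ (ns k))) := fun k =>
    measurable_noise_of_vanish hW ht (h0 (ns k))
  obtain ⟨Y, hYm, hY⟩ := exists_measurable_limit (m := noiseFiltration P μ W t) hmk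
  have hXY : X =ᵐ[P] Y := by
    filter_upwards [hns] with ω hω using (hY ω _ hω).symm
  exact ⟨Y, hX.congr (hYm.mono (noiseFiltration_le t) le_rfl) hXY, hYm⟩

end

end AdditiveSPDE

end

/-! ### Multilinear interpolation on dyadic lattices -/

noncomputable section

namespace AdditiveSPDE


variable {D : ℕ}

/-- The tensor product of hat functions. -/
def tent (y : Fin D → ℝ) : ℝ := ∏ i, max 0 (1 - |y i|)

/-- The vertices of the unit cell of the integer lattice that contains `y`. -/
def cell (y : Fin D → ℝ) : Finset (Fin D → ℤ) :=
  Fintype.piFinset fun i => {⌊y i⌋, ⌊y i⌋ + 1}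

lemma tent_nonneg (y : Fin D → ℝ) : 0 ≤ tent y :=
  Finset.prod_nonneg fun _ _ => le_max_left _ _

lemma tent_le_one (y : Fin D → ℝ) : tent y ≤ 1 :=
  Finset.prod_le_one (fun _ _ => le_max_left _ _) fun i _ =>
    max_le zero_le_one (by linarith [abs_nonneg (y i)])

lemma continuous_tent : Continuous (tent : (Fin D → ℝ) → ℝ) := by
  unfold tent; fun_prop

lemma sum_hat (y : ℝ) : ∑ n ∈ ({⌊y⌋, ⌊y⌋ + 1} : Finset ℤ), max 0 (1 - |y - (n : ℝ)|) = 1 := by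
  rw [Finset.sum_pair (by omega)]
  have h1 := Int.floor_le y
  have h2 := Int.lt_floor_add_one y
  push_cast
  rw [abs_of_nonneg (by linarith), abs_of_nonpos (by linarith), max_eq_right (by linarith),
    max_eq_right (by linarith)]
  ring

lemma sum_tent (y : Fin D → ℝ) : ∑ m ∈ cell y, tent (fun i => y i - (m i : ℝ)) = 1 := by
  have := Finset.prod_univ_sum (fun i => ({⌊y i⌋, ⌊y i⌋ + 1} : Finset ℤ))
    (fun i (n : ℤ) => max 0 (1 - |y i - (n : ℝ)|))
  simp only [sum_hat, Finset.prod_const_one] at this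
  exact this.symm

lemma tent_eq_zero {y : Fin D → ℝ} {m : Fin D → ℤ} (hm : m ∉ cell y) :
    tent (fun i => y i - (m i : ℝ)) = 0 := by
  simp only [cell, Fintype.mem_piFinset, not_forall, Finset.mem_insert, Finset.mem_singleton,
    not_or] at hm
  obtain ⟨i, h1, h2⟩ := hm
  refine Finset.prod_eq_zero (Finset.mem_univ i) (max_eq_left ?_)
  have h3 := Int.floor_le (y i)
  have h4 := Int.lt_floor_add_one (y i)
  rcases lt_or_ge (m i) ⌊y i⌋ with h | h
  · have : (m i : ℝ) + 1 ≤ ⌊y i⌋ := by exact_mod_cast h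
    have := le_abs_self (y i - (m i : ℝ))
    linarith
  · have h5 : ⌊y i⌋ + 2 ≤ m i := by omega
    have : (⌊y i⌋ : ℝ) + 2 ≤ m i := by exact_mod_cast h5
    have := neg_le_abs (y i - (m i : ℝ))
    linarith

lemma abs_sub_le_of_mem_cell {y : Fin D → ℝ} {m : Fin D → ℤ} (hm : m ∈ cell y) (i : Fin D) :
    |y i - (m i : ℝ)| ≤ 1 := by
  simp only [cell, Fintype.mem_piFinset, Finset.mem_insert, Finset.mem_singleton] at hm
  have h3 := Int.floor_le (y i)
  have h4 := Int.lt_floor_add_one (y i)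
  rw [abs_le]
  rcases hm i with h | h <;> rw [h] <;> push_cast <;> constructor <;> linarith

/-- Multilinear interpolation of a function on the integer lattice. -/
def interp (F : (Fin D → ℤ) → ℝ) (y : Fin D → ℝ) : ℝ :=
  ∑ m ∈ cell y, tent (fun i => y i - (m i : ℝ)) * F m

/-- All tents outside the cell of `y` vanish at `y`, so a sum over a fixed finite set interpolates
the values extended by zero. The fixed set makes the interpolation depend on finitely many values.
-/
lemma sum_eq_interp {F : (Fin D → ℤ) → ℝ} (B : Finset (Fin D → ℤ)) (y : Fin D → ℝ) :
    ∑ m ∈ B, tent (fun i => y i - (m i : ℝ)) * F m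
      = interp (fun m => if m ∈ B then F m else 0) y := by
  classical
  unfold interp
  have h1 : ∑ m ∈ B, tent (fun i => y i - (m i : ℝ)) * F m
      = ∑ m ∈ B ∪ cell y, tent (fun i => y i - (m i : ℝ)) * (if m ∈ B then F m else 0) := by
    rw [← Finset.sum_subset (Finset.subset_union_left (s₁ := B) (s₂ := cell y))]
    · exact Finset.sum_congr rfl fun m hm => by rw [if_pos hm]
    · intro m _ hm; rw [if_neg hm, mul_zero]
  rw [h1]
  symm
  refine Finset.sum_subset Finset.subset_union_right fun m _ hm => ?_
  rw [tent_eq_zero hm, zero_mul]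

lemma interp_const (a : ℝ) (y : Fin D → ℝ) : interp (fun _ => a) y = a := by
  unfold interp; rw [← Finset.sum_mul, sum_tent, one_mul]

/-- Both interpolations are convex combinations, so their difference is the average of the pairwise
differences for the product weights. -/
lemma abs_interp_sub_le {F G : (Fin D → ℤ) → ℝ} {y z : Fin D → ℝ} {M : ℝ}
    (h : ∀ m ∈ cell y, ∀ n ∈ cell z, |F m - G n| ≤ M) : |interp F y - interp G z| ≤ M := by
  have h1 : interp F y - interp G z = ∑ m ∈ cell y, ∑ n ∈ cell z,
      tent (fun i => y i - (m i : ℝ)) * tent (fun i => z i - (n i : ℝ)) * (F m - G n) := by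
    have e1 : interp F y = ∑ m ∈ cell y, ∑ n ∈ cell z,
      tent (fun i => y i - (m i : ℝ)) * tent (fun i => z i - (n i : ℝ)) * F m := by
      refine Finset.sum_congr rfl fun m _ => ?_
      rw [← Finset.sum_mul, ← Finset.mul_sum, sum_tent, mul_one]
    have e2 : interp G z = ∑ m ∈ cell y, ∑ n ∈ cell z,
      tent (fun i => y i - (m i : ℝ)) * tent (fun i => z i - (n i : ℝ)) * G n := by
      rw [Finset.sum_comm]
      refine Finset.sum_congr rfl fun n _ => ?_
      rw [← Finset.sum_mul, ← Finset.sum_mul, sum_tent, one_mul]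
    rw [e1, e2, ← Finset.sum_sub_distrib]
    refine Finset.sum_congr rfl fun m _ => ?_
    rw [← Finset.sum_sub_distrib]
    exact Finset.sum_congr rfl fun n _ => by ring
  rw [h1]
  calc _ ≤ ∑ m ∈ cell y, ∑ n ∈ cell z,
      tent (fun i => y i - (m i : ℝ)) * tent (fun i => z i - (n i : ℝ)) * M := by
        refine (Finset.abs_sum_le_sum_abs _ _).trans (Finset.sum_le_sum fun m hm => ?_)
        refine (Finset.abs_sum_le_sum_abs _ _).trans (Finset.sum_le_sum fun n hn => ?_)
        rw [abs_mul, abs_of_nonneg (mul_nonneg (tent_nonneg _) (tent_nonneg _))]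
        exact mul_le_mul_of_nonneg_left (h m hm n hn) (mul_nonneg (tent_nonneg _) (tent_nonneg _))
    _ = M := by
        simp_rw [← Finset.sum_mul, ← Finset.mul_sum, sum_tent]
        simp only [mul_one, sum_tent, one_mul]

/-- The dyadic point `m 2^{-k}`. -/
def dyad (k : ℕ) (m : Fin D → ℤ) : Fin D → ℝ := fun i => (m i : ℝ) / 2 ^ k

/-- The lattice points `m` for which the dyadic point `m 2^{-k}` has norm at most `2^k`. -/
def box (D k : ℕ) : Finset (Fin D → ℤ) := Fintype.piFinset fun _ => Finset.Icc (-4 ^ k) (4 ^ k)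

lemma card_box_le (k : ℕ) : ((box D k).card : ℝ) ≤ (3 * 4 ^ k) ^ D := by
  have : (box D k).card = (2 * 4 ^ k + 1) ^ D := by
    simp only [box, Fintype.card_piFinset, Int.card_Icc, Finset.prod_const, Finset.card_univ,
      Fintype.card_fin]
    congr 1
    have : (4 : ℤ) ^ k + 1 - -4 ^ k = ((2 * 4 ^ k + 1 : ℕ) : ℤ) := by push_cast; ring
    rw [this, Int.toNat_natCast]
  rw [this]; push_cast
  have : (1 : ℝ) ≤ 4 ^ k := one_le_pow₀ (by norm_num)
  gcongr
  linarith

lemma mem_box_iff (k : ℕ) (m : Fin D → ℤ) : m ∈ box D k ↔ ‖dyad k m‖ ≤ 2 ^ k := by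
  have h0 : (0 : ℝ) < 2 ^ k := by positivity
  rw [pi_norm_le_iff_of_nonneg h0.le]
  simp only [box, Fintype.mem_piFinset, Finset.mem_Icc, dyad]
  refine forall_congr' fun i => ?_
  rw [Real.norm_eq_abs, abs_div, abs_of_pos h0, div_le_iff₀ h0, ← mul_pow, ← abs_le]
  norm_num
  rw [← Int.cast_abs]
  norm_cast

lemma norm_sub_dyad_le {k : ℕ} {x : Fin D → ℝ} {m : Fin D → ℤ}
    (hm : m ∈ cell (fun i => 2 ^ k * x i)) : ‖x - dyad k m‖ ≤ (1 / 2) ^ k := by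
  have h0 : (0 : ℝ) < 2 ^ k := by positivity
  rw [pi_norm_le_iff_of_nonneg (by positivity)]
  intro i
  have h := abs_sub_le_of_mem_cell hm i
  have e : x i - (m i : ℝ) / 2 ^ k = (2 ^ k * x i - m i) / 2 ^ k := by field_simp
  rw [Pi.sub_apply, dyad, Real.norm_eq_abs, e, abs_div, abs_of_pos h0, one_div, inv_pow,
    ← one_div]
  gcongr

/-- The bounded continuous function `x ↦ tent (2^k x - m)`. -/
def tentB (k : ℕ) (m : Fin D → ℤ) : BoundedContinuousFunction (Fin D → ℝ) ℝ :=
  BoundedContinuousFunction.ofNormedAddCommGroup (fun x => tent (fun i => 2 ^ k * x i - (m i : ℝ)))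
    (continuous_tent.comp (by fun_prop)) 1 fun x => by
      rw [Real.norm_eq_abs, abs_of_nonneg (tent_nonneg _)]; exact tent_le_one _

/-- The interpolation at level `k` of the values at the dyadic points. -/
def dyadicInterp (k : ℕ) (y : (Fin D → ℤ) → ℝ) : BoundedContinuousFunction (Fin D → ℝ) ℝ :=
  ∑ m ∈ box D k, y m • tentB k m

lemma dyadicInterp_apply (k : ℕ) (y : (Fin D → ℤ) → ℝ) (x : Fin D → ℝ) :
    dyadicInterp k y x =
      interp (fun m => if m ∈ box D k then y m else 0) (fun i => 2 ^ k * x i) := by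
  rw [← sum_eq_interp]
  simp only [dyadicInterp, BoundedContinuousFunction.coe_sum, Finset.sum_apply]
  refine Finset.sum_congr rfl fun m _ => ?_
  rw [mul_comm]; rfl

/-- Pairs of neighbouring dyadic points of consecutive levels. -/
def nearPairs (D k : ℕ) : Finset ((Fin D → ℤ) × (Fin D → ℤ)) := by
  classical
  exact (box D (k + 1) ×ˢ box D k).filter fun q => ‖dyad (k + 1) q.1 - dyad k q.2‖ ≤ 2 * (1 / 2) ^ k

/-- Dyadic points of level `k + 1` outside a large ball. -/
def farPoints (D k : ℕ) : Finset (Fin D → ℤ) := by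
  classical
  exact (box D (k + 1)).filter fun m => (2 : ℝ) ^ k - 2 ≤ ‖dyad (k + 1) m‖

/-- The sum that controls the difference of two consecutive interpolations. -/
def chainSum (Y : (Fin D → ℝ) → ℝ) (N k : ℕ) : ℝ :=
  ∑ q ∈ nearPairs D k, |Y (dyad (k + 1) q.1) - Y (dyad k q.2)| ^ N
    + ∑ m ∈ farPoints D k, |Y (dyad (k + 1) m)| ^ N

/-- A maximum is replaced by a sum of `N`-th powers, whose expectation is easy to bound. For
vertices `m`, `n` of the cells of one point at levels `k + 1` and `k`, either both lie in their
boxes and form a near pair, or only `n` has left its box and `m` is then a far point, or both values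
are zero. If only `m` had left its box, the distance would exceed `2^{k+1} - 2^k`, which is too much
for neighbours. -/
lemma norm_dyadicInterp_sub_pow_le (Y : (Fin D → ℝ) → ℝ) {N : ℕ} (hN : N ≠ 0) {k : ℕ} (hk : 1 ≤ k) :
    ‖dyadicInterp (k + 1) (fun m => Y (dyad (k + 1) m)) - dyadicInterp k (fun m => Y (dyad k m))‖ ^ N
      ≤ chainSum Y N k := by
  classical
  have hs1 : 0 ≤ ∑ q ∈ nearPairs D k, |Y (dyad (k + 1) q.1) - Y (dyad k q.2)| ^ N :=
    Finset.sum_nonneg fun _ _ => by positivity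
  have hs2 : 0 ≤ ∑ m ∈ farPoints D k, |Y (dyad (k + 1) m)| ^ N :=
    Finset.sum_nonneg fun _ _ => by positivity
  have hA : 0 ≤ chainSum Y N k := add_nonneg hs1 hs2
  set M := chainSum Y N k ^ (1 / (N : ℝ)) with hM
  have hM0 : 0 ≤ M := by positivity
  have hMN : M ^ N = chainSum Y N k := by
    rw [hM, one_div, Real.rpow_inv_natCast_pow hA hN]
  rw [← hMN]
  have key : ∀ z : ℝ, |z| ^ N ≤ chainSum Y N k → |z| ≤ M := fun z hz => by
    rw [← hMN] at hz; exact le_of_pow_le_pow_left₀ hN hM0 hz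
  refine pow_le_pow_left₀ (norm_nonneg _) ?_ N
  rw [BoundedContinuousFunction.norm_le hM0]
  intro x
  rw [BoundedContinuousFunction.sub_apply, dyadicInterp_apply, dyadicInterp_apply, Real.norm_eq_abs]
  refine abs_interp_sub_le fun m hm n hn => ?_
  have h1 := norm_sub_dyad_le hm
  have h2 := norm_sub_dyad_le hn
  have h3 : ‖dyad (k + 1) m - dyad k n‖ ≤ 2 * (1 / 2) ^ k := by
    have e : dyad (k + 1) m - dyad k n = (x - dyad k n) - (x - dyad (k + 1) m) := by abel
    rw [e]
    refine (norm_sub_le _ _).trans ?_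
    have : ((1 : ℝ) / 2) ^ (k + 1) ≤ (1 / 2) ^ k := pow_le_pow_of_le_one (by norm_num) (by norm_num)
      (by omega)
    linarith
  have hhalf : ((1 : ℝ) / 2) ^ k ≤ 1 / 2 := by
    calc ((1 : ℝ) / 2) ^ k ≤ (1 / 2) ^ 1 := pow_le_pow_of_le_one (by norm_num) (by norm_num) hk
      _ = 1 / 2 := by norm_num
  have h2k : (2 : ℝ) ≤ 2 ^ k := by
    calc (2 : ℝ) = 2 ^ 1 := by norm_num
      _ ≤ 2 ^ k := pow_le_pow_right₀ (by norm_num) hk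
  by_cases hm' : m ∈ box D (k + 1) <;> by_cases hn' : n ∈ box D k
  · rw [if_pos hm', if_pos hn']
    refine key _ ?_
    have hq : (m, n) ∈ nearPairs D k := by
      simp only [nearPairs, Finset.mem_filter, Finset.mem_product]
      exact ⟨⟨hm', hn'⟩, h3⟩
    have := Finset.single_le_sum (f := fun q : (Fin D → ℤ) × (Fin D → ℤ) =>
      |Y (dyad (k + 1) q.1) - Y (dyad k q.2)| ^ N) (fun _ _ => by positivity) hq
    unfold chainSum
    simp only at this
    linarith
  · rw [if_pos hm', if_neg hn', sub_zero]
    refine key _ ?_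
    have hq : m ∈ farPoints D k := by
      simp only [farPoints, Finset.mem_filter]
      refine ⟨hm', ?_⟩
      rw [mem_box_iff, not_le] at hn'
      have := norm_sub_norm_le (dyad k n) (dyad (k + 1) m)
      rw [norm_sub_rev] at this
      linarith
    have := Finset.single_le_sum (f := fun m : (Fin D → ℤ) => |Y (dyad (k + 1) m)| ^ N)
      (fun _ _ => by positivity) hq
    unfold chainSum
    linarith
  · exfalso
    rw [mem_box_iff] at hm' hn'
    have := norm_sub_norm_le (dyad (k + 1) m) (dyad k n)
    rw [pow_succ] at hm'
    linarith
  · rw [if_neg hm', if_neg hn', sub_zero, abs_zero]; exact hM0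

end AdditiveSPDE

end

/-! ### Kolmogorov's criterion by chaining, with a uniform rate -/

noncomputable section

namespace AdditiveSPDE


variable {D : ℕ}

lemma lintegral_pow_eq_eLpNorm {α E : Type*} [MeasurableSpace α] [NormedAddCommGroup E] {m : Measure α}
    (f : α → E) {N : ℕ} (hN : N ≠ 0) : eLpNorm f N m = (∫⁻ a, ‖f a‖ₑ ^ N ∂m) ^ (1 / (N : ℝ)) := by
  rw [eLpNorm_eq_lintegral_rpow_enorm_toReal (by exact_mod_cast hN) (by simp)]
  simp

lemma eLpNorm_one_le_of_lintegral_pow_le {α E : Type*} [MeasurableSpace α] [NormedAddCommGroup E]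
    {m : Measure α} [IsProbabilityMeasure m] {f : α → E} (hf : AEStronglyMeasurable f m) {N : ℕ}
    (hN : N ≠ 0) {K : ℝ} (hK : 0 ≤ K) {k : ℕ}
    (h : ∫⁻ a, ‖f a‖ₑ ^ N ∂m ≤ ENNReal.ofReal (K * (1 / 2) ^ k)) :
    eLpNorm f 1 m ≤ ENNReal.ofReal (K ^ (1 / (N : ℝ)) * ((1 / 2) ^ (1 / (N : ℝ))) ^ k) := by
  have h1 : (1 : ℝ≥0∞) ≤ N := by exact_mod_cast Nat.one_le_iff_ne_zero.2 hN
  refine (eLpNorm_le_eLpNorm_of_exponent_le h1 hf).trans ?_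
  rw [lintegral_pow_eq_eLpNorm f hN]
  refine (ENNReal.rpow_le_rpow h (by positivity)).trans ?_
  rw [ENNReal.ofReal_rpow_of_nonneg (by positivity) (by positivity),
    Real.mul_rpow hK (by positivity), Real.rpow_pow_comm (by norm_num)]

/-- A sequence whose increments decay geometrically in `L¹` converges almost surely. -/
lemma exists_limit_of_geometric {α E : Type*} [MeasurableSpace α] [NormedAddCommGroup E]
    [CompleteSpace E] {m : Measure α} {f : ℕ → α → E} (hf : ∀ n, StronglyMeasurable (f n))
    {K r : ℝ} (hK : 0 ≤ K) (hr0 : 0 < r) (hr : r < 1)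
    (h : ∀ k, eLpNorm (f (k + 1) - f k) 1 m ≤ ENNReal.ofReal (K * r ^ k)) :
    ∃ V : α → E, StronglyMeasurable V ∧ (∀ᵐ a ∂m, Tendsto (fun n => f n a) atTop (𝓝 (V a))) ∧
      ∀ k, eLpNorm (V - f k) 1 m ≤ ENNReal.ofReal (K / (1 - r) * r ^ k) := by
  have h1r : 0 < 1 - r := by linarith
  have hstep : ∀ k j, eLpNorm (f (k + j) - f k) 1 m
      ≤ ENNReal.ofReal (K / (1 - r) * (r ^ k - r ^ (k + j))) := by
    intro k j
    induction j with
    | zero => simp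
    | succ j ih =>
      have e : f (k + (j + 1)) - f k = (f (k + j + 1) - f (k + j)) + (f (k + j) - f k) := by
        rw [← add_assoc]; abel
      rw [e]
      refine (eLpNorm_add_le ((hf _).sub (hf _)).aestronglyMeasurable
        ((hf _).sub (hf _)).aestronglyMeasurable le_rfl).trans ((add_le_add (h _) ih).trans ?_)
      have hle : r ^ (k + j) ≤ r ^ k := pow_le_pow_of_le_one hr0.le hr.le (by omega)
      rw [← ENNReal.ofReal_add (by positivity)
        (mul_nonneg (by positivity) (by linarith))]
      refine ENNReal.ofReal_le_ofReal (le_of_eq ?_)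
      rw [← add_assoc k j 1, pow_succ]
      field_simp
      ring
  have hle : ∀ k n, k ≤ n → eLpNorm (f n - f k) 1 m ≤ ENNReal.ofReal (K / (1 - r) * r ^ k) := by
    intro k n hkn
    obtain ⟨j, rfl⟩ := Nat.exists_eq_add_of_le hkn
    refine (hstep k j).trans (ENNReal.ofReal_le_ofReal ?_)
    have : 0 < r ^ (k + j) := by positivity
    gcongr
    linarith
  -- Twice the distance to level `N`, for two terms; the extra `1` keeps the Cauchy estimate strict
  -- when `K = 0`.
  set B : ℕ → ℝ≥0∞ := fun n => ENNReal.ofReal ((2 * (K / (1 - r)) + 1) * r ^ n) with hB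
  have hBsum : ∑' i, B i ≠ ∞ := by
    have hs : Summable fun n => (2 * (K / (1 - r)) + 1) * r ^ n :=
      (summable_geometric_of_lt_one hr0.le hr).mul_left _
    rw [hB, ← ENNReal.ofReal_tsum_of_nonneg (fun n => by positivity) hs]
    exact ENNReal.ofReal_ne_top
  have hcau : ∀ N n l : ℕ, N ≤ n → N ≤ l → eLpNorm (f n - f l) 1 m < B N := by
    intro N n l hn hl
    have e : f n - f l = (f n - f N) - (f l - f N) := by abel
    rw [e]
    refine ((eLpNorm_sub_le ((hf _).sub (hf _)).aestronglyMeasurable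
      ((hf _).sub (hf _)).aestronglyMeasurable le_rfl).trans
      (add_le_add (hle N n hn) (hle N l hl))).trans_lt ?_
    rw [← ENNReal.ofReal_add (by positivity) (by positivity)]
    refine ENNReal.ofReal_lt_ofReal_iff_of_nonneg (by positivity) |>.2 ?_
    have : 0 < r ^ N := by positivity
    linarith
  obtain ⟨V, hV, hlim⟩ := exists_stronglyMeasurable_limit_of_tendsto_ae
    (fun n => (hf n).aestronglyMeasurable)
    (Lp.ae_tendsto_of_cauchy_eLpNorm (fun n => (hf n).aestronglyMeasurable) le_rfl hBsum hcau)
  refine ⟨V, hV, hlim, fun k => ?_⟩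
  -- Fatou's lemma transfers the bound on `f n - f k` to the limit.
  refine (Lp.eLpNorm_lim_le_liminf_eLpNorm (f := fun n => f n - f k)
    (fun n => ((hf n).sub (hf k)).aestronglyMeasurable) _ ?_).trans ?_
  · filter_upwards [hlim] with a ha using ha.sub_const _
  · refine Filter.liminf_le_of_frequently_le' ?_
    exact (Filter.eventually_atTop.2 ⟨k, fun n hn => hle k n hn⟩).frequently

lemma half_pow_le_half {k : ℕ} (hk : 1 ≤ k) : ((1 : ℝ) / 2) ^ k ≤ 1 / 2 := by
  calc ((1 : ℝ) / 2) ^ k ≤ (1 / 2) ^ 1 := pow_le_pow_of_le_one (by norm_num) (by norm_num) hk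
    _ = 1 / 2 := by norm_num

/-- Moment assumptions for the chaining argument. -/
structure ChainMoments {Ω : Type*} [MeasurableSpace Ω] (P : Measure Ω) (Y : (Fin D → ℝ) → Ω → ℝ)
    (N : ℕ) (C : ℝ) : Prop where
  measurable : ∀ x, Measurable (Y x)
  incr : ∀ x y, ‖x - y‖ ≤ 1 →
    ∫⁻ ω, ‖Y x ω - Y y ω‖ₑ ^ N ∂P ≤ ENNReal.ofReal (C * ‖x - y‖ ^ (4 * D + 1))
  decay : ∀ x, ∫⁻ ω, ‖Y x ω‖ₑ ^ N ∂P ≤ ENNReal.ofReal (C * (1 / (1 + ‖x‖)) ^ (2 * D + 1))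

variable {Ω : Type*} [MeasurableSpace Ω] {P : Measure Ω} {Y : (Fin D → ℝ) → Ω → ℝ} {N : ℕ} {C : ℝ}

/-- The random interpolation of level `k`. -/
def randomInterp (Y : (Fin D → ℝ) → Ω → ℝ) (k : ℕ) (ω : Ω) :
    BoundedContinuousFunction (Fin D → ℝ) ℝ :=
  dyadicInterp k fun m => Y (dyad k m) ω

lemma ChainMoments.stronglyMeasurable_randomInterp (h : ChainMoments P Y N C) (k : ℕ) :
    StronglyMeasurable (randomInterp Y k) := by
  have : randomInterp Y k = fun ω => ∑ m ∈ box D k, Y (dyad k m) ω • tentB k m := rfl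
  rw [this]
  exact Finset.stronglyMeasurable_fun_sum _ fun m _ =>
    (h.measurable _).stronglyMeasurable.smul_const _

/-- This explains the exponents in `ChainMoments`. There are of order `16^{kD}` near pairs at
distance of order `2^{-k}`, and the power `4D + 1` leaves a factor `2^{-k}`. There are of order
`4^{kD}` far points of norm of order `2^k`, and the power `2D + 1` leaves the same factor. -/
lemma ChainMoments.lintegral_chainSum_le (h : ChainMoments P Y N C) (hC : 0 ≤ C) {k : ℕ}
    (hk : 1 ≤ k) : ∫⁻ ω, ENNReal.ofReal (chainSum (fun x => Y x ω) N k) ∂P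
      ≤ ENNReal.ofReal ((36 ^ D * C * 2 ^ (4 * D + 1) + 12 ^ D * C * 2 ^ (2 * D + 1)) * (1 / 2) ^ k) := by
  classical
  have hh := half_pow_le_half hk
  have e : ∀ ω, ENNReal.ofReal (chainSum (fun x => Y x ω) N k)
      = ∑ q ∈ nearPairs D k, ‖Y (dyad (k + 1) q.1) ω - Y (dyad k q.2) ω‖ₑ ^ N
        + ∑ m ∈ farPoints D k, ‖Y (dyad (k + 1) m) ω‖ₑ ^ N := by
    intro ω
    unfold chainSum
    rw [ENNReal.ofReal_add (Finset.sum_nonneg fun _ _ => by positivity)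
      (Finset.sum_nonneg fun _ _ => by positivity),
      ENNReal.ofReal_sum_of_nonneg (fun _ _ => by positivity),
      ENNReal.ofReal_sum_of_nonneg (fun _ _ => by positivity)]
    simp only [ENNReal.ofReal_pow (abs_nonneg _), ← Real.enorm_eq_ofReal_abs]
  simp_rw [e]
  have hm1 : ∀ q : (Fin D → ℤ) × (Fin D → ℤ),
      Measurable fun ω => ‖Y (dyad (k + 1) q.1) ω - Y (dyad k q.2) ω‖ₑ ^ N := fun q =>
    ((h.measurable _).sub (h.measurable _)).enorm.pow_const _
  have hm2 : ∀ m : Fin D → ℤ, Measurable fun ω => ‖Y (dyad (k + 1) m) ω‖ₑ ^ N := fun m =>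
    (h.measurable _).enorm.pow_const _
  rw [lintegral_add_left (Finset.measurable_fun_sum _ fun q _ => hm1 q),
    lintegral_finsetSum _ fun q _ => hm1 q, lintegral_finsetSum _ fun q _ => hm2 q]
  have hA : ∑ q ∈ nearPairs D k, ∫⁻ ω, ‖Y (dyad (k + 1) q.1) ω - Y (dyad k q.2) ω‖ₑ ^ N ∂P
      ≤ ENNReal.ofReal (36 ^ D * C * 2 ^ (4 * D + 1) * (1 / 2) ^ k) := by
    calc _ ≤ ∑ q ∈ nearPairs D k, ENNReal.ofReal (C * (2 * (1 / 2) ^ k) ^ (4 * D + 1)) := by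
          refine Finset.sum_le_sum fun q hq => ?_
          have hq2 : ‖dyad (k + 1) q.1 - dyad k q.2‖ ≤ 2 * (1 / 2) ^ k := by
            simp only [nearPairs, Finset.mem_filter] at hq; exact hq.2
          refine (h.incr _ _ (by linarith)).trans (ENNReal.ofReal_le_ofReal ?_)
          gcongr
      _ = ENNReal.ofReal ((nearPairs D k).card * (C * (2 * (1 / 2) ^ k) ^ (4 * D + 1))) := by
          rw [Finset.sum_const, nsmul_eq_mul, ← ENNReal.ofReal_natCast,
            ← ENNReal.ofReal_mul (by positivity)]
      _ ≤ _ := by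
          refine ENNReal.ofReal_le_ofReal ?_
          have hcard : ((nearPairs D k).card : ℝ) ≤ 36 ^ D * 16 ^ (k * D) := by
            calc ((nearPairs D k).card : ℝ) ≤ ((box D (k + 1) ×ˢ box D k).card : ℝ) := by
                  exact_mod_cast Finset.card_filter_le _ _
              _ = (box D (k + 1)).card * (box D k).card := by
                  rw [Finset.card_product]; push_cast; rfl
              _ ≤ (3 * 4 ^ (k + 1)) ^ D * (3 * 4 ^ k) ^ D := by
                  gcongr <;> exact card_box_le _
              _ = 36 ^ D * 16 ^ (k * D) := by
                  rw [← mul_pow, pow_mul, ← mul_pow]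
                  congr 1
                  rw [pow_succ, show (16 : ℝ) = 4 * 4 by norm_num, mul_pow]; ring
          calc _ ≤ 36 ^ D * 16 ^ (k * D) * (C * (2 * (1 / 2) ^ k) ^ (4 * D + 1)) := by gcongr
            _ = 36 ^ D * C * 2 ^ (4 * D + 1) * (1 / 2) ^ k *
                (16 ^ (k * D) * (1 / 2) ^ (k * (4 * D))) := by
                rw [mul_pow, ← pow_mul, mul_add, pow_add (1 / 2 : ℝ)]; ring
            _ = _ := by
                rw [show k * (4 * D) = 4 * (k * D) by ring, pow_mul (1 / 2 : ℝ) 4, ← mul_pow]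
                norm_num
  have hB : ∑ m ∈ farPoints D k, ∫⁻ ω, ‖Y (dyad (k + 1) m) ω‖ₑ ^ N ∂P
      ≤ ENNReal.ofReal (12 ^ D * C * 2 ^ (2 * D + 1) * (1 / 2) ^ k) := by
    calc _ ≤ ∑ m ∈ farPoints D k, ENNReal.ofReal (C * (2 * (1 / 2) ^ k) ^ (2 * D + 1)) := by
          refine Finset.sum_le_sum fun m hm => ?_
          have hm2 : (2 : ℝ) ^ k - 2 ≤ ‖dyad (k + 1) m‖ := by
            simp only [farPoints, Finset.mem_filter] at hm; exact hm.2
          refine (h.decay _).trans (ENNReal.ofReal_le_ofReal ?_)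
          have h2k : (2 : ℝ) ≤ 2 ^ k := by
            calc (2 : ℝ) = 2 ^ 1 := by norm_num
              _ ≤ 2 ^ k := pow_le_pow_right₀ (by norm_num) hk
          have : 1 / (1 + ‖dyad (k + 1) m‖) ≤ 2 * (1 / 2) ^ k := by
            rw [div_pow, one_pow, mul_one_div, div_le_div_iff₀ (by positivity) (by positivity)]
            linarith
          gcongr
      _ = ENNReal.ofReal ((farPoints D k).card * (C * (2 * (1 / 2) ^ k) ^ (2 * D + 1))) := by
          rw [Finset.sum_const, nsmul_eq_mul, ← ENNReal.ofReal_natCast,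
            ← ENNReal.ofReal_mul (by positivity)]
      _ ≤ _ := by
          refine ENNReal.ofReal_le_ofReal ?_
          have hcard : ((farPoints D k).card : ℝ) ≤ 12 ^ D * 4 ^ (k * D) := by
            calc ((farPoints D k).card : ℝ) ≤ ((box D (k + 1)).card : ℝ) := by
                  exact_mod_cast Finset.card_filter_le _ _
              _ ≤ (3 * 4 ^ (k + 1)) ^ D := card_box_le _
              _ = 12 ^ D * 4 ^ (k * D) := by
                  rw [pow_mul, ← mul_pow]
                  congr 1
                  rw [pow_succ]; ring
          calc _ ≤ 12 ^ D * 4 ^ (k * D) * (C * (2 * (1 / 2) ^ k) ^ (2 * D + 1)) := by gcongr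
            _ = 12 ^ D * C * 2 ^ (2 * D + 1) * (1 / 2) ^ k *
                (4 ^ (k * D) * (1 / 2) ^ (k * (2 * D))) := by
                rw [mul_pow, ← pow_mul, mul_add, pow_add (1 / 2 : ℝ)]; ring
            _ = _ := by
                rw [show k * (2 * D) = 2 * (k * D) by ring, pow_mul (1 / 2 : ℝ) 2, ← mul_pow]
                norm_num
  refine (add_le_add hA hB).trans_eq ?_
  rw [← ENNReal.ofReal_add (by positivity) (by positivity), add_mul]

/-- Needed to identify the uniform limit pointwise. Once `2^k ≥ |x| + 1` the cell of `x` lies in the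
box, and the interpolation at `x` averages at most `2^D` values taken within `2^{-k}` of `x`. -/
lemma ChainMoments.tendsto_randomInterp [IsProbabilityMeasure P] (h : ChainMoments P Y N C)
    (hN : N ≠ 0) (hC : 0 ≤ C) (x : Fin D → ℝ) :
    Tendsto (fun k => eLpNorm (fun ω => randomInterp Y k ω x - Y x ω) 1 P) atTop (𝓝 0) := by
  have hr1 : ((1 : ℝ) / 2) ^ (1 / (N : ℝ)) < 1 :=
    Real.rpow_lt_one (by norm_num) (by norm_num) (by positivity)
  have hlim : Tendsto (fun k : ℕ => ENNReal.ofReal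
      (2 ^ D * (C ^ (1 / (N : ℝ)) * ((1 / 2) ^ (1 / (N : ℝ))) ^ k))) atTop (𝓝 0) := by
    rw [← ENNReal.ofReal_zero]
    refine ENNReal.tendsto_ofReal ?_
    have := ((tendsto_pow_atTop_nhds_zero_of_lt_one (by positivity) hr1).const_mul
      (C ^ (1 / (N : ℝ)))).const_mul ((2 : ℝ) ^ D)
    simpa using this
  refine tendsto_of_tendsto_of_tendsto_of_le_of_le' tendsto_const_nhds hlim
    (Eventually.of_forall fun _ => zero_le) ?_
  have hev : ∀ᶠ k : ℕ in atTop, ‖x‖ + 1 ≤ (2 : ℝ) ^ k :=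
    (tendsto_pow_atTop_atTop_of_one_lt (by norm_num : (1 : ℝ) < 2)).eventually_ge_atTop _
  filter_upwards [hev] with k hk
  set S := cell (fun i => 2 ^ k * x i) with hS
  have hbox : ∀ m ∈ S, m ∈ box D k := by
    intro m hm
    rw [mem_box_iff]
    have h1 := norm_sub_dyad_le hm
    have h2 := norm_sub_norm_le (dyad k m) x
    rw [norm_sub_rev] at h2
    have : ((1 : ℝ) / 2) ^ k ≤ 1 := pow_le_one₀ (by norm_num) (by norm_num)
    linarith
  have hpt : ∀ ω, randomInterp Y k ω x - Y x ω
      = ∑ m ∈ S, tent (fun i => 2 ^ k * x i - (m i : ℝ)) * (Y (dyad k m) ω - Y x ω) := by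
    intro ω
    simp_rw [mul_sub]
    rw [Finset.sum_sub_distrib, randomInterp, dyadicInterp_apply]
    congr 1
    · refine Finset.sum_congr rfl fun m hm => ?_
      simp only [if_pos (hbox m hm)]
    · exact (interp_const (Y x ω) (fun i => 2 ^ k * x i)).symm
  have hmeas : ∀ m, AEStronglyMeasurable (fun ω => Y (dyad k m) ω - Y x ω) P := fun m =>
    ((h.measurable _).sub (h.measurable _)).aestronglyMeasurable
  calc eLpNorm (fun ω => randomInterp Y k ω x - Y x ω) 1 P
      = eLpNorm (∑ m ∈ S, fun ω => tent (fun i => 2 ^ k * x i - (m i : ℝ)) *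
          (Y (dyad k m) ω - Y x ω)) 1 P := by
        congr 1; ext ω; rw [hpt, Finset.sum_apply]
    _ ≤ ∑ m ∈ S, eLpNorm (fun ω => tent (fun i => 2 ^ k * x i - (m i : ℝ)) *
          (Y (dyad k m) ω - Y x ω)) 1 P :=
        eLpNorm_sum_le (fun m _ => (hmeas m).const_mul _) le_rfl
    _ ≤ ∑ m ∈ S, ENNReal.ofReal (C ^ (1 / (N : ℝ)) * ((1 / 2) ^ (1 / (N : ℝ))) ^ k) := by
        refine Finset.sum_le_sum fun m hm => ?_
        refine (eLpNorm_mono (g := fun ω => Y (dyad k m) ω - Y x ω) fun ω => ?_).trans ?_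
        · rw [norm_mul, Real.norm_of_nonneg (tent_nonneg _)]
          exact mul_le_of_le_one_left (norm_nonneg _) (tent_le_one _)
        · refine eLpNorm_one_le_of_lintegral_pow_le (hmeas m) hN hC ?_
          have h1 := norm_sub_dyad_le hm
          rw [norm_sub_rev] at h1
          have h2 : ((1 : ℝ) / 2) ^ k ≤ 1 := pow_le_one₀ (by norm_num) (by norm_num)
          refine (h.incr _ _ (h1.trans h2)).trans (ENNReal.ofReal_le_ofReal ?_)
          refine mul_le_mul_of_nonneg_left ?_ hC
          calc ‖dyad k m - x‖ ^ (4 * D + 1) ≤ ‖dyad k m - x‖ ^ 1 :=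
                pow_le_pow_of_le_one (norm_nonneg _) (h1.trans h2) (by omega)
            _ ≤ _ := by rw [pow_one]; exact h1
    _ = ENNReal.ofReal (S.card * (C ^ (1 / (N : ℝ)) * ((1 / 2) ^ (1 / (N : ℝ))) ^ k)) := by
        rw [Finset.sum_const, nsmul_eq_mul, ← ENNReal.ofReal_natCast,
          ← ENNReal.ofReal_mul (by positivity)]
    _ ≤ _ := by
        refine ENNReal.ofReal_le_ofReal ?_
        have : (S.card : ℝ) ≤ 2 ^ D := by
          have : S.card ≤ 2 ^ D := by
            rw [hS, cell, Fintype.card_piFinset]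
            refine (Finset.prod_le_prod' fun i _ => Finset.card_le_two).trans ?_
            simp
          exact_mod_cast this
        gcongr

/-- Kolmogorov's criterion with uniform approximation by interpolations: a random field with good
moments has a version with values in the bounded continuous functions, and the `L¹` distance to
its interpolations is controlled by the moment constants only. -/
theorem exists_continuous_version (N : ℕ) (hN : N ≠ 0) (C : ℝ) (hC : 0 ≤ C) (D : ℕ) :
    ∃ K r : ℝ, 0 ≤ r ∧ r < 1 ∧ ∀ {Ω : Type*} [MeasurableSpace Ω] (P : Measure Ω)
      [IsProbabilityMeasure P] (Y : (Fin D → ℝ) → Ω → ℝ), ChainMoments P Y N C →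
      ∃ V : Ω → BoundedContinuousFunction (Fin D → ℝ) ℝ, StronglyMeasurable V ∧
        (∀ x, ∀ᵐ ω ∂P, V ω x = Y x ω) ∧
        ∀ k, eLpNorm (fun ω => V ω - randomInterp Y (k + 1) ω) 1 P ≤ ENNReal.ofReal (K * r ^ k) := by
  have hr1 : ((1 : ℝ) / 2) ^ (1 / (N : ℝ)) < 1 :=
    Real.rpow_lt_one (by norm_num) (by norm_num) (by positivity)
  set r := ((1 : ℝ) / 2) ^ (1 / (N : ℝ)) with hr
  have hr0 : 0 < r := by positivity
  set K0 : ℝ := 36 ^ D * C * 2 ^ (4 * D + 1) + 12 ^ D * C * 2 ^ (2 * D + 1) with hK0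
  have hK00 : 0 ≤ K0 := by positivity
  -- The chaining estimate needs level at least one, so the sequence starts there; this index shift
  -- accounts for the extra factor `r`.
  refine ⟨K0 ^ (1 / (N : ℝ)) * r / (1 - r), r, hr0.le, hr1, ?_⟩
  intro Ω _ P _ Y h
  have hsm := h.stronglyMeasurable_randomInterp
  obtain ⟨V, hV, hlim, hVk⟩ := exists_limit_of_geometric (m := P)
    (f := fun k => randomInterp Y (k + 1)) (fun k => hsm _) (K := K0 ^ (1 / (N : ℝ)) * r)
    (by positivity) hr0 hr1 (by
      intro k
      have := eLpNorm_one_le_of_lintegral_pow_le (m := P)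
        (f := randomInterp Y (k + 1 + 1) - randomInterp Y (k + 1))
        ((hsm _).sub (hsm _)).aestronglyMeasurable hN hK00 (k := k + 1) (by
          refine le_trans (lintegral_mono fun ω => ?_) (h.lintegral_chainSum_le hC (by omega))
          rw [← ofReal_norm, ← ENNReal.ofReal_pow (norm_nonneg _)]
          exact ENNReal.ofReal_le_ofReal
            (norm_dyadicInterp_sub_pow_le (fun x => Y x ω) hN (by omega)))
      rw [pow_succ, mul_comm _ ((1 / 2) ^ (1 / (N : ℝ)) : ℝ), ← mul_assoc] at this
      exact this)
  refine ⟨V, hV, fun x => ?_, hVk⟩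
  have hmV : StronglyMeasurable fun ω => V ω x :=
    (continuous_eval_const x).comp_stronglyMeasurable hV
  have hmI : ∀ k, StronglyMeasurable fun ω => randomInterp Y k ω x := fun k =>
    (continuous_eval_const x).comp_stronglyMeasurable (hsm k)
  have hmY : StronglyMeasurable (Y x) := (h.measurable x).stronglyMeasurable
  have hz : eLpNorm (fun ω => V ω x - Y x ω) 1 P = 0 := by
    refine le_antisymm ?_ zero_le
    have h1 : Tendsto (fun k : ℕ => ENNReal.ofReal (K0 ^ (1 / (N : ℝ)) * r / (1 - r) * r ^ k)
        + eLpNorm (fun ω => randomInterp Y (k + 1) ω x - Y x ω) 1 P) atTop (𝓝 (0 + 0)) := by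
      refine Tendsto.add ?_ ((h.tendsto_randomInterp hN hC x).comp (tendsto_add_atTop_nat 1))
      rw [← ENNReal.ofReal_zero]
      refine ENNReal.tendsto_ofReal ?_
      simpa using (tendsto_pow_atTop_nhds_zero_of_lt_one hr0.le hr1).const_mul
        (K0 ^ (1 / (N : ℝ)) * r / (1 - r))
    rw [add_zero] at h1
    refine ge_of_tendsto' h1 fun k => ?_
    have e : (fun ω => V ω x - Y x ω) = (fun ω => V ω x - randomInterp Y (k + 1) ω x)
        + fun ω => randomInterp Y (k + 1) ω x - Y x ω := by ext ω; simp
    rw [e]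
    refine (eLpNorm_add_le (hmV.sub (hmI _)).aestronglyMeasurable
      ((hmI _).sub hmY).aestronglyMeasurable le_rfl).trans (add_le_add ?_ le_rfl)
    refine le_trans (eLpNorm_mono fun ω => ?_) (hVk k)
    exact (V ω - randomInterp Y (k + 1) ω).norm_coe_le_norm x
  replace hz := (eLpNorm_eq_zero_iff (hmV.sub hmY).aestronglyMeasurable one_ne_zero).1 hz
  filter_upwards [hz] with ω hω
  exact sub_eq_zero.1 hω

end AdditiveSPDE

end

/-! ### Spectral mass and Gaussian moments of the stochastic convolution -/

noncomputable section

namespace AdditiveSPDE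


variable {d : ℕ}

/-- The integral of `(1 + |ξ|²)^{-q/2}` with respect to a spectral measure. -/
def specMass (q : ℝ) (μ : Measure (Rd d)) : ℝ≥0∞ :=
  ∫⁻ ξ, ENNReal.ofReal ((1 / (1 + ‖ξ‖ ^ 2)) ^ (q / 2)) ∂μ

lemma continuous_specWeight_rpow (q : ℝ) :
    Continuous fun ξ : Rd d => (1 / (1 + ‖ξ‖ ^ 2)) ^ (q / 2) :=
  continuous_specWeight.rpow_const fun ξ => Or.inl (by positivity)

lemma specWeight_le_rpow {q : ℝ} (hq : q ≤ 2) (ξ : Rd d) :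
    1 / (1 + ‖ξ‖ ^ 2) ≤ (1 / (1 + ‖ξ‖ ^ 2)) ^ (q / 2) := by
  have h1 : 1 / (1 + ‖ξ‖ ^ 2) ≤ 1 := by
    rw [div_le_one (by positivity)]; nlinarith [sq_nonneg ‖ξ‖]
  calc 1 / (1 + ‖ξ‖ ^ 2) = (1 / (1 + ‖ξ‖ ^ 2)) ^ (1 : ℝ) := (Real.rpow_one _).symm
    _ ≤ _ := Real.rpow_le_rpow_of_exponent_ge (by positivity) h1 (by linarith)

lemma isSpectral_of_specMass {q : ℝ} (hq : q ≤ 2) {μ : Measure (Rd d)} {K : ℝ}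
    (h : specMass q μ ≤ ENNReal.ofReal K) : IsSpectral μ :=
  lt_of_le_of_lt (lintegral_mono fun ξ => ENNReal.ofReal_le_ofReal (specWeight_le_rpow hq ξ))
    (h.trans_lt ENNReal.ofReal_lt_top)

/-- The factor 2 comes from `1 + |ξ|^q ≤ 2 (1 + |ξ|²)^{q/2}`. A power of `1/(1+|ξ|²)` is the form of
the weight that interpolates with the decay of the kernel. -/
lemma HypH1.exists_specMass_le {μs : ℕ → Measure (Rd d)} (h : HypH1 μs) :
    ∃ q K : ℝ, 0 < q ∧ q < 2 ∧ 0 ≤ K ∧ ∀ n, specMass q (μs n) ≤ ENNReal.ofReal K := by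
  obtain ⟨q, hq0, hq2, hsup⟩ := h
  refine ⟨q, (2 * ⨆ n, ∫⁻ ξ, ENNReal.ofReal (1 / (1 + ‖ξ‖ ^ q)) ∂(μs n)).toReal, hq0, hq2,
    ENNReal.toReal_nonneg, fun n => ?_⟩
  rw [ENNReal.ofReal_toReal (ENNReal.mul_ne_top (by simp) hsup.ne)]
  calc specMass q (μs n) ≤ ∫⁻ ξ, 2 * ENNReal.ofReal (1 / (1 + ‖ξ‖ ^ q)) ∂(μs n) := by
        refine lintegral_mono fun ξ => ?_
        rw [two_mul_ofReal]
        refine ENNReal.ofReal_le_ofReal ?_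
        rw [one_div, Real.inv_rpow (by positivity), mul_one_div, ← one_div,
          div_le_div_iff₀ (by positivity) (by positivity), one_mul]
        have h1 : (1 : ℝ) ≤ (1 + ‖ξ‖ ^ 2) ^ (q / 2) :=
          Real.one_le_rpow (by nlinarith [sq_nonneg ‖ξ‖]) (by positivity)
        have h2 : ‖ξ‖ ^ q ≤ (1 + ‖ξ‖ ^ 2) ^ (q / 2) := by
          calc ‖ξ‖ ^ q = (‖ξ‖ ^ 2) ^ (q / 2) := by
                rw [← Real.rpow_natCast, ← Real.rpow_mul (norm_nonneg _)]; congr 1; push_cast; ring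
            _ ≤ _ := Real.rpow_le_rpow (by positivity) (by linarith) (by positivity)
        linarith
    _ = 2 * ∫⁻ ξ, ENNReal.ofReal (1 / (1 + ‖ξ‖ ^ q)) ∂(μs n) :=
        lintegral_const_mul' _ _ (by simp)
    _ ≤ _ := by gcongr; exact le_iSup (fun n => ∫⁻ ξ, ENNReal.ofReal (1 / (1 + ‖ξ‖ ^ q)) ∂(μs n)) n

/-- The limit measure inherits the bound of (H1). The weight decays too slowly for (H2), but its
product with a continuous cut-off does not; Fatou's lemma removes the cut-off. -/
lemma HypH2.specMass_le {μs : ℕ → Measure (Rd d)} {μ : Measure (Rd d)} (h : HypH2 μs μ) {q K : ℝ}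
    (hq : 0 < q) (hK : 0 ≤ K) (hμs : ∀ n, specMass q (μs n) ≤ ENNReal.ofReal K) :
    specMass q μ ≤ ENNReal.ofReal K := by
  set w : Rd d → ℝ := fun ξ => (1 / (1 + ‖ξ‖ ^ 2)) ^ (q / 2) with hw
  have hw0 : ∀ ξ, 0 ≤ w ξ := fun ξ => by positivity
  have hw1 : ∀ ξ, w ξ ≤ 1 := fun ξ => by
    refine Real.rpow_le_one (by positivity) ?_ (by positivity)
    rw [div_le_one (by positivity)]; nlinarith [sq_nonneg ‖ξ‖]
  set cut : ℕ → Rd d → ℝ := fun R ξ => max 0 (min 1 ((R : ℝ) + 1 - ‖ξ‖)) with hcut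
  have hc0 : ∀ R ξ, 0 ≤ cut R ξ := fun R ξ => le_max_left _ _
  have hc1 : ∀ R ξ, cut R ξ ≤ 1 := fun R ξ => max_le zero_le_one (min_le_left _ _)
  have hcont : ∀ R, Continuous fun ξ => w ξ * cut R ξ := fun R =>
    (continuous_specWeight_rpow q).mul (by fun_prop)
  have hbd : ∀ R : ℕ, ∀ ξ, |w ξ * cut R ξ| ≤ (1 + ((R : ℝ) + 1) ^ 2) * (1 / (1 + ‖ξ‖ ^ 2)) := by
    intro R ξ
    rw [abs_of_nonneg (mul_nonneg (hw0 ξ) (hc0 R ξ)), mul_one_div, le_div_iff₀ (by positivity)]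
    by_cases hξ : ‖ξ‖ ≤ R + 1
    · have h1 : w ξ * cut R ξ ≤ 1 := mul_le_one₀ (hw1 ξ) (hc0 R ξ) (hc1 R ξ)
      have h2 : ‖ξ‖ ^ 2 ≤ ((R : ℝ) + 1) ^ 2 := pow_le_pow_left₀ (norm_nonneg _) hξ 2
      calc w ξ * cut R ξ * (1 + ‖ξ‖ ^ 2) ≤ 1 * (1 + ‖ξ‖ ^ 2) := by gcongr
        _ ≤ _ := by linarith
    · have : cut R ξ = 0 := max_eq_left ((min_le_right _ _).trans (by linarith))
      rw [this, mul_zero, zero_mul]; positivity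
  have hR : ∀ R, ∫⁻ ξ, ENNReal.ofReal (w ξ * cut R ξ) ∂μ ≤ ENNReal.ofReal K := by
    intro R
    obtain ⟨hi, hlim⟩ := h (fun ξ => w ξ * cut R ξ) (hcont R) ⟨_, hbd R⟩
    rw [← ofReal_integral_eq_lintegral_ofReal hi
      (Eventually.of_forall fun ξ => mul_nonneg (hw0 ξ) (hc0 R ξ))]
    refine ENNReal.ofReal_le_ofReal (le_of_tendsto' hlim fun n => ?_)
    rw [integral_eq_lintegral_of_nonneg_ae
      (Eventually.of_forall fun ξ => mul_nonneg (hw0 ξ) (hc0 R ξ))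
      (hcont R).aestronglyMeasurable]
    refine ENNReal.toReal_le_of_le_ofReal hK (le_trans (lintegral_mono fun ξ => ?_) (hμs n))
    exact ENNReal.ofReal_le_ofReal (mul_le_of_le_one_right (hw0 ξ) (hc1 R ξ))
  calc specMass q μ ≤ ∫⁻ ξ, liminf (fun R => ENNReal.ofReal (w ξ * cut R ξ)) atTop ∂μ := by
        refine lintegral_mono fun ξ => ?_
        refine Filter.le_liminf_of_le (by isBoundedDefault) ?_
        obtain ⟨R0, hR0⟩ := exists_nat_ge ‖ξ‖
        filter_upwards [eventually_ge_atTop R0] with R hR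
        have : (R0 : ℝ) ≤ R := by exact_mod_cast hR
        have h1 : cut R ξ = 1 := by
          simp only [hcut]
          rw [min_eq_left (by linarith), max_eq_right zero_le_one]
        rw [h1, mul_one]
    _ ≤ liminf (fun R => ∫⁻ ξ, ENNReal.ofReal (w ξ * cut R ξ) ∂μ) atTop :=
        lintegral_liminf_le fun R => (hcont R).measurable.ennreal_ofReal
    _ ≤ ENNReal.ofReal K :=
        Filter.liminf_le_of_frequently_le' (Eventually.of_forall hR).frequently

/-- The `2j`-th absolute moment of a standard Gaussian variable. -/
def gaussMoment (j : ℕ) : ℝ≥0∞ := ∫⁻ x, ‖x‖ₑ ^ (2 * j) ∂(gaussianReal 0 1)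

lemma gaussMoment_lt_top (j : ℕ) : gaussMoment j < ∞ := by
  have h := (memLp_id_gaussianReal (μ := 0) (v := 1) ((2 * j : ℕ) : ℝ≥0)).2
  rcases Nat.eq_zero_or_pos j with rfl | hj
  · simp [gaussMoment]
  have h2 : (2 * j) ≠ 0 := by omega
  rw [show (((2 * j : ℕ) : ℝ≥0) : ℝ≥0∞) = ((2 * j : ℕ) : ℝ≥0∞) by push_cast; rfl,
    lintegral_pow_eq_eLpNorm _ h2] at h
  have := (ENNReal.rpow_lt_top_iff_of_pos (by positivity)).1 h
  simpa [gaussMoment] using this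

lemma lintegral_gaussian_pow {Ω : Type*} [MeasurableSpace Ω] {P : Measure Ω} {X : Ω → ℝ}
    (hX : Measurable X) {v : ℝ≥0} (h : P.map X = gaussianReal 0 v) (j : ℕ) :
    ∫⁻ ω, ‖X ω‖ₑ ^ (2 * j) ∂P = (v : ℝ≥0∞) ^ j * gaussMoment j := by
  have hm : Measurable fun x : ℝ => ‖x‖ₑ ^ (2 * j) := measurable_enorm.pow_const _
  have h1 : ∫⁻ ω, ‖X ω‖ₑ ^ (2 * j) ∂P = ∫⁻ x, ‖x‖ₑ ^ (2 * j) ∂(gaussianReal 0 v) := by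
    rw [← h, lintegral_map hm hX]
  have h2 : gaussianReal 0 v = (gaussianReal 0 1).map (fun x => Real.sqrt v * x) := by
    rw [gaussianReal_map_const_mul]
    congr 1
    · simp
    · ext; simp
  rw [h1, h2, lintegral_map hm (by fun_prop), gaussMoment, ← lintegral_const_mul _ hm]
  refine lintegral_congr fun x => ?_
  rw [enorm_mul, mul_pow]
  congr 1
  rw [pow_mul, ← enorm_pow, Real.sq_sqrt v.coe_nonneg]
  congr 1
  simp

/-- Here integrability becomes regularity: with `a = 1/(1+|ξ|²)` and `κ = 1 - q/2`, the factor
`a^{1-κ}` is the weight of `specMass` and `δ^κ` is a Hölder modulus. -/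
lemma min_le_rpow_mul {a δ κ : ℝ} (ha : 0 < a) (hδ : 0 ≤ δ) (hκ0 : 0 < κ) (hκ1 : κ < 1) :
    min a δ ≤ δ ^ κ * a ^ (1 - κ) := by
  have hm : 0 ≤ min a δ := le_min ha.le hδ
  calc min a δ = (min a δ) ^ κ * (min a δ) ^ (1 - κ) := by
        rw [← Real.rpow_add' hm (by norm_num)]; norm_num
    _ ≤ δ ^ κ * a ^ (1 - κ) := by
        refine mul_le_mul (Real.rpow_le_rpow hm (min_le_right _ _) hκ0.le)
          (Real.rpow_le_rpow hm (min_le_left _ _) (by linarith)) (by positivity) (by positivity)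

variable {G : ℝ → Measure (Rd d)} {ν : Measure (Rd d)} {c a : ℝ → ℝ}

lemma IsScaledKernel.eLpNorm_gHat_le (h : IsScaledKernel G ν c a) (T : ℝ) {q K : ℝ}
    (hq0 : 0 < q) (hq : q < 2) (hK : 0 ≤ K) : ∃ C : ℝ, 0 ≤ C ∧ ∀ μ : Measure (Rd d),
      specMass q μ ≤ ENNReal.ofReal K →
      (∀ t ∈ Icc 0 T, ∀ x, eLpNorm (fun p : ℝ × Rd d => gHat ν c a t x p.1 p.2) 2 (stMeasure μ) ^ 2
        ≤ ENNReal.ofReal C) ∧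
      ∀ t ∈ Icc 0 T, ∀ s ∈ Icc 0 T, ∀ x y,
        eLpNorm (fun p : ℝ × Rd d => gHat ν c a t x p.1 p.2 - gHat ν c a s y p.1 p.2) 2
          (stMeasure μ) ^ 2 ≤ ENNReal.ofReal (C * (|t - s| + ‖x - y‖) ^ (1 - q / 2)) := by
  obtain ⟨C1, hC1, h1⟩ := h.lintegral_gHat_le T
  obtain ⟨C2, hC2, h2⟩ := h.lintegral_gHat_sub_le T
  refine ⟨(C1 + C2) * K, by positivity, fun μ hμ => ?_⟩
  have : SigmaFinite μ := (isSpectral_of_specMass hq.le hμ).sigmaFinite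
  have hmain : ∀ (g : ℝ → Rd d → ℂ) (A : ℝ), 0 ≤ A → (Measurable fun p : ℝ × Rd d => g p.1 p.2) →
      (∀ ξ, ∫⁻ r in Ioi (0 : ℝ), ‖g r ξ‖ₑ ^ 2
        ≤ ENNReal.ofReal (A * (1 / (1 + ‖ξ‖ ^ 2)) ^ (q / 2))) →
      eLpNorm (fun p : ℝ × Rd d => g p.1 p.2) 2 (stMeasure μ) ^ 2 ≤ ENNReal.ofReal (A * K) := by
    intro g A hA hg hle
    rw [eLpNorm_two_sq, lintegral_stMeasure_symm (f := fun r ξ => ‖g r ξ‖ₑ ^ 2)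
      (hg.enorm.pow_const 2)]
    calc _ ≤ ∫⁻ ξ, ENNReal.ofReal (A * (1 / (1 + ‖ξ‖ ^ 2)) ^ (q / 2)) ∂μ :=
          lintegral_mono fun ξ => hle ξ
      _ = ENNReal.ofReal A * specMass q μ := by
          simp_rw [ENNReal.ofReal_mul hA]
          rw [lintegral_const_mul' _ _ ENNReal.ofReal_ne_top, specMass]
      _ ≤ ENNReal.ofReal A * ENNReal.ofReal K := by gcongr
      _ = _ := (ENNReal.ofReal_mul hA).symm
  refine ⟨fun t ht x => ?_, fun t ht s hs x y => ?_⟩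
  · refine (hmain (gHat ν c a t x) C1 hC1 (h.measurable_gHat t x) fun ξ => ?_).trans
      (ENNReal.ofReal_le_ofReal (by nlinarith))
    refine (h1 t ht x ξ).trans (ENNReal.ofReal_le_ofReal ?_)
    exact mul_le_mul_of_nonneg_left (specWeight_le_rpow hq.le ξ) hC1
  · have hδ : 0 ≤ |t - s| + ‖x - y‖ := by positivity
    refine (hmain (fun r ξ => gHat ν c a t x r ξ - gHat ν c a s y r ξ)
      (C2 * (|t - s| + ‖x - y‖) ^ (1 - q / 2)) (by positivity)
      ((h.measurable_gHat t x).sub (h.measurable_gHat s y)) fun ξ => ?_).trans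
      (ENNReal.ofReal_le_ofReal ?_)
    · refine (h2 t ht s hs x y ξ).trans (ENNReal.ofReal_le_ofReal ?_)
      rw [mul_assoc]
      refine mul_le_mul_of_nonneg_left ?_ hC2
      have := min_le_rpow_mul (a := 1 / (1 + ‖ξ‖ ^ 2)) (κ := 1 - q / 2) (by positivity) hδ
        (by linarith) (by linarith)
      rwa [sub_sub_cancel] at this
    · have : 0 ≤ (|t - s| + ‖x - y‖) ^ (1 - q / 2) := by positivity
      have : 0 ≤ C1 * K * (|t - s| + ‖x - y‖) ^ (1 - q / 2) := by positivity
      linarith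

section Field

variable {Ω : Type*} [MeasurableSpace Ω] {P : Measure Ω} [IsProbabilityMeasure P]
  {μ : Measure (Rd d)} {W : TestFn d → Ω → ℝ}

lemma _root_.IsWienerIntegral.lintegral_pow_le (hW : IsHomogeneousNoise P μ W) (hμ : IsSpectral μ)
    {g : ℝ → Rd d → ℂ} (hg : Measurable fun p : ℝ × Rd d => g p.1 p.2) {X : Ω → ℝ}
    (hX : IsWienerIntegral P μ W g X) {A : ℝ}
    (hA : eLpNorm (fun p : ℝ × Rd d => g p.1 p.2) 2 (stMeasure μ) ^ 2 ≤ ENNReal.ofReal A) (j : ℕ) :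
    ∫⁻ ω, ‖X ω‖ₑ ^ (2 * j) ∂P ≤ ENNReal.ofReal A ^ j * gaussMoment j := by
  rw [lintegral_gaussian_pow hX.measurable (hX.map_eq hW hμ hg) j]
  gcongr
  refine le_trans ?_ hA
  rw [ENNReal.coe_pow, ENNReal.coe_toNNReal]
  intro htop
  rw [htop] at hA
  simp at hA

/-- `Z` is a version of the stochastic convolution with the kernel on `[0, T] × ℝ^d`. -/
def IsStochConv (P : Measure Ω) (μ : Measure (Rd d)) (W : TestFn d → Ω → ℝ) (ν : Measure (Rd d))
    (c a : ℝ → ℝ) (T : ℝ) (Z : ℝ → Rd d → Ω → ℝ) : Prop :=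
  ∀ t ∈ Icc 0 T, ∀ x, IsWienerIntegral P μ W (gHat ν c a t x) (Z t x)

end Field

/-- Uniform moment bounds for the stochastic convolution and its increments. -/
lemma IsScaledKernel.exists_moment_bound (h : IsScaledKernel G ν c a) (T : ℝ) {q K : ℝ}
    (hq0 : 0 < q) (hq : q < 2) (hK : 0 ≤ K) (j : ℕ) : ∃ C : ℝ, 0 ≤ C ∧
      ∀ {Ω : Type*} [MeasurableSpace Ω] (P : Measure Ω) [IsProbabilityMeasure P]
      (μ : Measure (Rd d)) (W : TestFn d → Ω → ℝ) (Z : ℝ → Rd d → Ω → ℝ),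
      IsHomogeneousNoise P μ W → specMass q μ ≤ ENNReal.ofReal K → IsStochConv P μ W ν c a T Z →
      (∀ t ∈ Icc 0 T, ∀ x, ∫⁻ ω, ‖Z t x ω‖ₑ ^ (2 * j) ∂P ≤ ENNReal.ofReal C) ∧
      ∀ t ∈ Icc 0 T, ∀ s ∈ Icc 0 T, ∀ x y, ∫⁻ ω, ‖Z t x ω - Z s y ω‖ₑ ^ (2 * j) ∂P
        ≤ ENNReal.ofReal (C * (|t - s| + ‖x - y‖) ^ ((1 - q / 2) * j)) := by
  obtain ⟨C0, hC0, hC⟩ := h.eLpNorm_gHat_le T hq0 hq hK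
  have hM : gaussMoment j = ENNReal.ofReal (gaussMoment j).toReal :=
    (ENNReal.ofReal_toReal (gaussMoment_lt_top j).ne).symm
  refine ⟨C0 ^ j * (gaussMoment j).toReal, by positivity, ?_⟩
  intro Ω _ P _ μ W Z hW hμK hZ
  have hμ := isSpectral_of_specMass hq.le hμK
  have : SigmaFinite μ := hμ.sigmaFinite
  obtain ⟨hC1, hC2⟩ := hC μ hμK
  refine ⟨fun t ht x => ?_, fun t ht s hs x y => ?_⟩
  · refine ((hZ t ht x).lintegral_pow_le hW hμ (h.measurable_gHat t x) (hC1 t ht x) j).trans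
      (le_of_eq ?_)
    rw [hM, ← ENNReal.ofReal_pow hC0, ← ENNReal.ofReal_mul (by positivity), ← hM]
  · have hlc := (hZ s hs y).linComb hW hμ (h.measurable_gHat s y) (h.measurable_gHat t x)
      (hZ t ht x) (-1)
    have hδ : 0 ≤ |t - s| + ‖x - y‖ := by positivity
    have := hlc.lintegral_pow_le hW hμ (A := C0 * (|t - s| + ‖x - y‖) ^ (1 - q / 2))
      (by
        have := ((h.measurable_gHat s y).const_mul (((-1 : ℝ) : ℂ))).add (h.measurable_gHat t x)
        exact this)
      (by
        refine le_trans (le_of_eq ?_) (hC2 t ht s hs x y)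
        congr 2
        ext p
        push_cast; ring) j
    refine le_trans (le_of_eq ?_) (this.trans (le_of_eq ?_))
    · refine lintegral_congr fun ω => ?_
      congr 2
      ring
    · rw [hM, ← ENNReal.ofReal_pow (by positivity), ← ENNReal.ofReal_mul (by positivity), ← hM,
        mul_pow, Real.rpow_mul hδ, Real.rpow_natCast]
      congr 1
      ring

end AdditiveSPDE

end

/-! ### The weighted stochastic convolution as a field on `ℝ^{d+1}` -/

noncomputable section

namespace AdditiveSPDE


variable {d : ℕ}

/-- The time coordinate of a point of `ℝ^{d+1}`, truncated to `[0, T]`. -/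
def gridTime (T : ℝ) (x : Fin (d + 1) → ℝ) : ℝ := max 0 (min (x 0) T)

/-- The space coordinate of a point of `ℝ^{d+1}`. -/
def gridSpace (x : Fin (d + 1) → ℝ) : Rd d := WithLp.toLp 2 fun i => x i.succ

lemma gridTime_mem {T : ℝ} (hT : 0 ≤ T) (x : Fin (d + 1) → ℝ) : gridTime T x ∈ Icc 0 T :=
  ⟨le_max_left _ _, max_le hT (min_le_right _ _)⟩

lemma abs_gridTime_sub_le (T : ℝ) (x y : Fin (d + 1) → ℝ) :
    |gridTime T x - gridTime T y| ≤ ‖x - y‖ := by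
  refine le_trans ?_ (norm_le_pi_norm (x - y) 0)
  rw [Pi.sub_apply, Real.norm_eq_abs]
  unfold gridTime
  refine (abs_max_sub_max_le_max _ _ _ _).trans ?_
  rw [sub_self, abs_zero, max_eq_right (abs_nonneg _)]
  refine (abs_min_sub_min_le_max _ _ _ _).trans ?_
  rw [sub_self, abs_zero, max_eq_left (abs_nonneg _)]

lemma exists_norm_gridSpace_sub_le (d : ℕ) : ∃ A : ℝ, 0 ≤ A ∧ ∀ x y : Fin (d + 1) → ℝ,
    ‖gridSpace x - gridSpace y‖ ≤ A * ‖x - y‖ := by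
  refine ⟨_, norm_nonneg ((EuclideanSpace.equiv (Fin d) ℝ).symm : (Fin d → ℝ) →L[ℝ] Rd d),
    fun x y => ?_⟩
  have e : gridSpace x - gridSpace y
      = ((EuclideanSpace.equiv (Fin d) ℝ).symm : (Fin d → ℝ) →L[ℝ] Rd d)
        (fun i => x i.succ - y i.succ) := rfl
  rw [e]
  refine (ContinuousLinearMap.le_opNorm _ _).trans ?_
  gcongr
  rw [pi_norm_le_iff_of_nonneg (norm_nonneg _)]
  exact fun i => norm_le_pi_norm (x - y) i.succ

/-- A random field on `[0, T] × ℝ^d`, extended to `ℝ^{d+1}` and divided by `1 + |x|`. -/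
def weightField {Ω : Type*} (T : ℝ) (Z : ℝ → Rd d → Ω → ℝ) (x : Fin (d + 1) → ℝ) (ω : Ω) : ℝ :=
  1 / (1 + ‖x‖) * Z (gridTime T x) (gridSpace x) ω

lemma ennreal_add_pow_le (x y : ℝ≥0∞) (N : ℕ) : (x + y) ^ N ≤ 2 ^ N * (x ^ N + y ^ N) := by
  rcases le_total x y with hxy | hxy
  · calc (x + y) ^ N ≤ (2 * y) ^ N := by rw [two_mul]; gcongr
      _ = 2 ^ N * y ^ N := mul_pow _ _ _
      _ ≤ _ := by gcongr; exact le_add_self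
  · calc (x + y) ^ N ≤ (2 * x) ^ N := by rw [two_mul]; gcongr
      _ = 2 ^ N * x ^ N := mul_pow _ _ _
      _ ≤ _ := by gcongr; exact le_self_add

variable {G : ℝ → Measure (Rd d)} {ν : Measure (Rd d)} {c a : ℝ → ℝ}

/-- Product rule: an increment of `Z/(1+|x|)` is an increment of `Z` times a weight at most one,
plus a value of `Z` times an increment of the weight, which is 1-Lipschitz. The bound on `N` lets
`δ^N` and the `N`-th power of the weight dominate the exponents of `ChainMoments` in dimension `d +
1`. -/
lemma chainMoments_weightField {Ω : Type*} [MeasurableSpace Ω] {P : Measure Ω}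
    {Z : ℝ → Rd d → Ω → ℝ} {T : ℝ} (hT : 0 ≤ T) {N : ℕ} (hN : 4 * (d + 1) + 1 ≤ N) {C A β : ℝ}
    (hC : 0 ≤ C) (hA : 0 ≤ A)
    (hA' : ∀ x y : Fin (d + 1) → ℝ, ‖gridSpace x - gridSpace y‖ ≤ A * ‖x - y‖)
    (hβ : (4 * (d + 1) + 1 : ℕ) ≤ β) (hm : ∀ t ∈ Icc 0 T, ∀ x, Measurable (Z t x))
    (h1 : ∀ t ∈ Icc 0 T, ∀ x, ∫⁻ ω, ‖Z t x ω‖ₑ ^ N ∂P ≤ ENNReal.ofReal C)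
    (h2 : ∀ t ∈ Icc 0 T, ∀ s ∈ Icc 0 T, ∀ x y, ∫⁻ ω, ‖Z t x ω - Z s y ω‖ₑ ^ N ∂P
        ≤ ENNReal.ofReal (C * (|t - s| + ‖x - y‖) ^ β)) :
    ChainMoments P (weightField T Z) N (2 ^ N * (C * (1 + A) ^ β + C)) := by
  have hβ0 : 0 ≤ β := le_trans (Nat.cast_nonneg _) hβ
  have hmY : ∀ x, Measurable (weightField T Z x) := fun x =>
    (hm _ (gridTime_mem hT x) _).const_mul _
  refine ⟨hmY, fun x y hxy => ?_, fun x => ?_⟩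
  · set δ := ‖x - y‖ with hδ
    have hδ0 : 0 ≤ δ := norm_nonneg _
    have hmx := hm _ (gridTime_mem hT x) (gridSpace x)
    have hmy := hm _ (gridTime_mem hT y) (gridSpace y)
    have hpt : ∀ ω, ‖weightField T Z x ω - weightField T Z y ω‖ₑ ^ N
        ≤ 2 ^ N * (‖Z (gridTime T x) (gridSpace x) ω - Z (gridTime T y) (gridSpace y) ω‖ₑ ^ N
          + ENNReal.ofReal (δ ^ N) * ‖Z (gridTime T y) (gridSpace y) ω‖ₑ ^ N) := by
      intro ω
      have e : weightField T Z x ω - weightField T Z y ω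
          = 1 / (1 + ‖x‖) * (Z (gridTime T x) (gridSpace x) ω - Z (gridTime T y) (gridSpace y) ω)
            + (1 / (1 + ‖x‖) - 1 / (1 + ‖y‖)) * Z (gridTime T y) (gridSpace y) ω := by
        unfold weightField; ring
      have hw : ‖1 / (1 + ‖x‖)‖ ≤ 1 := by
        rw [Real.norm_of_nonneg (by positivity), div_le_one (by positivity)]
        linarith [norm_nonneg x]
      have hw2 : ‖1 / (1 + ‖x‖) - 1 / (1 + ‖y‖)‖ ≤ δ := by
        rw [Real.norm_eq_abs, div_sub_div _ _ (by positivity) (by positivity), abs_div,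
          abs_of_pos (a := (1 + ‖x‖) * (1 + ‖y‖)) (by positivity), div_le_iff₀ (by positivity)]
        have h3 : |‖x‖ - ‖y‖| ≤ δ := abs_norm_sub_norm_le x y
        have h4 : |1 * (1 + ‖y‖) - (1 + ‖x‖) * 1| = |‖x‖ - ‖y‖| := by
          rw [abs_sub_comm]; congr 1; ring
        rw [h4]
        have h5 : 1 ≤ (1 + ‖x‖) * (1 + ‖y‖) := by nlinarith [norm_nonneg x, norm_nonneg y]
        nlinarith
      rw [e]
      refine le_trans (pow_le_pow_left' (enorm_add_le _ _) N) ((ennreal_add_pow_le _ _ N).trans ?_)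
      gcongr
      · rw [enorm_mul]
        refine mul_le_of_le_one_left zero_le ?_
        rw [← ofReal_norm]; exact ENNReal.ofReal_le_one.2 hw
      · rw [enorm_mul, mul_pow, ENNReal.ofReal_pow hδ0]
        gcongr
        rw [← ofReal_norm]; exact ENNReal.ofReal_le_ofReal hw2
    refine (lintegral_mono hpt).trans ?_
    have hmd : Measurable fun ω =>
        ‖Z (gridTime T x) (gridSpace x) ω - Z (gridTime T y) (gridSpace y) ω‖ₑ ^ N :=
      (hmx.sub hmy).enorm.pow_const N
    rw [lintegral_const_mul' _ _ (by simp), lintegral_add_left hmd,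
      lintegral_const_mul' _ _ (by simp)]
    have hb1 : ∫⁻ ω, ‖Z (gridTime T x) (gridSpace x) ω - Z (gridTime T y) (gridSpace y) ω‖ₑ ^ N ∂P
        ≤ ENNReal.ofReal (C * (1 + A) ^ β * δ ^ (4 * (d + 1) + 1)) := by
      refine (h2 _ (gridTime_mem hT x) _ (gridTime_mem hT y) _ _).trans
        (ENNReal.ofReal_le_ofReal ?_)
      rw [mul_assoc]
      refine mul_le_mul_of_nonneg_left ?_ hC
      calc _ ≤ ((1 + A) * δ) ^ β := by
            refine Real.rpow_le_rpow (by positivity) ?_ hβ0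
            have := abs_gridTime_sub_le T x y
            have := hA' x y
            linarith
        _ = (1 + A) ^ β * δ ^ β := Real.mul_rpow (by positivity) hδ0
        _ ≤ _ := by
            refine mul_le_mul_of_nonneg_left ?_ (by positivity)
            rcases hδ0.eq_or_lt with h0 | h0
            · rw [← h0, Real.zero_rpow, zero_pow (by omega)]
              have : (0 : ℝ) < (4 * (d + 1) + 1 : ℕ) := by positivity
              linarith
            · rw [← Real.rpow_natCast]
              exact Real.rpow_le_rpow_of_exponent_ge h0 hxy hβ
    have hb2 : ENNReal.ofReal (δ ^ N) * ∫⁻ ω, ‖Z (gridTime T y) (gridSpace y) ω‖ₑ ^ N ∂P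
        ≤ ENNReal.ofReal (C * δ ^ (4 * (d + 1) + 1)) := by
      refine (mul_le_mul_right (h1 _ (gridTime_mem hT y) _) _).trans ?_
      rw [← ENNReal.ofReal_mul (by positivity), mul_comm C]
      refine ENNReal.ofReal_le_ofReal ?_
      gcongr ?_ * C
      exact pow_le_pow_of_le_one hδ0 hxy hN
    calc _ ≤ 2 ^ N * (ENNReal.ofReal (C * (1 + A) ^ β * δ ^ (4 * (d + 1) + 1))
            + ENNReal.ofReal (C * δ ^ (4 * (d + 1) + 1))) := by gcongr
      _ = _ := by
        rw [← ENNReal.ofReal_add (by positivity) (by positivity),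
          show (2 : ℝ≥0∞) ^ N = ENNReal.ofReal (2 ^ N) by
            rw [ENNReal.ofReal_pow (by norm_num)]; norm_num,
          ← ENNReal.ofReal_mul (by positivity)]
        congr 1; ring
  · have hw0 : 0 ≤ 1 / (1 + ‖x‖) := by positivity
    have hw : 1 / (1 + ‖x‖) ≤ 1 := by
      rw [div_le_one (by positivity)]
      linarith [norm_nonneg x]
    have hpt : ∀ ω, ‖weightField T Z x ω‖ₑ ^ N
        = ENNReal.ofReal ((1 / (1 + ‖x‖)) ^ N) * ‖Z (gridTime T x) (gridSpace x) ω‖ₑ ^ N := by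
      intro ω
      unfold weightField
      rw [enorm_mul, mul_pow, ENNReal.ofReal_pow hw0, ← ofReal_norm, Real.norm_of_nonneg hw0]
    simp_rw [hpt]
    rw [lintegral_const_mul' _ _ (by simp)]
    refine (mul_le_mul_right (h1 _ (gridTime_mem hT x) _) _).trans ?_
    rw [← ENNReal.ofReal_mul (by positivity), mul_comm]
    refine ENNReal.ofReal_le_ofReal ?_
    have hb : C ≤ 2 ^ N * (C * (1 + A) ^ β + C) := by
      have h3 : (1 : ℝ) ≤ 2 ^ N := one_le_pow₀ (by norm_num)
      have h4 : 0 ≤ C * (1 + A) ^ β := by positivity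
      nlinarith
    refine mul_le_mul hb (pow_le_pow_of_le_one hw0 hw (by omega)) (by positivity) (hC.trans hb)

/-- The stochastic convolution has a version whose weighted paths are bounded and continuous, with
uniform control of the distance to its interpolations. -/
theorem IsScaledKernel.exists_weighted_version (h : IsScaledKernel G ν c a) {T : ℝ} (hT : 0 ≤ T)
    {q K : ℝ} (hq0 : 0 < q) (hq : q < 2) (hK : 0 ≤ K) : ∃ K' r : ℝ, 0 ≤ r ∧ r < 1 ∧
      ∀ {Ω : Type*} [MeasurableSpace Ω] (P : Measure Ω) [IsProbabilityMeasure P]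
      (μ : Measure (Rd d)) (W : TestFn d → Ω → ℝ) (Z : ℝ → Rd d → Ω → ℝ),
      IsHomogeneousNoise P μ W → specMass q μ ≤ ENNReal.ofReal K → IsStochConv P μ W ν c a T Z →
      ∃ V : Ω → BoundedContinuousFunction (Fin (d + 1) → ℝ) ℝ, StronglyMeasurable V ∧
        (∀ x, ∀ᵐ ω ∂P, V ω x = weightField T Z x ω) ∧
        ∀ k, eLpNorm (fun ω => V ω - randomInterp (weightField T Z) (k + 1) ω) 1 P
          ≤ ENNReal.ofReal (K' * r ^ k) := by
  have hκ : 0 < 1 - q / 2 := by linarith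
  -- The `2j`-th moment of an increment is of order `δ^{(1-q/2) j}`; `j` is taken so large that this
  -- exponent reaches `4D + 1` with `D = d + 1`.
  obtain ⟨j, hj⟩ := exists_nat_ge (((4 * (d + 1) + 1 : ℕ) : ℝ) / (1 - q / 2))
  have hβ : ((4 * (d + 1) + 1 : ℕ) : ℝ) ≤ (1 - q / 2) * j := by
    rw [div_le_iff₀ hκ] at hj
    linarith
  have hjN : 4 * (d + 1) + 1 ≤ 2 * j := by
    have h1 : ((4 * (d + 1) + 1 : ℕ) : ℝ) ≤ j := by
      refine hβ.trans (mul_le_of_le_one_left (Nat.cast_nonneg _) (by linarith))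
    have : 4 * (d + 1) + 1 ≤ j := by exact_mod_cast h1
    omega
  obtain ⟨C, hC, hCm⟩ := h.exists_moment_bound T hq0 hq hK j
  obtain ⟨A, hA, hA'⟩ := exists_norm_gridSpace_sub_le d
  obtain ⟨K', r, hr0, hr1, hmain⟩ := exists_continuous_version (2 * j) (by omega)
    (2 ^ (2 * j) * (C * (1 + A) ^ ((1 - q / 2) * j) + C)) (by positivity) (d + 1)
  refine ⟨K', r, hr0, hr1, ?_⟩
  intro Ω _ P _ μ W Z hW hμ hZ
  obtain ⟨h1, h2⟩ := hCm P μ W Z hW hμ hZ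
  exact hmain P (weightField T Z) (chainMoments_weightField hT hjN hC hA hA' hβ
    (fun t ht x => (hZ t ht x).measurable) h1 h2)

end AdditiveSPDE

end

/-! ### Space-time convolution with the kernel in a weighted norm -/

noncomputable section

namespace AdditiveSPDE


variable {d : ℕ} {G : ℝ → Measure (Rd d)} {ν : Measure (Rd d)} {c a : ℝ → ℝ}

/-- The weight `e^{lt} (1 + |x|)`. -/
def weight (l t : ℝ) (x : Rd d) : ℝ := Real.exp (l * t) * (1 + ‖x‖)

lemma weight_pos (l t : ℝ) (x : Rd d) : 0 < weight l t x := by unfold weight; positivity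

lemma one_le_weight {l t : ℝ} (hl : 0 ≤ l) (ht : 0 ≤ t) (x : Rd d) : 1 ≤ weight l t x :=
  one_le_mul_of_one_le_of_one_le (Real.one_le_exp (by positivity)) (by linarith [norm_nonneg x])

lemma continuous_weight (l : ℝ) : Continuous fun p : ℝ × Rd d => weight l p.1 p.2 := by
  unfold weight; fun_prop

/-- The measure `dr ν(dy)` on `(0, T) × ℝ^d`. -/
def potMeasure (T : ℝ) (ν : Measure (Rd d)) : Measure (ℝ × Rd d) :=
  (volume.restrict (Ioo (0 : ℝ) T)).prod ν

instance (T : ℝ) (ν : Measure (Rd d)) [IsFiniteMeasure ν] : IsFiniteMeasure (potMeasure T ν) := by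
  unfold potMeasure; infer_instance

/-- The integrand of the space-time convolution with the kernel. -/
def potIntegrand (c a : ℝ → ℝ) (F : ℝ → Rd d → ℝ) (t : ℝ) (x : Rd d) (p : ℝ × Rd d) : ℝ :=
  if p.1 < t then c p.1 * F (t - p.1) (x - a p.1 • p.2) else 0

/-- The space-time convolution `∫₀ᵗ (F(s) * G_{t-s})(x) ds`, written with the scaled kernel. -/
def potential (T : ℝ) (ν : Measure (Rd d)) (c a : ℝ → ℝ) (F : ℝ → Rd d → ℝ) (t : ℝ) (x : Rd d) : ℝ :=
  ∫ p, potIntegrand c a F t x p ∂(potMeasure T ν)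

/-- Measurable functions on `[0, T] × ℝ^d` that are continuous for positive times and grow at most
like the weight. -/
structure HasGrowth (T l B : ℝ) (F : ℝ → Rd d → ℝ) : Prop where
  measurable : Measurable fun p : ℝ × Rd d => F p.1 p.2
  continuousOn : ContinuousOn (fun p : ℝ × Rd d => F p.1 p.2) (Ioc 0 T ×ˢ univ)
  bound : ∀ s ∈ Ioc 0 T, ∀ y, |F s y| ≤ B * weight l s y

lemma measurable_potIntegrand (hc : Measurable c) (ha : Measurable a) {F : ℝ → Rd d → ℝ}
    (hF : Measurable fun p : ℝ × Rd d => F p.1 p.2) (t : ℝ) (x : Rd d) :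
    Measurable (potIntegrand c a F t x) := by
  unfold potIntegrand
  refine Measurable.ite (measurableSet_lt measurable_fst measurable_const) ?_ measurable_const
  refine (hc.comp measurable_fst).mul (hF.comp ((measurable_const.sub measurable_fst).prodMk ?_))
  exact measurable_const.sub ((ha.comp measurable_fst).smul measurable_snd)

lemma ae_potMeasure [SFinite ν] (T : ℝ) : ∀ᵐ p ∂(potMeasure T ν), p.1 ∈ Ioo 0 T := by
  unfold potMeasure
  exact Measure.quasiMeasurePreserving_fst.ae (ae_restrict_mem measurableSet_Ioo)

/-- Constants for the kernel on `[0, T]`. -/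
lemma IsScaledKernel.exists_bounds (h : IsScaledKernel G ν c a) (T : ℝ) : ∃ C A : ℝ, 0 ≤ C ∧ 0 ≤ A ∧
    ∀ r ∈ Icc 0 T, c r ≤ C ∧ a r ≤ A := by
  obtain ⟨C, hC⟩ := isCompact_Icc.exists_bound_of_continuousOn (s := Icc 0 T) h.amp_cont.continuousOn
  obtain ⟨A, hA⟩ := isCompact_Icc.exists_bound_of_continuousOn (s := Icc 0 T) h.dil_cont.continuousOn
  exact ⟨max C 0, max A 0, le_max_right _ _, le_max_right _ _, fun r hr =>
    ⟨((le_abs_self _).trans (hC r hr)).trans (le_max_left _ _),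
      ((le_abs_self _).trans (hA r hr)).trans (le_max_left _ _)⟩⟩

lemma IsScaledKernel.abs_potIntegrand_le (h : IsScaledKernel G ν c a) {T C A : ℝ} (hC : 0 ≤ C)
    (hCA : ∀ r ∈ Icc 0 T, c r ≤ C ∧ a r ≤ A) {l B : ℝ} (hB : 0 ≤ B) {F : ℝ → Rd d → ℝ}
    (hF : ∀ s ∈ Ioc 0 T, ∀ y, |F s y| ≤ B * weight l s y) {t : ℝ} (ht : t ∈ Icc 0 T) (x : Rd d)
    {p : ℝ × Rd d} (hp : p.1 ∈ Ioo 0 T) :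
    |potIntegrand c a F t x p| ≤ C * B * ((if p.1 < t then Real.exp (l * (t - p.1)) else 0)
      * (1 + ‖x‖ + A * ‖p.2‖)) := by
  unfold potIntegrand
  split_ifs with hpt
  · obtain ⟨h1, h2⟩ := hCA p.1 ⟨hp.1.le, hp.2.le⟩
    rw [abs_mul, abs_of_nonneg (h.amp_nonneg _)]
    have h3 := hF (t - p.1) ⟨by linarith, by linarith [ht.2, hp.1]⟩ (x - a p.1 • p.2)
    have h4 : ‖x - a p.1 • p.2‖ ≤ ‖x‖ + A * ‖p.2‖ := by
      refine (norm_sub_le _ _).trans ?_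
      rw [norm_smul, Real.norm_of_nonneg (h.dil_nonneg _)]
      gcongr
    calc c p.1 * |F (t - p.1) (x - a p.1 • p.2)|
        ≤ C * (B * (Real.exp (l * (t - p.1)) * (1 + (‖x‖ + A * ‖p.2‖)))) := by
          refine mul_le_mul h1 (h3.trans ?_) (abs_nonneg _) hC
          unfold weight
          gcongr
      _ = _ := by ring
  · simp

/-- Source of the small factor `1/l` that yields a contraction. -/
lemma integral_Ioo_exp_le {l : ℝ} (hl : 0 < l) {t T : ℝ} (ht : t ∈ Icc 0 T) :
    ∫ r in Ioo 0 T, (if r < t then Real.exp (l * (t - r)) else 0) ≤ Real.exp (l * t) / l := by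
  have e1 : (fun r => if r < t then Real.exp (l * (t - r)) else 0)
      = (Iio t).indicator fun r => Real.exp (l * (t - r)) := by
    ext r; simp [indicator]
  rw [e1, setIntegral_indicator measurableSet_Iio, Ioo_inter_Iio, min_eq_right ht.2,
    ← integral_Ioc_eq_integral_Ioo, ← intervalIntegral.integral_of_le ht.1,
    intervalIntegral.integral_comp_sub_left (fun r => Real.exp (l * r)) t, sub_self, sub_zero,
    intervalIntegral.integral_comp_mul_left (fun r => Real.exp r) hl.ne', integral_exp]
  simp only [mul_zero, Real.exp_zero, smul_eq_mul]
  rw [inv_mul_eq_div]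
  gcongr
  linarith

lemma IsScaledKernel.integrable_potBound (h : IsScaledKernel G ν c a) (T A t l : ℝ) (x : Rd d) :
    Integrable (fun p : ℝ × Rd d => (if p.1 < t then Real.exp (l * (t - p.1)) else 0)
      * (1 + ‖x‖ + A * ‖p.2‖)) (potMeasure T ν) := by
  have := h.prob
  unfold potMeasure
  refine Integrable.mul_prod (f := fun r => if r < t then Real.exp (l * (t - r)) else 0)
    (g := fun y : Rd d => 1 + ‖x‖ + A * ‖y‖) ?_ ?_
  · refine Integrable.mono' (g := fun r => Real.exp (l * (t - r))) ?_ ?_ ?_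
    · exact ((by fun_prop : Continuous fun r => Real.exp (l * (t - r))).integrableOn_Icc
        (a := 0) (b := T)).mono_set Ioo_subset_Icc_self
    · exact (Measurable.ite measurableSet_Iio (by fun_prop) measurable_const).aestronglyMeasurable
    · refine Eventually.of_forall fun r => ?_
      split_ifs
      · rw [Real.norm_of_nonneg (by positivity)]
      · simp; positivity
  · exact (integrable_const _).add (h.moment.const_mul A)

lemma IsScaledKernel.integrable_potIntegrand (h : IsScaledKernel G ν c a) {T l B : ℝ} (hB : 0 ≤ B)
    {F : ℝ → Rd d → ℝ} (hF : HasGrowth T l B F) {t : ℝ} (ht : t ∈ Icc 0 T) (x : Rd d) :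
    Integrable (potIntegrand c a F t x) (potMeasure T ν) := by
  have := h.prob
  obtain ⟨C, A, hC, hA, hCA⟩ := h.exists_bounds T
  refine Integrable.mono' ((h.integrable_potBound T A t l x).const_mul (C * B))
    (measurable_potIntegrand h.amp_cont.measurable h.dil_cont.measurable hF.measurable t
      x).aestronglyMeasurable ?_
  filter_upwards [ae_potMeasure (ν := ν) T] with p hp
  exact h.abs_potIntegrand_le hC hCA hB hF.bound ht x hp

/-- The potential is bounded in the weighted norm, with a constant that is small for large `l`. -/
lemma IsScaledKernel.abs_potential_le (h : IsScaledKernel G ν c a) (T : ℝ) : ∃ C : ℝ, 0 ≤ C ∧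
    ∀ l B : ℝ, 0 < l → 0 ≤ B → ∀ F : ℝ → Rd d → ℝ,
    (∀ s ∈ Ioc 0 T, ∀ y, |F s y| ≤ B * weight l s y) → ∀ t ∈ Icc 0 T, ∀ x,
    |potential T ν c a F t x| ≤ C / l * B * weight l t x := by
  have := h.prob
  obtain ⟨C, A, hC, hA, hCA⟩ := h.exists_bounds T
  set m1 := ∫ y, ‖y‖ ∂ν with hm1
  have hm10 : 0 ≤ m1 := integral_nonneg fun _ => norm_nonneg _
  refine ⟨C * (1 + A * m1), by positivity, ?_⟩
  intro l B hl hB F hF t ht x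
  calc |potential T ν c a F t x|
      ≤ ∫ p, C * B * ((if p.1 < t then Real.exp (l * (t - p.1)) else 0)
          * (1 + ‖x‖ + A * ‖p.2‖)) ∂(potMeasure T ν) := by
        unfold potential
        rw [← Real.norm_eq_abs]
        refine norm_integral_le_of_norm_le ((h.integrable_potBound T A t l x).const_mul (C * B)) ?_
        filter_upwards [ae_potMeasure (ν := ν) T] with p hp
        exact h.abs_potIntegrand_le hC hCA hB hF ht x hp
    _ = C * B * ((∫ r in Ioo 0 T, (if r < t then Real.exp (l * (t - r)) else 0))
          * ∫ y, (1 + ‖x‖ + A * ‖y‖) ∂ν) := by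
        rw [integral_const_mul, potMeasure]
        congr 1
        exact integral_prod_mul (fun r => if r < t then Real.exp (l * (t - r)) else 0)
          (fun y : Rd d => 1 + ‖x‖ + A * ‖y‖)
    _ ≤ C * B * ((Real.exp (l * t) / l) * ((1 + A * m1) * (1 + ‖x‖))) := by
        have e : ∫ y, (1 + ‖x‖ + A * ‖y‖) ∂ν = 1 + ‖x‖ + A * m1 := by
          rw [integral_add (integrable_const _) (h.moment.const_mul A), integral_const,
            integral_const_mul, ← hm1]
          simp
        rw [e]
        have h1 := integral_Ioo_exp_le hl ht
        -- The weight `1 + |x|` is preserved by averaging, up to a constant, because `ν` has a first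
        -- moment.
        have h2 : 1 + ‖x‖ + A * m1 ≤ (1 + A * m1) * (1 + ‖x‖) := by
          nlinarith [norm_nonneg x, mul_nonneg (mul_nonneg hA hm10) (norm_nonneg x)]
        gcongr
    _ = _ := by unfold weight; field_simp

lemma IsScaledKernel.potential_sub (h : IsScaledKernel G ν c a) {T l B B' : ℝ} (hB : 0 ≤ B)
    (hB' : 0 ≤ B') {F F' : ℝ → Rd d → ℝ} (hF : HasGrowth T l B F) (hF' : HasGrowth T l B' F') {t : ℝ}
    (ht : t ∈ Icc 0 T) (x : Rd d) : potential T ν c a F t x - potential T ν c a F' t x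
      = potential T ν c a (fun s y => F s y - F' s y) t x := by
  unfold potential
  rw [← integral_sub (h.integrable_potIntegrand hB hF ht x) (h.integrable_potIntegrand hB' hF' ht x)]
  refine integral_congr_ae (Eventually.of_forall fun p => ?_)
  simp only [potIntegrand]
  split_ifs <;> ring

/-- Dominated convergence: the truncation jumps only at `r = t`, a null set of times, and for `r <
t` the function `F` is evaluated at the positive time `t - r`. Continuity of `F` at time zero is
therefore not needed. -/
lemma IsScaledKernel.continuous_potential (h : IsScaledKernel G ν c a) {T l B : ℝ} (hl : 0 ≤ l)
    (hB : 0 ≤ B) {F : ℝ → Rd d → ℝ} (hF : HasGrowth T l B F) :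
    Continuous fun z : Icc (0 : ℝ) T × Rd d => potential T ν c a F z.1 z.2 := by
  have := h.prob
  obtain ⟨C, A, hC, hA, hCA⟩ := h.exists_bounds T
  rw [continuous_iff_continuousAt]
  intro z
  refine tendsto_integral_filter_of_dominated_convergence
    (fun p => C * B * (Real.exp (l * T) * (1 + (‖z.2‖ + 1) + A * ‖p.2‖))) ?_ ?_ ?_ ?_
  · exact Eventually.of_forall fun z => (measurable_potIntegrand h.amp_cont.measurable
      h.dil_cont.measurable hF.measurable _ _).aestronglyMeasurable
  · have hev : ∀ᶠ z' : Icc (0 : ℝ) T × Rd d in 𝓝 z, ‖z'.2‖ < ‖z.2‖ + 1 :=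
      (continuous_snd.norm.tendsto z).eventually (gt_mem_nhds (by linarith))
    filter_upwards [hev] with z' hz'
    filter_upwards [ae_potMeasure (ν := ν) T] with p hp
    refine (h.abs_potIntegrand_le hC hCA hB hF.bound z'.1.2 z'.2 hp).trans ?_
    have h1 : (if p.1 < z'.1 then Real.exp (l * (z'.1 - p.1)) else 0) ≤ Real.exp (l * T) := by
      split_ifs
      · refine Real.exp_le_exp.2 (mul_le_mul_of_nonneg_left ?_ hl)
        linarith [z'.1.2.2, hp.1]
      · positivity
    gcongr
  · unfold potMeasure
    refine Integrable.const_mul ?_ _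
    exact ((integrable_const (μ := volume.restrict (Ioo 0 T)) (Real.exp (l * T)))).mul_prod
      (g := fun y : Rd d => 1 + (‖z.2‖ + 1) + A * ‖y‖)
      ((integrable_const _).add (h.moment.const_mul A))
  · have hne : ∀ᵐ p ∂(potMeasure T ν), p.1 ≠ (z.1 : ℝ) := by
      unfold potMeasure
      refine Measure.quasiMeasurePreserving_fst.ae (p := fun r => r ≠ (z.1 : ℝ))
        (ae_restrict_of_ae ?_)
      exact (measure_eq_zero_iff_ae_notMem.1 (measure_singleton (z.1 : ℝ)))
    filter_upwards [ae_potMeasure (ν := ν) T, hne] with p hp hpz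
    have ct : Tendsto (fun z' : Icc (0 : ℝ) T × Rd d => (z'.1 : ℝ)) (𝓝 z) (𝓝 (z.1 : ℝ)) :=
      (continuous_subtype_val.comp continuous_fst).tendsto z
    rcases lt_or_gt_of_ne hpz with hlt | hgt
    · have hev : ∀ᶠ z' : Icc (0 : ℝ) T × Rd d in 𝓝 z, p.1 < z'.1 := ct.eventually (lt_mem_nhds hlt)
      have hlim : Tendsto (fun z' : Icc (0 : ℝ) T × Rd d =>
          c p.1 * F (z'.1 - p.1) (z'.2 - a p.1 • p.2)) (𝓝 z)
          (𝓝 (c p.1 * F (z.1 - p.1) (z.2 - a p.1 • p.2))) := by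
        refine Tendsto.const_mul _ ?_
        have hcw := hF.continuousOn ((z.1 : ℝ) - p.1, z.2 - a p.1 • p.2)
          ⟨⟨by simpa using hlt, by have := z.1.2.2; have := hp.1; simp; linarith⟩, mem_univ _⟩
        refine Tendsto.comp (f := fun z' : Icc (0 : ℝ) T × Rd d =>
          ((z'.1 : ℝ) - p.1, z'.2 - a p.1 • p.2)) hcw.tendsto (tendsto_nhdsWithin_iff.2 ⟨?_, ?_⟩)
        · exact (ct.sub_const _).prodMk_nhds ((continuous_snd.tendsto z).sub_const _)
        · filter_upwards [hev] with z' hz'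
          exact ⟨⟨by simpa using hz', by have := z'.1.2.2; have := hp.1; simp; linarith⟩, mem_univ _⟩
      simp only [potIntegrand]
      rw [if_pos hlt]
      refine hlim.congr' ?_
      filter_upwards [hev] with z' hz'
      rw [if_pos hz']
    · have hev : ∀ᶠ z' : Icc (0 : ℝ) T × Rd d in 𝓝 z, z'.1 < p.1 := ct.eventually (gt_mem_nhds hgt)
      simp only [potIntegrand]
      rw [if_neg hgt.le.not_gt]
      refine tendsto_const_nhds.congr' ?_
      filter_upwards [hev] with z' hz'
      rw [if_neg hz'.le.not_gt]

/-- The potential is the time integral of the spatial convolutions. -/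
lemma IsScaledKernel.potential_eq {eqn : Equation}
    (h : IsScaledKernel (fundamentalSolution eqn d) ν c a) {T : ℝ} {F : ℝ → Rd d → ℝ}
    (hF : Measurable fun p : ℝ × Rd d => F p.1 p.2) {t : ℝ} (ht : t ∈ Icc 0 T) (x : Rd d)
    (hi : Integrable (potIntegrand c a F t x) (potMeasure T ν)) :
    potential T ν c a F t x = ∫ s in (0 : ℝ)..t, kernelConv eqn (F s) (t - s) x := by
  have := h.prob
  have hFs : ∀ s, Measurable (F s) := fun s => hF.comp (measurable_const.prodMk measurable_id)
  have e1 : ∫ s in (0 : ℝ)..t, kernelConv eqn (F s) (t - s) x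
      = ∫ s in (0 : ℝ)..t, (fun r => c r * ∫ y, F (t - r) (x - a r • y) ∂ν) (t - s) := by
    refine intervalIntegral.integral_congr_ae ?_
    have hne : ∀ᵐ s : ℝ, s ≠ t := measure_eq_zero_iff_ae_notMem.1 (measure_singleton t)
    filter_upwards [hne] with s hst hs
    rw [uIoc_of_le ht.1] at hs
    have hs' : 0 < t - s := sub_pos.2 (lt_of_le_of_ne hs.2 hst)
    unfold kernelConv
    have hm : Measurable fun y => F s (x - y) := (hFs s).comp (measurable_const.sub measurable_id)
    rw [h.integral_eq hs' hm.aestronglyMeasurable]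
    simp
  rw [e1, intervalIntegral.integral_comp_sub_left
    (fun r => c r * ∫ y, F (t - r) (x - a r • y) ∂ν) t, sub_self, sub_zero,
    intervalIntegral.integral_of_le ht.1, integral_Ioc_eq_integral_Ioo]
  unfold potential potMeasure
  rw [integral_prod _ hi]
  have e2 : ∀ r, ∫ y, potIntegrand c a F t x (r, y) ∂ν
      = (Iio t).indicator (fun r => c r * ∫ y, F (t - r) (x - a r • y) ∂ν) r := by
    intro r
    simp only [potIntegrand, indicator, mem_Iio]
    split_ifs
    · rw [integral_const_mul]
    · simp
  simp_rw [e2]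
  rw [setIntegral_indicator measurableSet_Iio, Ioo_inter_Iio, min_eq_right ht.2]

end AdditiveSPDE

end

/-! ### The drift as a contraction, and its resolvent -/

noncomputable section

namespace AdditiveSPDE


variable {d : ℕ} {G : ℝ → Measure (Rd d)} {ν : Measure (Rd d)} {c a : ℝ → ℝ}

/-- Bounded continuous functions on `[0, T] × ℝ^d`. -/
abbrev Path (T : ℝ) (d : ℕ) : Type := BoundedContinuousFunction (Icc (0 : ℝ) T × Rd d) ℝ

/-- The properties of the linear part that are used for positive times. -/
structure LinData (T M : ℝ) (I : ℝ → Rd d → ℝ) : Prop where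
  measurable : Measurable fun p : ℝ × Rd d => I p.1 p.2
  continuousOn : ContinuousOn (fun p : ℝ × Rd d => I p.1 p.2) (Ioc 0 T ×ˢ univ)
  bound : ∀ s y, |I s y| ≤ M

/-- The drift evaluated along the field `I + weight · v`. -/
def driftField (b : ℝ → ℝ) (I : ℝ → Rd d → ℝ) (l : ℝ) {T : ℝ} (hT : 0 ≤ T) (v : Path T d)
    (s : ℝ) (y : Rd d) : ℝ :=
  b (I s y + weight l s y * v (projIcc 0 T hT s, y))

lemma abs_le_of_lipschitz {b : ℝ → ℝ} {K : ℝ≥0} (hb : LipschitzWith K b) (z : ℝ) :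
    |b z| ≤ |b 0| + K * |z| := by
  have h1 := hb.dist_le_mul z 0
  rw [Real.dist_eq, Real.dist_eq, sub_zero] at h1
  have h2 := abs_sub_abs_le_abs_sub (b z) (b 0)
  linarith

lemma hasGrowth_driftField {b : ℝ → ℝ} {K : ℝ≥0} (hb : LipschitzWith K b) {T M : ℝ} (hT : 0 ≤ T)
    (hM : 0 ≤ M) {I : ℝ → Rd d → ℝ} (hI : LinData T M I) {l : ℝ} (hl : 0 ≤ l) (v : Path T d) :
    HasGrowth T l (|b 0| + K * (M + ‖v‖)) (driftField b I l hT v) := by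
  have hv : Continuous fun p : ℝ × Rd d => weight l p.1 p.2 * v (projIcc 0 T hT p.1, p.2) :=
    (continuous_weight l).mul (v.continuous.comp
      ((continuous_projIcc.comp continuous_fst).prodMk continuous_snd))
  refine ⟨?_, ?_, fun s hs y => ?_⟩
  · exact hb.continuous.measurable.comp (hI.measurable.add hv.measurable)
  · exact hb.continuous.comp_continuousOn (hI.continuousOn.add hv.continuousOn)
  · have hw := one_le_weight hl hs.1.le y
    have hw0 := weight_pos l s y
    have h1 : |I s y + weight l s y * v (projIcc 0 T hT s, y)| ≤ M + weight l s y * ‖v‖ := by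
      refine (abs_add_le _ _).trans (add_le_add (hI.bound s y) ?_)
      rw [abs_mul, abs_of_pos hw0]
      exact mul_le_mul_of_nonneg_left (v.norm_coe_le_norm _) hw0.le
    calc |driftField b I l hT v s y| ≤ |b 0| + K * (M + weight l s y * ‖v‖) :=
          (abs_le_of_lipschitz hb _).trans (by gcongr)
      _ ≤ |b 0| * weight l s y + K * (M * weight l s y + weight l s y * ‖v‖) := by
          gcongr
          · exact le_mul_of_one_le_right (abs_nonneg _) hw
          · exact le_mul_of_one_le_right hM hw
      _ = _ := by ring

/-- In a suitable weighted norm the integral part of the equation is a contraction. -/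
lemma IsScaledKernel.exists_contraction (h : IsScaledKernel G ν c a) {T : ℝ} (hT : 0 ≤ T) {b : ℝ → ℝ}
    {K : ℝ≥0} (hb : LipschitzWith K b) : ∃ l : ℝ, 0 < l ∧ ∀ (M : ℝ) (I : ℝ → Rd d → ℝ), 0 ≤ M →
    LinData T M I → ∃ Q : Path T d → Path T d,
      (∀ v z, weight l z.1 z.2 * Q v z = potential T ν c a (driftField b I l hT v) z.1 z.2) ∧
      ∀ v v', ‖Q v - Q v'‖ ≤ 1 / 2 * ‖v - v'‖ := by
  obtain ⟨C, hC, hpot⟩ := h.abs_potential_le T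
  -- With this `l` the Lipschitz constant `C K / l` of `Q` is at most 1/2. It depends on the kernel,
  -- `T` and the drift, not on `I`.
  refine ⟨2 * C * K + 1, by positivity, fun M I hM hI => ?_⟩
  set l : ℝ := 2 * C * K + 1 with hl
  have hl0 : 0 < l := by positivity
  have hgr := fun v : Path T d => hasGrowth_driftField hb hT hM hI hl0.le v
  have hB : ∀ v : Path T d, 0 ≤ |b 0| + K * (M + ‖v‖) := fun v => by positivity
  set Q : Path T d → Path T d := fun v => BoundedContinuousFunction.ofNormedAddCommGroup
    (fun z => potential T ν c a (driftField b I l hT v) z.1 z.2 / weight l z.1 z.2)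
    ((h.continuous_potential hl0.le (hB v) (hgr v)).div
      ((continuous_weight l).comp ((continuous_subtype_val.comp continuous_fst).prodMk
        continuous_snd)) fun z => (weight_pos l z.1 z.2).ne')
    (C / l * (|b 0| + K * (M + ‖v‖))) (fun z => by
      rw [Real.norm_eq_abs, abs_div, abs_of_pos (weight_pos l z.1 z.2),
        div_le_iff₀ (weight_pos l z.1 z.2)]
      exact hpot l _ hl0 (hB v) _ (hgr v).bound z.1 z.1.2 z.2) with hQ
  have hQv : ∀ v z, Q v z = potential T ν c a (driftField b I l hT v) z.1 z.2 / weight l z.1 z.2 :=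
    fun v z => rfl
  refine ⟨Q, fun v z => ?_, fun v v' => ?_⟩
  · rw [hQv, mul_div_cancel₀ _ (weight_pos l z.1 z.2).ne']
  · refine (BoundedContinuousFunction.norm_le (by positivity)).2 fun z => ?_
    have hw := weight_pos l z.1 z.2
    rw [BoundedContinuousFunction.sub_apply, hQv, hQv, ← sub_div, Real.norm_eq_abs, abs_div,
      abs_of_pos hw, div_le_iff₀ hw, h.potential_sub (hB v) (hB v') (hgr v) (hgr v') z.1.2 z.2]
    refine (hpot l (K * ‖v - v'‖) hl0 (by positivity) _ (fun s hs y => ?_) z.1 z.1.2 z.2).trans ?_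
    · unfold driftField
      have := hb.dist_le_mul (I s y + weight l s y * v (projIcc 0 T hT s, y))
        (I s y + weight l s y * v' (projIcc 0 T hT s, y))
      rw [Real.dist_eq, Real.dist_eq] at this
      refine this.trans ?_
      rw [add_sub_add_left_eq_sub, ← mul_sub, abs_mul, abs_of_pos (weight_pos l s y), mul_assoc,
        mul_comm ‖v - v'‖]
      have h2 := (v - v').norm_coe_le_norm (projIcc 0 T hT s, y)
      rw [BoundedContinuousFunction.sub_apply, Real.norm_eq_abs] at h2
      have := weight_pos l s y
      gcongr
    · have : C / l * (K * ‖v - v'‖) ≤ 1 / 2 * ‖v - v'‖ := by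
        rw [← mul_assoc]
        refine mul_le_mul_of_nonneg_right ?_ (norm_nonneg _)
        rw [div_mul_eq_mul_div, div_le_iff₀ hl0]
        linarith
      gcongr

/-- The inverse of a perturbation of the identity by a contraction. -/
lemma exists_resolvent {E : Type*} [NormedAddCommGroup E] [CompleteSpace E] {Q : E → E}
    (hQ : ∀ v v', ‖Q v - Q v'‖ ≤ 1 / 2 * ‖v - v'‖) : ∃ S : E → E, (∀ z, S z = z + Q (S z)) ∧
      LipschitzWith 2 S ∧ ∀ z, Tendsto (fun j => (fun v => z + Q v)^[j] 0) atTop (𝓝 (S z)) := by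
  have hcon : ∀ z, ContractingWith (1 / 2 : ℝ≥0) fun v => z + Q v := fun z => by
    refine ⟨by rw [← NNReal.coe_lt_coe]; norm_num, LipschitzWith.of_dist_le_mul fun v v' => ?_⟩
    rw [dist_eq_norm, dist_eq_norm, add_sub_add_left_eq_sub]
    simpa using hQ v v'
  -- Convergence of the Picard iterates from `0` is part of the conclusion because measurability and
  -- moment bounds reach `S` through them.
  refine ⟨fun z => (hcon z).fixedPoint _, fun z => ((hcon z).fixedPoint_isFixedPt).symm, ?_,
    fun z => (hcon z).tendsto_iterate_fixedPoint 0⟩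
  refine LipschitzWith.of_dist_le_mul fun z z' => ?_
  set u := (hcon z).fixedPoint _ with hu
  set u' := (hcon z').fixedPoint _ with hu'
  have e1 : z + Q u = u := (hcon z).fixedPoint_isFixedPt
  have e2 : z' + Q u' = u' := (hcon z').fixedPoint_isFixedPt
  rw [dist_eq_norm, dist_eq_norm]
  have e3 : u - u' = (z - z') + (Q u - Q u') := by
    have : u - u' = (z + Q u) - (z' + Q u') := by rw [e1, e2]
    rw [this]; abel
  have h1 : ‖u - u'‖ ≤ ‖z - z'‖ + 1 / 2 * ‖u - u'‖ := by
    calc ‖u - u'‖ = ‖(z - z') + (Q u - Q u')‖ := by rw [← e3]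
      _ ≤ _ := (norm_add_le _ _).trans (by gcongr; exact hQ u u')
  push_cast
  linarith

/-! ### Causality of the solution map -/

section Adapted

variable {Ω : Type*} [MeasurableSpace Ω]

/-- The values of the random path at times up to `τ` are measurable. -/
def MeasUpTo {T : ℝ} (τ : ℝ) (V : Ω → Path T d) : Prop :=
  ∀ z : Icc (0 : ℝ) T × Rd d, (z.1 : ℝ) ≤ τ → Measurable fun ω => V ω z

/-- Paths are continuous in `(t, x)` and measurable in `ω`, hence jointly measurable. Truncating the
time at `τ` keeps only values measurable for the σ-algebra considered. -/
lemma MeasUpTo.measurable_uncurry {T : ℝ} (hT : 0 ≤ T) {τ : ℝ} (hτ : 0 ≤ τ) {V : Ω → Path T d}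
    (hV : MeasUpTo τ V) :
    Measurable fun q : (ℝ × Rd d) × Ω => V q.2 (projIcc 0 T hT (min q.1.1 τ), q.1.2) := by
  refine measurable_uncurry_of_continuous_of_measurable
    (u := fun (p : ℝ × Rd d) ω => V ω (projIcc 0 T hT (min p.1 τ), p.2)) (fun ω => ?_) fun p => ?_
  · exact (V ω).continuous.comp ((continuous_projIcc.comp (by fun_prop)).prodMk continuous_snd)
  · refine hV _ ?_
    rw [coe_projIcc]
    exact max_le hτ ((min_le_right _ _).trans (min_le_right _ _))

/-- At a time `t ≤ τ` the potential only involves earlier times `t - r`, so the truncation at `τ`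
changes nothing. The σ-algebra on `Ω` is arbitrary and will be that of the noise up to `τ`. -/
lemma MeasUpTo.picard {T : ℝ} (hT : 0 ≤ T) {τ : ℝ} (hτ : 0 ≤ τ) {b : ℝ → ℝ} (hb : Measurable b)
    (hc : Measurable c) (ha : Measurable a) [IsFiniteMeasure ν] {I : ℝ → Rd d → ℝ}
    (hI : Measurable fun p : ℝ × Rd d => I p.1 p.2) {l : ℝ} {Q : Path T d → Path T d}
    (hQ : ∀ v z, weight l z.1 z.2 * Q v z = potential T ν c a (driftField b I l hT v) z.1 z.2)
    {V : Ω → Path T d} (hV : MeasUpTo τ V) : MeasUpTo τ fun ω => Q (V ω) := by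
  intro z hz
  set t : ℝ := (z.1 : ℝ) with ht
  set f : Ω × (ℝ × Rd d) → ℝ := fun q => if q.2.1 < t then c q.2.1 *
    b (I (t - q.2.1) (z.2 - a q.2.1 • q.2.2) + weight l (t - q.2.1) (z.2 - a q.2.1 • q.2.2) *
      V q.1 (projIcc 0 T hT (min (t - q.2.1) τ), z.2 - a q.2.1 • q.2.2)) else 0 with hf
  have hmap : Measurable fun q : Ω × (ℝ × Rd d) => (t - q.2.1, z.2 - a q.2.1 • q.2.2) := by
    refine (measurable_const.sub measurable_snd.fst).prodMk (measurable_const.sub ?_)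
    exact (ha.comp measurable_snd.fst).smul measurable_snd.snd
  have hfm : Measurable f := by
    refine Measurable.ite (measurableSet_lt measurable_snd.fst measurable_const) ?_ measurable_const
    refine (hc.comp measurable_snd.fst).mul (hb.comp ?_)
    refine (hI.comp hmap).add (((continuous_weight l).measurable.comp hmap).mul ?_)
    exact (hV.measurable_uncurry hT hτ).comp (hmap.prodMk measurable_fst)
  have key : (fun ω => Q (V ω) z)
      = fun ω => (∫ p, f (ω, p) ∂(potMeasure T ν)) / weight l z.1 z.2 := by
    ext ω
    rw [eq_div_iff (weight_pos l z.1 z.2).ne', mul_comm, hQ]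
    unfold potential
    refine integral_congr_ae ?_
    filter_upwards [ae_potMeasure (ν := ν) T] with p hp
    simp only [potIntegrand, hf, driftField]
    split_ifs
    · rw [min_eq_left (by linarith [hp.1])]
    · rfl
  rw [key]
  have := (hfm.stronglyMeasurable.integral_prod_right' (ν := potMeasure T ν)).measurable
  exact this.div_const _

lemma MeasUpTo.resolvent {T : ℝ} (hT : 0 ≤ T) {τ : ℝ} (hτ : 0 ≤ τ) {b : ℝ → ℝ} (hb : Measurable b)
    (hc : Measurable c) (ha : Measurable a) [IsFiniteMeasure ν] {I : ℝ → Rd d → ℝ}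
    (hI : Measurable fun p : ℝ × Rd d => I p.1 p.2) {l : ℝ} {Q S : Path T d → Path T d}
    (hQ : ∀ v z, weight l z.1 z.2 * Q v z = potential T ν c a (driftField b I l hT v) z.1 z.2)
    (hS : ∀ z, Tendsto (fun j => (fun v => z + Q v)^[j] 0) atTop (𝓝 (S z)))
    {V : Ω → Path T d} (hV : MeasUpTo τ V) : MeasUpTo τ fun ω => S (V ω) := by
  have hj : ∀ j : ℕ, MeasUpTo τ fun ω => (fun v => V ω + Q v)^[j] 0 := by
    intro j
    induction j with
    | zero => exact fun z _ => measurable_const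
    | succ j ih =>
      simp only [Function.iterate_succ', Function.comp]
      exact fun z hz => (hV z hz).add (ih.picard hT hτ hb hc ha hI hQ z hz)
  intro z hz
  refine measurable_of_tendsto_metrizable (fun j => hj j z hz) ?_
  rw [tendsto_pi_nhds]
  exact fun ω => ((continuous_eval_const z).tendsto _).comp (hS (V ω))

end Adapted

end AdditiveSPDE

end

/-! ### Volterra estimates and moments of the solution map -/

noncomputable section

namespace AdditiveSPDE


variable {d : ℕ} {G : ℝ → Measure (Rd d)} {ν : Measure (Rd d)} {c a : ℝ → ℝ}

/-- The space-time convolution of a nonnegative function with the scaled measures. -/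
def posPotential (T : ℝ) (ν : Measure (Rd d)) (a : ℝ → ℝ) (g : ℝ → Rd d → ℝ≥0∞) (t : ℝ) (x : Rd d) :
    ℝ≥0∞ :=
  ∫⁻ p, (if p.1 < t then g (t - p.1) (x - a p.1 • p.2) else 0) ∂(potMeasure T ν)

lemma posPotential_mono {T : ℝ} [SFinite ν] {g g' : ℝ → Rd d → ℝ≥0∞}
    (h : ∀ s ∈ Icc 0 T, ∀ y, g s y ≤ g' s y) {t : ℝ} (ht : t ∈ Icc 0 T) (x : Rd d) :
    posPotential T ν a g t x ≤ posPotential T ν a g' t x := by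
  unfold posPotential
  refine lintegral_mono_ae ?_
  filter_upwards [ae_potMeasure (ν := ν) T] with p hp
  split_ifs with hpt
  · exact h _ ⟨by linarith, by linarith [ht.2, hp.1]⟩ _
  · exact le_rfl

/-- Exponentials `e^{ls}` are almost eigenfunctions of the Volterra operator: one application costs
a factor `1/l`. This replaces Gronwall's lemma in the inductions below. -/
lemma posPotential_exp_le [IsProbabilityMeasure ν] {T l A : ℝ} (hl : 0 < l) (hA : 0 ≤ A) {t : ℝ}
    (ht : t ∈ Icc 0 T) (x : Rd d) :
    posPotential T ν a (fun s _ => ENNReal.ofReal (A * Real.exp (l * s))) t x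
      ≤ ENNReal.ofReal (A / l * Real.exp (l * t)) := by
  unfold posPotential potMeasure
  have hm : Measurable fun r : ℝ => if r < t then A * Real.exp (l * (t - r)) else 0 :=
    Measurable.ite measurableSet_Iio (by fun_prop) measurable_const
  have e1 : ∀ p : ℝ × Rd d, (if p.1 < t then ENNReal.ofReal (A * Real.exp (l * (t - p.1))) else 0)
      = ENNReal.ofReal (if p.1 < t then A * Real.exp (l * (t - p.1)) else 0) := by
    intro p; split_ifs <;> simp
  simp_rw [e1]
  have hm2 : Measurable fun p : ℝ × Rd d =>
      ENNReal.ofReal (if p.1 < t then A * Real.exp (l * (t - p.1)) else 0) :=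
    (hm.comp measurable_fst).ennreal_ofReal
  rw [lintegral_prod _ hm2.aemeasurable]
  simp only [lintegral_const, measure_univ, mul_one]
  have hi : Integrable (fun r : ℝ => if r < t then A * Real.exp (l * (t - r)) else 0)
      (volume.restrict (Ioo 0 T)) := by
    refine Integrable.mono' (g := fun r => A * Real.exp (l * (t - r))) ?_ hm.aestronglyMeasurable ?_
    · exact ((by fun_prop : Continuous fun r => A * Real.exp (l * (t - r))).integrableOn_Icc
        (a := 0) (b := T)).mono_set Ioo_subset_Icc_self
    · refine Eventually.of_forall fun r => ?_
      split_ifs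
      · rw [Real.norm_of_nonneg (by positivity)]
      · simp; positivity
  rw [← ofReal_integral_eq_lintegral_ofReal hi (Eventually.of_forall fun r => by
    simp only [Pi.zero_apply]; split_ifs <;> positivity)]
  refine ENNReal.ofReal_le_ofReal ?_
  have e2 : ∀ r : ℝ, (if r < t then A * Real.exp (l * (t - r)) else 0)
      = A * (if r < t then Real.exp (l * (t - r)) else 0) := by intro r; split_ifs <;> simp
  simp_rw [e2]
  rw [integral_const_mul, div_mul_eq_mul_div, mul_div_assoc]
  exact mul_le_mul_of_nonneg_left (integral_Ioo_exp_le hl ht) hA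

lemma measurable_shift (ha : Measurable a) (t : ℝ) (x : Rd d) :
    Measurable fun p : ℝ × Rd d => (t - p.1, x - a p.1 • p.2) :=
  (measurable_const.sub measurable_fst).prodMk
    (measurable_const.sub ((ha.comp measurable_fst).smul measurable_snd))

/-- Tonelli and a Volterra estimate. -/
lemma lintegral_posPotential_le {Ω : Type*} [MeasurableSpace Ω] {P : Measure Ω} [SFinite P]
    [IsProbabilityMeasure ν] (ha : Measurable a) {T l A : ℝ} (hl : 0 < l) (hA : 0 ≤ A)
    {u : ℝ → Rd d → Ω → ℝ≥0∞} (hu : Measurable fun q : (ℝ × Rd d) × Ω => u q.1.1 q.1.2 q.2)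
    (h : ∀ s ∈ Icc 0 T, ∀ y, ∫⁻ ω, u s y ω ∂P ≤ ENNReal.ofReal (A * Real.exp (l * s))) {t : ℝ}
    (ht : t ∈ Icc 0 T) (x : Rd d) :
    ∫⁻ ω, posPotential T ν a (fun s y => u s y ω) t x ∂P
      ≤ ENNReal.ofReal (A / l * Real.exp (l * t)) := by
  unfold posPotential
  rw [lintegral_lintegral_swap]
  · have e : ∀ p : ℝ × Rd d, ∫⁻ ω, (if p.1 < t then u (t - p.1) (x - a p.1 • p.2) ω else 0) ∂P
        = if p.1 < t then ∫⁻ ω, u (t - p.1) (x - a p.1 • p.2) ω ∂P else 0 := by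
      intro p; split_ifs <;> simp
    simp_rw [e]
    exact (posPotential_mono (g := fun s y => ∫⁻ ω, u s y ω ∂P) h ht x).trans
      (posPotential_exp_le hl hA ht x)
  · refine Measurable.aemeasurable ?_
    refine Measurable.ite (measurableSet_lt measurable_snd.fst measurable_const) ?_ measurable_const
    exact hu.comp (((measurable_shift ha t x).comp measurable_snd).prodMk measurable_fst)

lemma IsScaledKernel.enorm_potIntegrand_le (h : IsScaledKernel G ν c a) {T C A : ℝ}
    (hCA : ∀ r ∈ Icc 0 T, c r ≤ C ∧ a r ≤ A) {F : ℝ → Rd d → ℝ} {t : ℝ} {x : Rd d} {p : ℝ × Rd d}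
    (hp : p.1 ∈ Ioo 0 T) : ‖potIntegrand c a F t x p‖ₑ
      ≤ if p.1 < t then ENNReal.ofReal C * ‖F (t - p.1) (x - a p.1 • p.2)‖ₑ else 0 := by
  unfold potIntegrand
  split_ifs
  · rw [enorm_mul, ← ofReal_norm (c p.1), Real.norm_of_nonneg (h.amp_nonneg _)]
    gcongr
    exact (hCA p.1 ⟨hp.1.le, hp.2.le⟩).1
  · simp

lemma IsScaledKernel.lintegral_potIntegrand_le (h : IsScaledKernel G ν c a) {T C A : ℝ}
    (hCA : ∀ r ∈ Icc 0 T, c r ≤ C ∧ a r ≤ A) (F : ℝ → Rd d → ℝ) (t : ℝ) (x : Rd d) :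
    ∫⁻ p, ‖potIntegrand c a F t x p‖ₑ ∂(potMeasure T ν)
      ≤ ENNReal.ofReal C * posPotential T ν a (fun s y => ‖F s y‖ₑ) t x := by
  have := h.prob
  unfold posPotential
  rw [← lintegral_const_mul' _ _ ENNReal.ofReal_ne_top]
  refine lintegral_mono_ae ?_
  filter_upwards [ae_potMeasure (ν := ν) T] with p hp
  refine (h.enorm_potIntegrand_le hCA hp).trans ?_
  split_ifs <;> simp

/-- Hölder's inequality against the constant one, on a finite measure. -/
lemma exists_lintegral_pow_le {α : Type*} [MeasurableSpace α] (m : Measure α) [IsFiniteMeasure m]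
    {N : ℕ} (hN : N ≠ 0) : ∃ C : ℝ, 0 ≤ C ∧ ∀ g : α → ℝ≥0∞, Measurable g →
      (∫⁻ x, g x ∂m) ^ N ≤ ENNReal.ofReal C * ∫⁻ x, g x ^ N ∂m := by
  have hfin : m univ ^ (1 - 1 / (N : ℝ)) ≠ ∞ := by
    refine (ENNReal.rpow_lt_top_of_nonneg ?_ (measure_ne_top m _)).ne
    rw [sub_nonneg, div_le_one (by positivity)]
    exact_mod_cast Nat.one_le_iff_ne_zero.2 hN
  refine ⟨((m univ ^ (1 - 1 / (N : ℝ))).toReal) ^ N, by positivity, fun g hg => ?_⟩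
  rw [ENNReal.ofReal_pow ENNReal.toReal_nonneg, ENNReal.ofReal_toReal hfin]
  -- For `N = 1` there is no finite conjugate exponent, and the inequality is an equality.
  rcases eq_or_ne N 1 with rfl | hN1
  · simp
  have hN1' : (1 : ℝ) < N := by
    have : 1 < N := by omega
    exact_mod_cast this
  have hpq : (N : ℝ).HolderConjugate (N.cast / (N.cast - 1)) := Real.HolderConjugate.conjExponent hN1'
  have h1 := ENNReal.lintegral_mul_le_Lp_mul_Lq m hpq hg.aemeasurable
    (aemeasurable_const (b := (1 : ℝ≥0∞)))
  simp only [Pi.mul_apply, mul_one, ENNReal.one_rpow, lintegral_const, one_mul] at h1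
  have e : 1 / ((N : ℝ) / ((N : ℝ) - 1)) = 1 - 1 / (N : ℝ) := by
    have : (N : ℝ) ≠ 0 := by positivity
    rw [one_div_div]; field_simp
  rw [e] at h1
  refine (pow_le_pow_left' h1 N).trans ?_
  rw [mul_pow, mul_comm]
  gcongr
  rw [← ENNReal.rpow_natCast, ← ENNReal.rpow_mul, one_div, inv_mul_cancel₀ (by positivity),
    ENNReal.rpow_one]
  simp

lemma enorm_le_of_lipschitz {b : ℝ → ℝ} {K : ℝ≥0} (hb : LipschitzWith K b) (z : ℝ) :
    ‖b z‖ₑ ≤ ‖b 0‖ₑ + K * ‖z‖ₑ := by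
  have h := abs_le_of_lipschitz hb z
  rw [← ofReal_norm, ← ofReal_norm, ← ofReal_norm, ← ENNReal.ofReal_coe_nnreal,
    ← ENNReal.ofReal_mul (by positivity), ← ENNReal.ofReal_add (by positivity) (by positivity)]
  exact ENNReal.ofReal_le_ofReal h

section Moments

variable {Ω : Type*} [MeasurableSpace Ω] {P : Measure Ω} [IsProbabilityMeasure P]

/-- The random field `I + weight · V`. -/
def pathField (I : ℝ → Rd d → ℝ) (l : ℝ) {T : ℝ} (hT : 0 ≤ T) (V : Ω → Path T d) (s : ℝ) (y : Rd d)
    (ω : Ω) : ℝ :=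
  I s y + weight l s y * V ω (projIcc 0 T hT s, y)

lemma measurable_pathField {T : ℝ} (hT : 0 ≤ T) {I : ℝ → Rd d → ℝ}
    (hI : Measurable fun p : ℝ × Rd d => I p.1 p.2) (l : ℝ) {V : Ω → Path T d} (hV : MeasUpTo T V) :
    Measurable fun q : (ℝ × Rd d) × Ω => pathField I l hT V q.1.1 q.1.2 q.2 := by
  refine (hI.comp measurable_fst).add (((continuous_weight l).measurable.comp measurable_fst).mul ?_)
  refine measurable_uncurry_of_continuous_of_measurable
    (u := fun (p : ℝ × Rd d) ω => V ω (projIcc 0 T hT p.1, p.2)) (fun ω => ?_) fun p => ?_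
  · exact (V ω).continuous.comp ((continuous_projIcc.comp (by fun_prop)).prodMk continuous_snd)
  · exact hV _ (projIcc 0 T hT p.1).2.2

set_option maxHeartbeats 1000000 in
/-- Moments of the solution map, by Picard iteration. -/
lemma IsScaledKernel.exists_moment_resolvent (h : IsScaledKernel G ν c a) {T : ℝ} (hT : 0 ≤ T)
    {b : ℝ → ℝ} {K : ℝ≥0} (hb : LipschitzWith K b) {M : ℝ} (hM : 0 ≤ M) {I : ℝ → Rd d → ℝ}
    (hI : LinData T M I) {l : ℝ} {Q S : Path T d → Path T d}
    (hQ : ∀ v z, weight l z.1 z.2 * Q v z = potential T ν c a (driftField b I l hT v) z.1 z.2)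
    (hS : ∀ z, Tendsto (fun j => (fun v => z + Q v)^[j] 0) atTop (𝓝 (S z)))
    {V : Ω → Path T d} (hV : MeasUpTo T V) {Z : ℝ → Rd d → Ω → ℝ}
    (hVZ : ∀ (t : Icc (0 : ℝ) T) x, ∀ᵐ ω ∂P, weight l t x * V ω (t, x) = Z t x ω) {N : ℕ} (hN : N ≠ 0)
    {A : ℝ} (hA : 0 ≤ A)
    (hZ : ∀ t ∈ Icc 0 T, ∀ x, ∫⁻ ω, ‖Z t x ω‖ₑ ^ N ∂P ≤ ENNReal.ofReal A) :
    ∃ B : ℝ, 0 ≤ B ∧ ∀ t ∈ Icc 0 T, ∀ x,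
      ∫⁻ ω, ‖pathField I l hT (fun ω => S (V ω)) t x ω‖ₑ ^ N ∂P ≤ ENNReal.ofReal B := by
  have := h.prob
  obtain ⟨C, A0, hC, hA0, hCA⟩ := h.exists_bounds T
  obtain ⟨CT, hCT, hpow⟩ := exists_lintegral_pow_le (potMeasure T ν) hN
  set v : ℕ → Ω → Path T d := fun j ω => (fun v => V ω + Q v)^[j] 0 with hv
  have hvs : ∀ j ω, v (j + 1) ω = V ω + Q (v j ω) := fun j ω => by
    simp only [hv, Function.iterate_succ', Function.comp]
  have hvm : ∀ j, MeasUpTo T (v j) := by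
    intro j
    induction j with
    | zero => exact fun z _ => measurable_const
    | succ j ih =>
      intro z hz
      simp only [hvs]
      exact (hV z hz).add (ih.picard hT hT hb.continuous.measurable h.amp_cont.measurable
        h.dil_cont.measurable hI.measurable hQ z hz)
  set u : ℕ → ℝ → Rd d → Ω → ℝ := fun j => pathField I l hT (v j) with hu
  have hum : ∀ j, Measurable fun q : (ℝ × Rd d) × Ω => u j q.1.1 q.1.2 q.2 := fun j =>
    measurable_pathField hT hI.measurable l (hvm j)
  set π1 := potMeasure T ν univ with hπ
  have hπfin : π1 ≠ ∞ := measure_ne_top _ _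
  set k1 : ℝ := 2 ^ N * (2 ^ N * (M ^ N + A) + CT * C ^ N * 2 ^ N * (|b 0| ^ N * π1.toReal)) with hk1
  set k2 : ℝ := 2 ^ N * (CT * C ^ N * 2 ^ N * K ^ N) with hk2
  have hk10 : 0 ≤ k1 := by positivity
  have hk20 : 0 ≤ k2 := by positivity
  -- One Picard step sends the bound `2 k1 e^{Lt}` to `k1 + k2 (2 k1 / L) e^{Lt}`, which stays below
  -- `2 k1 e^{Lt}` since `2 k2 ≤ L`.
  set L : ℝ := 2 * k2 + 1 with hL
  have hL0 : 0 < L := by positivity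
  have o2 : (2 : ℝ≥0∞) ^ N = ENNReal.ofReal (2 ^ N) := by
    rw [ENNReal.ofReal_pow (by norm_num)]; norm_num
  have hMk : M ^ N ≤ k1 := by
    have h2 : (1 : ℝ) ≤ 2 ^ N := one_le_pow₀ (by norm_num)
    have h3 : 0 ≤ CT * C ^ N * 2 ^ N * (|b 0| ^ N * π1.toReal) := by positivity
    have h4 : 0 ≤ M ^ N := by positivity
    have h5 : M ^ N + A ≤ 2 ^ N * (M ^ N + A) := le_mul_of_one_le_left (by positivity) h2
    rw [hk1]
    refine le_trans ?_ (le_mul_of_one_le_left (by positivity) h2)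
    linarith
  -- The weighted norm allows growth in `x`, so it gives no moments uniform in `x`. The iterates are
  -- therefore estimated in `L^N(Ω)` at each point, and Fatou's lemma then passes to the limit.
  have claim : ∀ j, ∀ t ∈ Icc 0 T, ∀ x,
      ∫⁻ ω, ‖u j t x ω‖ₑ ^ N ∂P ≤ ENNReal.ofReal (2 * k1 * Real.exp (L * t)) := by
    intro j
    induction j with
    | zero =>
      intro t ht x
      have hexp : 1 ≤ Real.exp (L * t) := Real.one_le_exp (by have := ht.1; positivity)
      have e : ∀ ω, ‖u 0 t x ω‖ₑ ^ N ≤ ENNReal.ofReal (M ^ N) := by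
        intro ω
        have : u 0 t x ω = I t x := by simp [hu, pathField, hv]
        rw [this, ENNReal.ofReal_pow hM, ← ofReal_norm]
        gcongr
        exact hI.bound t x
      refine (lintegral_mono e).trans ?_
      simp only [lintegral_const, measure_univ, mul_one]
      exact ENNReal.ofReal_le_ofReal (by nlinarith)
    | succ j ih =>
      intro t ht x
      have hexp : 1 ≤ Real.exp (L * t) := Real.one_le_exp (by have := ht.1; positivity)
      have hpt : ∀ᵐ ω ∂P, ‖u (j + 1) t x ω‖ₑ ^ N ≤ 2 ^ N * (2 ^ N * (ENNReal.ofReal (M ^ N)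
          + ‖Z t x ω‖ₑ ^ N) + ENNReal.ofReal (CT * C ^ N * 2 ^ N) * (ENNReal.ofReal (|b 0| ^ N) * π1
          + ENNReal.ofReal (K ^ N) * posPotential T ν a (fun s y => ‖u j s y ω‖ₑ ^ N) t x)) := by
        filter_upwards [hVZ ⟨t, ht⟩ x] with ω hω
        have e1 : u (j + 1) t x ω = (I t x + Z t x ω)
            + potential T ν c a (driftField b I l hT (v j ω)) t x := by
          simp only [hu, pathField, hvs, projIcc_of_mem hT ht, BoundedContinuousFunction.add_apply,
            mul_add]
          rw [hQ (v j ω) (⟨t, ht⟩, x), ← hω]; ring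
        rw [e1]
        refine (pow_le_pow_left' (enorm_add_le _ _) N).trans ((ennreal_add_pow_le _ _ N).trans ?_)
        gcongr
        · refine (pow_le_pow_left' (enorm_add_le _ _) N).trans ((ennreal_add_pow_le _ _ N).trans ?_)
          gcongr
          rw [ENNReal.ofReal_pow hM, ← ofReal_norm]
          gcongr
          exact hI.bound t x
        · set F := driftField b I l hT (v j ω) with hF
          have hFm : Measurable fun p : ℝ × Rd d => F p.1 p.2 :=
            hb.continuous.measurable.comp ((hum j).comp (measurable_id.prodMk measurable_const))
          calc ‖potential T ν c a F t x‖ₑ ^ N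
              ≤ (∫⁻ p, ‖potIntegrand c a F t x p‖ₑ ∂(potMeasure T ν)) ^ N := by
                gcongr; exact enorm_integral_le_lintegral_enorm _
            _ ≤ ENNReal.ofReal CT * ∫⁻ p, ‖potIntegrand c a F t x p‖ₑ ^ N ∂(potMeasure T ν) :=
                hpow _ (measurable_potIntegrand h.amp_cont.measurable h.dil_cont.measurable hFm t
                  x).enorm
            _ ≤ ENNReal.ofReal CT * ∫⁻ p, ENNReal.ofReal (C ^ N * 2 ^ N) *
                  (ENNReal.ofReal (|b 0| ^ N) + ENNReal.ofReal (K ^ N) *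
                    (if p.1 < t then ‖u j (t - p.1) (x - a p.1 • p.2) ω‖ₑ ^ N else 0))
                    ∂(potMeasure T ν) := by
                gcongr ENNReal.ofReal CT * ?_
                refine lintegral_mono_ae ?_
                filter_upwards [ae_potMeasure (ν := ν) T] with p hp
                refine (pow_le_pow_left' (h.enorm_potIntegrand_le hCA hp) N).trans ?_
                split_ifs with hpt
                · rw [mul_pow, ENNReal.ofReal_mul (by positivity), ENNReal.ofReal_pow hC, ← o2,
                    mul_assoc]
                  gcongr
                  refine (pow_le_pow_left' (enorm_le_of_lipschitz hb _) N).trans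
                    ((ennreal_add_pow_le _ _ N).trans ?_)
                  rw [mul_pow, ENNReal.ofReal_pow (abs_nonneg _), ENNReal.ofReal_pow K.coe_nonneg,
                    ENNReal.ofReal_coe_nnreal, Real.enorm_eq_ofReal_abs (b 0)]
                  rfl
                · rw [zero_pow hN]; exact zero_le
            _ = _ := by
                have hmI : Measurable fun p : ℝ × Rd d =>
                    if p.1 < t then ‖u j (t - p.1) (x - a p.1 • p.2) ω‖ₑ ^ N else 0 := by
                  refine Measurable.ite (measurableSet_lt measurable_fst measurable_const) ?_
                    measurable_const
                  exact ((hum j).comp ((measurable_shift h.dil_cont.measurable t x).prodMk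
                    measurable_const)).enorm.pow_const N
                rw [lintegral_const_mul' _ _ ENNReal.ofReal_ne_top, lintegral_add_left measurable_const,
                  lintegral_const_mul' _ _ ENNReal.ofReal_ne_top, ← mul_assoc,
                  ← ENNReal.ofReal_mul hCT, ← mul_assoc, lintegral_const, ← hπ]
                rfl
      refine (lintegral_mono_ae hpt).trans ?_
      have hmP : Measurable fun ω => posPotential T ν a (fun s y => ‖u j s y ω‖ₑ ^ N) t x := by
        unfold posPotential
        refine Measurable.lintegral_prod_right' (f := fun q : Ω × (ℝ × Rd d) =>
          if q.2.1 < t then ‖u j (t - q.2.1) (x - a q.2.1 • q.2.2) q.1‖ₑ ^ N else 0) ?_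
        refine Measurable.ite (measurableSet_lt measurable_snd.fst measurable_const) ?_
          measurable_const
        exact ((hum j).comp (((measurable_shift h.dil_cont.measurable t x).comp
          measurable_snd).prodMk measurable_fst)).enorm.pow_const N
      have htail := lintegral_posPotential_le (P := P) (ν := ν) h.dil_cont.measurable hL0
        (A := 2 * k1) (by positivity) (u := fun s y ω => ‖u j s y ω‖ₑ ^ N)
        ((hum j).enorm.pow_const N) ih ht x
      have hmR : Measurable fun ω => ENNReal.ofReal (CT * C ^ N * 2 ^ N) *
          (ENNReal.ofReal (|b 0| ^ N) * π1 + ENNReal.ofReal (K ^ N)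
            * posPotential T ν a (fun s y => ‖u j s y ω‖ₑ ^ N) t x) :=
        (measurable_const.add (hmP.const_mul _)).const_mul _
      rw [lintegral_const_mul' _ _ (by simp), lintegral_add_right _ hmR,
        lintegral_const_mul' _ _ (by simp),
        lintegral_add_left measurable_const, lintegral_const_mul' _ _ (by simp),
        lintegral_add_left measurable_const, lintegral_const_mul' _ _ (by simp)]
      simp only [lintegral_const, measure_univ, mul_one]
      calc _ ≤ 2 ^ N * (2 ^ N * (ENNReal.ofReal (M ^ N) + ENNReal.ofReal A)
            + ENNReal.ofReal (CT * C ^ N * 2 ^ N) * (ENNReal.ofReal (|b 0| ^ N)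
              * ENNReal.ofReal π1.toReal + ENNReal.ofReal (K ^ N)
                * ENNReal.ofReal (2 * k1 / L * Real.exp (L * t)))) := by
            rw [ENNReal.ofReal_toReal hπfin]
            gcongr
            · exact hZ t ht x
            · rw [lintegral_const_mul' _ _ ENNReal.ofReal_ne_top]
              exact mul_le_mul_right htail _
        _ = ENNReal.ofReal (k1 + k2 * (2 * k1 / L * Real.exp (L * t))) := by
            rw [o2]
            rw [← ENNReal.ofReal_add (by positivity) hA, ← ENNReal.ofReal_mul (by positivity),
              ← ENNReal.ofReal_mul (by positivity), ← ENNReal.ofReal_mul (by positivity),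
              ← ENNReal.ofReal_add (by positivity) (by positivity),
              ← ENNReal.ofReal_mul (by positivity),
              ← ENNReal.ofReal_add (by positivity) (by positivity),
              ← ENNReal.ofReal_mul (by positivity)]
            congr 1
            rw [hk1, hk2]; ring
        _ ≤ _ := by
            refine ENNReal.ofReal_le_ofReal ?_
            have h1 : k2 * (2 * k1 / L * Real.exp (L * t)) ≤ k1 * Real.exp (L * t) := by
              rw [← mul_assoc]
              gcongr
              rw [← mul_div_assoc, div_le_iff₀ hL0, hL]
              nlinarith
            nlinarith
  refine ⟨2 * k1 * Real.exp (L * T), by positivity, fun t ht x => ?_⟩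
  have hlim : ∀ ω, Tendsto (fun j => ‖u j t x ω‖ₑ ^ N) atTop
      (𝓝 (‖pathField I l hT (fun ω => S (V ω)) t x ω‖ₑ ^ N)) := by
    intro ω
    refine (ENNReal.continuous_pow N).tendsto _ |>.comp ?_
    refine (continuous_enorm.tendsto _).comp ?_
    refine Tendsto.const_add _ (Tendsto.const_mul _ ?_)
    exact ((continuous_eval_const _).tendsto _).comp (hS (V ω))
  calc ∫⁻ ω, ‖pathField I l hT (fun ω => S (V ω)) t x ω‖ₑ ^ N ∂P
      = ∫⁻ ω, liminf (fun j => ‖u j t x ω‖ₑ ^ N) atTop ∂P :=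
        lintegral_congr fun ω => (hlim ω).liminf_eq.symm
    _ ≤ liminf (fun j => ∫⁻ ω, ‖u j t x ω‖ₑ ^ N ∂P) atTop :=
        lintegral_liminf_le fun j => ((hum j).comp (measurable_prodMk_left
          (x := (t, x)))).enorm.pow_const N
    _ ≤ ENNReal.ofReal (2 * k1 * Real.exp (L * T)) := by
        refine Filter.liminf_le_of_frequently_le' (Eventually.of_forall fun j => ?_).frequently
        refine (claim j t ht x).trans (ENNReal.ofReal_le_ofReal ?_)
        gcongr
        exact ht.2

end Moments

end AdditiveSPDE

end

/-! ### Existence and uniqueness of mild solutions -/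

noncomputable section

namespace AdditiveSPDE


variable {d : ℕ} {ν : Measure (Rd d)} {c a : ℝ → ℝ}

/-- The properties of the linear part of a Cauchy problem that the construction needs. -/
structure GoodLinearPart (pb : CauchyProblem d) (M : ℝ) : Prop where
  measurable : Measurable fun z : Icc (0 : ℝ) pb.T × Rd d => linearPart pb z.1 z.2
  continuousOn : ContinuousOn (fun p : ℝ × Rd d => linearPart pb p.1 p.2) (Ioc 0 pb.T ×ˢ univ)
  bound : ∀ t ∈ Icc 0 pb.T, ∀ x, |linearPart pb t x| ≤ M

open Classical in
/-- The linear part, set to zero outside `(0, T]`. -/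
def cutPart (pb : CauchyProblem d) (t : ℝ) (x : Rd d) : ℝ :=
  if t ∈ Ioc 0 pb.T then linearPart pb t x else 0

lemma GoodLinearPart.linData {pb : CauchyProblem d} {M : ℝ} (h : GoodLinearPart pb M) (hM : 0 ≤ M) :
    LinData pb.T M (cutPart pb) := by
  classical
  have e : EqOn (fun p : ℝ × Rd d => cutPart pb p.1 p.2) (fun p => linearPart pb p.1 p.2)
      (Ioc 0 pb.T ×ˢ univ) := fun p hp => if_pos hp.1
  refine ⟨?_, h.continuousOn.congr e, fun s y => ?_⟩
  · have hs : MeasurableSet (Ioc 0 pb.T ×ˢ univ : Set (ℝ × Rd d)) :=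
      measurableSet_Ioc.prod MeasurableSet.univ
    have := h.continuousOn.measurable_piecewise (g := fun _ => (0 : ℝ)) continuousOn_const hs
    convert this using 1
    ext p
    simp [cutPart, piecewise]
  · unfold cutPart
    split_ifs with hs
    · exact h.bound s ⟨hs.1.le, hs.2⟩ y
    · simpa using hM

section

variable {Ω : Type*} [m0 : MeasurableSpace Ω] {P : Measure Ω} {μ : Measure (Rd d)}
  {W : TestFn d → Ω → ℝ}

lemma noiseFiltration_mono {s t : ℝ} (hst : s ≤ t) :
    noiseFiltration P μ W s ≤ noiseFiltration P μ W t := by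
  refine MeasurableSpace.generateFrom_mono (union_subset_union_right _ ?_)
  rintro A ⟨r, hr, φ, X, hX⟩
  exact ⟨r, ⟨hr.1, hr.2.trans hst⟩, φ, X, hX⟩

variable [IsProbabilityMeasure P]

/-- The solution of the equation expressed with the path of the weighted fluctuation. -/
def solField (pb : CauchyProblem d) (l : ℝ) (hT : 0 ≤ pb.T) (V : Ω → Path pb.T d) (t : ℝ) (x : Rd d)
    (ω : Ω) : ℝ :=
  linearPart pb t x + weight l t x * V ω (projIcc 0 pb.T hT t, x)

/-- The equation is the fixed point identity `S z = z + Q (S z)` multiplied by the weight, with `z`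
the weighted stochastic convolution. Adaptedness is causality of `S` and the moments are those of
the Picard limit. The fields built from `linearPart` and `cutPart` differ on `[0, T]` only at time
zero, by at most `M`. -/
lemma isMildSolution_solField [P.IsComplete] {pb : CauchyProblem d}
    (h : IsScaledKernel (fundamentalSolution pb.eqn d) ν c a) (hT : 0 ≤ pb.T) {K : ℝ≥0}
    (hb : LipschitzWith K pb.b) {M : ℝ} (hM : 0 ≤ M) (hI : GoodLinearPart pb M) {l : ℝ} (hl : 0 < l)
    {Q S : Path pb.T d → Path pb.T d}
    (hQ : ∀ v z, weight l z.1 z.2 * Q v z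
      = potential pb.T ν c a (driftField pb.b (cutPart pb) l hT v) z.1 z.2)
    (hS1 : ∀ z, S z = z + Q (S z))
    (hS : ∀ z, Tendsto (fun j => (fun v => z + Q v)^[j] 0) atTop (𝓝 (S z)))
    {Z : ℝ → Rd d → Ω → ℝ} (hZ : IsStochConv P μ W ν c a pb.T Z)
    (hZad : ∀ t ∈ Icc 0 pb.T, ∀ x, Measurable[noiseFiltration P μ W t] (Z t x))
    {V : Ω → Path pb.T d}
    (hVZ : ∀ (t : Icc (0 : ℝ) pb.T) x, ∀ᵐ ω ∂P, weight l t x * V ω (t, x) = Z t x ω) {N : ℕ}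
    {p : ℝ≥0} (hN : N ≠ 0) (hp : p ≤ N) {A : ℝ} (hA : 0 ≤ A)
    (hZm : ∀ t ∈ Icc 0 pb.T, ∀ x, ∫⁻ ω, ‖Z t x ω‖ₑ ^ N ∂P ≤ ENNReal.ofReal A) :
    IsMildSolution P μ W pb p (solField pb l hT fun ω => S (V ω)) := by
  have := h.prob
  have hID := hI.linData hM
  -- `MeasUpTo` is used with the σ-algebra of the noise at time `τ`. Completeness is needed because
  -- `V` agrees with the adapted field `Z` only almost surely.
  have hVad : ∀ τ ∈ Icc 0 pb.T, @MeasUpTo d Ω (noiseFiltration P μ W τ) pb.T τ V := by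
    intro τ hτ z hz
    have h1 : Measurable[noiseFiltration P μ W τ] (fun ω => Z z.1 z.2 ω / weight l z.1 z.2) := by
      have : Measurable[noiseFiltration P μ W τ] (Z z.1 z.2) :=
        (hZad z.1 z.1.2 z.2).mono (noiseFiltration_mono hz) le_rfl
      exact this.div_const _
    refine measurable_noiseFiltration_congr h1 ?_
    filter_upwards [hVZ z.1 z.2] with ω hω
    rw [← hω, mul_div_cancel_left₀ _ (weight_pos l z.1 z.2).ne']
  have hSad : ∀ τ ∈ Icc 0 pb.T, @MeasUpTo d Ω (noiseFiltration P μ W τ) pb.T τ fun ω => S (V ω) :=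
    fun τ hτ => @MeasUpTo.resolvent d ν c a Ω (noiseFiltration P μ W τ) pb.T hT τ hτ.1 pb.b
      hb.continuous.measurable h.amp_cont.measurable h.dil_cont.measurable _ (cutPart pb)
      hID.measurable l Q S hQ hS V (hVad τ hτ)
  have hTmem : pb.T ∈ Icc 0 pb.T := ⟨hT, le_rfl⟩
  have hVm : MeasUpTo pb.T V := fun z hz => (hVad pb.T hTmem z hz).mono (noiseFiltration_le _) le_rfl
  have hSm : MeasUpTo pb.T fun ω => S (V ω) := fun z hz =>
    (hSad pb.T hTmem z hz).mono (noiseFiltration_le _) le_rfl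
  refine ⟨fun t ht x => ?_, ?_, ?_, fun t ht x => ?_⟩
  · have h1 := hSad t ht (projIcc 0 pb.T hT t, x) (by rw [projIcc_of_mem hT ht])
    unfold solField
    exact (h1.const_mul _).const_add _
  · unfold solField
    have e : ∀ z : Icc (0 : ℝ) pb.T × Rd d × Ω, projIcc 0 pb.T hT (z.1 : ℝ) = z.1 := fun z =>
      projIcc_val hT z.1
    simp_rw [e]
    refine (hI.measurable.comp (measurable_fst.prodMk measurable_snd.fst)).add (Measurable.mul ?_ ?_)
    · exact (continuous_weight l).measurable.comp
        ((measurable_subtype_coe.comp measurable_fst).prodMk measurable_snd.fst)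
    · have := measurable_uncurry_of_continuous_of_measurable
        (u := fun (z : Icc (0 : ℝ) pb.T × Rd d) ω => S (V ω) z) (fun ω => (S (V ω)).continuous)
        (fun z => hSm z z.1.2.2)
      exact this.comp ((measurable_fst.prodMk measurable_snd.fst).prodMk measurable_snd.snd)
  · obtain ⟨B, hB, hmom⟩ := h.exists_moment_resolvent hT hb hM hID hQ hS hVm hVZ hN hA hZm
    refine ⟨((ENNReal.ofReal B) ^ (1 / (N : ℝ)) + ENNReal.ofReal M).toNNReal, fun t ht x => ?_⟩
    rw [ENNReal.coe_toNNReal (by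
      refine ENNReal.add_ne_top.2 ⟨?_, ENNReal.ofReal_ne_top⟩
      exact (ENNReal.rpow_lt_top_of_nonneg (by positivity) ENNReal.ofReal_ne_top).ne)]
    have hpm : Measurable (pathField (cutPart pb) l hT (fun ω => S (V ω)) t x) :=
      (measurable_pathField hT hID.measurable l hSm).comp (measurable_prodMk_left (x := (t, x)))
    have e : solField pb l hT (fun ω => S (V ω)) t x
        = pathField (cutPart pb) l hT (fun ω => S (V ω)) t x
          + fun _ => linearPart pb t x - cutPart pb t x := by
      ext ω; simp only [solField, pathField, Pi.add_apply]; ring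
    have hpN : ((p : ℝ≥0) : ℝ≥0∞) ≤ (N : ℝ≥0∞) := by exact_mod_cast hp
    have h1N : (1 : ℝ≥0∞) ≤ N := by exact_mod_cast Nat.one_le_iff_ne_zero.2 hN
    have hsm : AEStronglyMeasurable (solField pb l hT (fun ω => S (V ω)) t x) P := by
      rw [e]; exact (hpm.add measurable_const).aestronglyMeasurable
    refine (eLpNorm_le_eLpNorm_of_exponent_le hpN hsm).trans ?_
    rw [e]
    refine (eLpNorm_add_le hpm.aestronglyMeasurable aestronglyMeasurable_const h1N).trans ?_
    gcongr
    · rw [lintegral_pow_eq_eLpNorm _ hN]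
      gcongr
      exact hmom t ht x
    · rw [eLpNorm_const _ (by positivity) (NeZero.ne P)]
      simp only [measure_univ, ENNReal.one_rpow, mul_one]
      rw [← ofReal_norm]
      refine ENNReal.ofReal_le_ofReal ?_
      rw [Real.norm_eq_abs]
      unfold cutPart
      split_ifs
      · simpa using hM
      · rw [sub_zero]; exact hI.bound t ht x
  · refine ⟨Z t x, ?_, ?_⟩
    · rw [convIntegrand_eq_gHat h t x]; exact hZ t ht x
    · filter_upwards [hVZ ⟨t, ht⟩ x] with ω hω
      have hgr := hasGrowth_driftField hb hT hM hID hl.le (S (V ω))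
      have hBn : 0 ≤ |pb.b 0| + K * (M + ‖S (V ω)‖) := by positivity
      have e1 : solField pb l hT (fun ω => S (V ω)) t x ω = linearPart pb t x + Z t x ω
          + potential pb.T ν c a (driftField pb.b (cutPart pb) l hT (S (V ω))) t x := by
        simp only [solField, projIcc_of_mem hT ht]
        rw [hS1 (V ω), BoundedContinuousFunction.add_apply, mul_add, ← hS1 (V ω),
          hQ (S (V ω)) (⟨t, ht⟩, x), ← hω]
        ring
      rw [e1, h.potential_eq hgr.measurable ht x (h.integrable_potIntegrand hBn hgr ht x)]
      congr 1
      refine intervalIntegral.integral_congr_ae (Eventually.of_forall fun s hs => ?_)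
      rw [uIoc_of_le ht.1] at hs
      congr 1
      ext y
      simp only [driftField, solField, cutPart]
      rw [if_pos ⟨hs.1, hs.2.trans ht.2⟩]

/-- Mild solutions are unique up to modification. -/
lemma IsMildSolution.ae_eq {pb : CauchyProblem d}
    (h : IsScaledKernel (fundamentalSolution pb.eqn d) ν c a) (hT : 0 ≤ pb.T) {K : ℝ≥0}
    (hb : LipschitzWith K pb.b) (hW : IsHomogeneousNoise P μ W) (hμ : IsSpectral μ) {p : ℝ≥0}
    (hp : 1 ≤ p) {u u' : ℝ → Rd d → Ω → ℝ} (hu : IsMildSolution P μ W pb p u)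
    (hu' : IsMildSolution P μ W pb p u') : ∀ t ∈ Icc 0 pb.T, ∀ x, u t x =ᵐ[P] u' t x := by
  have := h.prob
  have : SigmaFinite μ := hμ.sigmaFinite
  obtain ⟨C0, A0, hC0, hA0, hCA⟩ := h.exists_bounds pb.T
  have hmeas : ∀ {u}, IsMildSolution P μ W pb p u → ∀ t ∈ Icc 0 pb.T, ∀ x, Measurable (u t x) :=
    fun hu t ht x => (hu.adapted t ht x).mono (noiseFiltration_le _) le_rfl
  have hext : ∀ {u}, IsMildSolution P μ W pb p u → Measurable fun q : (ℝ × Rd d) × Ω =>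
      u (projIcc 0 pb.T hT q.1.1) q.1.2 q.2 := fun hu =>
    hu.jointly_measurable.comp (((continuous_projIcc (h := hT)).measurable.comp
      measurable_fst.fst).prodMk
      (measurable_fst.snd.prodMk measurable_snd))
  have hfirst : ∀ {u}, IsMildSolution P μ W pb p u → ∃ C : ℝ≥0, ∀ t ∈ Icc 0 pb.T, ∀ x,
      ∫⁻ ω, ‖u t x ω‖ₑ ∂P ≤ C := by
    intro u hu
    obtain ⟨C, hC⟩ := hu.moment_bound
    refine ⟨C, fun t ht x => ?_⟩
    rw [← eLpNorm_one_eq_lintegral_enorm]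
    exact (eLpNorm_le_eLpNorm_of_exponent_le (by exact_mod_cast hp)
      (hmeas hu t ht x).aestronglyMeasurable).trans (hC t ht x)
  -- For fixed `(t, x)` the moment bound makes the drift integrand almost surely integrable. Without
  -- this the integrals could take their default value zero, and the two equations could not be
  -- subtracted under the integral sign.
  have hint : ∀ {u}, IsMildSolution P μ W pb p u → ∀ t ∈ Icc 0 pb.T, ∀ x, ∀ᵐ ω ∂P,
      Integrable (potIntegrand c a (fun s y => pb.b (u (projIcc 0 pb.T hT s) y ω)) t x)
        (potMeasure pb.T ν) ∧
      ∫ s in (0 : ℝ)..t, kernelConv pb.eqn (fun y => pb.b (u s y ω)) (t - s) x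
        = potential pb.T ν c a (fun s y => pb.b (u (projIcc 0 pb.T hT s) y ω)) t x := by
    intro u hu t ht x
    obtain ⟨C, hC⟩ := hfirst hu
    have hbm : Measurable fun q : (ℝ × Rd d) × Ω => pb.b (u (projIcc 0 pb.T hT q.1.1) q.1.2 q.2) :=
      hb.continuous.measurable.comp (hext hu)
    have hfin := lintegral_posPotential_le (P := P) (ν := ν) h.dil_cont.measurable (l := 1) one_pos
      (A := |pb.b 0| + K * C) (by positivity)
      (u := fun s y ω => ‖pb.b (u (projIcc 0 pb.T hT s) y ω)‖ₑ) hbm.enorm (by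
        intro s hs y
        calc ∫⁻ ω, ‖pb.b (u (projIcc 0 pb.T hT s) y ω)‖ₑ ∂P
            ≤ ∫⁻ ω, (‖pb.b 0‖ₑ + K * ‖u s y ω‖ₑ) ∂P := by
              refine lintegral_mono fun ω => ?_
              rw [projIcc_of_mem hT hs]
              exact enorm_le_of_lipschitz hb _
          _ ≤ ‖pb.b 0‖ₑ + K * C := by
              rw [lintegral_add_left measurable_const, lintegral_const_mul' _ _ ENNReal.coe_ne_top]
              simp only [lintegral_const, measure_univ, mul_one]
              gcongr
              exact hC s hs y
          _ = ENNReal.ofReal (|pb.b 0| + K * C) := by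
              rw [ENNReal.ofReal_add (by positivity) (by positivity),
                ENNReal.ofReal_mul (by positivity), ENNReal.ofReal_coe_nnreal,
                ENNReal.ofReal_coe_nnreal, Real.enorm_eq_ofReal_abs]
          _ ≤ _ := by
              refine ENNReal.ofReal_le_ofReal (le_mul_of_one_le_right (by positivity) ?_)
              exact Real.one_le_exp (by have := hs.1; positivity)) ht x
    have hmP : Measurable fun ω => posPotential pb.T ν a
        (fun s y => ‖pb.b (u (projIcc 0 pb.T hT s) y ω)‖ₑ) t x := by
      unfold posPotential
      refine Measurable.lintegral_prod_right' (f := fun q : Ω × (ℝ × Rd d) =>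
        if q.2.1 < t then ‖pb.b (u (projIcc 0 pb.T hT (t - q.2.1)) (x - a q.2.1 • q.2.2) q.1)‖ₑ
          else 0) ?_
      refine Measurable.ite (measurableSet_lt measurable_snd.fst measurable_const) ?_
        measurable_const
      exact (hbm.comp (((measurable_shift h.dil_cont.measurable t x).comp
          measurable_snd).prodMk measurable_fst)).enorm
    have hae := ae_lt_top hmP (hfin.trans_lt ENNReal.ofReal_lt_top).ne
    filter_upwards [hae] with ω hω
    have hFm : Measurable fun p : ℝ × Rd d => pb.b (u (projIcc 0 pb.T hT p.1) p.2 ω) :=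
      hbm.comp (measurable_id.prodMk measurable_const)
    have hi : Integrable (potIntegrand c a (fun s y => pb.b (u (projIcc 0 pb.T hT s) y ω)) t x)
        (potMeasure pb.T ν) := by
      refine ⟨(measurable_potIntegrand h.amp_cont.measurable h.dil_cont.measurable hFm t
        x).aestronglyMeasurable, ?_⟩
      exact (h.lintegral_potIntegrand_le hCA _ t x).trans_lt
        (ENNReal.mul_lt_top ENNReal.ofReal_lt_top hω)
    refine ⟨hi, ?_⟩
    rw [h.potential_eq hFm ht x hi]
    refine intervalIntegral.integral_congr_ae (Eventually.of_forall fun s hs => ?_)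
    rw [uIoc_of_le ht.1] at hs
    rw [projIcc_of_mem hT ⟨hs.1.le, hs.2.trans ht.2⟩]
  have hineq : ∀ t ∈ Icc 0 pb.T, ∀ x, ∀ᵐ ω ∂P, ‖u t x ω - u' t x ω‖ₑ ≤ ENNReal.ofReal C0 *
      posPotential pb.T ν a (fun s y => (K : ℝ≥0∞) * ‖u (projIcc 0 pb.T hT s) y ω
        - u' (projIcc 0 pb.T hT s) y ω‖ₑ) t x := by
    intro t ht x
    obtain ⟨X, hX, hXu⟩ := hu.mild t ht x
    obtain ⟨X', hX', hXu'⟩ := hu'.mild t ht x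
    rw [convIntegrand_eq_gHat h t x] at hX hX'
    have hXX := hX.ae_eq hW hμ (h.measurable_gHat t x) hX'
    filter_upwards [hXu, hXu', hXX, hint hu t ht x, hint hu' t ht x] with ω h1 h2 h3 h4 h5
    rw [h1, h2, h3, add_sub_add_left_eq_sub, h4.2, h5.2]
    unfold potential
    rw [← integral_sub h4.1 h5.1]
    refine (enorm_integral_le_lintegral_enorm _).trans ?_
    have e : ∀ q, potIntegrand c a (fun s y => pb.b (u (projIcc 0 pb.T hT s) y ω)) t x q
        - potIntegrand c a (fun s y => pb.b (u' (projIcc 0 pb.T hT s) y ω)) t x q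
        = potIntegrand c a (fun s y => pb.b (u (projIcc 0 pb.T hT s) y ω)
          - pb.b (u' (projIcc 0 pb.T hT s) y ω)) t x q := by
      intro q
      simp only [potIntegrand]
      split_ifs <;> ring
    simp_rw [e]
    refine (h.lintegral_potIntegrand_le hCA _ t x).trans ?_
    gcongr
    refine posPotential_mono (fun s hs y => ?_) ht x
    have := hb (u (projIcc 0 pb.T hT s) y ω) (u' (projIcc 0 pb.T hT s) y ω)
    rwa [edist_eq_enorm_sub, edist_eq_enorm_sub] at this
  obtain ⟨C1, hC1⟩ := hfirst hu
  obtain ⟨C2, hC2⟩ := hfirst hu'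
  set L : ℝ := 2 * C0 * K + 1 with hL
  have hL0 : 0 < L := by positivity
  -- Each use of the integral inequality `hineq` gains the factor `C0 K / L ≤ 1/2`, starting from
  -- the a priori first moments.
  have claim : ∀ j : ℕ, ∀ t ∈ Icc 0 pb.T, ∀ x, ∫⁻ ω, ‖u t x ω - u' t x ω‖ₑ ∂P
      ≤ ENNReal.ofReal ((C1 + C2) * (1 / 2) ^ j * Real.exp (L * t)) := by
    intro j
    induction j with
    | zero =>
      intro t ht x
      have hexp : 1 ≤ Real.exp (L * t) := Real.one_le_exp (by have := ht.1; positivity)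
      calc ∫⁻ ω, ‖u t x ω - u' t x ω‖ₑ ∂P ≤ ∫⁻ ω, (‖u t x ω‖ₑ + ‖u' t x ω‖ₑ) ∂P :=
            lintegral_mono fun ω => enorm_sub_le
        _ ≤ C1 + C2 := by
            rw [lintegral_add_left (hmeas hu t ht x).enorm]
            exact add_le_add (hC1 t ht x) (hC2 t ht x)
        _ = ENNReal.ofReal (C1 + C2) := by
            rw [ENNReal.ofReal_add (by positivity) (by positivity), ENNReal.ofReal_coe_nnreal,
              ENNReal.ofReal_coe_nnreal]
        _ ≤ _ := by
            refine ENNReal.ofReal_le_ofReal ?_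
            rw [pow_zero, mul_one]
            exact le_mul_of_one_le_right (by positivity) hexp
    | succ j ih =>
      intro t ht x
      have hgm : Measurable fun q : (ℝ × Rd d) × Ω => (K : ℝ≥0∞) *
          ‖u (projIcc 0 pb.T hT q.1.1) q.1.2 q.2 - u' (projIcc 0 pb.T hT q.1.1) q.1.2 q.2‖ₑ :=
        ((hext hu).sub (hext hu')).enorm.const_mul _
      have hstep := lintegral_posPotential_le (P := P) (ν := ν) h.dil_cont.measurable hL0
        (A := K * ((C1 + C2) * (1 / 2) ^ j)) (by positivity)
        (u := fun s y ω => (K : ℝ≥0∞) * ‖u (projIcc 0 pb.T hT s) y ω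
          - u' (projIcc 0 pb.T hT s) y ω‖ₑ) hgm (by
          intro s hs y
          rw [lintegral_const_mul' _ _ ENNReal.coe_ne_top, projIcc_of_mem hT hs, mul_assoc (K : ℝ),
            ENNReal.ofReal_mul K.coe_nonneg, ENNReal.ofReal_coe_nnreal]
          gcongr
          exact ih s hs y) ht x
      calc ∫⁻ ω, ‖u t x ω - u' t x ω‖ₑ ∂P ≤ _ := lintegral_mono_ae (hineq t ht x)
        _ ≤ ENNReal.ofReal C0 *
            ENNReal.ofReal (K * ((C1 + C2) * (1 / 2) ^ j) / L * Real.exp (L * t)) := by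
            rw [lintegral_const_mul' _ _ ENNReal.ofReal_ne_top]
            gcongr
        _ ≤ _ := by
            rw [← ENNReal.ofReal_mul hC0, ← mul_assoc]
            refine ENNReal.ofReal_le_ofReal ?_
            refine mul_le_mul_of_nonneg_right ?_ (Real.exp_pos _).le
            rw [← mul_div_assoc, div_le_iff₀ hL0, hL, pow_succ]
            have : 0 ≤ ((C1 : ℝ) + C2) * (1 / 2) ^ j := by positivity
            linarith
  intro t ht x
  have hz : ∫⁻ ω, ‖u t x ω - u' t x ω‖ₑ ∂P = 0 := by
    refine le_antisymm ?_ zero_le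
    have hlim : Tendsto (fun j : ℕ => ENNReal.ofReal ((C1 + C2) * (1 / 2) ^ j * Real.exp (L * t)))
        atTop (𝓝 0) := by
      rw [← ENNReal.ofReal_zero]
      refine ENNReal.tendsto_ofReal ?_
      have := ((tendsto_pow_atTop_nhds_zero_of_lt_one (r := (1 : ℝ) / 2) (by norm_num)
        (by norm_num)).const_mul ((C1 : ℝ) + C2)).mul_const (Real.exp (L * t))
      simpa using this
    exact ge_of_tendsto' hlim fun j => claim j t ht x
  have hdm : Measurable fun ω => ‖u t x ω - u' t x ω‖ₑ :=
    ((hmeas hu t ht x).sub (hmeas hu' t ht x)).enorm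
  rw [lintegral_eq_zero_iff hdm] at hz
  filter_upwards [hz] with ω hω
  exact sub_eq_zero.1 (enorm_eq_zero.1 hω)

end

end AdditiveSPDE

end

/-! ### Finite-dimensional laws of the stochastic convolution -/

noncomputable section

namespace AdditiveSPDE


variable {d : ℕ} {G : ℝ → Measure (Rd d)} {ν : Measure (Rd d)} {c a : ℝ → ℝ} {ι : Type*} [Fintype ι]

/-- A linear combination of the integrands of the stochastic convolution. -/
def gComb (ν : Measure (Rd d)) (c a : ℝ → ℝ) (θ t : ι → ℝ) (x : ι → Rd d) (r : ℝ) (ξ : Rd d) : ℂ :=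
  ∑ i, (θ i : ℂ) * gHat ν c a (t i) (x i) r ξ

/-- The density with respect to the spectral measure of the variance of a linear combination of
values of the stochastic convolution. -/
def specVar (ν : Measure (Rd d)) (c a : ℝ → ℝ) (θ t : ι → ℝ) (x : ι → Rd d) (ξ : Rd d) : ℝ :=
  ∫ r in Ioi (0 : ℝ), ‖gComb ν c a θ t x r ξ‖ ^ 2

lemma measurable_gComb (h : IsScaledKernel G ν c a) (θ t : ι → ℝ) (x : ι → Rd d) :
    Measurable fun p : ℝ × Rd d => gComb ν c a θ t x p.1 p.2 :=
  Finset.measurable_fun_sum _ fun i _ => (h.measurable_gHat (t i) (x i)).const_mul _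

lemma norm_gHat_le (h : IsScaledKernel G ν c a) {T C A : ℝ} (hC : 0 ≤ C)
    (hCA : ∀ r ∈ Icc 0 T, c r ≤ C ∧ a r ≤ A) {t : ℝ} (ht : t ∈ Icc 0 T) (x : Rd d) (r : ℝ)
    (ξ : Rd d) : ‖gHat ν c a t x r ξ‖ ≤ (Ioo 0 T).indicator (fun _ => C) r := by
  have := h.prob
  unfold gHat
  by_cases hr : r ∈ Ioo 0 t
  · have hr' : r ∈ Ioo 0 T := ⟨hr.1, hr.2.trans_le ht.2⟩
    rw [indicator_of_mem hr, indicator_of_mem hr', norm_mul,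
      norm_exp_neg_I_mul, one_mul]
    exact (norm_kHat_le h.amp_nonneg _ _).trans
      (hCA _ ⟨by linarith [hr.2], by linarith [hr.1, ht.2]⟩).1
  · rw [indicator_of_notMem hr, norm_zero]
    exact indicator_nonneg (fun _ _ => hC) r

lemma norm_gComb_le (h : IsScaledKernel G ν c a) {T C A : ℝ} (hC : 0 ≤ C)
    (hCA : ∀ r ∈ Icc 0 T, c r ≤ C ∧ a r ≤ A) (θ : ι → ℝ) {t : ι → ℝ} (ht : ∀ i, t i ∈ Icc 0 T)
    (x : ι → Rd d) (r : ℝ) (ξ : Rd d) :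
    ‖gComb ν c a θ t x r ξ‖ ^ 2 ≤ (Ioo 0 T).indicator (fun _ => ((∑ i, |θ i|) * C) ^ 2) r := by
  have h1 : ‖gComb ν c a θ t x r ξ‖ ≤ (∑ i, |θ i|) * (Ioo 0 T).indicator (fun _ => C) r := by
    rw [Finset.sum_mul]
    refine (norm_sum_le _ _).trans (Finset.sum_le_sum fun i _ => ?_)
    rw [norm_mul, Complex.norm_real, Real.norm_eq_abs]
    exact mul_le_mul_of_nonneg_left (norm_gHat_le h hC hCA (ht i) _ _ _) (abs_nonneg _)
  refine (pow_le_pow_left₀ (norm_nonneg _) h1 2).trans (le_of_eq ?_)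
  by_cases hr : r ∈ Ioo 0 T
  · simp [indicator_of_mem hr]
  · simp [indicator_of_notMem hr]

lemma integrable_indicator_Ioo_const (T C : ℝ) :
    Integrable ((Ioo 0 T).indicator fun _ => C) (volume.restrict (Ioi (0 : ℝ))) :=
  (integrable_indicator_iff measurableSet_Ioo).2
    ((integrableOn_const (by simp : volume (Ioo 0 T) ≠ ∞)).restrict)

lemma integrable_gComb (h : IsScaledKernel G ν c a) {T : ℝ} (θ : ι → ℝ) {t : ι → ℝ}
    (ht : ∀ i, t i ∈ Icc 0 T) (x : ι → Rd d) (ξ : Rd d) :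
    Integrable (fun r => ‖gComb ν c a θ t x r ξ‖ ^ 2) (volume.restrict (Ioi (0 : ℝ))) := by
  obtain ⟨C, A, hC, hA, hCA⟩ := h.exists_bounds T
  refine (integrable_indicator_Ioo_const T _).mono' ?_
    (Eventually.of_forall fun r => ?_) (g := (Ioo 0 T).indicator fun _ => ((∑ i, |θ i|) * C) ^ 2)
  · have : Measurable fun r => gComb ν c a θ t x r ξ :=
      Finset.measurable_fun_sum _ fun i _ => (h.measurable_gHat_left (t i) (x i) ξ).const_mul _
    exact (this.norm.pow_const 2).aestronglyMeasurable
  · rw [Real.norm_of_nonneg (by positivity)]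
    exact norm_gComb_le h hC hCA θ ht x r ξ

lemma continuous_gHat_right (h : IsScaledKernel G ν c a) (t : ℝ) (x : Rd d) (r : ℝ) :
    Continuous fun ξ => gHat ν c a t x r ξ := by
  have := h.prob
  unfold gHat
  by_cases hr : r ∈ Ioo 0 t
  · simp_rw [indicator_of_mem hr]
    refine Continuous.mul (by fun_prop) ?_
    exact h.continuous_kHat.comp (continuous_const.prodMk continuous_id)
  · simp_rw [indicator_of_notMem hr]; exact continuous_const

/-- Together with `exists_specVar_le` this makes `specVar` an admissible integrand in (H2). The
integrand is continuous in `ξ` for each time, bounded, and supported in `(0, T)`. -/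
lemma continuous_specVar (h : IsScaledKernel G ν c a) {T : ℝ} (θ : ι → ℝ) {t : ι → ℝ}
    (ht : ∀ i, t i ∈ Icc 0 T) (x : ι → Rd d) : Continuous (specVar ν c a θ t x) := by
  obtain ⟨C, A, hC, hA, hCA⟩ := h.exists_bounds T
  refine continuous_of_dominated (bound := (Ioo 0 T).indicator fun _ => ((∑ i, |θ i|) * C) ^ 2)
    (fun ξ => (integrable_gComb h θ ht x ξ).aestronglyMeasurable)
    (fun ξ => Eventually.of_forall fun r => ?_) (integrable_indicator_Ioo_const T _)
    (Eventually.of_forall fun r => ?_)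
  · rw [Real.norm_of_nonneg (by positivity)]
    exact norm_gComb_le h hC hCA θ ht x r ξ
  · refine Continuous.pow (Continuous.norm ?_) 2
    exact continuous_finsetSum _ fun i _ => continuous_const.mul (continuous_gHat_right h _ _ r)

lemma specVar_nonneg (θ t : ι → ℝ) (x : ι → Rd d) (ξ : Rd d) : 0 ≤ specVar ν c a θ t x ξ :=
  integral_nonneg fun _ => by positivity

lemma lintegral_gComb (h : IsScaledKernel G ν c a) {T : ℝ} (θ : ι → ℝ) {t : ι → ℝ}
    (ht : ∀ i, t i ∈ Icc 0 T) (x : ι → Rd d) (ξ : Rd d) :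
    ∫⁻ r in Ioi (0 : ℝ), ‖gComb ν c a θ t x r ξ‖ₑ ^ 2 = ENNReal.ofReal (specVar ν c a θ t x ξ) := by
  unfold specVar
  rw [ofReal_integral_eq_lintegral_ofReal (integrable_gComb h θ ht x ξ)
    (Eventually.of_forall fun r => by positivity)]
  refine lintegral_congr fun r => ?_
  rw [ENNReal.ofReal_pow (norm_nonneg _), ofReal_norm]

/-- The Cauchy–Schwarz inequality reduces the linear combination to single kernels, whose squares
have integral `O(1/(1+|ξ|²))`. -/
lemma exists_specVar_le (h : IsScaledKernel G ν c a) {T : ℝ} (θ : ι → ℝ) {t : ι → ℝ}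
    (ht : ∀ i, t i ∈ Icc 0 T) (x : ι → Rd d) :
    ∃ C : ℝ, ∀ ξ, |specVar ν c a θ t x ξ| ≤ C * (1 / (1 + ‖ξ‖ ^ 2)) := by
  obtain ⟨C1, hC1, hle⟩ := h.lintegral_gHat_le T
  refine ⟨Fintype.card ι * ∑ i, θ i ^ 2 * C1, fun ξ => ?_⟩
  rw [abs_of_nonneg (specVar_nonneg _ _ _ _)]
  have hi : ∀ i, Integrable (fun r => ‖gHat ν c a (t i) (x i) r ξ‖ ^ 2)
      (volume.restrict (Ioi (0 : ℝ))) := by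
    intro i
    have := integrable_gComb h (ι := Unit) (fun _ => 1) (t := fun _ => t i) (fun _ => ht i)
      (fun _ => x i) ξ
    simpa [gComb] using this
  have hb : ∀ i, ∫ r in Ioi (0 : ℝ), ‖gHat ν c a (t i) (x i) r ξ‖ ^ 2
      ≤ C1 * (1 / (1 + ‖ξ‖ ^ 2)) := by
    intro i
    rw [integral_eq_lintegral_of_nonneg_ae (Eventually.of_forall fun r => by positivity)
      (hi i).aestronglyMeasurable]
    refine ENNReal.toReal_le_of_le_ofReal (by positivity) ?_
    refine le_trans (le_of_eq (lintegral_congr fun r => ?_)) (hle (t i) (ht i) (x i) ξ)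
    rw [ENNReal.ofReal_pow (norm_nonneg _), ofReal_norm]
  calc specVar ν c a θ t x ξ
      ≤ ∫ r in Ioi (0 : ℝ), Fintype.card ι * ∑ i, θ i ^ 2 * ‖gHat ν c a (t i) (x i) r ξ‖ ^ 2 := by
        refine integral_mono (integrable_gComb h θ ht x ξ)
          ((integrable_finsetSum _ fun i _ => (hi i).const_mul _).const_mul _) fun r => ?_
        have h1 : ‖gComb ν c a θ t x r ξ‖ ≤ ∑ i, |θ i| * ‖gHat ν c a (t i) (x i) r ξ‖ := by
          refine (norm_sum_le _ _).trans (Finset.sum_le_sum fun i _ => ?_)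
          rw [norm_mul, Complex.norm_real, Real.norm_eq_abs]
        refine (pow_le_pow_left₀ (norm_nonneg _) h1 2).trans ?_
        refine (sq_sum_le_card_mul_sum_sq (s := Finset.univ)).trans (le_of_eq ?_)
        simp only [mul_pow, sq_abs, Finset.card_univ]
    _ = Fintype.card ι * ∑ i, θ i ^ 2 * ∫ r in Ioi (0 : ℝ), ‖gHat ν c a (t i) (x i) r ξ‖ ^ 2 := by
        rw [integral_const_mul, integral_finsetSum _ fun i _ => (hi i).const_mul _]
        simp_rw [integral_const_mul]
    _ ≤ Fintype.card ι * ∑ i, θ i ^ 2 * (C1 * (1 / (1 + ‖ξ‖ ^ 2))) := by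
        gcongr with i
        exact hb i
    _ = _ := by
        rw [mul_assoc, Finset.sum_mul]; simp_rw [mul_assoc]

lemma integrable_of_specWeight {μ : Measure (Rd d)} (hμ : IsSpectral μ) {f : Rd d → ℝ}
    (hf : Continuous f) {C : ℝ} (hC : ∀ ξ, |f ξ| ≤ C * (1 / (1 + ‖ξ‖ ^ 2))) : Integrable f μ := by
  refine Integrable.mono' (g := fun ξ => C * (1 / (1 + ‖ξ‖ ^ 2))) (Integrable.const_mul ?_ C)
    hf.aestronglyMeasurable (Eventually.of_forall hC)
  refine ⟨continuous_specWeight.aestronglyMeasurable, ?_⟩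
  refine lt_of_eq_of_lt (lintegral_congr fun ξ => ?_) hμ
  rw [← ofReal_norm, Real.norm_of_nonneg (by positivity)]

section

variable {Ω : Type*} [MeasurableSpace Ω] {P : Measure Ω} [IsProbabilityMeasure P]
  {μ : Measure (Rd d)} {W : TestFn d → Ω → ℝ}

omit [IsProbabilityMeasure P] in
lemma IsStochConv.isWienerIntegral_sum (hW : IsHomogeneousNoise P μ W) (hμ : IsSpectral μ)
    (h : IsScaledKernel G ν c a) {T : ℝ} (hT : 0 ≤ T) {Z : ℝ → Rd d → Ω → ℝ}
    (hZ : IsStochConv P μ W ν c a T Z) (θ : ι → ℝ) {t : ι → ℝ} (ht : ∀ i, t i ∈ Icc 0 T)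
    (x : ι → Rd d) :
    IsWienerIntegral P μ W (gComb ν c a θ t x) (fun ω => ∑ i, θ i * Z (t i) (x i) ω) := by
  classical
  -- The zero integrand starts the induction; its integral is obtained as `-Z + Z` at time zero.
  have hzero : IsWienerIntegral P μ W (fun _ _ => (0 : ℂ)) (fun _ => (0 : ℝ)) := by
    have h0 := hZ 0 ⟨le_rfl, hT⟩ 0
    have := h0.linComb hW hμ (h.measurable_gHat 0 0) (h.measurable_gHat 0 0) h0 (-1)
    convert this using 1
    · ext r ξ; simp
    · ext ω; simp
  have key : ∀ s : Finset ι, IsWienerIntegral P μ W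
      (fun r ξ => ∑ i ∈ s, (θ i : ℂ) * gHat ν c a (t i) (x i) r ξ)
      (fun ω => ∑ i ∈ s, θ i * Z (t i) (x i) ω) := by
    intro s
    induction s using Finset.induction_on with
    | empty => simpa using hzero
    | insert i s his ih =>
      simp_rw [Finset.sum_insert his]
      exact (hZ (t i) (ht i) (x i)).linComb hW hμ (h.measurable_gHat _ _)
        (Finset.measurable_fun_sum _ fun j _ => (h.measurable_gHat (t j) (x j)).const_mul _) ih (θ i)
  exact key Finset.univ

/-- The characteristic function of a vector of values of the stochastic convolution. -/
lemma IsStochConv.charFun_eq (hW : IsHomogeneousNoise P μ W) (hμ : IsSpectral μ)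
    (h : IsScaledKernel G ν c a) {T : ℝ} (hT : 0 ≤ T) {Z : ℝ → Rd d → Ω → ℝ}
    (hZ : IsStochConv P μ W ν c a T Z) (θ : EuclideanSpace ℝ ι) {t : ι → ℝ}
    (ht : ∀ i, t i ∈ Icc 0 T) (x : ι → Rd d) :
    charFun (P.map fun ω => (WithLp.toLp 2 fun i => Z (t i) (x i) ω : EuclideanSpace ℝ ι)) θ
      = Complex.exp (-((∫ ξ, specVar ν c a (fun i => θ i) t x ξ ∂μ : ℝ) : ℂ) / 2) := by
  have : SigmaFinite μ := hμ.sigmaFinite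
  have hX := hZ.isWienerIntegral_sum hW hμ h hT (fun i => θ i) ht x
  have hgm := measurable_gComb h (fun i => θ i) t x
  have hlaw := hX.map_eq hW hμ hgm
  set g := fun p : ℝ × Rd d => gComb ν c a (fun i => θ i) t x p.1 p.2 with hg
  obtain ⟨C, hC⟩ := exists_specVar_le h (fun i => θ i) ht x
  have hint := integrable_of_specWeight hμ (continuous_specVar h (fun i => θ i) ht x) hC
  have hv : (((eLpNorm g 2 (stMeasure μ)).toNNReal ^ 2 : ℝ≥0) : ℝ)
      = ∫ ξ, specVar ν c a (fun i => θ i) t x ξ ∂μ := by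
    have e1 : eLpNorm g 2 (stMeasure μ) ^ 2
        = ENNReal.ofReal (∫ ξ, specVar ν c a (fun i => θ i) t x ξ ∂μ) := by
      rw [eLpNorm_two_sq, lintegral_stMeasure_symm
        (f := fun r ξ => ‖gComb ν c a (fun i => θ i) t x r ξ‖ₑ ^ 2) (hgm.enorm.pow_const 2),
        ofReal_integral_eq_lintegral_ofReal hint
          (Eventually.of_forall fun ξ => specVar_nonneg _ _ _ _)]
      exact lintegral_congr fun ξ => lintegral_gComb h _ ht x ξ
    rw [NNReal.coe_pow, ENNReal.coe_toNNReal_eq_toReal, ← ENNReal.toReal_pow, e1,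
      ENNReal.toReal_ofReal (integral_nonneg fun ξ => specVar_nonneg _ _ _ _)]
  have hmv : Measurable fun ω => (WithLp.toLp 2 fun i => Z (t i) (x i) ω : EuclideanSpace ℝ ι) :=
    (WithLp.measurable_toLp 2 _).comp
      (measurable_pi_lambda _ fun i => (hZ (t i) (ht i) (x i)).measurable)
  -- The Cramér–Wold device: the characteristic function at `θ` is that of the scalar combination
  -- with coefficients `θ`, at one.
  have e2 : charFun (P.map fun ω => (WithLp.toLp 2 fun i => Z (t i) (x i) ω : EuclideanSpace ℝ ι)) θ
      = charFun (P.map fun ω => ∑ i, θ i * Z (t i) (x i) ω) 1 := by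
    rw [charFun_apply, charFun_apply, integral_map hmv.aemeasurable
      (by fun_prop), integral_map hX.measurable.aemeasurable (by fun_prop)]
    refine integral_congr_ae (Eventually.of_forall fun ω => ?_)
    simp [PiLp.inner_apply]
  rw [e2, hlaw, charFun_gaussianReal, hv]
  congr 1
  push_cast
  ring

end

/-- Convergence of the finite dimensional distributions of the stochastic convolutions. -/
lemma tendstoInDistribution_stochConv {Ωs : ℕ → Type*} [∀ n, MeasurableSpace (Ωs n)]
    {Ps : ∀ n, Measure (Ωs n)} [∀ n, IsProbabilityMeasure (Ps n)]
    {Ω : Type*} [MeasurableSpace Ω] {P : Measure Ω} [IsProbabilityMeasure P]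
    {μs : ℕ → Measure (Rd d)} {μ : Measure (Rd d)} (h2 : HypH2 μs μ)
    {Ws : ∀ n, TestFn d → Ωs n → ℝ} (hWs : ∀ n, IsHomogeneousNoise (Ps n) (μs n) (Ws n))
    {W : TestFn d → Ω → ℝ} (hW : IsHomogeneousNoise P μ W) (hμs : ∀ n, IsSpectral (μs n))
    (hμ : IsSpectral μ) (h : IsScaledKernel G ν c a) {T : ℝ} (hT : 0 ≤ T)
    {Zs : ∀ n, ℝ → Rd d → Ωs n → ℝ} (hZs : ∀ n, IsStochConv (Ps n) (μs n) (Ws n) ν c a T (Zs n))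
    {Z : ℝ → Rd d → Ω → ℝ} (hZ : IsStochConv P μ W ν c a T Z) {t : ι → ℝ}
    (ht : ∀ i, t i ∈ Icc 0 T) (x : ι → Rd d) :
    TendstoInDistribution
      (fun n ω => (WithLp.toLp 2 fun i => Zs n (t i) (x i) ω : EuclideanSpace ℝ ι)) atTop
      (fun ω => (WithLp.toLp 2 fun i => Z (t i) (x i) ω : EuclideanSpace ℝ ι)) Ps P where
  forall_aemeasurable n := ((WithLp.measurable_toLp 2 _).comp
      (measurable_pi_lambda _ fun i => (hZs n (t i) (ht i) (x i)).measurable)).aemeasurable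
  aemeasurable_limit := ((WithLp.measurable_toLp 2 _).comp
      (measurable_pi_lambda _ fun i => (hZ (t i) (ht i) (x i)).measurable)).aemeasurable
  tendsto := by
    refine ProbabilityMeasure.tendsto_of_tendsto_charFun fun θ => ?_
    simp only [ProbabilityMeasure.coe_mk]
    rw [hZ.charFun_eq hW hμ h hT θ ht x]
    simp_rw [fun n => (hZs n).charFun_eq (hWs n) (hμs n) h hT θ ht x]
    refine (Complex.continuous_exp.tendsto _).comp (Tendsto.div_const (Tendsto.neg ?_) 2)
    refine (Complex.continuous_ofReal.tendsto _).comp ?_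
    exact (h2 _ (continuous_specVar h (fun i => θ i) ht x)
      (exists_specVar_le h (fun i => θ i) ht x)).2

end AdditiveSPDE

end

/-! ### Convergence in law through uniformly close approximations -/

noncomputable section

namespace AdditiveSPDE


section Approximation

variable {B : Type*} [NormedAddCommGroup B]

lemma abs_integral_comp_sub_le {Ω : Type*} [MeasurableSpace Ω] {P : Measure Ω} [IsProbabilityMeasure P]
    {f : B → ℝ} {R : ℝ} (hR : ∀ x y, dist (f x) (f y) ≤ R) {L : ℝ≥0} (hL : LipschitzWith L f)
    {V V' : Ω → B} (hV : StronglyMeasurable V) (hV' : StronglyMeasurable V') {e : ℝ} (he : 0 ≤ e)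
    (h : eLpNorm (fun ω => V ω - V' ω) 1 P ≤ ENNReal.ofReal e) :
    |∫ ω, f (V ω) ∂P - ∫ ω, f (V' ω) ∂P| ≤ L * e := by
  have hint : ∀ {U : Ω → B}, StronglyMeasurable U → Integrable (fun ω => f (U ω)) P := by
    intro U hU
    refine Integrable.of_bound (hL.continuous.comp_stronglyMeasurable hU).aestronglyMeasurable
      (‖f 0‖ + R) (Eventually.of_forall fun ω => ?_)
    have h1 := hR (U ω) 0
    have h2 := norm_le_norm_add_norm_sub' (f (U ω)) (f 0)
    rw [dist_eq_norm] at h1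
    linarith
  rw [← integral_sub (hint hV) (hint hV'), ← Real.norm_eq_abs]
  have h0 : 0 ≤ (L : ℝ) * e := by positivity
  rw [← ENNReal.ofReal_le_ofReal_iff h0, ofReal_norm]
  refine (enorm_integral_le_lintegral_enorm _).trans ?_
  calc ∫⁻ ω, ‖f (V ω) - f (V' ω)‖ₑ ∂P ≤ ∫⁻ ω, L * ‖V ω - V' ω‖ₑ ∂P := by
        refine lintegral_mono fun ω => ?_
        have := hL (V ω) (V' ω)
        rwa [edist_eq_enorm_sub, edist_eq_enorm_sub] at this
    _ = L * eLpNorm (fun ω => V ω - V' ω) 1 P := by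
        rw [lintegral_const_mul' _ _ (by simp), eLpNorm_one_eq_lintegral_enorm]
    _ ≤ L * ENNReal.ofReal e := mul_le_mul_right h _
    _ = _ := by rw [ENNReal.ofReal_mul (by positivity)]; simp

variable [MeasurableSpace B] [BorelSpace B]

/-- Convergence in law follows from the convergence in law of uniformly close approximations. -/
lemma tendstoInDistribution_of_approx {Ωs : ℕ → Type*} [∀ n, MeasurableSpace (Ωs n)]
    {Ps : ∀ n, Measure (Ωs n)} [∀ n, IsProbabilityMeasure (Ps n)]
    {Ω : Type*} [MeasurableSpace Ω] {P : Measure Ω} [IsProbabilityMeasure P]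
    {Vs : ∀ n, Ωs n → B} {V : Ω → B} {Vsk : ℕ → ∀ n, Ωs n → B} {Vk : ℕ → Ω → B}
    (hVs : ∀ n, StronglyMeasurable (Vs n)) (hV : StronglyMeasurable V)
    (hVsk : ∀ k n, StronglyMeasurable (Vsk k n)) (hVk : ∀ k, StronglyMeasurable (Vk k))
    {e e' : ℕ → ℝ} (he0 : ∀ k, 0 ≤ e k) (he0' : ∀ k, 0 ≤ e' k) (he : Tendsto e atTop (𝓝 0))
    (he' : Tendsto e' atTop (𝓝 0))
    (h1 : ∀ k n, eLpNorm (fun ω => Vs n ω - Vsk k n ω) 1 (Ps n) ≤ ENNReal.ofReal (e k))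
    (h2 : ∀ k, eLpNorm (fun ω => V ω - Vk k ω) 1 P ≤ ENNReal.ofReal (e' k))
    (hk : ∀ k, TendstoInDistribution (Vsk k) atTop (Vk k) Ps P) :
    TendstoInDistribution Vs atTop V Ps P where
  forall_aemeasurable n := (hVs n).measurable.aemeasurable
  aemeasurable_limit := hV.measurable.aemeasurable
  tendsto := by
    refine tendsto_iff_forall_lipschitz_integral_tendsto.2 ?_
    rintro f ⟨R, hR⟩ ⟨L, hL⟩
    simp only [ProbabilityMeasure.coe_mk]
    have emap : ∀ {Ω' : Type _} [MeasurableSpace Ω'] (P' : Measure Ω') {U : Ω' → B},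
        StronglyMeasurable U → ∫ x, f x ∂(P'.map U) = ∫ ω, f (U ω) ∂P' := by
      intro Ω' _ P' U hU
      exact integral_map hU.measurable.aemeasurable
        hL.continuous.measurable.stronglyMeasurable.aestronglyMeasurable
    rw [emap P hV]
    have : ∀ n, ∫ x, f x ∂((Ps n).map (Vs n)) = ∫ ω, f (Vs n ω) ∂(Ps n) := fun n =>
      integral_map (hVs n).measurable.aemeasurable
        hL.continuous.measurable.stronglyMeasurable.aestronglyMeasurable
    simp_rw [this]
    rw [Metric.tendsto_atTop]
    intro ε hε
    have hlim : Tendsto (fun k => L * e k + L * e' k) atTop (𝓝 0) := by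
      simpa using (he.const_mul (L : ℝ)).add (he'.const_mul (L : ℝ))
    -- The level `k` is fixed before `n`; this is possible because the error `e k` is the same for
    -- all `n`.
    obtain ⟨k, hk2⟩ := (hlim.eventually (gt_mem_nhds (half_pos hε))).exists
    have hkf := tendsto_iff_forall_lipschitz_integral_tendsto.1 (hk k).tendsto f ⟨R, hR⟩ ⟨L, hL⟩
    simp only [ProbabilityMeasure.coe_mk] at hkf
    rw [emap P (hVk k)] at hkf
    have : ∀ n, ∫ x, f x ∂((Ps n).map (Vsk k n)) = ∫ ω, f (Vsk k n ω) ∂(Ps n) := fun n =>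
      integral_map (hVsk k n).measurable.aemeasurable
        hL.continuous.measurable.stronglyMeasurable.aestronglyMeasurable
    simp_rw [this] at hkf
    obtain ⟨N, hN⟩ := Metric.tendsto_atTop.1 hkf (ε / 2) (half_pos hε)
    refine ⟨N, fun n hn => ?_⟩
    have a1 := abs_integral_comp_sub_le hR hL (hVs n) (hVsk k n) (he0 k) (h1 k n)
    have a2 := abs_integral_comp_sub_le hR hL hV (hVk k) (he0' k) (h2 k)
    have a3 := hN n hn
    rw [Real.dist_eq] at a3 ⊢
    rw [abs_le] at a1 a2
    rw [abs_lt] at a3 ⊢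
    constructor <;> linarith [a1.1, a1.2, a2.1, a2.2, a3.1, a3.2]

end Approximation

/-! ### From weighted fields on `ℝ^{d+1}` to paths on `J × ℝ^d` -/

section Lift

variable {d : ℕ}

/-- The space-time point of `ℝ^{d+1}` with given time and space coordinates. -/
def gridPoint {T : ℝ} (z : Icc (0 : ℝ) T × Rd d) : Fin (d + 1) → ℝ :=
  Fin.cons (z.1 : ℝ) fun i => z.2 i

lemma continuous_gridPoint {T : ℝ} : Continuous (gridPoint : Icc (0 : ℝ) T × Rd d → _) := by
  refine continuous_pi fun i => ?_
  refine Fin.cases ?_ (fun i => ?_) i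
  · simp only [gridPoint, Fin.cons_zero]
    exact continuous_subtype_val.comp continuous_fst
  · simp only [gridPoint, Fin.cons_succ]
    fun_prop

lemma gridTime_gridPoint {T : ℝ} (z : Icc (0 : ℝ) T × Rd d) : gridTime T (gridPoint z) = z.1 := by
  simp only [gridTime, gridPoint, Fin.cons_zero]
  rw [min_eq_left z.1.2.2, max_eq_right z.1.2.1]

lemma gridSpace_gridPoint {T : ℝ} (z : Icc (0 : ℝ) T × Rd d) : gridSpace (gridPoint z) = z.2 := rfl

lemma norm_gridPoint_le {T : ℝ} (z : Icc (0 : ℝ) T × Rd d) : ‖gridPoint z‖ ≤ T + ‖z.2‖ := by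
  have hT : 0 ≤ T := z.1.2.1.trans z.1.2.2
  refine (pi_norm_le_iff_of_nonneg (add_nonneg hT (norm_nonneg _))).2 fun i => ?_
  refine Fin.cases ?_ (fun i => ?_) i
  · simp only [gridPoint, Fin.cons_zero, Real.norm_eq_abs]
    rw [abs_of_nonneg z.1.2.1]
    linarith [z.1.2.2, norm_nonneg z.2]
  · simp only [gridPoint, Fin.cons_succ]
    linarith [PiLp.norm_apply_le z.2 i]

/-- The ratio of the weight used for the chaining and the weight used for the equation. -/
def weightRatio (l T : ℝ) (d : ℕ) (hl : 0 ≤ l) : Path T d :=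
  BoundedContinuousFunction.ofNormedAddCommGroup
    (fun z => (1 + ‖gridPoint z‖) / weight l z.1 z.2)
    ((continuous_const.add continuous_gridPoint.norm).div
      ((continuous_weight l).comp ((continuous_subtype_val.comp continuous_fst).prodMk
        continuous_snd)) fun z => (weight_pos l z.1 z.2).ne') (1 + T) fun z => by
    have hT : 0 ≤ T := z.1.2.1.trans z.1.2.2
    have hw := weight_pos l (z.1 : ℝ) z.2
    rw [Real.norm_of_nonneg (by positivity), div_le_iff₀ hw]
    have h1 : 1 + ‖z.2‖ ≤ weight l (z.1 : ℝ) z.2 := by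
      unfold weight
      exact le_mul_of_one_le_left (by positivity)
        (Real.one_le_exp (mul_nonneg hl z.1.2.1))
    nlinarith [norm_gridPoint_le z, norm_nonneg z.2]

/-- The path of the weighted fluctuation on `[0, T] × ℝ^d` obtained from a function on `ℝ^{d+1}`. -/
def liftPath (l T : ℝ) (hl : 0 ≤ l) (v : BoundedContinuousFunction (Fin (d + 1) → ℝ) ℝ) : Path T d :=
  v.compContinuous ⟨gridPoint, continuous_gridPoint⟩ * weightRatio l T d hl

lemma continuous_liftPath (l T : ℝ) (hl : 0 ≤ l) :
    Continuous (liftPath l T hl : BoundedContinuousFunction (Fin (d + 1) → ℝ) ℝ → Path T d) := by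
  unfold liftPath
  exact (BoundedContinuousFunction.continuous_compContinuous _).mul continuous_const

lemma weight_mul_liftPath {l T : ℝ} (hl : 0 ≤ l) {Ω : Type*} {Z : ℝ → Rd d → Ω → ℝ}
    {v : BoundedContinuousFunction (Fin (d + 1) → ℝ) ℝ} (z : Icc (0 : ℝ) T × Rd d) {ω : Ω}
    (h : v (gridPoint z) = weightField T Z (gridPoint z) ω) :
    weight l z.1 z.2 * liftPath l T hl v z = Z z.1 z.2 ω := by
  have hw := (weight_pos l (z.1 : ℝ) z.2).ne'
  have e : liftPath l T hl v z = v (gridPoint z) * ((1 + ‖gridPoint z‖) / weight l z.1 z.2) := rfl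
  rw [e, h, weightField, gridTime_gridPoint, gridSpace_gridPoint]
  have : 1 + ‖gridPoint z‖ ≠ 0 := by positivity
  field_simp

/-- The continuous paths on `J × ℝ^d` determined by the weighted fluctuation. -/
def pathMap (pb : CauchyProblem d) (l : ℝ) {J : Set ℝ} (hJ : J ⊆ Icc 0 pb.T)
    (hI : ContinuousOn (fun p : ℝ × Rd d => linearPart pb p.1 p.2) (J ×ˢ univ)) (v : Path pb.T d) :
    C(J × Rd d, ℝ) where
  toFun z := linearPart pb z.1 z.2 + weight l z.1 z.2 * v (inclusion hJ z.1, z.2)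
  continuous_toFun := by
    refine Continuous.add ?_ (Continuous.mul ?_ ?_)
    · exact hI.comp_continuous (f := fun z : J × Rd d => ((z.1 : ℝ), z.2)) (by fun_prop)
        fun z => ⟨z.1.2, mem_univ _⟩
    · exact (continuous_weight l).comp (f := fun z : J × Rd d => ((z.1 : ℝ), z.2)) (by fun_prop)
    · exact v.continuous.comp (((continuous_inclusion hJ).comp continuous_fst).prodMk continuous_snd)

/-- Continuity into the compact-open topology is joint continuity of the evaluation, so the
unbounded weight does no harm. -/
lemma continuous_pathMap (pb : CauchyProblem d) (l : ℝ) {J : Set ℝ} (hJ : J ⊆ Icc 0 pb.T)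
    (hI : ContinuousOn (fun p : ℝ × Rd d => linearPart pb p.1 p.2) (J ×ˢ univ)) :
    Continuous (pathMap pb l hJ hI) := by
  refine ContinuousMap.continuous_of_continuous_uncurry _ ?_
  have e : (Function.uncurry fun (v : Path pb.T d) z => pathMap pb l hJ hI v z)
      = fun q => pathMap pb l hJ hI 0 q.2
        + weight l q.2.1 q.2.2 * q.1 (inclusion hJ q.2.1, q.2.2) := by
    ext q
    simp [pathMap, Function.uncurry]
  rw [e]
  refine ((pathMap pb l hJ hI 0).continuous.comp continuous_snd).add (Continuous.mul ?_ ?_)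
  · exact (continuous_weight l).comp
      (f := fun q : Path pb.T d × (J × Rd d) => ((q.2.1 : ℝ), q.2.2)) (by fun_prop)
  · exact continuous_eval.comp (continuous_fst.prodMk
      (((continuous_inclusion hJ).comp continuous_snd.fst).prodMk continuous_snd.snd))

end Lift

end AdditiveSPDE

end

/-! ### Convergence in law for a general scaled kernel -/

noncomputable section

namespace AdditiveSPDE


variable {d : ℕ} {G : ℝ → Measure (Rd d)} {ν : Measure (Rd d)} {c a : ℝ → ℝ}

/-- There are an adapted version of the stochastic convolution and a version whose weighted paths
are bounded and continuous. -/
lemma IsScaledKernel.exists_adapted_and_weighted_version (h : IsScaledKernel G ν c a) {T : ℝ}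
    (hT : 0 ≤ T) {q K : ℝ} (hq0 : 0 < q) (hq : q < 2) (hK : 0 ≤ K) : ∃ K' r : ℝ, 0 ≤ r ∧ r < 1 ∧
      ∀ {Ω : Type*} [MeasurableSpace Ω] (P : Measure Ω) [IsProbabilityMeasure P] [P.IsComplete]
      (μ : Measure (Rd d)) (W : TestFn d → Ω → ℝ), IsHomogeneousNoise P μ W →
      specMass q μ ≤ ENNReal.ofReal K →
      ∃ (Z : ℝ → Rd d → Ω → ℝ) (V : Ω → BoundedContinuousFunction (Fin (d + 1) → ℝ) ℝ),
        IsStochConv P μ W ν c a T Z ∧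
        (∀ t ∈ Icc 0 T, ∀ x, Measurable[noiseFiltration P μ W t] (Z t x)) ∧ StronglyMeasurable V ∧
        (∀ x, ∀ᵐ ω ∂P, V ω x = weightField T Z x ω) ∧
        ∀ k, eLpNorm (fun ω => V ω - randomInterp (weightField T Z) (k + 1) ω) 1 P
          ≤ ENNReal.ofReal (K' * r ^ k) := by
  obtain ⟨K', r, hr0, hr1, hmain⟩ := h.exists_weighted_version hT hq0 hq hK
  refine ⟨K', r, hr0, hr1, ?_⟩
  intro Ω _ P _ _ μ W hW hμ
  have hμs := isSpectral_of_specMass hq.le hμ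
  choose X hX using fun (t : Icc (0 : ℝ) T) (x : Rd d) => exists_stochConv hW hμs h t.2.1 x
  set Z : ℝ → Rd d → Ω → ℝ := fun t x => X (projIcc 0 T hT t) x with hZ
  have hZX : ∀ t (ht : t ∈ Icc 0 T) x, Z t x = X ⟨t, ht⟩ x := fun t ht x => by
    simp only [hZ]; rw [projIcc_of_mem hT ht]
  have hZc : IsStochConv P μ W ν c a T Z := fun t ht x => by
    rw [hZX t ht]; exact (hX ⟨t, ht⟩ x).1
  obtain ⟨V, hV⟩ := hmain P μ W Z hW hμ hZc
  refine ⟨Z, V, hZc, fun t ht x => ?_, hV⟩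
  rw [hZX t ht]; exact (hX ⟨t, ht⟩ x).2

lemma stronglyMeasurable_randomInterp_weightField {Ω : Type*} [MeasurableSpace Ω] {T : ℝ}
    (hT : 0 ≤ T) {Z : ℝ → Rd d → Ω → ℝ} (hZ : ∀ t ∈ Icc 0 T, ∀ x, Measurable (Z t x)) (k : ℕ) :
    StronglyMeasurable (randomInterp (weightField T Z) k) := by
  have : randomInterp (weightField T Z) k
      = fun ω => ∑ m ∈ box (d + 1) k, weightField T Z (dyad k m) ω • tentB k m := rfl
  rw [this]
  refine Finset.stronglyMeasurable_fun_sum _ fun m _ => StronglyMeasurable.smul_const ?_ _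
  exact ((hZ _ (gridTime_mem hT _) _).const_mul _).stronglyMeasurable

/-- The interpolation of a weighted field as a function of the values of the field. -/
def interpOfValues (d k : ℕ) (y : EuclideanSpace ℝ (box (d + 1) k)) :
    BoundedContinuousFunction (Fin (d + 1) → ℝ) ℝ :=
  ∑ m : box (d + 1) k, (1 / (1 + ‖dyad k (m : Fin (d + 1) → ℤ)‖) * y m) • tentB k m

lemma continuous_interpOfValues (d k : ℕ) : Continuous (interpOfValues d k) := by
  unfold interpOfValues
  refine continuous_finsetSum _ fun m _ => ?_
  exact ((continuous_const.mul (PiLp.continuous_apply 2 (fun _ => ℝ) m)).smul continuous_const)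

lemma randomInterp_weightField_eq {Ω : Type*} (T : ℝ) (Z : ℝ → Rd d → Ω → ℝ) (k : ℕ) (ω : Ω) :
    randomInterp (weightField T Z) k ω = interpOfValues d k (WithLp.toLp 2 fun m =>
      Z (gridTime T (dyad k (m : Fin (d + 1) → ℤ))) (gridSpace (dyad k m)) ω) := by
  unfold randomInterp dyadicInterp interpOfValues weightField
  rw [← Finset.sum_coe_sort]

/-- Almost sure equality at each point of a countable dense set, extended by continuity of the
paths. -/
lemma IsContinuousVersion.ae_eq {Ω : Type*} [MeasurableSpace Ω] {P : Measure Ω} {J : Set ℝ}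
    {u u' : ℝ → Rd d → Ω → ℝ} {U U' : Ω → C(J × Rd d, ℝ)} (hU : IsContinuousVersion P J u U)
    (hU' : IsContinuousVersion P J u' U') (h : ∀ t ∈ J, ∀ x, u t x =ᵐ[P] u' t x) : U =ᵐ[P] U' := by
  obtain ⟨s, hs, hsd⟩ := TopologicalSpace.exists_countable_dense (J × Rd d)
  have : ∀ᵐ ω ∂P, ∀ z ∈ s, U ω z = U' ω z := by
    rw [ae_ball_iff hs]
    intro z _
    filter_upwards [hU z.1 z.2, hU' z.1 z.2, h z.1 z.1.2 z.2] with ω h1 h2 h3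
    exact h1.trans (h3.trans h2.symm)
  filter_upwards [this] with ω hω
  exact DFunLike.coe_injective ((U ω).continuous.ext_on hsd (U' ω).continuous hω)

/-- The resolvent applied to the weighted fluctuation gives a mild solution with continuous paths. -/
lemma isMildSolution_and_isContinuousVersion {Ω : Type*} [MeasurableSpace Ω] {P : Measure Ω}
    [IsProbabilityMeasure P] [P.IsComplete] {μ : Measure (Rd d)} {W : TestFn d → Ω → ℝ}
    {pb : CauchyProblem d} (h : IsScaledKernel (fundamentalSolution pb.eqn d) ν c a)
    (hT : 0 ≤ pb.T) {L : ℝ≥0} (hb : LipschitzWith L pb.b) {M : ℝ} (hM : 0 ≤ M)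
    (hI : GoodLinearPart pb M) {J : Set ℝ} (hJ : J ⊆ Icc 0 pb.T)
    (hIJ : ContinuousOn (fun p : ℝ × Rd d => linearPart pb p.1 p.2) (J ×ˢ univ)) {l : ℝ} (hl : 0 < l)
    {Q S : Path pb.T d → Path pb.T d}
    (hQ : ∀ v z, weight l z.1 z.2 * Q v z
      = potential pb.T ν c a (driftField pb.b (cutPart pb) l hT v) z.1 z.2)
    (hS1 : ∀ z, S z = z + Q (S z))
    (hS : ∀ z, Tendsto (fun j => (fun v => z + Q v)^[j] 0) atTop (𝓝 (S z)))
    {Z : ℝ → Rd d → Ω → ℝ} {V : Ω → BoundedContinuousFunction (Fin (d + 1) → ℝ) ℝ}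
    (hZ : IsStochConv P μ W ν c a pb.T Z)
    (hZad : ∀ t ∈ Icc 0 pb.T, ∀ x, Measurable[noiseFiltration P μ W t] (Z t x))
    (hV : ∀ x, ∀ᵐ ω ∂P, V ω x = weightField pb.T Z x ω) {N : ℕ} {p : ℝ≥0} (hN : N ≠ 0) (hp : p ≤ N)
    {A : ℝ} (hA : 0 ≤ A)
    (hZm : ∀ t ∈ Icc 0 pb.T, ∀ x, ∫⁻ ω, ‖Z t x ω‖ₑ ^ N ∂P ≤ ENNReal.ofReal A) :
    IsMildSolution P μ W pb p (solField pb l hT fun ω => S (liftPath l pb.T hl.le (V ω))) ∧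
    IsContinuousVersion P J (solField pb l hT fun ω => S (liftPath l pb.T hl.le (V ω)))
      fun ω => pathMap pb l hJ hIJ (S (liftPath l pb.T hl.le (V ω))) := by
  refine ⟨isMildSolution_solField h hT hb hM hI hl hQ hS1 hS hZ hZad (fun t x => ?_) hN hp hA hZm,
    fun t x => Eventually.of_forall fun ω => ?_⟩
  · filter_upwards [hV (gridPoint (t, x))] with ω hω
    exact weight_mul_liftPath hl.le (t, x) hω
  · simp only [pathMap, solField, ContinuousMap.coe_mk]
    rw [projIcc_of_mem hT (hJ t.2)]

/-- Convergence in law of the solutions, for a kernel with a scaling property and a linear part that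
is bounded and continuous. -/
theorem solutionsConvergeInLaw_of_isScaledKernel
    {Ωs : ℕ → Type*} [∀ n, MeasurableSpace (Ωs n)]
    (Ps : ∀ n, Measure (Ωs n)) [∀ n, IsProbabilityMeasure (Ps n)] [∀ n, (Ps n).IsComplete]
    {Ω : Type*} [MeasurableSpace Ω] (P : Measure Ω) [IsProbabilityMeasure P] [P.IsComplete]
    (μs : ℕ → Measure (Rd d)) (μ : Measure (Rd d)) (h1 : HypH1 μs) (h2 : HypH2 μs μ)
    (Ws : ∀ n, TestFn d → Ωs n → ℝ) (hWs : ∀ n, IsHomogeneousNoise (Ps n) (μs n) (Ws n))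
    (W : TestFn d → Ω → ℝ) (hW : IsHomogeneousNoise P μ W) (pb : CauchyProblem d) (hT : 0 ≤ pb.T)
    (h : IsScaledKernel (fundamentalSolution pb.eqn d) ν c a) {L : ℝ≥0} (hb : LipschitzWith L pb.b)
    {M : ℝ} (hM : 0 ≤ M) (hI : GoodLinearPart pb M) {p : ℝ≥0} (hp : 1 ≤ p) {J : Set ℝ}
    (hJ : J ⊆ Icc 0 pb.T)
    (hIJ : ContinuousOn (fun p : ℝ × Rd d => linearPart pb p.1 p.2) (J ×ˢ univ)) :
    SolutionsConvergeInLaw Ps μs Ws P μ W pb p J := by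
  obtain ⟨q, K, hq0, hq, hK, hμs⟩ := HypH1.exists_specMass_le h1
  have hμ := HypH2.specMass_le h2 hq0 hK hμs
  have hSμs : ∀ n, IsSpectral (μs n) := fun n => isSpectral_of_specMass hq.le (hμs n)
  have hSμ : IsSpectral μ := isSpectral_of_specMass hq.le hμ
  obtain ⟨l, hl, hQex⟩ := h.exists_contraction hT hb
  obtain ⟨Q, hQ, hQc⟩ := hQex M (cutPart pb) hM (hI.linData hM)
  obtain ⟨S, hS1, hSL, hS⟩ := exists_resolvent hQc
  -- Moments of the even order `2j ≥ p` are computed for Gaussian variables and dominate the `L^p`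
  -- norm.
  obtain ⟨j, hj⟩ := exists_nat_ge p
  have hj0 : 2 * j ≠ 0 := by
    rintro h0
    have : j = 0 := by omega
    rw [this] at hj
    exact absurd (hp.trans hj) (by simp)
  have hpj : p ≤ ((2 * j : ℕ) : ℝ≥0) := hj.trans (by exact_mod_cast (by omega : j ≤ 2 * j))
  -- One map `Ψ`, independent of the noise, sends every weighted stochastic convolution to the paths
  -- of the corresponding solution.
  set Ψ : BoundedContinuousFunction (Fin (d + 1) → ℝ) ℝ → C(J × Rd d, ℝ) :=
    fun v => pathMap pb l hJ hIJ (S (liftPath l pb.T hl.le v)) with hΨ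
  have hΨc : Continuous Ψ := (continuous_pathMap pb l hJ hIJ).comp
    (hSL.continuous.comp (continuous_liftPath l pb.T hl.le))
  -- The spaces `Ωs n` may lie in another universe than `Ω`, and the constants are attached to a
  -- universe; they are therefore obtained separately for the sequence and for the limit.
  obtain ⟨K1, r1, hr10, hr11, hV1⟩ := h.exists_adapted_and_weighted_version hT hq0 hq hK
  obtain ⟨K2, r2, hr20, hr21, hV2⟩ := h.exists_adapted_and_weighted_version hT hq0 hq hK
  obtain ⟨A1, hA1, hm1⟩ := h.exists_moment_bound pb.T hq0 hq hK j
  obtain ⟨A2, hA2, hm2⟩ := h.exists_moment_bound pb.T hq0 hq hK j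
  choose Zs Vs hZs hZsad hVsm hVs hVsa using fun n => hV1 (Ps n) (μs n) (Ws n) (hWs n) (hμs n)
  obtain ⟨Z, V, hZ, hZad, hVm, hV, hVa⟩ := hV2 P μ W hW hμ
  have hsols := fun n => isMildSolution_and_isContinuousVersion h hT hb hM hI hJ hIJ hl hQ hS1 hS
    (hZs n) (hZsad n) (hVs n) hj0 hpj hA1 (hm1 (Ps n) (μs n) (Ws n) (Zs n) (hWs n) (hμs n) (hZs n)).1
  have hsol := isMildSolution_and_isContinuousVersion h hT hb hM hI hJ hIJ hl hQ hS1 hS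
    hZ hZad hV hj0 hpj hA2 (hm2 P μ W Z hW hμ hZ).1
  refine ⟨fun n => ⟨_, (hsols n).1, ⟨_, (hsols n).2⟩, fun u' hu' => ?_⟩,
    ⟨_, hsol.1, ⟨_, hsol.2⟩, fun u' hu' => ?_⟩, ?_⟩
  · exact IsMildSolution.ae_eq h hT hb (hWs n) (hSμs n) hp hu' (hsols n).1
  · exact IsMildSolution.ae_eq h hT hb hW hSμ hp hu' hsol.1
  -- By uniqueness, arbitrary solutions and arbitrary continuous versions agree almost surely with
  -- those constructed through `Ψ`.
  intro us u Us U hus hu hUs hU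
  have e1 : ∀ n, (fun ω => Ψ (Vs n ω)) =ᵐ[Ps n] Us n := fun n =>
    IsContinuousVersion.ae_eq (hsols n).2 (hUs n) fun t ht x =>
      IsMildSolution.ae_eq h hT hb (hWs n) (hSμs n) hp (hsols n).1 (hus n) t (hJ ht) x
  have e2 : (fun ω => Ψ (V ω)) =ᵐ[P] U := IsContinuousVersion.ae_eq hsol.2 hU fun t ht x =>
    IsMildSolution.ae_eq h hT hb hW hSμ hp hsol.1 hu t (hJ ht) x
  refine TendstoInDistribution.congr e1 e2 ?_
  let _ : MeasurableSpace (BoundedContinuousFunction (Fin (d + 1) → ℝ) ℝ) := borel _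
  have : BorelSpace (BoundedContinuousFunction (Fin (d + 1) → ℝ) ℝ) := ⟨rfl⟩
  refine TendstoInDistribution.continuous_comp hΨc ?_
  have hlim : ∀ K' r : ℝ, 0 ≤ r → r < 1 → Tendsto (fun k : ℕ => |K'| * r ^ k) atTop (𝓝 0) :=
    fun K' r h0 h1 => by simpa using (tendsto_pow_atTop_nhds_zero_of_lt_one h0 h1).const_mul |K'|
  refine tendstoInDistribution_of_approx hVsm hVm
    (fun k n => stronglyMeasurable_randomInterp_weightField hT
      (fun t ht x => (hZs n t ht x).measurable) (k + 1))
    (fun k => stronglyMeasurable_randomInterp_weightField hT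
      (fun t ht x => (hZ t ht x).measurable) (k + 1))
    (fun k => by positivity) (fun k => by positivity) (hlim K1 r1 hr10 hr11) (hlim K2 r2 hr20 hr21)
    (fun k n => (hVsa n k).trans (ENNReal.ofReal_le_ofReal (by gcongr; exact le_abs_self _)))
    (fun k => (hVa k).trans (ENNReal.ofReal_le_ofReal (by gcongr; exact le_abs_self _)))
    fun k => ?_
  -- At a fixed level the interpolation depends continuously on the values at the finitely many
  -- points of the box, whose joint laws converge.
  have hfd := tendstoInDistribution_stochConv h2 hWs hW hSμs hSμ h hT hZs hZ
    (ι := box (d + 1) (k + 1)) 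
    (t := fun m => gridTime pb.T (dyad (k + 1) (m : Fin (d + 1) → ℤ)))
    (fun m => gridTime_mem hT _) fun m => gridSpace (dyad (k + 1) (m : Fin (d + 1) → ℤ))
  have hc := TendstoInDistribution.continuous_comp (continuous_interpOfValues d (k + 1)) hfd
  refine TendstoInDistribution.congr (fun n => Eventually.of_forall fun ω => ?_)
    (Eventually.of_forall fun ω => ?_) hc
  · exact (randomInterp_weightField_eq _ _ _ _).symm
  · exact (randomInterp_weightField_eq _ _ _ _).symm

end AdditiveSPDE

end

/-! ### The heat kernel -/

noncomputable section

namespace AdditiveSPDE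


variable {d : ℕ}

lemma map_smul_withDensity {s : ℝ} (hs : 0 < s) {f : Rd d → ℝ≥0∞} (hf : Measurable f) :
    (volume.withDensity f).map (fun y => s • y)
      = ENNReal.ofReal (s ^ d)⁻¹ • volume.withDensity fun x => f (s⁻¹ • x) := by
  have hm : Measurable fun y : Rd d => s • y := measurable_const_smul s
  ext A hA
  rw [Measure.map_apply hm hA, withDensity_apply _ (hm hA), Measure.smul_apply, smul_eq_mul,
    withDensity_apply _ hA, ← lintegral_indicator (hm hA), ← lintegral_indicator hA]
  have hg : Measurable (A.indicator fun x => f (s⁻¹ • x)) :=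
    (hf.comp (measurable_const_smul _)).indicator hA
  have h1 := Measure.map_addHaar_smul (volume : Measure (Rd d)) hs.ne'
  have h2 := lintegral_map (μ := (volume : Measure (Rd d))) hg hm
  rw [h1, lintegral_smul_measure, finrank_euclideanSpace_fin, abs_of_pos (by positivity),
    smul_eq_mul] at h2
  rw [h2]
  congr 1
  ext x
  by_cases hx : s • x ∈ A
  · rw [indicator_of_mem (by exact hx), indicator_of_mem hx, inv_smul_smul₀ hs.ne']
  · rw [indicator_of_notMem (by exact hx), indicator_of_notMem hx]

/-- The density of the heat kernel at time `1`. -/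
def gaussDensity (d : ℕ) (x : Rd d) : ℝ :=
  1 / (2 * Real.pi * 1) ^ ((d : ℝ) / 2) * Real.exp (-‖x‖ ^ 2 / (2 * 1))

lemma gaussDensity_nonneg (x : Rd d) : 0 ≤ gaussDensity d x := by
  unfold gaussDensity; positivity

lemma continuous_gaussDensity : Continuous (gaussDensity d) := by
  unfold gaussDensity; fun_prop

lemma heatKernel_eq_map {r : ℝ} (hr : 0 < r) : heatKernel d r
    = ENNReal.ofReal 1 • (heatKernel d 1).map fun y => Real.sqrt r • y := by
  have hs : 0 < Real.sqrt r := Real.sqrt_pos.2 hr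
  have hm : Measurable fun x : Rd d => ENNReal.ofReal (gaussDensity d x) :=
    continuous_gaussDensity.measurable.ennreal_ofReal
  have hm2 : Measurable fun x : Rd d => ENNReal.ofReal (gaussDensity d ((Real.sqrt r)⁻¹ • x)) :=
    hm.comp (measurable_const_smul _)
  have e1 : heatKernel d 1 = volume.withDensity fun x => ENNReal.ofReal (gaussDensity d x) := rfl
  rw [e1, map_smul_withDensity hs hm, ENNReal.ofReal_one, one_smul,
    ← withDensity_smul _ hm2]
  unfold heatKernel
  congr 1
  ext x
  rw [Pi.smul_apply, smul_eq_mul, ← ENNReal.ofReal_mul (by positivity)]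
  congr 1
  have h1 : (2 * Real.pi * r) ^ ((d : ℝ) / 2)
      = (2 * Real.pi * 1) ^ ((d : ℝ) / 2) * Real.sqrt r ^ d := by
    rw [mul_one, Real.mul_rpow (by positivity) hr.le, Real.sqrt_eq_rpow, ← Real.rpow_natCast,
      ← Real.rpow_mul hr.le]
    ring_nf
  have h2 : ‖(Real.sqrt r)⁻¹ • x‖ ^ 2 = ‖x‖ ^ 2 / r := by
    rw [norm_smul, mul_pow, norm_inv, Real.norm_of_nonneg hs.le, inv_pow, Real.sq_sqrt hr.le]
    field_simp
  unfold gaussDensity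
  rw [h1, h2]
  have e : -‖x‖ ^ 2 / (2 * r) = -(‖x‖ ^ 2 / r) / (2 * 1) := by field_simp
  rw [e]
  field_simp

lemma integral_gaussDensity_mul_exp (ξ : Rd d) :
    ∫ x, (gaussDensity d x : ℂ) * Complex.exp (((inner ℝ x ξ : ℝ) : ℂ) * Complex.I)
      = Complex.exp (-(‖ξ‖ ^ 2 / 2 : ℝ)) := by
  have h := GaussianFourier.integral_cexp_neg_mul_sq_norm_add_of_euclideanSpace (ι := Fin d)
    (b := 1 / 2) (by norm_num) Complex.I ξ
  have e : ∀ x : Rd d, (gaussDensity d x : ℂ) * Complex.exp (((inner ℝ x ξ : ℝ) : ℂ) * Complex.I)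
      = (1 / (2 * Real.pi * 1) ^ ((d : ℝ) / 2) : ℝ) *
        Complex.exp (-(1 / 2) * ‖x‖ ^ 2 + Complex.I * (inner ℝ ξ x : ℝ)) := by
    intro x
    unfold gaussDensity
    rw [Complex.exp_add, real_inner_comm, mul_comm Complex.I]
    push_cast
    rw [mul_assoc]
    congr 3
    ring
  simp_rw [e]
  rw [integral_const_mul, h, Fintype.card_fin]
  have h2 : ((1 / (2 * Real.pi * 1) ^ ((d : ℝ) / 2) : ℝ) : ℂ) * (Real.pi / (1 / 2)) ^ (d / 2 : ℂ) = 1 := by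
    have : ((Real.pi : ℂ) / (1 / 2)) ^ (d / 2 : ℂ) = (((2 * Real.pi * 1) ^ ((d : ℝ) / 2) : ℝ) : ℂ) := by
      rw [Complex.ofReal_cpow (by positivity)]
      push_cast
      congr 1
      ring
    rw [this, ← Complex.ofReal_mul, one_div, inv_mul_cancel₀ (by positivity), Complex.ofReal_one]
  rw [← mul_assoc, h2, one_mul, Complex.I_sq]
  push_cast
  congr 1
  ring

lemma integrable_gaussDensity : Integrable (gaussDensity d) := by
  have h := GaussianFourier.integrable_cexp_neg_mul_sq_norm_add_of_euclideanSpace (ι := Fin d)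
    (b := 1 / 2) (by norm_num) 0 0
  refine (h.norm.const_mul (1 / (2 * Real.pi * 1) ^ ((d : ℝ) / 2))).congr
    (Eventually.of_forall fun x => ?_)
  unfold gaussDensity
  simp only [Complex.norm_exp]
  congr 2
  simp [← Complex.ofReal_pow]
  ring

lemma integral_gaussDensity : ∫ x, gaussDensity d x = 1 := by
  have h := integral_gaussDensity_mul_exp (0 : Rd d)
  simp only [inner_zero_right, Complex.ofReal_zero, zero_mul, Complex.exp_zero, mul_one, norm_zero]
    at h
  rw [integral_complex_ofReal] at h
  simpa using h

instance isProbabilityMeasure_heatKernel_one : IsProbabilityMeasure (heatKernel d 1) := by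
  constructor
  have e1 : heatKernel d 1 = volume.withDensity fun x => ENNReal.ofReal (gaussDensity d x) := rfl
  rw [e1, withDensity_apply _ MeasurableSet.univ, Measure.restrict_univ,
    ← ofReal_integral_eq_lintegral_ofReal integrable_gaussDensity
      (Eventually.of_forall gaussDensity_nonneg), integral_gaussDensity, ENNReal.ofReal_one]

lemma integral_heatKernel_one {E : Type*} [NormedAddCommGroup E] [NormedSpace ℝ E] (f : Rd d → E) :
    ∫ x, f x ∂(heatKernel d 1) = ∫ x, gaussDensity d x • f x := by
  have e1 : heatKernel d 1 = volume.withDensity fun x => ENNReal.ofReal (gaussDensity d x) := rfl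
  rw [e1, integral_withDensity_eq_integral_toReal_smul
    continuous_gaussDensity.measurable.ennreal_ofReal (Eventually.of_forall fun _ => by simp)]
  simp_rw [ENNReal.toReal_ofReal (gaussDensity_nonneg _)]

lemma charFun_heatKernel_one (ξ : Rd d) :
    charFun (heatKernel d 1) ξ = Complex.exp (-(‖ξ‖ ^ 2 / 2 : ℝ)) := by
  rw [charFun_apply, integral_heatKernel_one, ← integral_gaussDensity_mul_exp]
  simp_rw [Complex.real_smul]

/-- The bound `|x| ≤ e^{|x|²/4}` absorbs the norm into half of the Gaussian exponent. -/
lemma integrable_norm_heatKernel_one : Integrable (fun y => ‖y‖) (heatKernel d 1) := by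
  have e1 : heatKernel d 1 = volume.withDensity fun x => ENNReal.ofReal (gaussDensity d x) := rfl
  rw [e1, integrable_withDensity_iff_integrable_smul'
    continuous_gaussDensity.measurable.ennreal_ofReal (Eventually.of_forall fun _ => by simp)]
  simp_rw [ENNReal.toReal_ofReal (gaussDensity_nonneg _)]
  have h := GaussianFourier.integrable_cexp_neg_mul_sq_norm_add_of_euclideanSpace (ι := Fin d)
    (b := 1 / 4) (by norm_num) 0 0
  refine (h.norm.const_mul (1 / (2 * Real.pi * 1) ^ ((d : ℝ) / 2))).mono'
    (continuous_gaussDensity.smul continuous_norm).aestronglyMeasurable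
    (Eventually.of_forall fun x => ?_)
  have hx : ‖x‖ ≤ Real.exp (‖x‖ ^ 2 / 4) := by
    nlinarith [Real.add_one_le_exp (‖x‖ ^ 2 / 4), sq_nonneg (‖x‖ - 2)]
  rw [smul_eq_mul, Real.norm_of_nonneg (mul_nonneg (gaussDensity_nonneg x) (norm_nonneg x)), Complex.norm_exp]
  have e : (-(1 / 4 : ℂ) * ‖x‖ ^ 2 + 0 * (inner ℝ (0 : Rd d) x : ℝ)).re = -‖x‖ ^ 2 / 4 := by
    simp [← Complex.ofReal_pow]
    ring
  rw [e]
  unfold gaussDensity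
  calc _ ≤ 1 / (2 * Real.pi * 1) ^ ((d : ℝ) / 2) * Real.exp (-‖x‖ ^ 2 / (2 * 1)) *
        Real.exp (‖x‖ ^ 2 / 4) := by gcongr
    _ = _ := by rw [mul_assoc, ← Real.exp_add]; congr 2; ring

/-- The bound `y ≤ 1/m` is written as `y m ≤ 1`, so that the frequency zero needs no separate
treatment. -/
lemma lintegral_exp_neg_mul_le {m T : ℝ} (hm : 0 ≤ m) (hT : 0 ≤ T) :
    ∃ y : ℝ, 0 ≤ y ∧ y ≤ T ∧ y * m ≤ 1 ∧
      ∫⁻ r in Ioc 0 T, ENNReal.ofReal (Real.exp (-(m * r))) = ENNReal.ofReal y := by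
  have hint : IntervalIntegrable (fun r => Real.exp (-(m * r))) volume 0 T :=
    (by fun_prop : Continuous fun r => Real.exp (-(m * r))).intervalIntegrable _ _
  refine ⟨∫ r in (0 : ℝ)..T, Real.exp (-(m * r)),
    intervalIntegral.integral_nonneg hT fun r _ => (Real.exp_pos _).le, ?_, ?_, ?_⟩
  · calc _ ≤ ∫ r in (0 : ℝ)..T, (1 : ℝ) := by
          refine intervalIntegral.integral_mono_on hT hint (by simp) fun r hr => ?_
          exact Real.exp_le_one_iff.2 (by nlinarith [hr.1])
      _ = T := by simp
  · have h := intervalIntegral.integral_eq_sub_of_hasDerivAt (a := 0) (b := T)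
      (f := fun r => -Real.exp (-(m * r))) (f' := fun r => Real.exp (-(m * r)) * m)
      (fun r _ => by
        have h1 : HasDerivAt (fun r => -(m * r)) (-m) r := by
          simpa using ((hasDerivAt_id r).const_mul m).fun_neg
        simpa using h1.exp.fun_neg) (hint.mul_const m)
    rw [intervalIntegral.integral_mul_const] at h
    rw [h]
    have := Real.exp_pos (-(m * T))
    simp
    linarith
  · rw [intervalIntegral.integral_of_le hT, ← ofReal_integral_eq_lintegral_ofReal
      ((intervalIntegrable_iff_integrableOn_Ioc_of_le hT).1 hint)
      (Eventually.of_forall fun r => (Real.exp_pos _).le)]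

/-- The heat kernel is obtained by scaling. -/
theorem isScaledKernel_heat :
    IsScaledKernel (fundamentalSolution .heat d) (heatKernel d 1) (fun _ => 1) Real.sqrt where
  prob := inferInstance
  moment := integrable_norm_heatKernel_one
  amp_cont := continuous_const
  dil_cont := Real.continuous_sqrt
  amp_nonneg _ := zero_le_one
  dil_nonneg := Real.sqrt_nonneg
  eq_map r hr := heatKernel_eq_map hr
  decay T := by
    refine ⟨2 * (1 + |T|), by positivity, fun ξ δ hδ hδT => ?_⟩
    have hT : 0 ≤ T := hδ.trans hδT
    rw [abs_of_nonneg hT]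
    set m := ‖ξ‖ ^ 2 with hm
    have hm0 : 0 ≤ m := by positivity
    have hk : ∀ r, 0 ≤ r → kHat (heatKernel d 1) (fun _ => 1) Real.sqrt r ξ
        = (Real.exp (-(m / 2 * r)) : ℝ) := by
      intro r hr
      unfold kHat
      rw [charFun_heatKernel_one, norm_smul, mul_pow, Real.norm_of_nonneg (Real.sqrt_nonneg r),
        Real.sq_sqrt hr]
      push_cast
      rw [one_mul]
      congr 1
      rw [hm]; push_cast; ring
    -- Adding `y ≤ T` and `y m ≤ 1` gives `y (1 + m) ≤ 1 + T`.
    have hmin : ∀ y, 0 ≤ y → y ≤ T → y * m ≤ 1 → y ≤ (1 + T) * (1 / (1 + m)) := by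
      intro y hy h1 h2
      rw [mul_one_div, le_div_iff₀ (by positivity)]
      linarith
    constructor
    · obtain ⟨y, hy0, hy1, hy2, hy⟩ := lintegral_exp_neg_mul_le hm0 hδ
      calc _ = ∫⁻ r in Ioc 0 δ, ENNReal.ofReal (Real.exp (-(m * r))) := by
            refine setLIntegral_congr_fun measurableSet_Ioc fun r hr => ?_
            rw [hk r hr.1.le, ← ofReal_norm, ← ENNReal.ofReal_pow (norm_nonneg _), Complex.norm_real,
              Real.norm_of_nonneg (Real.exp_pos _).le, ← Real.exp_nat_mul]
            congr 2; push_cast; ring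
        _ = ENNReal.ofReal y := hy
        _ ≤ _ := by
            refine ENNReal.ofReal_le_ofReal ?_
            rw [mul_min_of_nonneg _ _ (by positivity)]
            have h3 := hmin y hy0 (hy1.trans hδT) hy2
            refine le_min (h3.trans ?_) (by nlinarith)
            gcongr; linarith
    · obtain ⟨y, hy0, hy1, hy2, hy⟩ := lintegral_exp_neg_mul_le hm0 hT
      -- A time shift multiplies the transform by `E`. The increment therefore has the factor `(1 -
      -- E)² ≤ 1 - E ≤ m δ / 2`, and the frequency `m` is absorbed by `y m ≤ 1`.
      set E := Real.exp (-(m / 2 * δ)) with hE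
      have hE0 : 0 < E := Real.exp_pos _
      have hE1 : E ≤ 1 := Real.exp_le_one_iff.2 (by nlinarith)
      have hE2 : 1 - E ≤ m / 2 * δ := by
        have := Real.add_one_le_exp (-(m / 2 * δ)); linarith
      calc _ = ∫⁻ r in Ioc 0 T, ENNReal.ofReal ((1 - E) ^ 2) * ENNReal.ofReal (Real.exp (-(m * r))) := by
            refine setLIntegral_congr_fun measurableSet_Ioc fun r hr => ?_
            rw [hk r hr.1.le, hk (r + δ) (by linarith [hr.1]), ← Complex.ofReal_sub, ← ofReal_norm,
              ← ENNReal.ofReal_pow (norm_nonneg _), Complex.norm_real, Real.norm_eq_abs, sq_abs,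
              ← ENNReal.ofReal_mul (sq_nonneg _)]
            congr 1
            have e1 : Real.exp (-(m / 2 * (r + δ))) = Real.exp (-(m / 2 * r)) * E := by
              rw [hE, ← Real.exp_add]; congr 1; ring
            have e2 : Real.exp (-(m * r)) = Real.exp (-(m / 2 * r)) ^ 2 := by
              rw [← Real.exp_nat_mul]; congr 1; push_cast; ring
            rw [e1, e2]; ring
        _ = ENNReal.ofReal ((1 - E) ^ 2 * y) := by
            rw [lintegral_const_mul' _ _ (by simp), hy, ENNReal.ofReal_mul (sq_nonneg _)]
        _ ≤ _ := by
            refine ENNReal.ofReal_le_ofReal ?_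
            rw [mul_min_of_nonneg _ _ (by positivity)]
            have h3 := hmin y hy0 hy1 hy2
            have h4 : (1 - E) ^ 2 ≤ 1 - E := by nlinarith
            have h5 : (1 - E) ^ 2 ≤ 1 := by nlinarith
            have h6 : (1 - E) ^ 2 * y ≤ y := by nlinarith
            refine le_min (h6.trans (h3.trans ?_)) ?_
            · gcongr; linarith
            · have h7 : (1 - E) ^ 2 * y ≤ m / 2 * δ * y :=
                mul_le_mul_of_nonneg_right (h4.trans hE2) hy0
              have h8 : m / 2 * δ * y ≤ δ := by nlinarith
              nlinarith

end AdditiveSPDE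

end

/-! ### Projections of radial measures; wave kernels in dimensions one and two -/

noncomputable section

namespace AdditiveSPDE


variable {n : ℕ}

/-- The point of `ℝ^{n+1}` with given first coordinate. -/
def consPoint (s : ℝ) (y : Rd n) : Rd (n + 1) := WithLp.toLp 2 (Fin.cons s y : Fin (n + 1) → ℝ)

lemma norm_consPoint_sq (s : ℝ) (y : Rd n) : ‖consPoint s y‖ ^ 2 = s ^ 2 + ‖y‖ ^ 2 := by
  rw [EuclideanSpace.norm_sq_eq, EuclideanSpace.norm_sq_eq, Fin.sum_univ_succ]
  simp [consPoint]

/-- Integration over `ℝ^{n+1}` by slices. -/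
lemma lintegral_eq_consPoint {f : Rd (n + 1) → ℝ≥0∞} (hf : Measurable f) :
    ∫⁻ x, f x = ∫⁻ s : ℝ, ∫⁻ y : Rd n, f (consPoint s y) := by
  have h1 := (PiLp.volume_preserving_toLp (Fin (n + 1))).lintegral_comp hf
  have h2 := ((volume_preserving_piFinSuccAbove (fun _ : Fin (n + 1) => ℝ) 0).symm _).lintegral_comp
    (hf.comp (WithLp.measurable_toLp 2 (Fin (n + 1) → ℝ)))
  rw [← h1]
  simp only [Function.comp_def] at h2
  rw [← h2, Measure.volume_eq_prod, lintegral_prod]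
  · refine lintegral_congr fun s => ?_
    rw [← (PiLp.volume_preserving_toLp (Fin n)).lintegral_comp_emb
      (MeasurableEquiv.toLp 2 (Fin n → ℝ)).measurableEmbedding]
    refine lintegral_congr fun y => ?_
    congr 2
    ext i
    simp [MeasurableEquiv.piFinSuccAbove, Fin.insertNthEquiv]
  · exact ((hf.comp (WithLp.measurable_toLp 2 (Fin (n + 1) → ℝ))).comp
      (MeasurableEquiv.measurable _)).aemeasurable

/-- The projection of a radial measure on a line. -/
lemma map_inner_withDensity_radial {ρ : ℝ → ℝ≥0∞} (hρ : Measurable ρ) (ξ : Rd (n + 1)) :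
    (volume.withDensity fun x : Rd (n + 1) => ρ (‖x‖ ^ 2)).map (fun x => inner ℝ x ξ)
      = (volume.withDensity fun s => ∫⁻ y : Rd n, ρ (s ^ 2 + ‖y‖ ^ 2)).map fun s => s * ‖ξ‖ := by
  have hρ' : Measurable fun x : Rd (n + 1) => ρ (‖x‖ ^ 2) := hρ.comp (by fun_prop)
  have hρ2 : Measurable fun s : ℝ => ∫⁻ y : Rd n, ρ (s ^ 2 + ‖y‖ ^ 2) :=
    Measurable.lintegral_prod_right' (f := fun q : ℝ × Rd n => ρ (q.1 ^ 2 + ‖q.2‖ ^ 2))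
      (hρ.comp (by fun_prop))
  refine Measure.ext_of_lintegral _ fun g hg => ?_
  set e : Rd (n + 1) := consPoint ‖ξ‖ 0 with he
  have hne : ‖e‖ = ‖ξ‖ := by
    have := norm_consPoint_sq ‖ξ‖ (0 : Rd n)
    rw [norm_zero, zero_pow two_ne_zero, add_zero] at this
    exact (pow_left_inj₀ (norm_nonneg _) (norm_nonneg _) two_ne_zero).1 this
  -- The reflection exchanging `e` and `ξ` preserves the radial measure, so the projection along `ξ`
  -- becomes the one along the first axis, where the integral is cut into slices.
  set L := ((ℝ ∙ (e - ξ))ᗮ).reflection with hL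
  have hLe : L e = ξ := Submodule.reflection_sub hne
  have hinner : ∀ x, inner ℝ (L x) ξ = inner ℝ x e := fun x => by
    rw [← hLe, LinearIsometryEquiv.inner_map_map]
  have hg1 : Measurable fun x : Rd (n + 1) => g (inner ℝ x ξ) := hg.comp (by fun_prop)
  have hg2 : Measurable fun s : ℝ => g (s * ‖ξ‖) := hg.comp (by fun_prop)
  rw [lintegral_map hg (by fun_prop), lintegral_map hg (by fun_prop),
    lintegral_withDensity_eq_lintegral_mul _ hρ' hg1, lintegral_withDensity_eq_lintegral_mul _ hρ2 hg2]
  have hF : Measurable fun x : Rd (n + 1) => ρ (‖x‖ ^ 2) * g (inner ℝ x ξ) :=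
    hρ'.mul (hg.comp (by fun_prop))
  have hF2 : Measurable fun x : Rd (n + 1) => ρ (‖x‖ ^ 2) * g (inner ℝ x e) :=
    hρ'.mul (hg.comp (by fun_prop))
  calc ∫⁻ x, ρ (‖x‖ ^ 2) * g (inner ℝ x ξ) = ∫⁻ x, ρ (‖L x‖ ^ 2) * g (inner ℝ (L x) ξ) :=
        (L.measurePreserving.lintegral_comp hF).symm
    _ = ∫⁻ x, ρ (‖x‖ ^ 2) * g (inner ℝ x e) := by simp_rw [L.norm_map, hinner]
    _ = ∫⁻ s : ℝ, ∫⁻ y : Rd n, ρ (s ^ 2 + ‖y‖ ^ 2) * g (s * ‖ξ‖) := by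
        rw [lintegral_eq_consPoint hF2]
        refine lintegral_congr fun s => lintegral_congr fun y => ?_
        rw [norm_consPoint_sq]
        congr 2
        rw [he, PiLp.inner_apply, Fin.sum_univ_succ]
        simp [consPoint, mul_comm]
    _ = _ := by
        refine lintegral_congr fun s => ?_
        have hm : Measurable fun y : Rd n => ρ (s ^ 2 + ‖y‖ ^ 2) := hρ.comp (by fun_prop)
        rw [lintegral_mul_const _ hm]
        rfl

/-- The uniform law on `(-1, 1)`. -/
def uniformLaw : Measure ℝ :=
  volume.withDensity ((Ioo (-1) 1).indicator fun _ => ENNReal.ofReal (1 / 2))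

lemma uniformLaw_eq : uniformLaw = ENNReal.ofReal (1 / 2) • volume.restrict (Ioo (-1) 1) := by
  unfold uniformLaw
  rw [withDensity_indicator measurableSet_Ioo, withDensity_const]

instance : IsProbabilityMeasure uniformLaw := by
  constructor
  rw [uniformLaw_eq, Measure.smul_apply, Measure.restrict_apply_univ, Real.volume_Ioo, smul_eq_mul,
    ← ENNReal.ofReal_mul (by norm_num)]
  norm_num

lemma integral_uniformLaw {E : Type*} [NormedAddCommGroup E] [NormedSpace ℝ E] (f : ℝ → E) :
    ∫ s, f s ∂uniformLaw = (1 / 2 : ℝ) • ∫ s in (-1 : ℝ)..1, f s := by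
  rw [uniformLaw_eq, integral_smul_measure, intervalIntegral.integral_of_le (by norm_num),
    integral_Ioc_eq_integral_Ioo, ENNReal.toReal_ofReal (by norm_num)]

lemma charFun_of_map_inner {ν : Measure (Rd n)} {ξ : Rd n}
    (h : ν.map (fun x => inner ℝ x ξ) = uniformLaw.map fun s => s * ‖ξ‖) :
    charFun ν ξ = (1 / 2 : ℝ) * ∫ s in (-1 : ℝ)..1, Complex.exp ((s * ‖ξ‖ : ℝ) * Complex.I) := by
  rw [← Complex.real_smul, ← integral_uniformLaw, charFun_apply]
  have h1 := integral_map (μ := ν) (φ := fun x => inner ℝ x ξ) (by fun_prop)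
    (f := fun s : ℝ => Complex.exp ((s : ℂ) * Complex.I)) (by fun_prop)
  have h2 := integral_map (μ := uniformLaw) (φ := fun s => s * ‖ξ‖) (by fun_prop)
    (f := fun s : ℝ => Complex.exp ((s : ℂ) * Complex.I)) (by fun_prop)
  rw [← h1, ← h2, h]

/-- Pushing forward preserves total mass, and the direction zero suffices to compare it with that of
a probability measure. -/
lemma isProbabilityMeasure_of_map_inner {ν : Measure (Rd n)}
    (h : ν.map (fun x => inner ℝ x (0 : Rd n)) = uniformLaw.map fun s => s * ‖(0 : Rd n)‖) :
    IsProbabilityMeasure ν := by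
  constructor
  have h1 := congrArg (fun m => m univ) h
  simp only [Measure.map_apply (f := fun x : Rd n => inner ℝ x 0) (by fun_prop) MeasurableSet.univ,
    Measure.map_apply (f := fun s : ℝ => s * ‖(0 : Rd n)‖) (by fun_prop) MeasurableSet.univ,
    preimage_univ, measure_univ] at h1
  exact h1

/-- The reference measure of the wave kernel: a measure on the unit ball whose projections on the
lines are uniform, and which determines the kernel by scaling. -/
structure IsWaveProfile (G : ℝ → Measure (Rd n)) (ν : Measure (Rd n)) : Prop where
  eq_map : ∀ r, 0 < r → G r = ENNReal.ofReal r • ν.map (fun y => r • y)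
  prob : IsProbabilityMeasure ν
  charFun_eq : ∀ ξ, charFun ν ξ
    = (1 / 2 : ℝ) * ∫ s in (-1 : ℝ)..1, Complex.exp ((s * ‖ξ‖ : ℝ) * Complex.I)
  support : ∀ᵐ y ∂ν, ‖y‖ ≤ 1

/-- The density of the wave kernel at time `1` as a function of the square of the norm. -/
def waveProfile₁ (u : ℝ) : ℝ≥0∞ := (Iio 1).indicator (fun _ => ENNReal.ofReal (1 / 2)) u

def waveProfile₂ (u : ℝ) : ℝ≥0∞ :=
  (Iio 1).indicator (fun u => ENNReal.ofReal (1 / (2 * Real.pi) * (1 / Real.sqrt (1 - u)))) u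

lemma measurable_waveProfile₁ : Measurable waveProfile₁ :=
  measurable_const.indicator measurableSet_Iio

lemma measurable_waveProfile₂ : Measurable waveProfile₂ :=
  Measurable.indicator (by fun_prop) measurableSet_Iio

lemma mem_ball_iff_norm_sq {r : ℝ} (hr : 0 < r) (x : Rd n) :
    x ∈ Metric.ball (0 : Rd n) r ↔ ‖r⁻¹ • x‖ ^ 2 ∈ Iio (1 : ℝ) := by
  rw [mem_ball_zero_iff, norm_smul, mem_Iio, norm_inv, Real.norm_of_nonneg hr.le,
    sq_lt_one_iff₀ (by positivity), ← div_eq_inv_mul, div_lt_one hr]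

lemma waveKernel_one_eq {r : ℝ} (hr : 0 < r) : waveKernel 1 r
    = volume.withDensity fun x => waveProfile₁ (‖r⁻¹ • x‖ ^ 2) := by
  unfold waveProfile₁
  refine congrArg volume.withDensity (funext fun x => ?_)
  by_cases hx : x ∈ Metric.ball (0 : Rd 1) r
  · rw [indicator_of_mem hx, indicator_of_mem ((mem_ball_iff_norm_sq hr x).1 hx)]
  · rw [indicator_of_notMem hx, indicator_of_notMem fun h => hx ((mem_ball_iff_norm_sq hr x).2 h)]

lemma waveKernel_two_eq {r : ℝ} (hr : 0 < r) : waveKernel 2 r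
    = volume.withDensity fun x => ENNReal.ofReal r⁻¹ * waveProfile₂ (‖r⁻¹ • x‖ ^ 2) := by
  unfold waveProfile₂
  refine congrArg volume.withDensity (funext fun x => ?_)
  by_cases hx : x ∈ Metric.ball (0 : Rd 2) r
  · rw [indicator_of_mem hx, indicator_of_mem ((mem_ball_iff_norm_sq hr x).1 hx),
      ← ENNReal.ofReal_mul (by positivity)]
    congr 1
    have e : r ^ 2 - ‖x‖ ^ 2 = r ^ 2 * (1 - ‖r⁻¹ • x‖ ^ 2) := by
      rw [norm_smul, mul_pow, norm_inv, Real.norm_of_nonneg hr.le]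
      field_simp
    rw [e, Real.sqrt_mul (by positivity), Real.sqrt_sq hr.le]
    field_simp
  · rw [indicator_of_notMem hx, indicator_of_notMem fun h => hx ((mem_ball_iff_norm_sq hr x).2 h),
      mul_zero]

lemma waveKernel_one_one : waveKernel 1 1 = volume.withDensity fun x => waveProfile₁ (‖x‖ ^ 2) := by
  rw [waveKernel_one_eq one_pos]; simp

lemma waveKernel_two_one : waveKernel 2 1 = volume.withDensity fun x => waveProfile₂ (‖x‖ ^ 2) := by
  rw [waveKernel_two_eq one_pos]; simp

lemma ae_norm_le_one_of_profile {ρ : ℝ → ℝ≥0∞} (hρ : Measurable ρ) (h : ∀ u, 1 < u → ρ u = 0) :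
    ∀ᵐ x ∂(volume.withDensity fun x : Rd n => ρ (‖x‖ ^ 2)), ‖x‖ ≤ 1 := by
  have hm : Measurable fun x : Rd n => ρ (‖x‖ ^ 2) := hρ.comp (by fun_prop)
  rw [ae_withDensity_iff hm]
  refine Eventually.of_forall fun x hx => ?_
  by_contra! hx1
  exact hx (h _ (by nlinarith))

lemma lintegral_Rd_zero (f : Rd 0 → ℝ≥0∞) : ∫⁻ y, f y = f 0 := by
  rw [volume_euclideanSpace_eq_dirac, lintegral_dirac]

lemma lintegral_Rd_one {f : ℝ → ℝ≥0∞} (hf : Measurable f) : ∫⁻ y : Rd 1, f (‖y‖ ^ 2) = ∫⁻ s, f (s ^ 2) := by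
  have hm : Measurable fun y : Rd 1 => f (‖y‖ ^ 2) := hf.comp (by fun_prop)
  rw [lintegral_eq_consPoint hm]
  refine lintegral_congr fun s => ?_
  rw [lintegral_Rd_zero, norm_consPoint_sq]
  simp

lemma map_inner_waveKernel_one (ξ : Rd 1) : (waveKernel 1 1).map (fun x => inner ℝ x ξ)
    = uniformLaw.map fun s => s * ‖ξ‖ := by
  rw [waveKernel_one_one, map_inner_withDensity_radial measurable_waveProfile₁]
  congr 2
  ext s
  rw [lintegral_Rd_zero, norm_zero]
  unfold waveProfile₁ indicator
  simp [abs_lt]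

lemma isWaveProfile_one : IsWaveProfile (waveKernel 1) (waveKernel 1 1) := by
  refine ⟨fun r hr => ?_, isProbabilityMeasure_of_map_inner (map_inner_waveKernel_one 0),
    fun ξ => charFun_of_map_inner (map_inner_waveKernel_one ξ), ?_⟩
  · have hm : Measurable fun x : Rd 1 => waveProfile₁ (‖x‖ ^ 2) :=
      measurable_waveProfile₁.comp (by fun_prop)
    rw [waveKernel_one_one, map_smul_withDensity hr hm,
      waveKernel_one_eq hr, smul_smul, ← ENNReal.ofReal_mul hr.le, pow_one, mul_inv_cancel₀ hr.ne',
      ENNReal.ofReal_one, one_smul]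
  · rw [waveKernel_one_one]
    exact ae_norm_le_one_of_profile measurable_waveProfile₁ fun u hu =>
      indicator_of_notMem (by simpa using hu.le) _

/-- The primitive is `arcsin(y/R)/(2π)`. The value does not depend on `R`: every slice of the planar
wave kernel has mass 1/2, which is why its projections are uniform. -/
lemma lintegral_arcsine {R : ℝ} (hR : 0 < R) :
    ∫⁻ y in Ioo (-R) R, ENNReal.ofReal (1 / (2 * Real.pi) * (1 / Real.sqrt (R ^ 2 - y ^ 2)))
      = ENNReal.ofReal (1 / 2) := by
  have hcont : ContinuousOn (fun y => 1 / (2 * Real.pi) * Real.arcsin (y / R)) (Icc (-R) R) := by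
    fun_prop
  have hder : ∀ y ∈ Ioo (-R) R, HasDerivAt (fun y => 1 / (2 * Real.pi) * Real.arcsin (y / R))
      (1 / (2 * Real.pi) * (1 / Real.sqrt (R ^ 2 - y ^ 2))) y := by
    intro y hy
    have h1 : y / R ≠ -1 := by
      rw [Ne, div_eq_iff hR.ne']; linarith [hy.1]
    have h2 : y / R ≠ 1 := by
      rw [Ne, div_eq_iff hR.ne']; linarith [hy.2]
    have h3 := ((Real.hasDerivAt_arcsin h1 h2).comp y
      ((hasDerivAt_id y).div_const R)).const_mul (1 / (2 * Real.pi))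
    refine h3.congr_deriv ?_
    have e : R ^ 2 - y ^ 2 = R ^ 2 * (1 - (y / R) ^ 2) := by field_simp
    rw [e, Real.sqrt_mul (by positivity), Real.sqrt_sq hR.le]
    field_simp
  have hint := intervalIntegral.integrableOn_deriv_of_nonneg hcont hder fun y _ => by positivity
  have hle : -R ≤ R := by linarith
  have h := intervalIntegral.integral_eq_sub_of_hasDerivAt_of_le hle hcont hder
    ((intervalIntegrable_iff_integrableOn_Ioc_of_le hle).2 hint)
  rw [intervalIntegral.integral_of_le hle] at h
  rw [restrict_Ioo_eq_restrict_Ioc, ← ofReal_integral_eq_lintegral_ofReal hint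
    (Eventually.of_forall fun y => by positivity), h, neg_div, div_self hR.ne', Real.arcsin_one,
    Real.arcsin_neg_one]
  congr 1
  field_simp
  norm_num

lemma isWaveProfile_two : IsWaveProfile (waveKernel 2) (waveKernel 2 1) := by
  have hmap : ∀ ξ : Rd 2, (waveKernel 2 1).map (fun x => inner ℝ x ξ)
      = uniformLaw.map fun s => s * ‖ξ‖ := by
    intro ξ
    rw [waveKernel_two_one, map_inner_withDensity_radial measurable_waveProfile₂]
    congr 2
    ext s
    rw [lintegral_Rd_one (f := fun u => waveProfile₂ (s ^ 2 + u))
      (measurable_waveProfile₂.comp (by fun_prop))]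
    by_cases hs : s ∈ Ioo (-1 : ℝ) 1
    · have hs2 : 0 < 1 - s ^ 2 := by nlinarith [hs.1, hs.2]
      set R := Real.sqrt (1 - s ^ 2) with hR
      have hR0 : 0 < R := Real.sqrt_pos.2 hs2
      have hR2 : R ^ 2 = 1 - s ^ 2 := Real.sq_sqrt hs2.le
      rw [indicator_of_mem hs, ← lintegral_arcsine hR0, ← lintegral_indicator measurableSet_Ioo]
      refine lintegral_congr fun y => ?_
      have hiff : s ^ 2 + y ^ 2 ∈ Iio (1 : ℝ) ↔ y ∈ Ioo (-R) R := by
        rw [mem_Iio, mem_Ioo, ← abs_lt, show |y| < R ↔ y ^ 2 < R ^ 2 by rw [sq_lt_sq, abs_of_pos hR0], hR2]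
        constructor <;> intro h <;> linarith
      unfold waveProfile₂
      by_cases hy : y ∈ Ioo (-R) R
      · rw [indicator_of_mem hy, indicator_of_mem (hiff.2 hy), hR2, sub_sub]
      · rw [indicator_of_notMem hy, indicator_of_notMem (hiff.not.2 hy)]
    · rw [indicator_of_notMem hs, ← lintegral_zero (α := ℝ) (μ := volume)]
      refine lintegral_congr fun y => indicator_of_notMem ?_ _
      rw [mem_Iio, not_lt]
      rw [mem_Ioo, ← abs_lt, not_lt] at hs
      have := sq_abs s
      nlinarith [sq_nonneg y]
  refine ⟨fun r hr => ?_, isProbabilityMeasure_of_map_inner (hmap 0),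
    fun ξ => charFun_of_map_inner (hmap ξ), ?_⟩
  · have hm0 : Measurable fun x : Rd 2 => waveProfile₂ (‖x‖ ^ 2) :=
      measurable_waveProfile₂.comp (by fun_prop)
    have hm : Measurable fun x : Rd 2 => waveProfile₂ (‖r⁻¹ • x‖ ^ 2) :=
      measurable_waveProfile₂.comp (by fun_prop)
    rw [waveKernel_two_one, map_smul_withDensity hr hm0,
      waveKernel_two_eq hr, smul_smul, ← ENNReal.ofReal_mul hr.le, ← withDensity_smul _ hm]
    congr 1
    ext x
    rw [Pi.smul_apply, smul_eq_mul]
    congr 2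
    field_simp
  · rw [waveKernel_two_one]
    exact ae_norm_le_one_of_profile measurable_waveProfile₂ fun u hu =>
      indicator_of_notMem (by simpa using hu.le) _

end AdditiveSPDE

end

/-! ### Decay and regularity of the Fourier transform of the wave kernel -/

noncomputable section

namespace AdditiveSPDE


variable {n : ℕ}

lemma hasDerivAt_integral_symm {E : Type*} [NormedAddCommGroup E] [NormedSpace ℝ E] [CompleteSpace E]
    {f : ℝ → E} (hf : Continuous f) (R : ℝ) :
    HasDerivAt (fun r => ∫ s in (-r)..r, f s) (f R + f (-R)) R := by
  have hi : ∀ a b, IntervalIntegrable f volume a b := fun a b => hf.intervalIntegrable a b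
  have e : (fun r => ∫ s in (-r)..r, f s)
      = fun r => (∫ s in (0 : ℝ)..r, f s) - ∫ s in (0 : ℝ)..(-r), f s := by
    ext r
    rw [intervalIntegral.integral_interval_sub_left (hi _ _) (hi _ _)]
  have h1 := intervalIntegral.integral_hasDerivAt_right (hi 0 R)
    hf.stronglyMeasurable.stronglyMeasurableAtFilter hf.continuousAt
  have h2 := (intervalIntegral.integral_hasDerivAt_right (hi 0 (-R))
    hf.stronglyMeasurable.stronglyMeasurableAtFilter hf.continuousAt).scomp R (hasDerivAt_neg R)
  rw [e]
  exact (h1.fun_sub h2).congr_deriv (by simp)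

/-- For `m ≠ 0` the integral is `2 sin(rm)/m`; the bounds are written without division so that `m =
0` is included. -/
lemma norm_integral_cexp_le {r : ℝ} (hr : 0 ≤ r) (m : ℝ) :
    ‖∫ s in (-r)..r, Complex.exp ((s * m : ℝ) * Complex.I)‖ ≤ 2 * r ∧
    ‖∫ s in (-r)..r, Complex.exp ((s * m : ℝ) * Complex.I)‖ * |m| ≤ 2 := by
  constructor
  · refine (intervalIntegral.norm_integral_le_of_norm_le_const (C := 1) fun s _ => ?_).trans ?_
    · rw [Complex.norm_exp_ofReal_mul_I]
    · rw [one_mul, sub_neg_eq_add, abs_of_nonneg (by linarith)]; linarith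
  · have h := intervalIntegral.integral_eq_sub_of_hasDerivAt (a := -r) (b := r)
      (f := fun s : ℝ => Complex.exp ((s * m : ℝ) * Complex.I))
      (f' := fun s => Complex.exp ((s * m : ℝ) * Complex.I) * (m * Complex.I)) (fun s _ => by
        have h1 : HasDerivAt (fun s : ℝ => ((s * m : ℝ) : ℂ)) (m : ℂ) s := by
          simpa using ((hasDerivAt_id s).mul_const m).ofReal_comp
        exact (h1.mul_const Complex.I).cexp)
      ((by fun_prop : Continuous fun s : ℝ =>
        Complex.exp ((s * m : ℝ) * Complex.I) * (m * Complex.I)).intervalIntegrable _ _)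
    rw [intervalIntegral.integral_mul_const] at h
    have h2 := congrArg norm h
    rw [norm_mul, norm_mul, Complex.norm_I, mul_one, Complex.norm_real, Real.norm_eq_abs] at h2
    rw [h2]
    refine (norm_sub_le _ _).trans ?_
    rw [Complex.norm_exp_ofReal_mul_I, Complex.norm_exp_ofReal_mul_I]
    norm_num

lemma lintegral_Ioc_sq_le {k : ℝ → ℂ} {B L : ℝ} (hB : 0 ≤ B)
    (h : ∀ r ∈ Ioc 0 L, ‖k r‖ ^ 2 ≤ B) :
    ∫⁻ r in Ioc 0 L, ‖k r‖ₑ ^ 2 ≤ ENNReal.ofReal (B * L) := by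
  calc _ ≤ ∫⁻ r in Ioc 0 L, ENNReal.ofReal B := by
        refine setLIntegral_mono' measurableSet_Ioc fun r hr => ?_
        rw [← ofReal_norm, ← ENNReal.ofReal_pow (norm_nonneg _)]
        exact ENNReal.ofReal_le_ofReal (h r hr)
    _ = _ := by
        rw [lintegral_const, Measure.restrict_apply_univ, Real.volume_Ioc, sub_zero,
          ENNReal.ofReal_mul hB]

/-- The wave kernel is obtained by scaling. -/
theorem IsWaveProfile.isScaledKernel {G : ℝ → Measure (Rd n)} {ν : Measure (Rd n)}
    (h : IsWaveProfile G ν) : IsScaledKernel G ν (fun r => |r|) fun r => |r| where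
  prob := h.prob
  moment := by
    have := h.prob
    exact Integrable.of_bound continuous_norm.aestronglyMeasurable 1
      (h.support.mono fun y hy => by simpa using hy)
  amp_cont := continuous_abs
  dil_cont := continuous_abs
  amp_nonneg := abs_nonneg
  dil_nonneg := abs_nonneg
  eq_map r hr := by simpa only [abs_of_pos hr] using h.eq_map r hr
  decay T := by
    -- This is `sin(r|ξ|)/|ξ|`, kept as an integral so that it is defined at `ξ = 0` and can be
    -- differentiated in `r`.
    set k : ℝ → Rd n → ℂ := fun r ξ =>
      (1 / 2 : ℝ) * ∫ s in (-r)..r, Complex.exp ((s * ‖ξ‖ : ℝ) * Complex.I) with hkdef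
    have hk : ∀ r, 0 ≤ r → ∀ ξ, kHat ν (fun r => |r|) (fun r => |r|) r ξ = k r ξ := by
      intro r hr ξ
      unfold kHat
      rw [h.charFun_eq]
      simp only [abs_of_nonneg hr]
      rw [norm_smul, Real.norm_of_nonneg hr, hkdef]
      have e := intervalIntegral.smul_integral_comp_mul_left (a := -1) (b := 1)
        (fun s : ℝ => Complex.exp ((s * ‖ξ‖ : ℝ) * Complex.I)) r
      rw [mul_neg_one, mul_one, Complex.real_smul] at e
      simp only
      rw [← e, mul_left_comm]
      refine congrArg _ (congrArg _ (intervalIntegral.integral_congr fun s _ => ?_))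
      congr 3; ring
    have hk1 : ∀ r, 0 ≤ r → ∀ ξ, ‖k r ξ‖ ≤ r ∧ ‖k r ξ‖ * ‖ξ‖ ≤ 1 := by
      intro r hr ξ
      obtain ⟨h1, h2⟩ := norm_integral_cexp_le hr ‖ξ‖
      rw [abs_of_nonneg (norm_nonneg ξ)] at h2
      simp only [hkdef, norm_mul, Complex.norm_real]
      rw [show ‖(1 / 2 : ℝ)‖ = 1 / 2 by norm_num]
      constructor <;> linarith
    -- The derivative in `r` is `cos(r|ξ|)`, so the transform is 1-Lipschitz in time.
    have hk2 : ∀ r δ, 0 ≤ r → 0 ≤ δ → ∀ ξ, ‖k (r + δ) ξ - k r ξ‖ ≤ δ := by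
      intro r δ hr hδ ξ
      have hc : Continuous fun s : ℝ => Complex.exp ((s * ‖ξ‖ : ℝ) * Complex.I) := by fun_prop
      have := Convex.norm_image_sub_le_of_norm_hasDerivWithin_le (s := univ) (x := r) (y := r + δ)
        (f := fun r => k r ξ) (C := 1)
        (fun x _ => ((hasDerivAt_integral_symm hc x).const_mul ((1 / 2 : ℝ) : ℂ)).hasDerivWithinAt)
        (fun x _ => by
          rw [norm_mul, Complex.norm_real]
          have := norm_add_le (Complex.exp ((x * ‖ξ‖ : ℝ) * Complex.I))
            (Complex.exp (((-x) * ‖ξ‖ : ℝ) * Complex.I))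
          rw [Complex.norm_exp_ofReal_mul_I, Complex.norm_exp_ofReal_mul_I] at this
          norm_num at this ⊢
          linarith) convex_univ (mem_univ _) (mem_univ _)
      simpa [abs_of_nonneg hδ] using this
    refine ⟨(1 + |T|) * (4 + T ^ 2), by positivity, fun ξ δ hδ hδT => ?_⟩
    have hT : 0 ≤ T := hδ.trans hδT
    rw [abs_of_nonneg hT]
    -- Squaring and adding `y ≤ T` and `y|ξ| ≤ 2` gives `y² (1 + |ξ|²) ≤ 4 + T²`. The bound 2 covers
    -- a difference of two transforms, each satisfying `y|ξ| ≤ 1`.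
    have hw : ∀ y, 0 ≤ y → y ≤ T → y * ‖ξ‖ ≤ 2 → y ^ 2 ≤ (4 + T ^ 2) * (1 / (1 + ‖ξ‖ ^ 2)) := by
      intro y hy h1 h2
      rw [mul_one_div, le_div_iff₀ (by positivity)]
      have h3 : y ^ 2 ≤ T ^ 2 := by gcongr
      have h4 : (y * ‖ξ‖) ^ 2 ≤ 2 ^ 2 := by gcongr
      nlinarith
    have hq : (1 : ℝ) / (1 + ‖ξ‖ ^ 2) ≤ 1 := by
      rw [div_le_one (by positivity)]; nlinarith [sq_nonneg ‖ξ‖]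
    have hq0 : (0 : ℝ) ≤ 1 / (1 + ‖ξ‖ ^ 2) := by positivity
    constructor
    · refine (lintegral_Ioc_sq_le (B := (4 + T ^ 2) * (1 / (1 + ‖ξ‖ ^ 2))) (by positivity)
        fun r hr => ?_).trans (ENNReal.ofReal_le_ofReal ?_)
      · rw [hk r hr.1.le]
        obtain ⟨h1, h2⟩ := hk1 r hr.1.le ξ
        exact hw _ (norm_nonneg _) (by linarith [hr.2]) (by linarith)
      · rw [mul_min_of_nonneg _ _ (by positivity)]
        refine le_min ?_ ?_
        · have : δ ≤ 1 + T := by linarith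
          calc _ ≤ (4 + T ^ 2) * (1 / (1 + ‖ξ‖ ^ 2)) * (1 + T) := by gcongr
            _ = _ := by ring
        · calc _ ≤ (4 + T ^ 2) * 1 * δ := by gcongr
            _ ≤ (1 + T) * (4 + T ^ 2) * δ := by
              rw [mul_comm (4 + T ^ 2)]; gcongr; linarith
    -- An increment is at most `δ ≤ T`, so its square is at most `T δ`; the other term of the
    -- minimum is the decay in `ξ`.
    · set B := min ((4 + T ^ 2) * (1 / (1 + ‖ξ‖ ^ 2))) (T * δ) with hB
      have hB0 : 0 ≤ B := le_min (by positivity) (by positivity)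
      refine (lintegral_Ioc_sq_le (B := B) hB0 fun r hr => ?_).trans
        (ENNReal.ofReal_le_ofReal ?_)
      · rw [hk r hr.1.le, hk (r + δ) (by linarith [hr.1])]
        have h1 := hk2 r δ hr.1.le hδ ξ
        have h2 := (hk1 r hr.1.le ξ).2
        have h3 := (hk1 (r + δ) (by linarith [hr.1]) ξ).2
        refine le_min (hw _ (norm_nonneg _) (h1.trans hδT) ?_) ?_
        · have := norm_sub_le (k (r + δ) ξ) (k r ξ)
          nlinarith [norm_nonneg ξ]
        · nlinarith [norm_nonneg (k (r + δ) ξ - k r ξ)]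
      · rw [mul_min_of_nonneg _ _ (by positivity)]
        refine le_min ?_ ?_
        · calc B * T ≤ (4 + T ^ 2) * (1 / (1 + ‖ξ‖ ^ 2)) * (1 + T) := by
                gcongr
                · exact min_le_left _ _
                · linarith
            _ = _ := by ring
        · calc B * T ≤ T * δ * T := by
                gcongr; exact min_le_right _ _
            _ ≤ _ := by
                have : T * T ≤ (1 + T) * (4 + T ^ 2) := by nlinarith [sq_nonneg T, pow_nonneg hT 3]
                nlinarith

end AdditiveSPDE

end

/-! ### The spherical wave kernel in dimension three -/

noncomputable section

namespace AdditiveSPDE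


/-- The Fourier transform of the surface measure of the unit sphere of `ℝ³`, along a ray. -/
def sphereFourier (ξ : Rd 3) (r : ℝ) : ℂ :=
  ∫ y, Complex.exp ((r * inner ℝ (y : Rd 3) ξ : ℝ) * Complex.I) ∂(volume : Measure (Rd 3)).toSphere

lemma continuous_sphereFourier (ξ : Rd 3) : Continuous (sphereFourier ξ) := by
  refine continuous_of_dominated (bound := fun _ => 1) (fun r => ?_) (fun r => ?_)
    (integrable_const _) (Eventually.of_forall fun y => by fun_prop)
  · exact (by fun_prop : Continuous fun y : Metric.sphere (0 : Rd 3) 1 =>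
      Complex.exp ((r * inner ℝ (y : Rd 3) ξ : ℝ) * Complex.I)).aestronglyMeasurable
  · exact Eventually.of_forall fun y => by rw [Complex.norm_exp_ofReal_mul_I]

/-- The Fourier transform of a ball in polar coordinates. -/
lemma integral_ball_eq_sphereFourier (ξ : Rd 3) {R : ℝ} (hR : 0 < R) :
    ∫ x in Metric.ball (0 : Rd 3) R, Complex.exp ((inner ℝ x ξ : ℝ) * Complex.I)
      = ∫ r in (0 : ℝ)..R, (r ^ 2 : ℝ) • sphereFourier ξ r := by
  set e : Rd 3 → ℂ := fun x => Complex.exp ((inner ℝ x ξ : ℝ) * Complex.I) with he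
  set F : Rd 3 → ℂ := (Metric.ball (0 : Rd 3) R).indicator e with hF
  have hec : Continuous e := by fun_prop
  have hFi : Integrable F := by
    rw [hF, integrable_indicator_iff measurableSet_ball]
    refine Measure.integrableOn_of_bounded (M := 1) measure_ball_lt_top.ne
      hec.aestronglyMeasurable (Eventually.of_forall fun x => ?_)
    simp only [he]
    rw [Complex.norm_exp_ofReal_mul_I]
  set Φ := homeomorphUnitSphereProd (Rd 3) with hΦ
  have hmp := (volume : Measure (Rd 3)).measurePreserving_homeomorphUnitSphereProd
  rw [finrank_euclideanSpace_fin] at hmp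
  set Fp : Metric.sphere (0 : Rd 3) 1 × Ioi (0 : ℝ) → ℂ :=
    fun q => F ((q.2 : ℝ) • (q.1 : Rd 3)) with hFp
  have hcomp : ∀ x : ({0}ᶜ : Set (Rd 3)), Fp (Φ x) = F x := by
    intro x
    simp only [hFp, hΦ, homeomorphUnitSphereProd_apply_fst_coe,
      homeomorphUnitSphereProd_apply_snd_coe]
    rw [smul_inv_smul₀ (norm_ne_zero_iff.2 x.2)]
  have h1 : ∫ x, F x = ∫ q, Fp q ∂((volume : Measure (Rd 3)).toSphere.prod (.volumeIoiPow 2)) := by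
    rw [← hmp.integral_comp Φ.measurableEmbedding]
    rw [integral_congr_ae (Eventually.of_forall hcomp), integral_subtype_comap (measurableSet_singleton _).compl F,
      restrict_compl_singleton]
  have hint : Integrable Fp ((volume : Measure (Rd 3)).toSphere.prod (.volumeIoiPow 2)) := by
    rw [← hmp.integrable_comp_emb Φ.measurableEmbedding]
    have : Fp ∘ Φ = F ∘ ((↑) : ({0}ᶜ : Set (Rd 3)) → Rd 3) := funext hcomp
    rw [this, ← integrableOn_iff_comap_subtypeVal (measurableSet_singleton _).compl]
    exact hFi.integrableOn
  have hin : ∀ r : Ioi (0 : ℝ), ∫ y, Fp (y, r) ∂(volume : Measure (Rd 3)).toSphere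
      = (Iio R).indicator (sphereFourier ξ) r := by
    intro r
    have hr : (0 : ℝ) < r := r.2
    have hmem : ∀ y : Metric.sphere (0 : Rd 3) 1,
        (r : ℝ) • (y : Rd 3) ∈ Metric.ball (0 : Rd 3) R ↔ (r : ℝ) ∈ Iio R := by
      intro y
      rw [mem_ball_zero_iff, norm_smul, norm_eq_of_mem_sphere, mul_one, Real.norm_of_nonneg hr.le,
        mem_Iio]
    by_cases h : (r : ℝ) ∈ Iio R
    · rw [indicator_of_mem h, sphereFourier]
      refine integral_congr_ae (Eventually.of_forall fun y => ?_)
      simp only [hFp, hF]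
      rw [indicator_of_mem ((hmem y).2 h)]
      simp only [he, real_inner_smul_left]
    · rw [indicator_of_notMem h]
      refine integral_eq_zero_of_ae (Eventually.of_forall fun y => ?_)
      simp only [hFp, hF]
      rw [indicator_of_notMem ((hmem y).not.2 h)]
      rfl
  rw [← integral_indicator measurableSet_ball, ← hF, h1, integral_prod_symm _ hint]
  simp_rw [hin]
  simp only [Measure.volumeIoiPow, ENNReal.ofReal]
  rw [integral_withDensity_eq_integral_smul (measurable_subtype_coe.pow_const _).real_toNNReal,
    integral_subtype_comap measurableSet_Ioi fun a : ℝ =>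
      Real.toNNReal (a ^ 2) • (Iio R).indicator (sphereFourier ξ) a,
    intervalIntegral.integral_of_le hR.le, integral_Ioc_eq_integral_Ioo,
    ← integral_indicator measurableSet_Ioi, ← integral_indicator measurableSet_Ioo]
  congr 1
  ext r
  by_cases h1 : r ∈ Ioi (0 : ℝ) <;> by_cases h2 : r ∈ Iio R
  · rw [indicator_of_mem h1, indicator_of_mem h2, indicator_of_mem (show r ∈ Ioo 0 R from ⟨h1, h2⟩),
      NNReal.smul_def, Real.coe_toNNReal _ (by positivity)]
  · rw [indicator_of_mem h1, indicator_of_notMem h2, smul_zero, indicator_of_notMem fun h => h2 h.2]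
  · rw [indicator_of_notMem h1, indicator_of_notMem fun h => h1 h.1]
  · rw [indicator_of_notMem h1, indicator_of_notMem fun h => h1 h.1]

/-- The Fourier transform of a ball by slices. -/
lemma integral_ball_eq_slices (ξ : Rd 3) {R : ℝ} (hR : 0 < R) :
    ∫ x in Metric.ball (0 : Rd 3) R, Complex.exp ((inner ℝ x ξ : ℝ) * Complex.I)
      = ∫ s in (-R)..R, (Real.pi * (R ^ 2 - s ^ 2)) • Complex.exp ((s * ‖ξ‖ : ℝ) * Complex.I) := by
  set ρ : ℝ → ℝ≥0∞ := (Iio (R ^ 2)).indicator fun _ => 1 with hρ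
  have hρm : Measurable ρ := measurable_const.indicator measurableSet_Iio
  have hball : ∀ (k : ℕ) {t : ℝ}, 0 < t → ∀ y : Rd k, ‖y‖ ^ 2 < t ↔ y ∈ Metric.ball 0 (Real.sqrt t) :=
    fun k t ht y => by rw [mem_ball_zero_iff, Real.lt_sqrt (norm_nonneg _)]
  have e1 : volume.restrict (Metric.ball (0 : Rd 3) R)
      = volume.withDensity fun x : Rd 3 => ρ (‖x‖ ^ 2) := by
    rw [← withDensity_indicator_one measurableSet_ball]
    refine congrArg _ (funext fun x => ?_)
    have := hball 3 (t := R ^ 2) (by positivity) x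
    rw [Real.sqrt_sq hR.le] at this
    by_cases hx : x ∈ Metric.ball (0 : Rd 3) R
    · rw [indicator_of_mem hx, hρ, indicator_of_mem (show _ ∈ Iio _ from this.2 hx)]; rfl
    · rw [indicator_of_notMem hx, hρ, indicator_of_notMem (show _ ∉ Iio _ from this.not.2 hx)]
  set D : ℝ → ℝ≥0∞ := (Ioo (-R) R).indicator fun s => ENNReal.ofReal (Real.pi * (R ^ 2 - s ^ 2)) with hD
  have e2 : (fun s : ℝ => ∫⁻ y : Rd 2, ρ (s ^ 2 + ‖y‖ ^ 2)) = D := by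
    ext s
    have hiff : s ∈ Ioo (-R) R ↔ 0 < R ^ 2 - s ^ 2 := by
      rw [mem_Ioo, ← abs_lt, sub_pos, sq_lt_sq, abs_of_pos hR]
    by_cases hs : s ∈ Ioo (-R) R
    · have ht := hiff.1 hs
      have h1 : (fun y : Rd 2 => ρ (s ^ 2 + ‖y‖ ^ 2))
          = (Metric.ball (0 : Rd 2) (Real.sqrt (R ^ 2 - s ^ 2))).indicator 1 := by
        ext y
        have h2 : s ^ 2 + ‖y‖ ^ 2 ∈ Iio (R ^ 2) ↔ y ∈ Metric.ball 0 (Real.sqrt (R ^ 2 - s ^ 2)) := by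
          rw [← hball 2 ht, mem_Iio, lt_sub_iff_add_lt']
        by_cases hy : y ∈ Metric.ball (0 : Rd 2) (Real.sqrt (R ^ 2 - s ^ 2))
        · rw [indicator_of_mem hy, hρ, indicator_of_mem (h2.2 hy)]; rfl
        · rw [indicator_of_notMem hy, hρ, indicator_of_notMem (h2.not.2 hy)]
      rw [h1, lintegral_indicator_one measurableSet_ball, EuclideanSpace.volume_ball_fin_two, hD,
        indicator_of_mem hs, ← ENNReal.ofReal_pow (Real.sqrt_nonneg _), Real.sq_sqrt ht.le,
        ← ENNReal.ofReal_mul ht.le, mul_comm]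
    · rw [hD, indicator_of_notMem hs, ← lintegral_zero (α := Rd 2) (μ := volume)]
      refine lintegral_congr fun y => indicator_of_notMem ?_ _
      rw [hiff] at hs
      rw [mem_Iio]
      nlinarith [sq_nonneg ‖y‖]
  have hDm : Measurable D := Measurable.indicator (by fun_prop) measurableSet_Ioo
  have h1 := integral_map (μ := volume.restrict (Metric.ball (0 : Rd 3) R))
    (φ := fun x => inner ℝ x ξ) (by fun_prop)
    (f := fun s : ℝ => Complex.exp ((s : ℂ) * Complex.I)) (by fun_prop)
  rw [← h1, e1, map_inner_withDensity_radial hρm, e2, integral_map (by fun_prop) (by fun_prop),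
    integral_withDensity_eq_integral_toReal_smul hDm (Eventually.of_forall fun s => by
      simp only [hD, indicator]; split_ifs <;> simp),
    intervalIntegral.integral_of_le (by linarith), integral_Ioc_eq_integral_Ioo,
    ← integral_indicator measurableSet_Ioo]
  congr 1
  ext s
  by_cases hs : s ∈ Ioo (-R) R
  · rw [indicator_of_mem hs, hD, indicator_of_mem hs, ENNReal.toReal_ofReal]
    have : 0 < R ^ 2 - s ^ 2 := by nlinarith [hs.1, hs.2]
    positivity
  · rw [indicator_of_notMem hs, hD, indicator_of_notMem hs, ENNReal.toReal_zero, zero_smul]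

/-- Archimedes: surface area on the sphere projects uniformly onto a diameter. The transform of a
ball of radius `R` is written in polar coordinates and by slices of area `π(R² - s²)`, and both
expressions are differentiated at `R = 1`. The slices vanish at the end points, so only the
derivative `2πR` of the area contributes. -/
lemma sphereFourier_one (ξ : Rd 3) : sphereFourier ξ 1
    = (2 * Real.pi : ℝ) * ∫ s in (-1 : ℝ)..1, Complex.exp ((s * ‖ξ‖ : ℝ) * Complex.I) := by
  set e : ℝ → ℂ := fun s => Complex.exp ((s * ‖ξ‖ : ℝ) * Complex.I) with he
  have hec : Continuous e := by fun_prop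
  have hc2 : Continuous fun s : ℝ => (s ^ 2 : ℂ) * e s := by fun_prop
  set A : ℝ → ℂ := fun R =>
    ∫ x in Metric.ball (0 : Rd 3) R, Complex.exp ((inner ℝ x ξ : ℝ) * Complex.I) with hA
  have h1 : HasDerivAt A (sphereFourier ξ 1) 1 := by
    have hc : Continuous fun r : ℝ => (r ^ 2 : ℝ) • sphereFourier ξ r :=
      (continuous_pow 2).smul (continuous_sphereFourier ξ)
    have := intervalIntegral.integral_hasDerivAt_right (hc.intervalIntegrable 0 1)
      hc.stronglyMeasurable.stronglyMeasurableAtFilter hc.continuousAt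
    rw [one_pow, one_smul] at this
    refine this.congr_of_eventuallyEq ?_
    filter_upwards [Ioi_mem_nhds (zero_lt_one' ℝ)] with R hR
    exact integral_ball_eq_sphereFourier ξ hR
  have h2 : HasDerivAt A ((2 * Real.pi : ℝ) * ∫ s in (-1 : ℝ)..1, e s) 1 := by
    have hd1 := hasDerivAt_integral_symm hec 1
    have hd2 := hasDerivAt_integral_symm hc2 1
    have hsq : HasDerivAt (fun R : ℝ => ((R : ℂ) ^ 2)) 2 1 := by
      have := ((hasDerivAt_id (1 : ℝ)).ofReal_comp).fun_pow 2
      simpa using this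
    have := ((hsq.mul hd1).sub hd2).const_mul (Real.pi : ℂ)
    refine (this.congr_deriv ?_).congr_of_eventuallyEq ?_
    · push_cast
      ring
    · filter_upwards [Ioi_mem_nhds (zero_lt_one' ℝ)] with R hR
      simp only [hA]
      rw [integral_ball_eq_slices ξ hR]
      simp only [Pi.mul_apply, Pi.sub_apply]
      rw [← intervalIntegral.integral_const_mul, ← intervalIntegral.integral_sub
        ((hec.intervalIntegrable _ _).const_mul _) (hc2.intervalIntegrable _ _),
        ← intervalIntegral.integral_const_mul]
      refine intervalIntegral.integral_congr fun s _ => ?_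
      simp only [he, Complex.real_smul]
      push_cast
      ring
  exact h1.unique h2

lemma isWaveProfile_three : IsWaveProfile (waveKernel 3) (waveKernel 3 1) := by
  set σ := (volume : Measure (Rd 3)).toSphere with hσ
  have hpi := Real.pi_pos
  have hm : ∀ r : ℝ, Measurable fun y : Metric.sphere (0 : Rd 3) 1 => r • (y : Rd 3) := fun r =>
    (by fun_prop : Continuous _).measurable
  have hw : ∀ r : ℝ, 0 < r → waveKernel 3 r
      = ENNReal.ofReal (r / (4 * Real.pi)) • σ.map fun y : Metric.sphere (0 : Rd 3) 1 => r • (y : Rd 3) := by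
    intro r hr
    have e : waveKernel 3 r = ENNReal.ofReal (1 / (4 * Real.pi * r)) • ENNReal.ofReal (r ^ 2) •
        σ.map fun y : Metric.sphere (0 : Rd 3) 1 => r • (y : Rd 3) := rfl
    rw [e, smul_smul, ← ENNReal.ofReal_mul (by positivity)]
    congr 2
    field_simp
  have hsph : ∀ f : Rd 3 → ℂ, Continuous f → ∫ y, f y ∂(waveKernel 3 1)
      = (1 / (4 * Real.pi) : ℝ) • ∫ y, f (y : Rd 3) ∂σ := by
    intro f hf
    rw [hw 1 one_pos, integral_smul_measure, ENNReal.toReal_ofReal (by positivity),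
      integral_map (hm 1).aemeasurable hf.aestronglyMeasurable]
    simp_rw [one_smul]
  refine ⟨fun r hr => ?_, ⟨?_⟩, fun ξ => ?_, ?_⟩
  · rw [hw r hr, hw 1 one_pos, Measure.map_smul, Measure.map_map (measurable_const_smul r) (hm 1),
      smul_smul, ← ENNReal.ofReal_mul hr.le]
    congr 2
    · ring_nf
    · ext y; simp
  · rw [hw 1 one_pos, Measure.smul_apply, Measure.map_apply (hm 1) MeasurableSet.univ, preimage_univ,
      hσ, Measure.toSphere_apply_univ, finrank_euclideanSpace_fin,
      EuclideanSpace.volume_ball_fin_three, ENNReal.ofReal_one, one_pow, one_mul, smul_eq_mul,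
      show ((3 : ℕ) : ℝ≥0∞) = ENNReal.ofReal 3 by norm_num, ← ENNReal.ofReal_mul (by norm_num),
      ← ENNReal.ofReal_mul (by positivity), ← ENNReal.ofReal_one]
    congr 1
    field_simp
  · rw [charFun_apply, hsph _ (by fun_prop)]
    have h := sphereFourier_one ξ
    unfold sphereFourier at h
    simp only [one_mul] at h
    rw [h, Complex.real_smul, ← mul_assoc, ← Complex.ofReal_mul]
    congr 2
    field_simp
    norm_num
  · rw [hw 1 one_pos]
    refine Measure.ae_smul_measure ?_ _
    rw [ae_map_iff (hm 1).aemeasurable (measurableSet_le measurable_norm measurable_const)]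
    exact Eventually.of_forall fun y => by rw [one_smul, norm_eq_of_mem_sphere]

end AdditiveSPDE

end

/-! ### The linear part: heat semigroup and smooth wave data -/

noncomputable section

namespace AdditiveSPDE


variable {d : ℕ}

/-- Time zero is pasted in separately, since `u0` is only measurable there. -/
lemma goodLinearPart_of_continuousOn {pb : CauchyProblem d} {M : ℝ} (hu : Measurable pb.u0)
    (hc : ContinuousOn (fun p : ℝ × Rd d => linearPart pb p.1 p.2) (Ioc 0 pb.T ×ˢ univ))
    (hM : ∀ t ∈ Icc 0 pb.T, ∀ x, |linearPart pb t x| ≤ M) : GoodLinearPart pb M where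
  measurable := by
    classical
    have hS : MeasurableSet (Ioc 0 pb.T ×ˢ univ : Set (ℝ × Rd d)) :=
      measurableSet_Ioc.prod MeasurableSet.univ
    have h0 : Measurable ((Ioc 0 pb.T ×ˢ univ : Set (ℝ × Rd d)).piecewise
        (fun p => linearPart pb p.1 p.2) fun _ => 0) :=
      hc.measurable_piecewise continuousOn_const hS
    have h1 : Measurable ((Ioc 0 pb.T ×ˢ univ : Set (ℝ × Rd d)).piecewise
        ((Ioc 0 pb.T ×ˢ univ : Set (ℝ × Rd d)).piecewise
          (fun p => linearPart pb p.1 p.2) fun _ => 0) fun p => pb.u0 p.2) :=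
      h0.piecewise hS (hu.comp measurable_snd)
    have h2 : Measurable fun z : Icc (0 : ℝ) pb.T × Rd d => ((z.1 : ℝ), z.2) := by fun_prop
    convert h1.comp h2 using 1
    ext z
    by_cases h0 : (z.1 : ℝ) = 0
    · simp [piecewise, h0, linearPart]
    · have : 0 < (z.1 : ℝ) := lt_of_le_of_ne z.1.2.1 (Ne.symm h0)
      simp [piecewise, this, z.1.2.2]
  continuousOn := hc
  bound := hM

/-- The value at `x` of a function smoothed by a scaled measure. -/
def dilAvg (ν : Measure (Rd d)) (f : Rd d → ℝ) (s : ℝ) (x : Rd d) : ℝ := ∫ y, f (x - s • y) ∂ν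

lemma dilAvg_zero (ν : Measure (Rd d)) [IsProbabilityMeasure ν] (f : Rd d → ℝ) (x : Rd d) :
    dilAvg ν f 0 x = f x := by
  simp [dilAvg]

lemma abs_dilAvg_le {ν : Measure (Rd d)} [IsProbabilityMeasure ν] {f : Rd d → ℝ} {M : ℝ}
    (hM : ∀ x, |f x| ≤ M) (s : ℝ) (x : Rd d) : |dilAvg ν f s x| ≤ M := by
  have := norm_integral_le_of_norm_le_const (μ := ν) (f := fun y => f (x - s • y))
    (Eventually.of_forall fun y => by rw [Real.norm_eq_abs]; exact hM _)
  simpa [dilAvg] using this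

lemma continuous_dilAvg_of_bounded {ν : Measure (Rd d)} [IsProbabilityMeasure ν] {f : Rd d → ℝ}
    (hf : Continuous f) {M : ℝ} (hM : ∀ x, |f x| ≤ M) :
    Continuous fun q : ℝ × Rd d => dilAvg ν f q.1 q.2 := by
  refine continuous_of_dominated (bound := fun _ => M)
    (fun q => (hf.comp (by fun_prop)).aestronglyMeasurable)
    (fun q => Eventually.of_forall fun y => hM _) (integrable_const _)
    (Eventually.of_forall fun y => hf.comp (by fun_prop))

lemma kernelConv_eq_dilAvg {eqn : Equation} {ν : Measure (Rd d)} {c a : ℝ → ℝ}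
    (h : IsScaledKernel (fundamentalSolution eqn d) ν c a) {f : Rd d → ℝ} (hf : Measurable f) {t : ℝ}
    (ht : 0 < t) (x : Rd d) : kernelConv eqn f t x = c t * dilAvg ν f (a t) x :=
  h.integral_eq ht (hf.comp (measurable_const.sub measurable_id)).aestronglyMeasurable

section Heat

lemma kernelConv_heat_eq_integral {f : Rd d → ℝ} {t : ℝ} (ht : 0 < t) (x : Rd d) :
    kernelConv .heat f t x = ∫ z, (1 / (2 * Real.pi * t) ^ ((d : ℝ) / 2) *
      Real.exp (-‖x - z‖ ^ 2 / (2 * t))) * f z := by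
  have e : kernelConv .heat f t x = ∫ y, f (x - y) ∂(heatKernel d t) := rfl
  rw [e, heatKernel, integral_withDensity_eq_integral_toReal_smul (by fun_prop)
    (Eventually.of_forall fun _ => by simp), ← integral_sub_left_eq_self _ volume x]
  refine integral_congr_ae (Eventually.of_forall fun y => ?_)
  simp only [sub_sub_cancel]
  rw [ENNReal.toReal_ofReal (by positivity), smul_eq_mul]

lemma integrable_exp_neg_mul_norm_sub_sq {b : ℝ} (hb : 0 < b) (x : Rd d) :
    Integrable fun z : Rd d => Real.exp (-b * ‖x - z‖ ^ 2) := by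
  have h := GaussianFourier.integrable_cexp_neg_mul_sq_norm_add_of_euclideanSpace (ι := Fin d)
    (b := b) (by simpa using hb) 0 0
  refine (h.norm.comp_sub_left x).congr (Eventually.of_forall fun z => ?_)
  simp only [Complex.norm_exp]
  congr 1
  simp [← Complex.ofReal_pow]

/-- The heat semigroup maps bounded measurable functions to continuous functions. -/
lemma continuousAt_kernelConv_heat {f : Rd d → ℝ} (hf : Measurable f) {M : ℝ} (hM : ∀ x, |f x| ≤ M)
    {t₀ : ℝ} (ht₀ : 0 < t₀) (x₀ : Rd d) :
    ContinuousAt (fun p : ℝ × Rd d => kernelConv .heat f p.1 p.2) (t₀, x₀) := by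
  have hM0 : 0 ≤ M := (abs_nonneg _).trans (hM 0)
  have hev : ∀ᶠ p : ℝ × Rd d in 𝓝 (t₀, x₀), (t₀ / 2 < p.1 ∧ p.1 < 2 * t₀) ∧ ‖p.2 - x₀‖ < 1 := by
    refine Filter.Eventually.and (continuous_fst.continuousAt.eventually
      (Ioo_mem_nhds (by linarith) (by linarith))) ?_
    have : ContinuousAt (fun p : ℝ × Rd d => ‖p.2 - x₀‖) (t₀, x₀) := by fun_prop
    exact this.eventually (gt_mem_nhds (by simp))
  have e : (fun p : ℝ × Rd d => kernelConv .heat f p.1 p.2) =ᶠ[𝓝 (t₀, x₀)] fun p =>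
      ∫ z, (1 / (2 * Real.pi * p.1) ^ ((d : ℝ) / 2) *
        Real.exp (-‖p.2 - z‖ ^ 2 / (2 * p.1))) * f z := by
    filter_upwards [hev] with p hp
    exact kernelConv_heat_eq_integral (by linarith [hp.1.1]) _
  refine ContinuousAt.congr ?_ e.symm
  -- The bound comes from `|x₀-z|² ≤ 2|x-z|² + 2` for `|x-x₀| < 1`, together with `t₀/2 < t < 2t₀`:
  -- the exponent is at most `-|x₀-z|²/(8t₀) + 1/(4t₀)`.
  refine continuousAt_of_dominated (bound := fun z => 1 / (2 * Real.pi * (t₀ / 2)) ^ ((d : ℝ) / 2) *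
    (Real.exp (1 / (4 * t₀)) * Real.exp (-(1 / (8 * t₀)) * ‖x₀ - z‖ ^ 2)) * M) ?_ ?_ ?_ ?_
  · refine Eventually.of_forall fun p => ?_
    exact (((by fun_prop : Continuous fun z : Rd d => 1 / (2 * Real.pi * p.1) ^ ((d : ℝ) / 2) *
        Real.exp (-‖p.2 - z‖ ^ 2 / (2 * p.1))).measurable).mul hf).aestronglyMeasurable
  · filter_upwards [hev] with p hp
    refine Eventually.of_forall fun z => ?_
    obtain ⟨⟨h1, h2⟩, h3⟩ := hp
    have hp0 : 0 < p.1 := by linarith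
    rw [norm_mul, Real.norm_of_nonneg (by positivity), Real.norm_eq_abs]
    refine mul_le_mul ?_ (hM z) (abs_nonneg _) (by positivity)
    refine mul_le_mul ?_ ?_ (Real.exp_pos _).le (by positivity)
    · refine one_div_le_one_div_of_le (by positivity) ?_
      gcongr
    · rw [← Real.exp_add, Real.exp_le_exp]
      have h4 : ‖x₀ - z‖ ≤ ‖p.2 - z‖ + 1 := by
        have := norm_sub_le_norm_sub_add_norm_sub x₀ p.2 z
        rw [norm_sub_rev x₀ p.2] at this
        linarith
      have h5 : ‖x₀ - z‖ ^ 2 ≤ 2 * ‖p.2 - z‖ ^ 2 + 2 := by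
        nlinarith [norm_nonneg (x₀ - z), norm_nonneg (p.2 - z), sq_nonneg (‖p.2 - z‖ - 1)]
      have h6 : ‖p.2 - z‖ ^ 2 / (4 * t₀) ≤ ‖p.2 - z‖ ^ 2 / (2 * p.1) := by
        apply div_le_div_of_nonneg_left (by positivity) (by positivity) (by linarith)
      have h7 : (‖x₀ - z‖ ^ 2 - 2) / (8 * t₀) ≤ ‖p.2 - z‖ ^ 2 / (4 * t₀) := by
        rw [div_le_div_iff₀ (by positivity) (by positivity)]
        nlinarith
      have h8 : (‖x₀ - z‖ ^ 2 - 2) / (8 * t₀)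
          = 1 / (8 * t₀) * ‖x₀ - z‖ ^ 2 - 1 / (4 * t₀) := by
        field_simp; ring
      rw [neg_div]
      linarith
  · exact (((integrable_exp_neg_mul_norm_sub_sq (by positivity) x₀).const_mul _).const_mul _).mul_const _
  · refine Eventually.of_forall fun z => ContinuousAt.mul (ContinuousAt.mul ?_ ?_) continuousAt_const
    · refine ContinuousAt.div continuousAt_const ?_ (by positivity)
      exact ContinuousAt.rpow_const (by fun_prop) (Or.inl (by positivity))
    · refine Real.continuous_exp.continuousAt.comp ?_
      exact ContinuousAt.div (by fun_prop) (by fun_prop) (by positivity)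

variable {T : ℝ} {b : ℝ → ℝ} {u0 v0 : Rd d → ℝ}

lemma linearPart_heat {t : ℝ} (ht : 0 < t) (x : Rd d) :
    linearPart ⟨.heat, T, b, u0, v0⟩ t x = kernelConv .heat u0 t x := by
  simp [linearPart, ht.ne']

/-- Because `√0 = 0`, one formula covers all `t ≥ 0`, and continuity up to time zero for continuous
data is immediate. -/
lemma linearPart_heat_eq_dilAvg (hu : Measurable u0) {t : ℝ} (ht : 0 ≤ t) (x : Rd d) :
    linearPart ⟨.heat, T, b, u0, v0⟩ t x = dilAvg (heatKernel d 1) u0 (Real.sqrt t) x := by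
  rcases ht.eq_or_lt with rfl | ht
  · rw [Real.sqrt_zero, dilAvg_zero]
    simp [linearPart]
  · rw [linearPart_heat ht, kernelConv_eq_dilAvg isScaledKernel_heat hu ht, one_mul]

lemma goodLinearPart_heat (hu : Measurable u0) {M : ℝ} (hM : ∀ x, |u0 x| ≤ M) :
    GoodLinearPart ⟨.heat, T, b, u0, v0⟩ M := by
  refine goodLinearPart_of_continuousOn hu (fun p hp => ?_) fun t ht x => ?_
  · refine (ContinuousAt.congr (continuousAt_kernelConv_heat hu hM hp.1.1 p.2) ?_).continuousWithinAt
    filter_upwards [continuous_fst.continuousAt.eventually (lt_mem_nhds hp.1.1)] with q hq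
    exact (linearPart_heat hq _).symm
  · rw [linearPart_heat_eq_dilAvg hu ht.1]
    exact abs_dilAvg_le hM _ _

lemma continuousOn_linearPart_heat (hu : Continuous u0) {M : ℝ} (hM : ∀ x, |u0 x| ≤ M) :
    ContinuousOn (fun p : ℝ × Rd d => linearPart ⟨.heat, T, b, u0, v0⟩ p.1 p.2)
      (Icc 0 T ×ˢ univ) := by
  have h1 : Continuous fun p : ℝ × Rd d => dilAvg (heatKernel d 1) u0 (Real.sqrt p.1) p.2 :=
    (continuous_dilAvg_of_bounded hu hM).comp
      (f := fun p : ℝ × Rd d => (Real.sqrt p.1, p.2)) (by fun_prop)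
  exact h1.continuousOn.congr fun p hp => linearPart_heat_eq_dilAvg hu.measurable hp.1.1 _

end Heat

section SmoothData

variable {ν : Measure (Rd d)} [IsProbabilityMeasure ν]

/-- Finite speed of propagation: `ν` lives on the unit ball, so no growth condition on `F` is
required. -/
lemma continuous_integral_of_support (hν : ∀ᵐ y ∂ν, ‖y‖ ≤ 1) {X : Type*} [TopologicalSpace X]
    [FirstCountableTopology X] [LocallyCompactSpace X] {F : X → Rd d → ℝ}
    (hF : Continuous (Function.uncurry F)) : Continuous fun x => ∫ y, F x y ∂ν := by
  have e : ν.restrict (Metric.closedBall 0 1) = ν :=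
    Measure.restrict_eq_self_of_ae_mem (hν.mono fun y hy => by simpa using hy)
  have := continuous_parametric_integral_of_continuous (μ := ν) hF
    (isCompact_closedBall (0 : Rd d) 1)
  rwa [e] at this

lemma continuous_dilAvg (hν : ∀ᵐ y ∂ν, ‖y‖ ≤ 1) {f : Rd d → ℝ} (hf : Continuous f) :
    Continuous fun q : ℝ × Rd d => dilAvg ν f q.1 q.2 :=
  continuous_integral_of_support hν (F := fun (q : ℝ × Rd d) y => f (q.2 - q.1 • y))
    (hf.comp (by fun_prop))

/-- Minus the derivative in the dilation parameter of `dilAvg`. -/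
def dilAvgDeriv (ν : Measure (Rd d)) (f : Rd d → ℝ) (s : ℝ) (x : Rd d) : ℝ :=
  ∫ y, fderiv ℝ f (x - s • y) y ∂ν

lemma continuous_dilAvgDeriv (hν : ∀ᵐ y ∂ν, ‖y‖ ≤ 1) {f : Rd d → ℝ} (hf : ContDiff ℝ 1 f) :
    Continuous fun q : ℝ × Rd d => dilAvgDeriv ν f q.1 q.2 := by
  refine continuous_integral_of_support hν
    (F := fun (q : ℝ × Rd d) y => fderiv ℝ f (q.2 - q.1 • y) y) ?_
  have := hf.continuous_fderiv one_ne_zero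
  exact (this.comp (by fun_prop)).clm_apply continuous_snd

lemma hasDerivAt_dilAvg (hν : ∀ᵐ y ∂ν, ‖y‖ ≤ 1) {f : Rd d → ℝ} (hf : ContDiff ℝ 1 f) (t : ℝ)
    (x : Rd d) : HasDerivAt (fun s => dilAvg ν f s x) (-dilAvgDeriv ν f t x) t := by
  have hD := hf.continuous_fderiv one_ne_zero
  have hFc : Continuous fun q : ℝ × Rd d => fderiv ℝ f (x - q.1 • q.2) q.2 :=
    (hD.comp (by fun_prop)).clm_apply continuous_snd
  obtain ⟨C, hC⟩ := ((isCompact_closedBall t 1).prod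
    (isCompact_closedBall (0 : Rd d) 1)).exists_bound_of_continuousOn hFc.continuousOn
  have h := hasDerivAt_integral_of_dominated_loc_of_deriv_le (μ := ν) (x₀ := t)
    (s := Metric.ball t 1) (F := fun s y => f (x - s • y))
    (F' := fun s y => -fderiv ℝ f (x - s • y) y) (bound := fun _ => C) (Metric.ball_mem_nhds t one_pos)
    (Eventually.of_forall fun s => (hf.continuous.comp (by fun_prop)).aestronglyMeasurable) ?_
    ((hFc.comp (Continuous.prodMk_right t)).neg.aestronglyMeasurable) ?_ (integrable_const C) ?_
  · have h2 := h.2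
    rw [integral_neg] at h2
    exact h2
  · obtain ⟨C', hC'⟩ := (isCompact_closedBall (0 : Rd d) 1).exists_bound_of_continuousOn
      (f := fun y => f (x - t • y)) (hf.continuous.comp (by fun_prop)).continuousOn
    exact Integrable.of_bound (hf.continuous.comp (by fun_prop)).aestronglyMeasurable C'
      (hν.mono fun y hy => hC' y (by simpa using hy))
  · refine hν.mono fun y hy s hs => ?_
    rw [norm_neg]
    exact hC (s, y) ⟨Metric.ball_subset_closedBall hs, by simpa using hy⟩
  · refine Eventually.of_forall fun y s _ => ?_
    have h1 : HasDerivAt (fun s : ℝ => x - s • y) (-y) s := by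
      simpa using ((hasDerivAt_id s).smul_const y).const_sub x
    have h2 := ((hf.differentiable one_ne_zero) (x - s • y)).hasFDerivAt.comp_hasDerivAt s h1
    rw [map_neg] at h2
    exact h2

variable {T : ℝ} {b : ℝ → ℝ} {u0 v0 : Rd d → ℝ}

lemma linearPart_wave_zero (x : Rd d) : linearPart ⟨.wave, T, b, u0, v0⟩ 0 x = u0 x := by
  simp [linearPart]

lemma linearPart_wave {t : ℝ} (ht : 0 < t) (x : Rd d) : linearPart ⟨.wave, T, b, u0, v0⟩ t x
    = kernelConv .wave v0 t x + deriv (fun r => kernelConv .wave u0 r x) t := by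
  simp [linearPart, ht.ne']

omit [IsProbabilityMeasure ν] in
lemma kernelConv_wave_eq (h : IsWaveProfile (waveKernel d) ν) {f : Rd d → ℝ}
    (hf : Measurable f) {t : ℝ} (ht : 0 < t) (x : Rd d) :
    kernelConv .wave f t x = t * dilAvg ν f t x := by
  rw [kernelConv_eq_dilAvg (eqn := .wave) h.isScaledKernel hf ht, abs_of_pos ht]

/-- The kernel at time `t` has amplitude `t` and dilation `t`; the time derivative of `t * dilAvg ν
u0 t x` is the product rule. -/
lemma linearPart_wave_eq (h : IsWaveProfile (waveKernel d) ν) (hu : ContDiff ℝ 1 u0) {t : ℝ}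
    (ht : 0 < t) (x : Rd d) : linearPart ⟨.wave, T, b, u0, v0⟩ t x
      = kernelConv .wave v0 t x + (dilAvg ν u0 t x - t * dilAvgDeriv ν u0 t x) := by
  rw [linearPart_wave ht]
  congr 1
  have h1 := (hasDerivAt_id t).fun_mul (hasDerivAt_dilAvg h.support hu t x)
  have h2 : (fun r => kernelConv .wave u0 r x) =ᶠ[𝓝 t] fun s => id s * dilAvg ν u0 s x := by
    filter_upwards [Ioi_mem_nhds ht] with r hr
    exact kernelConv_wave_eq h hu.continuous.measurable hr x
  rw [h2.deriv_eq, h1.deriv]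
  simp only [id]
  ring

end SmoothData

end AdditiveSPDE

end

/-! ### Wave averages of functions in `L^p` -/

noncomputable section

namespace AdditiveSPDE


variable {d : ℕ}

/-- The averages of a function with respect to the dilations of `ν` are controlled by the norm of
the function in `L^p`. -/
def HasLpBound (ν : Measure (Rd d)) (p C : ℝ) : Prop :=
  ∀ h : Rd d → ℝ, Measurable h → ∀ t, 0 < t → ∀ x, ∫⁻ y, ‖h (x - t • y)‖ₑ ∂ν ≤
    ENNReal.ofReal (C * t ^ (-(d / p))) * eLpNorm h (ENNReal.ofReal p) volume

lemma lintegral_comp_sub_smul {f : Rd d → ℝ≥0∞} (hf : Measurable f) {t : ℝ} (ht : 0 < t) (x : Rd d) :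
    ∫⁻ y, f (x - t • y) = ENNReal.ofReal (t ^ d)⁻¹ * ∫⁻ y, f y := by
  have h1 := Measure.map_addHaar_smul (volume : Measure (Rd d)) ht.ne'
  have h2 := lintegral_map (μ := (volume : Measure (Rd d))) (f := fun z => f (x - z))
    (g := fun y => t • y) (hf.comp (measurable_const.sub measurable_id)) (measurable_const_smul t)
  rw [h1, lintegral_smul_measure, finrank_euclideanSpace_fin, abs_of_pos (by positivity), smul_eq_mul,
    lintegral_sub_left_eq_self f x] at h2
  exact h2.symm

/-- Hölder's inequality with the density in `L^q`; the change of variables `z = x - t y` produces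
`t^{-d/p}`. -/
lemma exists_hasLpBound {κ : Rd d → ℝ≥0∞} (hκ : Measurable κ) {p q : ℝ} (hpq : p.HolderConjugate q)
    (hκq : ∫⁻ y, κ y ^ q < ∞) : ∃ C, 0 ≤ C ∧ HasLpBound (volume.withDensity κ) p C := by
  have hp := hpq.pos
  have hC : (∫⁻ y, κ y ^ q) ^ (1 / q) ≠ ∞ :=
    ENNReal.rpow_ne_top_of_nonneg (one_div_nonneg.2 hpq.symm.nonneg) hκq.ne
  refine ⟨((∫⁻ y, κ y ^ q) ^ (1 / q)).toReal, ENNReal.toReal_nonneg, fun h hh t ht x => ?_⟩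
  have hm : Measurable fun y : Rd d => ‖h (x - t • y)‖ₑ :=
    (hh.comp (by fun_prop)).enorm
  have hm2 : Measurable fun y : Rd d => ‖h y‖ₑ ^ p := hh.enorm.pow_const p
  rw [lintegral_withDensity_eq_lintegral_mul _ hκ hm, mul_comm κ]
  refine (ENNReal.lintegral_mul_le_Lp_mul_Lq volume hpq hm.aemeasurable hκ.aemeasurable).trans_eq ?_
  rw [lintegral_comp_sub_smul hm2 ht x, ENNReal.mul_rpow_of_nonneg _ _ (by positivity),
    ENNReal.ofReal_rpow_of_pos (by positivity), ENNReal.ofReal_mul ENNReal.toReal_nonneg,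
    ENNReal.ofReal_toReal hC, eLpNorm_eq_lintegral_rpow_enorm_toReal (by simpa using hp) (by simp),
    ENNReal.toReal_ofReal hp.le]
  have e : ((t ^ d)⁻¹ : ℝ) ^ (1 / p) = t ^ (-(d / p)) := by
    rw [← Real.rpow_natCast, ← Real.rpow_neg ht.le, ← Real.rpow_mul ht.le]
    congr 1; ring
  rw [e]
  ring

/-- A function in `L^r` is locally in `L^p`, uniformly, for `p ≤ r`. -/
lemma exists_eLpNorm_indicator_le {f : Rd d → ℝ} {p : ℝ} {r : ℝ≥0∞} (hf : MemLp f r volume)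
    (hpr : ENNReal.ofReal p ≤ r) (hp : 1 ≤ p) (R : ℝ) : ∃ K, 0 ≤ K ∧ ∀ x,
      eLpNorm ((Metric.closedBall x R).indicator f) (ENNReal.ofReal p) volume ≤ ENNReal.ofReal K := by
  set B := eLpNorm f r volume *
    (volume (Metric.closedBall (0 : Rd d) R)) ^ (1 / p - 1 / r.toReal) with hB
  have hexp : 0 ≤ 1 / p - 1 / r.toReal := by
    rcases eq_or_ne r ∞ with rfl | hr
    · simp; linarith
    · rw [ENNReal.ofReal_le_iff_le_toReal hr] at hpr
      exact sub_nonneg.2 (one_div_le_one_div_of_le (by linarith) hpr)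
  have hB' : B ≠ ∞ := ENNReal.mul_ne_top hf.2.ne
    (ENNReal.rpow_ne_top_of_nonneg hexp measure_closedBall_lt_top.ne)
  refine ⟨B.toReal, ENNReal.toReal_nonneg, fun x => ?_⟩
  rw [ENNReal.ofReal_toReal hB', eLpNorm_indicator_eq_eLpNorm_restrict measurableSet_closedBall]
  refine (eLpNorm_le_eLpNorm_mul_rpow_measure_univ hpr hf.1.restrict).trans ?_
  rw [Measure.restrict_apply_univ, ENNReal.toReal_ofReal (by linarith),
    Measure.addHaar_closedBall_center]
  exact mul_le_mul_left (eLpNorm_mono_measure f Measure.restrict_le_self) _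

variable {ν : Measure (Rd d)} {p C : ℝ} {r : ℝ≥0∞} {f : Rd d → ℝ}

/-- Up to time `T` the average at `x` only sees the ball of radius `T` about `x`, where the `L^p`
norm is controlled by the `L^r` norm uniformly in `x`. -/
lemma HasLpBound.exists_lintegral_le (h : HasLpBound ν p C) (hC : 0 ≤ C) (hν : ∀ᵐ y ∂ν, ‖y‖ ≤ 1)
    (hp : 1 ≤ p) (hf : Measurable f) (hfr : MemLp f r volume) (hpr : ENNReal.ofReal p ≤ r) (T : ℝ) :
    ∃ K, 0 ≤ K ∧ ∀ t ∈ Ioc 0 T, ∀ x,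
      ∫⁻ y, ‖f (x - t • y)‖ₑ ∂ν ≤ ENNReal.ofReal (K * t ^ (-(d / p))) := by
  obtain ⟨K, hK, hKx⟩ := exists_eLpNorm_indicator_le hfr hpr hp T
  refine ⟨C * K, by positivity, fun t ht x => ?_⟩
  have h1 := h ((Metric.closedBall x T).indicator f) (hf.indicator measurableSet_closedBall) t ht.1 x
  calc ∫⁻ y, ‖f (x - t • y)‖ₑ ∂ν
      = ∫⁻ y, ‖(Metric.closedBall x T).indicator f (x - t • y)‖ₑ ∂ν := by
        refine lintegral_congr_ae (hν.mono fun y hy => ?_)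
        simp only
        rw [indicator_of_mem]
        rw [Metric.mem_closedBall, dist_eq_norm, sub_sub_cancel_left, norm_neg, norm_smul,
          Real.norm_of_nonneg ht.1.le]
        nlinarith [ht.1, ht.2, norm_nonneg y]
    _ ≤ _ := h1
    _ ≤ ENNReal.ofReal (C * t ^ (-(d / p))) * ENNReal.ofReal K := mul_le_mul_right (hKx x) _
    _ = _ := by
        rw [← ENNReal.ofReal_mul (mul_nonneg hC (Real.rpow_nonneg ht.1.le _))]
        congr 1; ring

lemma abs_integral_le_of_lintegral {α : Type*} [MeasurableSpace α] {μ : Measure α} {g : α → ℝ} {B : ℝ}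
    (hB : 0 ≤ B) (h : ∫⁻ y, ‖g y‖ₑ ∂μ ≤ ENNReal.ofReal B) : |∫ y, g y ∂μ| ≤ B := by
  rw [← Real.norm_eq_abs, ← ENNReal.ofReal_le_ofReal_iff hB, ofReal_norm]
  exact (enorm_integral_le_lintegral_enorm _).trans h

/-- Averages with respect to dilations depend continuously on the dilation and the centre. -/
lemma HasLpBound.continuousAt_dilAvg [IsProbabilityMeasure ν] (h : HasLpBound ν p C) (hC : 0 ≤ C)
    (hν : ∀ᵐ y ∂ν, ‖y‖ ≤ 1) (hp : 1 ≤ p) (hf : Measurable f) (hfr : MemLp f r volume)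
    (hpr : ENNReal.ofReal p ≤ r) {t₀ : ℝ} (ht₀ : 0 < t₀) (x₀ : Rd d) :
    ContinuousAt (fun q : ℝ × Rd d => dilAvg ν f q.1 q.2) (t₀, x₀) := by
  set R := 1 + 2 * t₀ with hR
  set g := (Metric.closedBall x₀ R).indicator f with hg
  have hgm : Measurable g := hf.indicator measurableSet_closedBall
  obtain ⟨K, hK, hKx⟩ := exists_eLpNorm_indicator_le hfr hpr hp R
  have hgp : MemLp g (ENNReal.ofReal p) volume :=
    ⟨hgm.aestronglyMeasurable, (hKx x₀).trans_lt ENNReal.ofReal_lt_top⟩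
  set D := C * (t₀ / 2) ^ (-(d / p)) with hD
  have hD0 : 0 ≤ D := by positivity
  -- Near `(t₀, x₀)` the function is replaced by its restriction `g` to a ball, and `g` by a
  -- continuous `φ` close in `L^p`. The error is uniform because `t > t₀/2` keeps `t^{-d/p}`
  -- bounded, and averages of `φ` are continuous.
  refine continuousAt_of_locally_uniform_approx_of_continuousAt fun u hu => ?_
  obtain ⟨ε, hε, hεu⟩ := Metric.mem_uniformity_dist.1 hu
  obtain ⟨φ, -, hφ, hφc, hφp⟩ := hgp.exists_hasCompactSupport_eLpNorm_sub_le (by simp)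
    (ε := ENNReal.ofReal (ε / 2 / (D + 1))) (by simp; positivity)
  refine ⟨{q | (t₀ / 2 < q.1 ∧ q.1 < 2 * t₀) ∧ ‖q.2 - x₀‖ < 1}, ?_,
    fun q => dilAvg ν φ q.1 q.2, (continuous_dilAvg hν hφc).continuousAt, ?_⟩
  · refine Filter.Eventually.and (continuous_fst.continuousAt.eventually
      (Ioo_mem_nhds (by linarith) (by linarith))) ?_
    have : ContinuousAt (fun p : ℝ × Rd d => ‖p.2 - x₀‖) (t₀, x₀) := by fun_prop
    exact this.eventually (gt_mem_nhds (by simp))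
  rintro ⟨t, x⟩ ⟨⟨ht1, ht2⟩, hx⟩
  simp only at ht1 ht2 hx
  have ht : 0 < t := by linarith
  refine hεu ?_
  have e : dilAvg ν f t x = dilAvg ν g t x := by
    refine integral_congr_ae (hν.mono fun y hy => ?_)
    simp only [hg]
    rw [indicator_of_mem]
    rw [Metric.mem_closedBall, dist_eq_norm, sub_right_comm]
    refine (norm_sub_le _ _).trans ?_
    rw [norm_smul, Real.norm_of_nonneg ht.le]
    nlinarith [norm_nonneg y]
  have hle := h (fun z => g z - φ z) (hgm.sub hφc.measurable) t ht x
  have hle2 : ∫⁻ y, ‖g (x - t • y) - φ (x - t • y)‖ₑ ∂ν ≤ ENNReal.ofReal (ε / 2) := by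
    refine hle.trans ?_
    calc _ ≤ ENNReal.ofReal D * ENNReal.ofReal (ε / 2 / (D + 1)) := by
          refine mul_le_mul' (ENNReal.ofReal_le_ofReal ?_) hφ
          refine mul_le_mul_of_nonneg_left ?_ hC
          exact Real.rpow_le_rpow_of_nonpos (by linarith) ht1.le
            (neg_nonpos.2 (by positivity))
      _ ≤ _ := by
          rw [← ENNReal.ofReal_mul hD0]
          refine ENNReal.ofReal_le_ofReal ?_
          rw [mul_div_assoc', div_le_iff₀ (by positivity)]
          nlinarith
  have hint : ∀ {w : Rd d → ℝ}, Measurable w → MemLp w (ENNReal.ofReal p) volume →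
      Integrable (fun y => w (x - t • y)) ν := fun hw hwp => by
    refine ⟨(hw.comp (by fun_prop)).aestronglyMeasurable, ?_⟩
    exact (h _ hw t ht x).trans_lt (ENNReal.mul_lt_top ENNReal.ofReal_lt_top hwp.2)
  rw [Real.dist_eq, e]
  unfold dilAvg
  rw [← integral_sub (hint hgm hgp) (hint hφc.measurable hφp)]
  exact (abs_integral_le_of_lintegral (by positivity) hle2).trans_lt (by linarith)

lemma mul_rpow_neg {t a : ℝ} (ht : 0 < t) : t * t ^ (-a) = t ^ (1 - a) := by
  rw [sub_eq_add_neg, Real.rpow_add ht, Real.rpow_one]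

/-- The contribution of the initial velocity is bounded and continuous up to time zero. -/
lemma HasLpBound.continuousOn_mul_dilAvg [IsProbabilityMeasure ν] (h : HasLpBound ν p C) (hC : 0 ≤ C)
    (hν : ∀ᵐ y ∂ν, ‖y‖ ≤ 1) (hp : 1 ≤ p) (hdp : d < p) (hf : Measurable f) (hfr : MemLp f r volume)
    (hpr : ENNReal.ofReal p ≤ r) (T : ℝ) :
    ContinuousOn (fun q : ℝ × Rd d => q.1 * dilAvg ν f q.1 q.2) (Icc 0 T ×ˢ univ) ∧
      ∃ M, ∀ t ∈ Icc 0 T, ∀ x, |t * dilAvg ν f t x| ≤ M := by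
  obtain ⟨K, hK, hKx⟩ := h.exists_lintegral_le hC hν hp hf hfr hpr T
  -- Since `d < p`, the amplitude `t` beats the singularity `t^{-d/p}`, so the contribution vanishes
  -- at time zero.
  have hα : 0 < 1 - d / p := by
    rw [sub_pos, div_lt_one (by linarith)]; exact hdp
  have hb : ∀ t ∈ Icc 0 T, ∀ x, |t * dilAvg ν f t x| ≤ K * t ^ (1 - d / p) := by
    intro t ht x
    rcases ht.1.eq_or_lt with rfl | ht0
    · rw [zero_mul, abs_zero, Real.zero_rpow hα.ne', mul_zero]
    · rw [abs_mul, abs_of_pos ht0, ← mul_rpow_neg ht0]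
      calc t * |dilAvg ν f t x| ≤ t * (K * t ^ (-(d / p))) := by
            gcongr
            exact abs_integral_le_of_lintegral (by positivity) (hKx t ⟨ht0, ht.2⟩ x)
        _ = _ := by ring
  refine ⟨fun q hq => ?_, K * T ^ (1 - d / p), fun t ht x => (hb t ht x).trans ?_⟩
  · rcases hq.1.1.eq_or_lt with h0 | h0
    · have hlim : Tendsto (fun q : ℝ × Rd d => K * q.1 ^ (1 - d / p))
          (𝓝[Icc 0 T ×ˢ univ] q) (𝓝 0) := by
        have : ContinuousAt (fun q : ℝ × Rd d => K * q.1 ^ (1 - d / p)) q :=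
          continuousAt_const.mul (continuousAt_fst.rpow_const (Or.inr hα.le))
        have h2 := this.tendsto.mono_left (nhdsWithin_le_nhds (s := Icc 0 T ×ˢ univ))
        rwa [← h0, Real.zero_rpow hα.ne', mul_zero] at h2
      have e0 : q.1 * dilAvg ν f q.1 q.2 = 0 := by rw [← h0, zero_mul]
      rw [ContinuousWithinAt, e0]
      refine squeeze_zero_norm' ?_ hlim
      filter_upwards [self_mem_nhdsWithin] with q' hq'
      exact hb _ hq'.1 _
    · exact (continuous_fst.continuousAt.mul
        (h.continuousAt_dilAvg hC hν hp hf hfr hpr h0 q.2)).continuousWithinAt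
  · gcongr
    · exact ht.1
    · exact ht.2

/-- A continuously differentiable function in `L^r` with gradient in `L^r` has bounded averages. -/
lemma HasLpBound.exists_abs_dilAvg_le [IsProbabilityMeasure ν] (h : HasLpBound ν p C) (hC : 0 ≤ C)
    (hν : ∀ᵐ y ∂ν, ‖y‖ ≤ 1) (hp : 1 ≤ p) (hdp : d < p) (hf : ContDiff ℝ 1 f) (hfr : MemLp f r volume)
    (hfr' : MemLp (gradient f) r volume) (hpr : ENNReal.ofReal p ≤ r) {T : ℝ} (hT : 0 < T) :
    ∃ M, ∀ t ∈ Icc 0 T, ∀ x, |dilAvg ν f t x| ≤ M ∧ |t * dilAvgDeriv ν f t x| ≤ M := by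
  obtain ⟨K, hK, hKx⟩ := h.exists_lintegral_le hC hν hp hf.continuous.measurable hfr hpr T
  have hgm : Measurable fun z => ‖gradient f z‖ := by
    have : (fun z => ‖gradient f z‖) = fun z => ‖fderiv ℝ f z‖ := by
      ext z; unfold gradient; rw [LinearIsometryEquiv.norm_map]
    rw [this]
    exact (hf.continuous_fderiv one_ne_zero).norm.measurable
  obtain ⟨K', hK', hKx'⟩ := h.exists_lintegral_le hC hν hp hgm hfr'.norm hpr T
  set β := 1 - d / p with hβ
  have hβ0 : 0 < β := by
    rw [hβ, sub_pos, div_lt_one (by linarith)]; exact hdp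
  have hder : ∀ t ∈ Ioc 0 T, ∀ x, |dilAvgDeriv ν f t x| ≤ K' * t ^ (-(d / p)) := by
    intro t ht x
    refine abs_integral_le_of_lintegral (mul_nonneg hK' (Real.rpow_nonneg ht.1.le _)) ?_
    refine le_trans (lintegral_mono_ae (hν.mono fun y hy => ?_)) (hKx' t ht x)
    rw [← ofReal_norm, ← ofReal_norm, norm_norm]
    refine ENNReal.ofReal_le_ofReal ?_
    unfold gradient
    rw [LinearIsometryEquiv.norm_map]
    exact (ContinuousLinearMap.le_opNorm _ _).trans (mul_le_of_le_one_right (norm_nonneg _) hy)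
  -- The direct bound blows up as `t → 0`, so it is used at time `T` only. Going back from `T` to
  -- `t`, the derivative is at most `K' s^{-d/p}`, integrable because `d < p`; the integration is
  -- expressed by the monotonicity of `(K'/β) s^β ± dilAvg`.
  have hw : ∀ t ∈ Icc 0 T, ∀ x,
      |dilAvg ν f t x| ≤ K * T ^ (-(d / p)) + K' / β * T ^ β := by
    intro t ht x
    have hTx : |dilAvg ν f T x| ≤ K * T ^ (-(d / p)) :=
      abs_integral_le_of_lintegral (by positivity) (hKx T ⟨hT, le_rfl⟩ x)
    have hcw : ContinuousOn (fun s => dilAvg ν f s x) (Icc 0 T) :=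
      ((continuous_dilAvg hν hf.continuous).comp
        (f := fun s : ℝ => (s, x)) (by fun_prop)).continuousOn
    have hcφ : ContinuousOn (fun s : ℝ => K' / β * s ^ β) (Icc 0 T) :=
      continuousOn_const.mul (continuousOn_id.rpow_const fun _ _ => Or.inr hβ0.le)
    have hdφ : ∀ s ∈ Ioo 0 T, HasDerivAt (fun s : ℝ => K' / β * s ^ β) (K' * s ^ (-(d / p))) s := by
      intro s hs
      refine ((Real.hasDerivAt_rpow_const (Or.inl hs.1.ne')).const_mul (K' / β)).congr_deriv ?_
      rw [show β - 1 = -(d / p) by rw [hβ]; ring]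
      field_simp
    have hm1 : MonotoneOn (fun s => K' / β * s ^ β + dilAvg ν f s x) (Icc 0 T) := by
      refine monotoneOn_of_hasDerivWithinAt_nonneg (convex_Icc 0 T) (hcφ.add hcw)
        (f' := fun s => K' * s ^ (-(d / p)) + -dilAvgDeriv ν f s x) (fun s hs => ?_) fun s hs => ?_
      · rw [interior_Icc] at hs
        exact ((hdφ s hs).fun_add (hasDerivAt_dilAvg hν hf s x)).hasDerivWithinAt
      · rw [interior_Icc] at hs
        have := (abs_le.1 (hder s ⟨hs.1, hs.2.le⟩ x)).2
        linarith
    have hm2 : MonotoneOn (fun s => K' / β * s ^ β - dilAvg ν f s x) (Icc 0 T) := by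
      refine monotoneOn_of_hasDerivWithinAt_nonneg (convex_Icc 0 T) (hcφ.sub hcw)
        (f' := fun s => K' * s ^ (-(d / p)) - -dilAvgDeriv ν f s x) (fun s hs => ?_) fun s hs => ?_
      · rw [interior_Icc] at hs
        exact ((hdφ s hs).fun_sub (hasDerivAt_dilAvg hν hf s x)).hasDerivWithinAt
      · rw [interior_Icc] at hs
        have := (abs_le.1 (hder s ⟨hs.1, hs.2.le⟩ x)).1
        linarith
    have hTmem : T ∈ Icc 0 T := ⟨hT.le, le_rfl⟩
    have h1 := hm1 ht hTmem ht.2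
    have h2 := hm2 ht hTmem ht.2
    simp only at h1 h2
    have h3 : 0 ≤ K' / β * t ^ β := mul_nonneg (by positivity) (Real.rpow_nonneg ht.1 _)
    rw [abs_le] at hTx ⊢
    constructor <;> linarith [hTx.1, hTx.2]
  refine ⟨max (K * T ^ (-(d / p)) + K' / β * T ^ β) (K' * T ^ β),
    fun t ht x => ⟨(hw t ht x).trans (le_max_left _ _), le_trans ?_ (le_max_right _ _)⟩⟩
  rcases ht.1.eq_or_lt with rfl | ht0
  · rw [zero_mul, abs_zero]; positivity
  · rw [abs_mul, abs_of_pos ht0]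
    calc t * |dilAvgDeriv ν f t x| ≤ t * (K' * t ^ (-(d / p))) := by
          gcongr; exact hder t ⟨ht0, ht.2⟩ x
      _ = K' * t ^ β := by rw [hβ, ← mul_rpow_neg ht0]; ring
      _ ≤ _ := by
          gcongr
          exact ht.2

end AdditiveSPDE

end

/-! ### The linear part of the wave equation in dimensions one, two and three -/

noncomputable section

namespace AdditiveSPDE


/-- The exponent 3 is a convenient one larger than the dimension; the density is bounded with
bounded support. -/
lemma exists_hasLpBound_waveKernel_one : ∃ C, 0 ≤ C ∧ HasLpBound (waveKernel 1 1) 3 C := by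
  rw [waveKernel_one_one]
  refine exists_hasLpBound (κ := fun y => waveProfile₁ (‖y‖ ^ 2)) (q := 3 / 2) (measurable_waveProfile₁.comp (by fun_prop))
    (Real.holderConjugate_iff.2 (by norm_num)) ?_
  refine lt_of_le_of_lt (lintegral_mono (g := (Metric.ball (0 : Rd 1) 1).indicator 1) fun y => ?_)
    ((lintegral_indicator_one measurableSet_ball).trans_lt measure_ball_lt_top)
  have h := mem_ball_iff_norm_sq one_pos y
  rw [inv_one, one_smul] at h
  unfold waveProfile₁
  by_cases hy : y ∈ Metric.ball (0 : Rd 1) 1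
  · rw [indicator_of_mem hy, indicator_of_mem (h.1 hy)]
    refine ENNReal.rpow_le_one ?_ (by norm_num)
    rw [ENNReal.ofReal_le_one]; norm_num
  · rw [indicator_of_notMem hy, indicator_of_notMem (h.not.1 hy), ENNReal.zero_rpow_of_pos (by norm_num)]

/-- In polar coordinates the singularity is at most `(1-ρ)^{-q/2}`, integrable for `q < 2`. The
conjugate exponents are `p > 2`, whence the condition `r > 2` on planar data. -/
lemma lintegral_waveProfile₂_rpow_lt_top {q : ℝ} (hq0 : 0 < q) (hq2 : q < 2) :
    ∫⁻ y : Rd 2, waveProfile₂ (‖y‖ ^ 2) ^ q < ∞ := by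
  set g : ℝ → ℝ := fun ρ => (1 / (2 * Real.pi) * (1 / Real.sqrt (1 - ρ ^ 2))) ^ q with hg
  have hg0 : ∀ ρ, 0 ≤ g ρ := fun ρ => by positivity
  have hgm : Measurable g := by fun_prop
  have h1 : IntegrableOn (fun y : Rd 2 => g ‖y‖) (Metric.ball 0 1) := by
    rw [integrableOn_fun_norm_addHaar, finrank_euclideanSpace_fin]
    have hdom : IntegrableOn (fun ρ : ℝ => (1 - ρ) ^ (-(q / 2))) (Ioo 0 1) := by
      have h := (intervalIntegral.intervalIntegrable_rpow' (a := 0) (b := 1)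
        (r := -(q / 2)) (by linarith)).comp_sub_left 1
      rw [sub_zero, sub_self] at h
      exact ((intervalIntegrable_iff_integrableOn_Ioc_of_le zero_le_one).1 h.symm).mono_set
        Ioo_subset_Ioc_self
    refine Integrable.mono' hdom (by fun_prop) ((ae_restrict_iff' measurableSet_Ioo).2
      (Eventually.of_forall fun ρ hρ => ?_))
    have h3 : 0 < 1 - ρ := by linarith [hρ.2]
    rw [smul_eq_mul, Real.norm_of_nonneg (mul_nonneg (pow_nonneg hρ.1.le _) (hg0 ρ))]
    have h4 : 1 / (2 * Real.pi) * (1 / Real.sqrt (1 - ρ ^ 2)) ≤ (1 - ρ) ^ (-(1 / 2) : ℝ) := by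
      have h5 : 1 / (2 * Real.pi) ≤ 1 := by
        rw [div_le_one (by positivity)]; linarith [Real.pi_gt_three]
      have h6 : Real.sqrt (1 - ρ) ≤ Real.sqrt (1 - ρ ^ 2) :=
        Real.sqrt_le_sqrt (by nlinarith [hρ.1, hρ.2])
      have h7 : 0 < Real.sqrt (1 - ρ) := Real.sqrt_pos.2 h3
      rw [Real.rpow_neg h3.le, ← Real.sqrt_eq_rpow, ← one_div]
      calc _ ≤ 1 * (1 / Real.sqrt (1 - ρ)) := by gcongr
        _ = _ := one_mul _
    calc ρ ^ (2 - 1) * g ρ ≤ 1 * ((1 - ρ) ^ (-(1 / 2) : ℝ)) ^ q := by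
          refine mul_le_mul (pow_le_one₀ hρ.1.le hρ.2.le) ?_ (hg0 ρ) zero_le_one
          exact Real.rpow_le_rpow (by positivity) h4 hq0.le
      _ = _ := by rw [one_mul, ← Real.rpow_mul h3.le]; congr 1; ring
  refine lt_of_le_of_lt (le_of_eq ?_) h1.lintegral_lt_top
  rw [← lintegral_indicator measurableSet_ball]
  refine lintegral_congr fun y => ?_
  have h := mem_ball_iff_norm_sq one_pos y
  rw [inv_one, one_smul] at h
  unfold waveProfile₂
  by_cases hy : y ∈ Metric.ball (0 : Rd 2) 1
  · rw [indicator_of_mem hy, indicator_of_mem (h.1 hy), ENNReal.ofReal_rpow_of_nonneg (by positivity)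
      hq0.le]
  · rw [indicator_of_notMem hy, indicator_of_notMem (h.not.1 hy), ENNReal.zero_rpow_of_pos hq0]

lemma exists_hasLpBound_waveKernel_two {p : ℝ} (hp : 2 < p) :
    ∃ C, 0 ≤ C ∧ HasLpBound (waveKernel 2 1) p C := by
  rw [waveKernel_two_one]
  have hpq := Real.HolderConjugate.conjExponent (by linarith : 1 < p)
  refine exists_hasLpBound (measurable_waveProfile₂.comp (by fun_prop)) hpq
    (lintegral_waveProfile₂_rpow_lt_top hpq.symm.pos ?_)
  unfold Real.conjExponent
  rw [div_lt_iff₀ (by linarith)]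
  linarith

variable {d : ℕ} {T : ℝ} {b : ℝ → ℝ} {u0 v0 : Rd d → ℝ}

lemma exists_goodLinearPart_of_eq {pb : CauchyProblem d} (hu : Measurable pb.u0) {A : ℝ → Rd d → ℝ}
    (hA : ContinuousOn (fun q : ℝ × Rd d => A q.1 q.2) (Icc 0 pb.T ×ˢ univ))
    (hM : ∃ M, ∀ t ∈ Icc 0 pb.T, ∀ x, |A t x| ≤ M)
    (h : ∀ t ∈ Icc 0 pb.T, ∀ x, linearPart pb t x = A t x) :
    ∃ M, 0 ≤ M ∧ GoodLinearPart pb M ∧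
      ContinuousOn (fun q : ℝ × Rd d => linearPart pb q.1 q.2) (Icc 0 pb.T ×ˢ univ) := by
  obtain ⟨M, hM⟩ := hM
  have hc := hA.congr (g := fun q : ℝ × Rd d => linearPart pb q.1 q.2) fun q hq => h _ hq.1 _
  refine ⟨|M|, abs_nonneg _, goodLinearPart_of_continuousOn hu
    (hc.mono (prod_mono Ioc_subset_Icc_self le_rfl)) fun t ht x => ?_, hc⟩
  rw [h t ht x]
  exact (hM t ht x).trans (le_abs_self M)

section SmoothData

variable {ν : Measure (Rd d)} [IsProbabilityMeasure ν]

/-- The function `v` stands for a measurable representative of `v0`: in dimension two the initial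
velocity is only almost everywhere equal to a measurable function. -/
lemma exists_goodLinearPart_wave_of_contDiff (h : IsWaveProfile (waveKernel d) ν)
    (hu : ContDiff ℝ 1 u0)
    (hub : ∃ M, ∀ t ∈ Icc 0 T, ∀ x, |dilAvg ν u0 t x| ≤ M ∧ |t * dilAvgDeriv ν u0 t x| ≤ M)
    {v : Rd d → ℝ} (hv : ∀ t, 0 < t → ∀ x, kernelConv .wave v0 t x = t * dilAvg ν v t x)
    (hvc : ContinuousOn (fun q : ℝ × Rd d => q.1 * dilAvg ν v q.1 q.2) (Icc 0 T ×ˢ univ))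
    (hvb : ∃ M, ∀ t ∈ Icc 0 T, ∀ x, |t * dilAvg ν v t x| ≤ M) :
    ∃ M, 0 ≤ M ∧ GoodLinearPart ⟨.wave, T, b, u0, v0⟩ M ∧ ContinuousOn
      (fun q : ℝ × Rd d => linearPart ⟨.wave, T, b, u0, v0⟩ q.1 q.2) (Icc 0 T ×ˢ univ) := by
  refine exists_goodLinearPart_of_eq (pb := ⟨.wave, T, b, u0, v0⟩) hu.continuous.measurable
    (A := fun t x => t * dilAvg ν v t x + (dilAvg ν u0 t x - t * dilAvgDeriv ν u0 t x))
    (hvc.add ((continuous_dilAvg h.support hu.continuous).sub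
      (continuous_fst.mul (continuous_dilAvgDeriv h.support hu))).continuousOn) ?_ fun t ht x => ?_
  · obtain ⟨M, hM⟩ := hub
    obtain ⟨M', hM'⟩ := hvb
    refine ⟨M' + (M + M), fun t ht x => (abs_add_le _ _).trans (add_le_add (hM' t ht x) ?_)⟩
    exact (abs_sub _ _).trans (add_le_add (hM t ht x).1 (hM t ht x).2)
  · rcases ht.1.eq_or_lt with rfl | ht0
    · rw [linearPart_wave_zero, dilAvg_zero ν u0, zero_mul, zero_mul, zero_add, sub_zero]
    · rw [linearPart_wave_eq h hu ht0, hv t ht0]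

end SmoothData

lemma exists_goodLinearPart_wave_three {u0 v0 : Rd 3 → ℝ} (h : WaveData 3 u0 v0) :
    ∃ M, 0 ≤ M ∧ GoodLinearPart ⟨.wave, T, b, u0, v0⟩ M ∧ ContinuousOn
      (fun q : ℝ × Rd 3 => linearPart ⟨.wave, T, b, u0, v0⟩ q.1 q.2) (Icc 0 T ×ˢ univ) := by
  obtain ⟨⟨hu, ⟨M, hM⟩, M', hM'⟩, hv, M'', hM''⟩ := h
  have hw := isWaveProfile_three
  have := hw.prob
  have hM0 : 0 ≤ M' := (norm_nonneg _).trans (hM' 0)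
  have hM0' : 0 ≤ M'' := (abs_nonneg _).trans (hM'' 0)
  refine exists_goodLinearPart_wave_of_contDiff hw hu ⟨max M (T * M'), fun t ht x =>
    ⟨(abs_dilAvg_le hM t x).trans (le_max_left _ _), le_trans ?_ (le_max_right _ _)⟩⟩
    (fun t ht x => kernelConv_wave_eq hw hv.measurable ht x)
    (continuous_fst.mul (continuous_dilAvg hw.support hv)).continuousOn
    ⟨T * M'', fun t ht x => ?_⟩
  · rw [abs_mul, abs_of_nonneg ht.1]
    refine mul_le_mul ht.2 ?_ (abs_nonneg _) (ht.1.trans ht.2)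
    have := norm_integral_le_of_norm_le_const (μ := waveKernel 3 1) (C := M')
      (f := fun y => fderiv ℝ u0 (x - t • y) y) (hw.support.mono fun y hy => by
        refine (ContinuousLinearMap.le_opNorm _ _).trans ?_
        have h1 := hM' (x - t • y)
        unfold gradient at h1
        rw [LinearIsometryEquiv.norm_map] at h1
        exact (mul_le_of_le_one_right (norm_nonneg _) hy).trans h1)
    simpa [dilAvgDeriv] using this
  · rw [abs_mul, abs_of_nonneg ht.1]
    exact mul_le_mul ht.2 (abs_dilAvg_le hM'' t x) (abs_nonneg _) (ht.1.trans ht.2)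

/-- The planar kernel has a density, so only the class of the initial velocity matters. -/
lemma kernelConv_wave_two_congr {f g : Rd 2 → ℝ} (h : f =ᵐ[volume] g) (t : ℝ) (x : Rd 2) :
    kernelConv .wave f t x = kernelConv .wave g t x := by
  have h1 : ∀ᵐ y : Rd 2, f (x - y) = g (x - y) :=
    (Measure.measurePreserving_sub_left volume x).quasiMeasurePreserving.ae h
  exact integral_congr_ae ((withDensity_absolutelyContinuous _ _).ae_le h1)

lemma exists_goodLinearPart_wave_two (hT : 0 < T) {u0 v0 : Rd 2 → ℝ} (h : WaveData 2 u0 v0) :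
    ∃ M, 0 ≤ M ∧ GoodLinearPart ⟨.wave, T, b, u0, v0⟩ M ∧ ContinuousOn
      (fun q : ℝ × Rd 2 => linearPart ⟨.wave, T, b, u0, v0⟩ q.1 q.2) (Icc 0 T ×ˢ univ) := by
  obtain ⟨hu, r, hr, hur, hgr, hvr⟩ := h
  -- A finite exponent strictly between 2 and `r` is available even when `r = ∞`.
  obtain ⟨p, hp2, hpr⟩ := ENNReal.lt_iff_exists_nnreal_btwn.1 hr
  have hp2' : (2 : ℝ) < p := by exact_mod_cast hp2
  have hpr' : ENNReal.ofReal (p : ℝ) ≤ r := by rw [ENNReal.ofReal_coe_nnreal]; exact hpr.le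
  have hw := isWaveProfile_two
  have := hw.prob
  obtain ⟨C, hC, hLp⟩ := exists_hasLpBound_waveKernel_two hp2'
  set v := hvr.1.mk v0 with hv
  have hvm : Measurable v := hvr.1.stronglyMeasurable_mk.measurable
  have hvv : v0 =ᵐ[volume] v := hvr.1.ae_eq_mk
  have hd : ((2 : ℕ) : ℝ) < p := by exact_mod_cast hp2'
  obtain ⟨hvc, hvb⟩ := hLp.continuousOn_mul_dilAvg hC hw.support (by linarith) hd hvm
    ((memLp_congr_ae hvv).1 hvr) hpr' T
  exact exists_goodLinearPart_wave_of_contDiff hw hu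
    (hLp.exists_abs_dilAvg_le hC hw.support (by linarith) hd hu hur hgr hpr' hT)
    (fun t ht x => (kernelConv_wave_two_congr hvv t x).trans (kernelConv_wave_eq hw hvm ht x)) hvc hvb

/-- The unit vector of the line. -/
def lineVec : Rd 1 := EuclideanSpace.single 0 1

/-- On the line `u0` is only continuous and cannot be differentiated. Written as an integral over
`[-r, r]`, the average is differentiable in `r`, and the derivative gives d'Alembert's formula. -/
lemma dilAvg_waveKernel_one {f : Rd 1 → ℝ} (hf : Continuous f) (r : ℝ) (x : Rd 1) :
    r * dilAvg (waveKernel 1 1) f r x = 1 / 2 * ∫ s in (-r)..r, f (x - s • lineVec) := by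
  have e1 : ∀ y : Rd 1, y = (inner ℝ y lineVec : ℝ) • lineVec := by
    intro y
    ext i
    rw [Subsingleton.elim i 0]
    simp [lineVec, EuclideanSpace.inner_single_right]
  have hn : ‖lineVec‖ = 1 := by simp [lineVec]
  have h1 := integral_map (μ := waveKernel 1 1) (φ := fun y => inner ℝ y lineVec) (by fun_prop)
    (f := fun s : ℝ => f (x - r • s • lineVec)) (hf.comp (by fun_prop)).aestronglyMeasurable
  have h2 : dilAvg (waveKernel 1 1) f r x = ∫ y, f (x - r • (inner ℝ y lineVec : ℝ) • lineVec)
      ∂(waveKernel 1 1) := by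
    unfold dilAvg
    exact integral_congr_ae (Eventually.of_forall fun y => by simp only; rw [← e1 y])
  have h3 := intervalIntegral.smul_integral_comp_mul_left (a := -1) (b := 1)
    (fun s : ℝ => f (x - s • lineVec)) r
  rw [mul_neg_one, mul_one, smul_eq_mul] at h3
  rw [h2, ← h1, map_inner_waveKernel_one, hn]
  simp only [mul_one]
  rw [Measure.map_id', integral_uniformLaw, ← h3, smul_eq_mul, mul_left_comm]
  simp_rw [smul_smul]

lemma exists_goodLinearPart_wave_one {u0 v0 : Rd 1 → ℝ} (h : WaveData 1 u0 v0) :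
    ∃ M, 0 ≤ M ∧ GoodLinearPart ⟨.wave, T, b, u0, v0⟩ M ∧ ContinuousOn
      (fun q : ℝ × Rd 1 => linearPart ⟨.wave, T, b, u0, v0⟩ q.1 q.2) (Icc 0 T ×ˢ univ) := by
  obtain ⟨⟨hu, M, hM⟩, hv, M', hM'⟩ := h
  have hw := isWaveProfile_one
  have := hw.prob
  obtain ⟨C, hC, hLp⟩ := exists_hasLpBound_waveKernel_one
  obtain ⟨hvc, M'', hvb⟩ := hLp.continuousOn_mul_dilAvg hC hw.support (by norm_num) (by norm_num) hv
    (memLp_top_of_bound hv.aestronglyMeasurable M' (Eventually.of_forall hM')) le_top T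
  refine exists_goodLinearPart_of_eq (pb := ⟨.wave, T, b, u0, v0⟩) hu.measurable
    (A := fun t x => t * dilAvg (waveKernel 1 1) v0 t x
      + 1 / 2 * (u0 (x - t • lineVec) + u0 (x - (-t) • lineVec)))
    (hvc.add (continuous_const.mul ((hu.comp (by fun_prop)).add
      (hu.comp (by fun_prop)))).continuousOn) ⟨M'' + M, fun t ht x => ?_⟩ fun t ht x => ?_
  · refine (abs_add_le _ _).trans (add_le_add (hvb t ht x) ?_)
    rw [abs_mul, abs_of_pos (by norm_num : (0 : ℝ) < 1 / 2)]
    have h1 := abs_add_le (u0 (x - t • lineVec)) (u0 (x - (-t) • lineVec))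
    linarith [hM (x - t • lineVec), hM (x - (-t) • lineVec)]
  · rcases ht.1.eq_or_lt with rfl | ht0
    · rw [linearPart_wave_zero]
      simp
      ring
    · rw [linearPart_wave ht0, kernelConv_wave_eq hw hv ht0]
      congr 1
      have h2 : (fun r => kernelConv .wave u0 r x)
          =ᶠ[𝓝 t] fun r => 1 / 2 * ∫ s in (-r)..r, u0 (x - s • lineVec) := by
        filter_upwards [Ioi_mem_nhds ht0] with r hr
        rw [kernelConv_wave_eq hw hu.measurable hr, dilAvg_waveKernel_one hu]
      have hc : Continuous fun s : ℝ => u0 (x - s • lineVec) := hu.comp (by fun_prop)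
      rw [h2.deriv_eq, ((hasDerivAt_integral_symm hc t).const_mul (1 / 2)).deriv]

/-- The kernel and the linear part of the wave equation satisfy the general assumptions. -/
theorem exists_wave_data (hT : 0 < T) {d : ℕ} {u0 v0 : Rd d → ℝ} (h : WaveData d u0 v0) :
    (∃ ν, IsWaveProfile (waveKernel d) ν) ∧
    ∃ M, 0 ≤ M ∧ GoodLinearPart ⟨.wave, T, b, u0, v0⟩ M ∧ ContinuousOn
      (fun q : ℝ × Rd d => linearPart ⟨.wave, T, b, u0, v0⟩ q.1 q.2) (Icc 0 T ×ˢ univ) := by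
  match d, u0, v0, h with
  | 1, _, _, h => exact ⟨⟨_, isWaveProfile_one⟩, exists_goodLinearPart_wave_one h⟩
  | 2, _, _, h => exact ⟨⟨_, isWaveProfile_two⟩, exists_goodLinearPart_wave_two hT h⟩
  | 3, _, _, h => exact ⟨⟨_, isWaveProfile_three⟩, exists_goodLinearPart_wave_three h⟩
  | 0, _, _, h => exact False.elim h
  | _ + 4, _, _, h => exact False.elim h

end AdditiveSPDE

end

/-! ### The wave and heat equations -/

theorem theorem2p4 {d : ℕ} (hd : 1 ≤ d) {T : ℝ} (hT : 0 < T)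
    {Ωs : ℕ → Type*} [∀ n, MeasurableSpace (Ωs n)]
    (Ps : ∀ n, Measure (Ωs n)) [∀ n, IsProbabilityMeasure (Ps n)] [∀ n, (Ps n).IsComplete]
    {Ω : Type*} [MeasurableSpace Ω] (P : Measure Ω) [IsProbabilityMeasure P] [P.IsComplete]
    (μs : ℕ → Measure (Rd d)) (μ : Measure (Rd d)) (h1 : HypH1 μs) (h2 : HypH2 μs μ)
    (Ws : ∀ n, TestFn d → Ωs n → ℝ) (hWs : ∀ n, IsHomogeneousNoise (Ps n) (μs n) (Ws n))
    (W : TestFn d → Ω → ℝ) (hW : IsHomogeneousNoise P μ W)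
    (b : ℝ → ℝ) (hb : ∃ K : ℝ≥0, LipschitzWith K b)
    (u0 v0 : Rd d → ℝ) (p : ℝ≥0) (hp : 2 ≤ p) :
    -- wave equation
    (WaveData d u0 v0 →
      SolutionsConvergeInLaw Ps μs Ws P μ W ⟨.wave, T, b, u0, v0⟩ p (Icc 0 T)) ∧
    -- heat equation with bounded drift
    ((∃ M, ∀ z, |b z| ≤ M) → HeatData u0 →
      SolutionsConvergeInLaw Ps μs Ws P μ W ⟨.heat, T, b, u0, v0⟩ p (Ioc 0 T) ∧
      (Continuous u0 →
        SolutionsConvergeInLaw Ps μs Ws P μ W ⟨.heat, T, b, u0, v0⟩ p (Icc 0 T))) ∧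
    -- heat equation with general drift
    (HeatData u0 → (∃ α : ℝ≥0, 0 < α ∧ α < 1 ∧ ∃ C : ℝ≥0, HolderWith C α u0) →
      SolutionsConvergeInLaw Ps μs Ws P μ W ⟨.heat, T, b, u0, v0⟩ p (Icc 0 T)) := by
  obtain ⟨K, hb⟩ := hb
  have hp1 : 1 ≤ p := le_trans one_le_two hp
  refine ⟨fun hwave => ?_, fun _ hheat => ?_, fun hheat hhol => ?_⟩
  · obtain ⟨⟨ν, hν⟩, M, hM, hI, hc⟩ := AdditiveSPDE.exists_wave_data (b := b) hT hwave
    exact AdditiveSPDE.solutionsConvergeInLaw_of_isScaledKernel Ps P μs μ h1 h2 Ws hWs W hW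
      ⟨.wave, T, b, u0, v0⟩ hT.le hν.isScaledKernel hb hM hI hp1 le_rfl hc
  · obtain ⟨hu, M, hM⟩ := hheat
    have hM0 : 0 ≤ M := (abs_nonneg _).trans (hM 0)
    have hI := AdditiveSPDE.goodLinearPart_heat (T := T) (b := b) (v0 := v0) hu hM
    have hmain := fun J => AdditiveSPDE.solutionsConvergeInLaw_of_isScaledKernel Ps P μs μ h1 h2 Ws
      hWs W hW ⟨.heat, T, b, u0, v0⟩ hT.le AdditiveSPDE.isScaledKernel_heat hb hM0 hI hp1 (J := J)
    -- For positive times the heat semigroup makes bounded measurable data continuous; time zero can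
    -- be added when `u0` itself is continuous.
    exact ⟨hmain _ Ioc_subset_Icc_self hI.continuousOn, fun hcont =>
      hmain _ le_rfl (AdditiveSPDE.continuousOn_linearPart_heat hcont hM)⟩
  · obtain ⟨hu, M, hM⟩ := hheat
    obtain ⟨α, hα, -, C, hC⟩ := hhol
    have hM0 : 0 ≤ M := (abs_nonneg _).trans (hM 0)
    exact AdditiveSPDE.solutionsConvergeInLaw_of_isScaledKernel Ps P μs μ h1 h2 Ws hWs W hW
      ⟨.heat, T, b, u0, v0⟩ hT.le AdditiveSPDE.isScaledKernel_heat hb hM0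
      (AdditiveSPDE.goodLinearPart_heat hu hM) hp1 le_rfl
      (AdditiveSPDE.continuousOn_linearPart_heat (hC.continuous hα) hM)
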